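/- Let $k$ be a field of characteristic $p>0$, let $G=\operatorname{Spec}\mathcal O(G)$ be an affine group scheme of finite type over $k$; representations of $G$ are (locally finite) $\mathcal O(G)$-comodules, and a dg $G$-algebra is an algebra object in cochain complexes of $G$-representations. Let $Z$ be a commutative $G$-algebra which is isomorphic, as an algebra, to a power series ring $k[[x_1,\dots,x_n]]$ ($n\ge 0$), with $G$-linear augmentation $Z\to k$, whose kernel we call $m_Z$. Consider the $G$-representation $m_Z/m_Z^2$ and the dg $G$-algebras with zero differential $$A_Z=\operatorname{Sym}\big(\Sigma^{-2}(m_Z/m_Z^2)^*\big),\qquad B=\operatorname{Sym}(\Sigma\, m_Z/m_Z^2)=\wedge^*(m_Z/m_Z^2),$$ with generators in degrees $2$ and $-1$, respectively. Let $\mathcal K$ be an equivariant Koszul resolution of $k$ over $Z$: a $G$-equivariant dg $Z$-algebra which is finite and flat over $Z$, together with a $G$-equivariant quasi-isomorphism of dg $Z$-algebras $\epsilon:\mathcal K\to k$ and a $G$-equivariant map of dg $Z$-algebras $\pi:\mathcal K\to B$ such that the induced map $k\otimes_Z\mathcal K\to B$ is a quasi-isomorphism. Consider $\mathcal K$ as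 the regular dg $\mathcal K$-bimodule, i.e. as an equivariant dg module over $\mathcal K\otimes_Z\mathcal K$ (dg modules over $\mathcal K\otimes_Z\mathcal K$ being the $Z$-central dg $\mathcal K$-bimodules, $(a\otimes b)m=(-1)^{|b||m|}amb$). Let $F\to\mathcal K$ be any equivariant semi-projective resolution over $\mathcal K\otimes_Z\mathcal K$: a $G$-linear quasi-isomorphism of equivariant dg modules for which $F$ has, non-equivariantly, an exhaustive filtration $F(0)\subseteq F(1)\subseteq\cdots$ by dg submodules whose subquotients $F(i)/F(i-1)$, with $F(-1)=0$, are summands of free dg modules $\bigoplus_j\Sigma^{n_j}(\mathcal K\otimes_Z\mathcal K)$. Let $\operatorname{REnd}_{\mathcal K\otimes_Z\mathcal K}(\mathcal K)=\operatorname{End}_{\mathcal K\otimes_Z\mathcal K}(F)$ with the $G$-action $(x\cdot f)(m)=x_1f(S(x_2)m)$. If $G$ is not finite, assume that this action makes each $\operatorname{Hom}^n_{\mathcal K\otimes_Z\mathcal K}(F,F)$ an $\mathcal O(G)$-comodule, so that $\operatorname{REnd}_{\mathcal K\otimes_Z\mathcal K}(\mathcal K)$ is a dg $G$-algebra; for a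 finite group scheme $G$ this is automatic. Then there is a $G$-equivariant homotopy isomorphism, i.e. a finite zig-zag of $G$-linear dg algebra quasi-isomorphisms, between $\operatorname{REnd}_{\mathcal K\otimes_Z\mathcal K}(\mathcal K)$ and $A_Z$. In particular, $\operatorname{REnd}_{\mathcal K\otimes_Z\mathcal K}(\mathcal K)$ is equivariantly formal, i.e. it is connected by such a zig-zag to its cohomology algebra with zero differential. -/

import Mathlib

open scoped TensorProduct

universe u

namespace EqFormality

/-! ### Slices of tensors over a field -/

section Slices

variable {k : Type*} [Field k] {M N W : Type*} [AddCommGroup M] [Module k M]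
  [AddCommGroup N] [Module k N] [AddCommGroup W] [Module k W]

/-- `slice φ (m ⊗ w) = φ w • m`. -/
noncomputable def slice (φ : W →ₗ[k] k) : M ⊗[k] W →ₗ[k] M :=
  (TensorProduct.rid k M).toLinearMap ∘ₗ φ.lTensor M

@[simp] theorem slice_tmul (φ : W →ₗ[k] k) (m : M) (w : W) : slice φ (m ⊗ₜ[k] w) = φ w • m := by
  simp [slice]

theorem slice_rTensor (φ : W →ₗ[k] k) (f : M →ₗ[k] N) (t : M ⊗[k] W) :
    slice φ (f.rTensor W t) = f (slice φ t) := by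
  induction t with
  | zero => simp
  | tmul m w => simp
  | add x y hx hy => simp [hx, hy]

theorem equivFinsupp_eq_slice {κ : Type*} [DecidableEq κ] (b : Module.Basis κ k W) (t : M ⊗[k] W) (i : κ) :
    TensorProduct.equivFinsuppOfBasisRight b t i = slice (b.coord i) t := by
  induction t with
  | zero => simp
  | tmul m w => simp
  | add x y hx hy => simp [hx, hy]

theorem slice_ext {t t' : M ⊗[k] W} (h : ∀ φ : W →ₗ[k] k, slice φ t = slice φ t') : t = t' := by
  classical
  let b := Module.Basis.ofVectorSpace k W
  apply (TensorProduct.equivFinsuppOfBasisRight b).injective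
  ext i
  rw [equivFinsupp_eq_slice, equivFinsupp_eq_slice, h]

theorem mem_range_rTensor_iff (X : Submodule k M) (t : M ⊗[k] W) :
    t ∈ LinearMap.range (X.subtype.rTensor W) ↔ ∀ φ : W →ₗ[k] k, slice φ t ∈ X := by
  constructor
  · rintro ⟨s, rfl⟩ φ
    rw [slice_rTensor]
    exact (slice φ s).2
  · intro h
    have : (X.mkQ.rTensor W) t = 0 := by
      apply slice_ext
      intro φ
      rw [slice_rTensor]
      simpa using h φ
    have ex := rTensor_exact W (f := X.subtype) (g := X.mkQ)
      (by rw [LinearMap.exact_iff]; simp) (Submodule.mkQ_surjective X)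
    exact (ex t).1 this

theorem rTensor_injective {f : M →ₗ[k] N} (hf : Function.Injective f) :
    Function.Injective (f.rTensor W) := by
  intro t t' h
  apply slice_ext
  intro φ
  apply hf
  rw [← slice_rTensor, ← slice_rTensor, h]

end Slices

/-! ### Gradings -/

section Gradings

variable {k : Type*} [Field k] {M : Type*} [AddCommGroup M] [Module k M]
  {gr : ℤ → Submodule k M}

/-- The isomorphism of `M` with the external direct sum of its graded pieces. -/
noncomputable def decompEquiv (h : DirectSum.IsInternal gr) :
    M ≃ₗ[k] DirectSum ℤ (fun i => gr i) :=
  letI := h.chooseDecomposition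
  DirectSum.decomposeLinearEquiv gr

theorem decompEquiv_of_mem (h : DirectSum.IsInternal gr) {n : ℤ} {x : M} (hx : x ∈ gr n) :
    decompEquiv h x = DirectSum.lof k ℤ (fun i => gr i) n ⟨x, hx⟩ := by
  let _ := h.chooseDecomposition
  exact DirectSum.decompose_of_mem gr hx

/-- The projection to the component of degree `n`. -/
noncomputable def component (h : DirectSum.IsInternal gr) (n : ℤ) : M →ₗ[k] M :=
  (gr n).subtype ∘ₗ DirectSum.component k ℤ (fun i => gr i) n ∘ₗ (decompEquiv h).toLinearMap

theorem component_mem (h : DirectSum.IsInternal gr) (n : ℤ) (x : M) : component h n x ∈ gr n := by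
  simp [component]

theorem component_of_mem (h : DirectSum.IsInternal gr) {n : ℤ} {x : M} (hx : x ∈ gr n) :
    component h n x = x := by
  simp only [component, LinearMap.comp_apply, LinearEquiv.coe_coe, decompEquiv_of_mem h hx]
  rw [DirectSum.component.lof_self]
  rfl

theorem component_of_ne (h : DirectSum.IsInternal gr) {m n : ℤ} (hmn : m ≠ n) {x : M}
    (hx : x ∈ gr m) : component h n x = 0 := by
  simp only [component, LinearMap.comp_apply, LinearEquiv.coe_coe, decompEquiv_of_mem h hx]
  rw [DirectSum.component.of, dif_neg hmn, map_zero]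

theorem gr_induction (h : DirectSum.IsInternal gr) {p : M → Prop} (x : M)
    (hom : ∀ n, ∀ x ∈ gr n, p x) (zero : p 0) (add : ∀ x y, p x → p y → p (x + y)) : p x := by
  have hx : x ∈ iSup gr := by rw [h.submodule_iSup_eq_top]; trivial
  exact Submodule.iSup_induction gr (motive := p) hx hom zero add

theorem linearMap_ext_gr (h : DirectSum.IsInternal gr) {N : Type*} [AddCommGroup N] [Module k N]
    {f g : M →ₗ[k] N} (hfg : ∀ n, ∀ x ∈ gr n, f x = g x) : f = g := by
  ext x
  exact gr_induction h x hfg (by simp) (fun x y hx hy => by simp [hx, hy])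

theorem isInternal_of_separating {N : ℤ → Type*} [∀ n, AddCommGroup (N n)] [∀ n, Module k (N n)]
    (p : ∀ n, M →ₗ[k] N n) (hp : ∀ n, ∀ x ∈ gr n, p n x = 0 → x = 0)
    (hp' : ∀ m n, m ≠ n → ∀ x ∈ gr m, p n x = 0) (top : iSup gr = ⊤) :
    DirectSum.IsInternal gr := by
  refine ⟨?_, ?_⟩
  · rw [injective_iff_map_eq_zero]
    intro x hx
    ext n
    have h1 : p n (DirectSum.coeLinearMap gr x) = p n (x n) := by
      clear hx
      induction x using DirectSum.induction_on with
      | zero => simp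
      | of i y =>
        by_cases hin : i = n
        · subst hin; simp
        · rw [DirectSum.coeLinearMap_of, hp' i n hin _ y.2, DirectSum.of_eq_of_ne _ _ _ (Ne.symm hin)]
          simp
      | add a b ha hb => simp [ha, hb]
    have h2 : p n (x n) = 0 := by
      rw [← h1]
      have : DirectSum.coeLinearMap gr x = 0 := hx
      rw [this, map_zero]
    simpa using hp n _ (x n).2 h2
  · intro x
    have hx : x ∈ iSup gr := by rw [top]; trivial
    rw [← DirectSum.range_coeLinearMap] at hx
    exact hx

/-- The sign involution, `x ↦ (-1) ^ n x` for `x` of degree `n`. -/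
noncomputable def signMap (h : DirectSum.IsInternal gr) : M →ₗ[k] M :=
  DirectSum.toModule k ℤ M (fun n => n.negOnePow • (gr n).subtype) ∘ₗ (decompEquiv h).toLinearMap

theorem signMap_of_mem (h : DirectSum.IsInternal gr) {n : ℤ} {x : M} (hx : x ∈ gr n) :
    signMap h x = n.negOnePow • x := by
  simp only [signMap, LinearMap.comp_apply, LinearEquiv.coe_coe, decompEquiv_of_mem h hx,
    DirectSum.toModule_lof]
  rfl

end Gradings

/-! ### Representations of an affine group scheme `G = Spec O`, as right `O`-comodules -/

section Coactions

variable {k : Type*} [Field k] {O : Type*} [CommRing O] [HopfAlgebra k O]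
  {M N X : Type*} [AddCommGroup M] [Module k M] [AddCommGroup N] [Module k N]
  [AddCommGroup X] [Module k X]

/-- `ρ : M → M ⊗ O` is a (counital, coassociative) coaction of the coalgebra `O`. -/
structure IsCoaction (ρ : M →ₗ[k] M ⊗[k] O) : Prop where
  counit : ∀ m, slice (Coalgebra.counit (R := k) (A := O)) (ρ m) = m
  coassoc : ∀ m, TensorProduct.assoc k M O O (ρ.rTensor O (ρ m)) =
    (Coalgebra.comul (R := k) (A := O)).lTensor M (ρ m)

/-- For a bilinear `X × M → N`, the induced bilinear map `(X ⊗ R) × (M ⊗ R) → N ⊗ R`,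
`(x ⊗ r, m ⊗ s) ↦ x(m) ⊗ r s`. -/
noncomputable def act (R : Type*) [CommRing R] [Algebra k R] (j : X →ₗ[k] M →ₗ[k] N) :
    X ⊗[k] R →ₗ[k] M ⊗[k] R →ₗ[k] N ⊗[k] R :=
  TensorProduct.map₂ j (LinearMap.mul k R)

@[simp] theorem act_tmul {R : Type*} [CommRing R] [Algebra k R] (j : X →ₗ[k] M →ₗ[k] N)
    (x : X) (m : M) (r s : R) : act R j (x ⊗ₜ r) (m ⊗ₜ s) = j x m ⊗ₜ (r * s) := by
  simp [act, TensorProduct.map₂_apply_tmul]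

/-- The linear map `m ↦ f(m₀)₀ ⊗ f(m₀)₁ S(m₁)`: the coaction form of the action
`(x · f)(m) = x₁ f(S(x₂) m)` of the group ring on linear maps. -/
noncomputable def conj (ρM : M →ₗ[k] M ⊗[k] O) (ρN : N →ₗ[k] N ⊗[k] O) :
    (M →ₗ[k] N) →ₗ[k] M →ₗ[k] N ⊗[k] O :=
  LinearMap.mk₂ k
    (fun f m => (LinearMap.mul' k O).lTensor N (TensorProduct.assoc k N O O
      (ρN.rTensor O (TensorProduct.map f (HopfAlgebra.antipode k) (ρM m)))))
    (by intro f g m; simp [TensorProduct.map_add_left])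
    (by intro c f m; simp [TensorProduct.map_smul_left])
    (by intro f m n; simp)
    (by intro c f m; simp)

theorem conj_apply (ρM : M →ₗ[k] M ⊗[k] O) (ρN : N →ₗ[k] N ⊗[k] O) (f : M →ₗ[k] N) (m : M) :
    conj ρM ρN f m = (LinearMap.mul' k O).lTensor N (TensorProduct.assoc k N O O
      (ρN.rTensor O (TensorProduct.map f (HopfAlgebra.antipode k) (ρM m)))) := rfl

/-- A subspace `j : X → Hom(M, N)` is integrable if for all its elements `f`, the map `conj f`
comes from an element `∑ fᵢ ⊗ oᵢ` of `X ⊗ O`. -/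
def IsIntegrable (ρM : M →ₗ[k] M ⊗[k] O) (ρN : N →ₗ[k] N ⊗[k] O) (j : X →ₗ[k] M →ₗ[k] N) : Prop :=
  ∀ x, ∃ t : X ⊗[k] O, ∀ m, act O j t (m ⊗ₜ 1) = conj ρM ρN (j x) m

section
variable {R : Type*} [CommRing R] [Algebra k R]

/-- `y ↦ y · r` on `M ⊗ R`. -/
noncomputable def mulR (M : Type*) [AddCommGroup M] [Module k M] (r : R) :
    M ⊗[k] R →ₗ[k] M ⊗[k] R := (LinearMap.mulRight k r).lTensor M

@[simp] theorem mulR_tmul (m : M) (r s : R) : mulR (k := k) M r (m ⊗ₜ s) = m ⊗ₜ (s * r) := by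
  simp [mulR]

theorem act_mulR (j : X →ₗ[k] M →ₗ[k] N) (t : X ⊗[k] R) (y : M ⊗[k] R) (r : R) :
    act R j t (mulR M r y) = mulR N r (act R j t y) := by
  induction t with
  | zero => simp
  | add x y hx hy => simp [hx, hy]
  | tmul x s =>
    induction y with
    | zero => simp
    | add x y hx hy => simp [hx, hy]
    | tmul m s' => simp [mul_assoc]

theorem act_ext {j : X →ₗ[k] M →ₗ[k] N} (hj : Function.Injective j) {t t' : X ⊗[k] R}
    (h : ∀ m, act R j t (m ⊗ₜ 1) = act R j t' (m ⊗ₜ 1)) : t = t' := by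
  apply slice_ext
  intro φ
  apply hj
  ext m
  have key : ∀ t : X ⊗[k] R, slice φ (act R j t (m ⊗ₜ 1)) = j (slice φ t) m := by
    intro t
    induction t with
    | zero => simp
    | add x y hx hy => simp [hx, hy]
    | tmul x s => simp
  rw [← key, ← key, h]

theorem act_lTensor {R' : Type*} [CommRing R'] [Algebra k R'] (g : R →ₐ[k] R')
    (j : X →ₗ[k] M →ₗ[k] N) (t : X ⊗[k] R) (y : M ⊗[k] R) :
    act R' j (g.toLinearMap.lTensor X t) (g.toLinearMap.lTensor M y) =
      g.toLinearMap.lTensor N (act R j t y) := by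
  induction t with
  | zero => simp
  | add x y hx hy => simp [hx, hy]
  | tmul x s =>
    induction y with
    | zero => simp
    | add x y hx hy => simp only [map_add, hx, hy]
    | tmul m s' => simp

theorem mulR_lTensor {R' : Type*} [CommRing R'] [Algebra k R'] (g : R →ₐ[k] R')
    (y : M ⊗[k] R) (r : R) :
    g.toLinearMap.lTensor M (mulR M r y) = mulR M (g r) (g.toLinearMap.lTensor M y) := by
  induction y with
  | zero => simp
  | add x y hx hy => simp only [map_add, hx, hy]
  | tmul m s' => simp

theorem slice_act_counit (j : X →ₗ[k] M →ₗ[k] N) (t : X ⊗[k] O) (y : M ⊗[k] O) :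
    slice (Coalgebra.counit (R := k) (A := O)) (act O j t y) =
      j (slice Coalgebra.counit t) (slice Coalgebra.counit y) := by
  induction t with
  | zero => simp
  | add x y hx hy => simp [hx, hy]
  | tmul x s =>
    induction y with
    | zero => simp
    | add x y hx hy => simp only [map_add, hx, hy]
    | tmul m s' => simp [smul_smul, mul_comm]

end

/-- The `O`-linear extension `m ⊗ o ↦ ρ(m) o` of a coaction. -/
noncomputable def extendO (ρ : M →ₗ[k] M ⊗[k] O) : M ⊗[k] O →ₗ[k] M ⊗[k] O :=
  (LinearMap.mul' k O).lTensor M ∘ₗ (TensorProduct.assoc k M O O).toLinearMap ∘ₗ ρ.rTensor O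

theorem extendO_tmul (ρ : M →ₗ[k] M ⊗[k] O) (m : M) (o : O) :
    extendO ρ (m ⊗ₜ o) = mulR M o (ρ m) := by
  simp only [extendO, LinearMap.comp_apply, LinearMap.rTensor_tmul, LinearEquiv.coe_coe]
  induction ρ m with
  | zero => simp
  | add x y hx hy => simp only [map_add, TensorProduct.add_tmul, hx, hy]
  | tmul m s' => simp

theorem extendO_mulR (ρ : M →ₗ[k] M ⊗[k] O) (y : M ⊗[k] O) (o : O) :
    extendO ρ (mulR M o y) = mulR M o (extendO ρ y) := by
  induction y with
  | zero => simp
  | add x y hx hy => simp only [map_add, hx, hy]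
  | tmul m s' =>
    rw [mulR_tmul, extendO_tmul, extendO_tmul]
    induction ρ m with
    | zero => simp
    | add x y hx hy => simp only [map_add, hx, hy]
    | tmul m s => simp [mul_assoc]

theorem conj_eq_extendO (ρM : M →ₗ[k] M ⊗[k] O) (ρN : N →ₗ[k] N ⊗[k] O) (f : M →ₗ[k] N) (m : M) :
    conj ρM ρN f m = extendO ρN (TensorProduct.map f (HopfAlgebra.antipode k) (ρM m)) := rfl

/-- Helper: both composites of `ρ` with multiplication by the antipode. -/
theorem coassoc_antipode {ρ : M →ₗ[k] M ⊗[k] O} (hρ : IsCoaction ρ)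
    (b : O →ₗ[k] O →ₗ[k] O) (hb : ∀ o : O, TensorProduct.lift b (Coalgebra.comul (R := k) o) =
      algebraMap k O (Coalgebra.counit (R := k) o)) (m : M) :
    (TensorProduct.lift b).lTensor M (TensorProduct.assoc k M O O (ρ.rTensor O (ρ m))) =
      m ⊗ₜ 1 := by
  rw [hρ.coassoc, ← LinearMap.lTensor_comp_apply]
  have : ∀ y : M ⊗[k] O, (TensorProduct.lift b ∘ₗ Coalgebra.comul).lTensor M y
      = (slice Coalgebra.counit y) ⊗ₜ[k] (1 : O) := by
    intro y
    induction y with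
    | zero => simp
    | add x y hx hy => simp only [map_add, hx, hy, TensorProduct.add_tmul]
    | tmul m s =>
      simp only [LinearMap.lTensor_tmul, LinearMap.comp_apply, hb, slice_tmul]
      rw [Algebra.algebraMap_eq_smul_one, TensorProduct.tmul_smul, TensorProduct.smul_tmul']
  rw [this, hρ.counit]

theorem extendO_antipode {ρ : M →ₗ[k] M ⊗[k] O} (hρ : IsCoaction ρ) (m : M) :
    extendO ρ ((HopfAlgebra.antipode k (A := O)).lTensor M (ρ m)) = m ⊗ₜ 1 := by
  rw [← coassoc_antipode hρ ((LinearMap.mul k O).compl₂ (HopfAlgebra.antipode k)) _ m]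
  · induction ρ m with
    | zero => simp
    | add x y hx hy => simp only [map_add, hx, hy]
    | tmul m o =>
      simp only [LinearMap.lTensor_tmul, LinearMap.rTensor_tmul, extendO_tmul]
      induction ρ m with
      | zero => simp
      | add x y hx hy => simp only [map_add, hx, hy, TensorProduct.add_tmul]
      | tmul m s => simp
  · intro o
    rw [← HopfAlgebra.mul_antipode_lTensor_comul_apply]
    induction (Coalgebra.comul (R := k) o) with
    | zero => simp
    | add x y hx hy => simp only [map_add, hx, hy]
    | tmul m s => simp

theorem act_ext_coaction {R : Type*} [CommRing R] [Algebra k R] {ρM : M →ₗ[k] M ⊗[k] O}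
    (hM : IsCoaction ρM) (g : O →ₐ[k] R)
    {j : X →ₗ[k] M →ₗ[k] N} (hj : Function.Injective j) {t t' : X ⊗[k] R}
    (h : ∀ m, act R j t (g.toLinearMap.lTensor M (ρM m)) =
      act R j t' (g.toLinearMap.lTensor M (ρM m))) : t = t' := by
  apply act_ext hj
  intro m
  have key : ∀ y : M ⊗[k] O, act R j t (g.toLinearMap.lTensor M (extendO ρM y)) =
      act R j t' (g.toLinearMap.lTensor M (extendO ρM y)) := by
    intro y
    induction y with
    | zero => simp
    | add x y hx hy => simp only [map_add, hx, hy]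
    | tmul m o => rw [extendO_tmul, mulR_lTensor, act_mulR, act_mulR, h]
  have := key ((HopfAlgebra.antipode k (A := O)).lTensor M (ρM m))
  rw [extendO_antipode hM] at this
  simpa using this

theorem act_eval {ρM : M →ₗ[k] M ⊗[k] O} (hM : IsCoaction ρM) {ρN : N →ₗ[k] N ⊗[k] O}
    (j : X →ₗ[k] M →ₗ[k] N) (x : X) (t : X ⊗[k] O)
    (ht : ∀ m, act O j t (m ⊗ₜ 1) = conj ρM ρN (j x) m) (m : M) :
    act O j t (ρM m) = ρN (j x m) := by
  have h1 : ∀ y : M ⊗[k] O, act O j t y = extendO ρN ((j x).rTensor O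
      ((TensorProduct.lift ((LinearMap.mul k O).comp (HopfAlgebra.antipode k))).lTensor M
        (TensorProduct.assoc k M O O (ρM.rTensor O y)))) := by
    intro y
    induction y with
    | zero => simp
    | add x y hx hy => simp only [map_add, hx, hy]
    | tmul m o =>
      have : (m ⊗ₜ[k] o : M ⊗[k] O) = mulR M o (m ⊗ₜ 1) := by simp
      rw [this, act_mulR, ht, conj_eq_extendO, ← extendO_mulR, ← this, LinearMap.rTensor_tmul]
      congr 1
      induction ρM m with
      | zero => simp
      | add x y hx hy => simp only [map_add, hx, hy, TensorProduct.add_tmul]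
      | tmul m s => simp
  rw [h1, coassoc_antipode hM]
  · simp [extendO_tmul]
    induction ρN (j x m) with
    | zero => simp
    | add x y hx hy => simp only [map_add, hx, hy]
    | tmul m s => simp
  · intro o
    rw [← HopfAlgebra.mul_antipode_rTensor_comul_apply]
    induction (Coalgebra.comul (R := k) o) with
    | zero => simp
    | add x y hx hy => simp only [map_add, hx, hy]
    | tmul m s => simp

/-- The coaction on an integrable space of linear maps: `homCoact f = ∑ fᵢ ⊗ oᵢ` where
`conj f = ∑ fᵢ(-) ⊗ oᵢ`. -/
noncomputable def homCoact {ρM : M →ₗ[k] M ⊗[k] O} {ρN : N →ₗ[k] N ⊗[k] O}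
    {j : X →ₗ[k] M →ₗ[k] N} (hj : Function.Injective j) (h : IsIntegrable ρM ρN j) :
    X →ₗ[k] X ⊗[k] O where
  toFun x := (h x).choose
  map_add' x y := by
    apply act_ext hj
    intro m
    rw [(h (x + y)).choose_spec]
    simp only [map_add, LinearMap.add_apply, (h _).choose_spec]
  map_smul' c x := by
    apply act_ext hj
    intro m
    rw [(h (c • x)).choose_spec]
    simp only [map_smul, LinearMap.smul_apply, (h _).choose_spec, RingHom.id_apply]

theorem homCoact_spec {ρM : M →ₗ[k] M ⊗[k] O} {ρN : N →ₗ[k] N ⊗[k] O}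
    {j : X →ₗ[k] M →ₗ[k] N} (hj : Function.Injective j) (h : IsIntegrable ρM ρN j) (x : X) (m : M) :
    act O j (homCoact hj h x) (m ⊗ₜ 1) = conj ρM ρN (j x) m :=
  (h x).choose_spec m

theorem homCoact_eval {ρM : M →ₗ[k] M ⊗[k] O} (hM : IsCoaction ρM) {ρN : N →ₗ[k] N ⊗[k] O}
    {j : X →ₗ[k] M →ₗ[k] N} (hj : Function.Injective j) (h : IsIntegrable ρM ρN j) (x : X) (m : M) :
    act O j (homCoact hj h x) (ρM m) = ρN (j x m) :=
  act_eval hM j x _ (homCoact_spec hj h x) m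

theorem isCoaction_homCoact {ρM : M →ₗ[k] M ⊗[k] O} (hM : IsCoaction ρM)
    {ρN : N →ₗ[k] N ⊗[k] O} (hN : IsCoaction ρN)
    {j : X →ₗ[k] M →ₗ[k] N} (hj : Function.Injective j) (h : IsIntegrable ρM ρN j) :
    IsCoaction (homCoact hj h) where
  counit x := by
    apply hj
    ext m
    have := congrArg (slice (Coalgebra.counit (R := k) (A := O))) (homCoact_eval hM hj h x m)
    rw [slice_act_counit, hM.counit, hN.counit] at this
    exact this
  coassoc x := by
    apply act_ext_coaction hM (Bialgebra.comulAlgHom k O) hj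
    intro m
    have e : (Bialgebra.comulAlgHom k O).toLinearMap = Coalgebra.comul := rfl
    have h2 : ∀ (t : X ⊗[k] O) (y : M ⊗[k] O),
        act (O ⊗[k] O) j (TensorProduct.assoc k X O O ((homCoact hj h).rTensor O t))
          (TensorProduct.assoc k M O O (ρM.rTensor O y)) =
        TensorProduct.assoc k N O O (ρN.rTensor O (act O j t y)) := by
      intro t y
      induction t with
      | zero => simp
      | add x y hx hy => simp [hx, hy]
      | tmul x s =>
        induction y with
        | zero => simp
        | add x y hx hy => simp only [map_add, hx, hy]
        | tmul m s' =>
          simp only [LinearMap.rTensor_tmul, act_tmul]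
          rw [← homCoact_eval hM hj h x m]
          induction (homCoact hj h x) with
          | zero => simp
          | add x y hx hy => simp only [map_add, TensorProduct.add_tmul, LinearMap.add_apply, hx, hy]
          | tmul a b =>
            induction (ρM m) with
            | zero => simp
            | add x y hx hy => simp only [map_add, TensorProduct.add_tmul, hx, hy]
            | tmul a b => simp
    rw [e, ← hM.coassoc, h2, hM.coassoc, homCoact_eval hM, hN.coassoc, ← e, act_lTensor,
      homCoact_eval hM]

/-- Compatibility with a linear map is inherited by both sides of coassociativity. -/
theorem coassoc_natural {ρM : M →ₗ[k] M ⊗[k] O} {ρN : N →ₗ[k] N ⊗[k] O} (f : M →ₗ[k] N)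
    (hf : ∀ m, ρN (f m) = f.rTensor O (ρM m)) (t : M ⊗[k] O) :
    f.rTensor (O ⊗[k] O) (TensorProduct.assoc k M O O (ρM.rTensor O t)) =
      TensorProduct.assoc k N O O (ρN.rTensor O (f.rTensor O t)) := by
  induction t with
  | zero => simp
  | add x y hx hy => simp only [map_add, hx, hy]
  | tmul m o =>
    simp only [LinearMap.rTensor_tmul, hf]
    induction ρM m with
    | zero => simp
    | add x y hx hy => simp only [map_add, TensorProduct.add_tmul, hx, hy]
    | tmul x o => simp

theorem comul_natural (f : M →ₗ[k] N) (t : M ⊗[k] O) :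
    f.rTensor (O ⊗[k] O) ((Coalgebra.comul (R := k) (A := O)).lTensor M t) =
      (Coalgebra.comul (R := k) (A := O)).lTensor N (f.rTensor O t) := by
  induction t with
  | zero => simp
  | add x y hx hy => simp only [map_add, hx, hy]
  | tmul x o => simp

theorem IsCoaction.of_injective {ρM : M →ₗ[k] M ⊗[k] O} {ρN : N →ₗ[k] N ⊗[k] O}
    (hN : IsCoaction ρN) (f : M →ₗ[k] N) (hf : ∀ m, ρN (f m) = f.rTensor O (ρM m))
    (inj : Function.Injective f) : IsCoaction ρM where
  counit m := by
    apply inj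
    rw [← slice_rTensor, ← hf, hN.counit]
  coassoc m := by
    apply rTensor_injective (W := O ⊗[k] O) inj
    rw [coassoc_natural f hf, comul_natural, ← hf, hN.coassoc]

theorem IsCoaction.of_surjective {ρM : M →ₗ[k] M ⊗[k] O} {ρN : N →ₗ[k] N ⊗[k] O}
    (hM : IsCoaction ρM) (f : M →ₗ[k] N) (hf : ∀ m, ρN (f m) = f.rTensor O (ρM m))
    (surj : Function.Surjective f) : IsCoaction ρN where
  counit n := by
    obtain ⟨m, rfl⟩ := surj n
    rw [hf, slice_rTensor, hM.counit]
  coassoc n := by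
    obtain ⟨m, rfl⟩ := surj n
    rw [hf, ← coassoc_natural f hf, ← comul_natural, hM.coassoc]

end Coactions

/-! ### Quasi-isomorphisms -/

/-- A chain map `f : (M, dM) → (N, dN)` induces a bijection `ker dM / im dM → ker dN / im dN`. -/
def IsQuasiIso {k M N : Type*} [Field k] [AddCommGroup M] [Module k M] [AddCommGroup N] [Module k N]
    (dM : M →ₗ[k] M) (dN : N →ₗ[k] N) (f : M →ₗ[k] N) : Prop :=
  (∀ x, dM x = 0 → (∃ w, f x = dN w) → ∃ v, x = dM v) ∧
    (∀ y, dN y = 0 → ∃ x, dM x = 0 ∧ ∃ w, y = f x + dN w)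

/-! ### dg `G`-algebras -/

/-- A dg `G`-algebra, `G = Spec O`: a cochain dg algebra (written as the direct sum of its graded
pieces) with a coaction of `O` for which the pieces are subrepresentations and the product, unit and
differential are `G`-linear. -/
structure DGGAlgebra (k : Type u) [Field k] (O : Type u) [CommRing O] [HopfAlgebra k O] where
  carrier : Type u
  [ring : Ring carrier]
  [algebra : Algebra k carrier]
  gr : ℤ → Submodule k carrier
  isInternal : DirectSum.IsInternal gr
  gradedMonoid : SetLike.GradedMonoid gr
  d : carrier →ₗ[k] carrier
  d_mem : ∀ {n x}, x ∈ gr n → d x ∈ gr (n + 1)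
  d_d : ∀ x, d (d x) = 0
  leibniz : ∀ {n x} (y), x ∈ gr n → d (x * y) = d x * y + n.negOnePow • (x * d y)
  coact : carrier →ₐ[k] carrier ⊗[k] O
  isCoaction : IsCoaction coact.toLinearMap
  coact_gr : ∀ {n x}, x ∈ gr n → coact x ∈ LinearMap.range ((gr n).subtype.rTensor O)
  coact_d : ∀ x, coact (d x) = d.rTensor O (coact x)

attribute [instance] DGGAlgebra.ring DGGAlgebra.algebra

namespace DGGAlgebra

variable {k : Type u} [Field k] {O : Type u} [CommRing O] [HopfAlgebra k O]

/-- Morphisms of dg `G`-algebras. -/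
structure Hom (A B : DGGAlgebra k O) where
  toAlgHom : A.carrier →ₐ[k] B.carrier
  map_gr : ∀ {n x}, x ∈ A.gr n → toAlgHom x ∈ B.gr n
  map_d : ∀ x, toAlgHom (A.d x) = B.d (toAlgHom x)
  map_coact : ∀ x, B.coact (toAlgHom x) = toAlgHom.toLinearMap.rTensor O (A.coact x)

/-- `G`-linear dg algebra quasi-isomorphisms. -/
def Hom.QuasiIso {A B : DGGAlgebra k O} (f : Hom A B) : Prop :=
  IsQuasiIso A.d B.d f.toAlgHom.toLinearMap

/-- Equivariant homotopy isomorphism: the existence of a finite zig-zag of `G`-linear dg algebra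
quasi-isomorphisms from `A` to `B`. -/
def HomotopyIso (A B : DGGAlgebra k O) : Prop :=
  Relation.EqvGen (fun A B : DGGAlgebra k O => ∃ f : Hom A B, f.QuasiIso) A B

variable (A : DGGAlgebra k O)

theorem one_mem : (1 : A.carrier) ∈ A.gr 0 := A.gradedMonoid.one_mem

theorem d_one : A.d 1 = 0 := by
  have := A.leibniz (1 : A.carrier) A.one_mem
  simpa using this

theorem d_algebraMap (c : k) : A.d (algebraMap k A.carrier c) = 0 := by
  rw [Algebra.algebraMap_eq_smul_one, map_smul, d_one, smul_zero]

theorem d_mul (x y : A.carrier) :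
    A.d (x * y) = A.d x * y + signMap A.isInternal x * A.d y := by
  refine gr_induction (p := fun x => A.d (x * y) = A.d x * y + signMap A.isInternal x * A.d y) A.isInternal x ?_ (by simp) ?_
  · intro n x hx
    rw [A.leibniz y hx, signMap_of_mem _ hx, smul_mul_assoc]
  · intro x x' h h'
    simp only [add_mul, map_add, h, h']
    abel

theorem signMap_signMap (x : A.carrier) : signMap A.isInternal (signMap A.isInternal x) = x := by
  refine gr_induction (p := fun x => signMap A.isInternal (signMap A.isInternal x) = x) A.isInternal x ?_ (by simp) ?_
  · intro n x hx
    rw [signMap_of_mem _ hx, Units.smul_def, map_zsmul, signMap_of_mem _ hx, ← Units.smul_def,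
      smul_smul, Int.units_mul_self, one_smul]
  · intro x x' h h'
    simp only [map_add, h, h']

theorem d_signMap (x : A.carrier) :
    A.d (signMap A.isInternal x) = - signMap A.isInternal (A.d x) := by
  refine gr_induction (p := fun x => A.d (signMap A.isInternal x) = - signMap A.isInternal (A.d x)) A.isInternal x ?_ (by simp) ?_
  · intro n x hx
    rw [signMap_of_mem _ hx, signMap_of_mem _ (A.d_mem hx), Units.smul_def, map_zsmul,
      ← Units.smul_def, Int.negOnePow_succ, Units.smul_def, Units.smul_def]
    simp
  · intro x x' h h'
    simp only [map_add, h, h']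
    abel

/-- The subalgebra of cocycles. -/
def cocycles : Subalgebra k A.carrier where
  carrier := {x | A.d x = 0}
  mul_mem' {x y} hx hy := by
    simp only [Set.mem_ofPred_eq] at *
    rw [d_mul, hx, hy]; simp
  add_mem' {x y} hx hy := by
    simp only [Set.mem_ofPred_eq] at *
    rw [map_add, hx, hy, add_zero]
  algebraMap_mem' c := A.d_algebraMap c

/-- The two-sided ideal of coboundaries in the algebra of cocycles. -/
def coboundaries : Ideal A.cocycles where
  carrier := {x | ∃ w, A.d w = x}
  add_mem' := by
    rintro x y ⟨w, hw⟩ ⟨v, hv⟩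
    exact ⟨w + v, by simp [hw, hv]⟩
  zero_mem' := ⟨0, by simp⟩
  smul_mem' := by
    rintro z x ⟨w, hw⟩
    refine ⟨signMap A.isInternal z * w, ?_⟩
    have hz : A.d z = 0 := z.2
    rw [d_mul, d_signMap, hz, signMap_signMap, hw]
    simp

instance : A.coboundaries.IsTwoSided where
  mul_mem_of_left := by
    rintro x z ⟨w, hw⟩
    refine ⟨w * z, ?_⟩
    have hz : A.d z = 0 := z.2
    rw [d_mul, hz, hw]
    simp

/-- The underlying algebra of the cohomology `H^*(A)`. -/
abbrev Cohomology : Type u := A.cocycles ⧸ A.coboundaries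

/-- The class of a cocycle. -/
noncomputable abbrev cls : A.cocycles →ₐ[k] A.Cohomology := Ideal.Quotient.mkₐ k A.coboundaries

theorem cls_surjective : Function.Surjective A.cls := Ideal.Quotient.mkₐ_surjective k _

theorem cls_eq_zero (x : A.cocycles) : A.cls x = 0 ↔ ∃ w, A.d w = x :=
  Ideal.Quotient.eq_zero_iff_mem

/-- The classes of cocycles of degree `n`. -/
noncomputable def cohomologyGr (n : ℤ) : Submodule k A.Cohomology :=
  ((A.gr n).comap A.cocycles.val.toLinearMap).map A.cls.toLinearMap

theorem mem_cohomologyGr {n : ℤ} {y : A.Cohomology} :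
    y ∈ A.cohomologyGr n ↔ ∃ x : A.cocycles, (x : A.carrier) ∈ A.gr n ∧ A.cls x = y := by
  simp only [cohomologyGr, Submodule.mem_map, Submodule.mem_comap]
  rfl

theorem d_component (n : ℤ) (x : A.carrier) :
    A.d (component A.isInternal n x) = component A.isInternal (n + 1) (A.d x) := by
  refine gr_induction (p := fun x => A.d (component A.isInternal n x) = component A.isInternal (n + 1) (A.d x)) A.isInternal x ?_ (by simp) ?_
  · intro m x hx
    by_cases h : m = n
    · subst h
      rw [component_of_mem _ hx, component_of_mem _ (A.d_mem hx)]
    · rw [component_of_ne _ h hx, component_of_ne _ (by omega) (A.d_mem hx), map_zero]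
  · intro x x' h h'
    simp only [map_add, h, h']

/-- The component of degree `n` on cocycles. -/
noncomputable def cocycleComponent (n : ℤ) : A.cocycles →ₗ[k] A.cocycles :=
  (component A.isInternal n).restrict (p := Subalgebra.toSubmodule A.cocycles)
    (q := Subalgebra.toSubmodule A.cocycles) (fun x hx => by
    change A.d x = 0 at hx
    change A.d _ = 0
    rw [d_component, hx, map_zero])

theorem cohomology_isInternal : DirectSum.IsInternal A.cohomologyGr := by
  let p : ∀ n : ℤ, A.Cohomology →ₗ[k] A.Cohomology := fun n =>
    ((A.coboundaries).restrictScalars k).liftQ (A.cls.toLinearMap ∘ₗ A.cocycleComponent n) (by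
      intro x hx
      obtain ⟨w, hw⟩ := hx
      simp only [LinearMap.mem_ker, LinearMap.comp_apply, AlgHom.toLinearMap_apply]
      rw [cls_eq_zero]
      refine ⟨component A.isInternal (n - 1) w, ?_⟩
      rw [d_component, hw, sub_add_cancel]
      rfl)
  have hp : ∀ n x, p n (A.cls x) = A.cls (A.cocycleComponent n x) := fun n x => rfl
  refine isInternal_of_separating p ?_ ?_ ?_
  · intro n y hy h
    obtain ⟨x, hx, rfl⟩ := A.mem_cohomologyGr.1 hy
    rw [hp] at h
    have : A.cocycleComponent n x = x := Subtype.ext (component_of_mem A.isInternal hx)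
    rwa [this] at h
  · intro m n hmn y hy
    obtain ⟨x, hx, rfl⟩ := A.mem_cohomologyGr.1 hy
    rw [hp]
    have : A.cocycleComponent n x = 0 := Subtype.ext (component_of_ne A.isInternal hmn hx)
    rw [this, map_zero]
  · rw [eq_top_iff]
    rintro y -
    obtain ⟨x, rfl⟩ := A.cls_surjective y
    have hx : (x : A.carrier) ∈ LinearMap.range (DirectSum.coeLinearMap A.gr) := by
      rw [DirectSum.range_coeLinearMap, A.isInternal.submodule_iSup_eq_top]; trivial
    obtain ⟨s, hs⟩ := hx
    classical
    have hsum : x = ∑ n ∈ s.support, A.cocycleComponent n x := by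
      apply Subtype.ext
      rw [AddSubmonoidClass.coe_finsetSum]
      have h2 : ∀ n, ((A.cocycleComponent n x : A.cocycles) : A.carrier) = s n := by
        intro n
        change component A.isInternal n (x : A.carrier) = s n
        have : (decompEquiv A.isInternal) x = s := by
          rw [← hs]
          clear hs
          induction s using DirectSum.induction_on with
          | zero => simp
          | of i y => rw [DirectSum.coeLinearMap_of, decompEquiv_of_mem _ y.2]; rfl
          | add a b ha hb => simp [ha, hb]
        simp only [component, LinearMap.comp_apply, LinearEquiv.coe_coe, this]
        rfl
      simp only [h2]
      rw [← hs, DirectSum.coeLinearMap_eq_dfinsuppSum]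
      rfl
    rw [hsum, map_sum]
    refine Submodule.sum_mem _ (fun n _ => Submodule.mem_iSup_of_mem n ?_)
    exact A.mem_cohomologyGr.2 ⟨_, component_mem A.isInternal n _, rfl⟩

theorem coact_mem_cocycles (x : A.cocycles) :
    A.coact x ∈ LinearMap.range
      ((Subalgebra.toSubmodule A.cocycles).subtype.rTensor O) := by
  rw [mem_range_rTensor_iff]
  intro φ
  change A.d _ = 0
  have hx : A.d x = 0 := x.2
  rw [← slice_rTensor, ← coact_d, hx, map_zero, map_zero]

theorem cocycles_tensor_injective :
    Function.Injective (Algebra.TensorProduct.map A.cocycles.val (AlgHom.id k O)) :=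
  rTensor_injective (W := O) (f := A.cocycles.val.toLinearMap) Subtype.val_injective

/-- The coaction on cocycles. -/
noncomputable def cocycleCoact : A.cocycles →ₐ[k] A.cocycles ⊗[k] O :=
  (AlgEquiv.ofInjective _ A.cocycles_tensor_injective).symm.toAlgHom.comp
    ((A.coact.comp A.cocycles.val).codRestrict _ (fun x => A.coact_mem_cocycles x))

theorem cocycleCoact_spec (x : A.cocycles) :
    (A.cocycles.val.toLinearMap).rTensor O (A.cocycleCoact x) = A.coact x := by
  have := AlgEquiv.apply_symm_apply (AlgEquiv.ofInjective _ A.cocycles_tensor_injective)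
    (((A.coact.comp A.cocycles.val).codRestrict _ (fun x => A.coact_mem_cocycles x)) x)
  exact congrArg Subtype.val this

theorem slice_cocycleCoact (φ : O →ₗ[k] k) (x : A.cocycles) :
    ((slice φ (A.cocycleCoact x) : A.cocycles) : A.carrier) = slice φ (A.coact x) := by
  rw [← cocycleCoact_spec, slice_rTensor]
  rfl

/-- The induced coaction on cohomology. -/
noncomputable def cohomologyCoact : A.Cohomology →ₐ[k] A.Cohomology ⊗[k] O :=
  Ideal.Quotient.liftₐ A.coboundaries
    ((Algebra.TensorProduct.map A.cls (AlgHom.id k O)).comp A.cocycleCoact) (by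
      rintro x ⟨w, hw⟩
      apply slice_ext
      intro φ
      rw [map_zero]
      change slice φ (A.cls.toLinearMap.rTensor O (A.cocycleCoact x)) = 0
      rw [slice_rTensor, AlgHom.toLinearMap_apply, cls_eq_zero]
      refine ⟨slice φ (A.coact w), ?_⟩
      rw [slice_cocycleCoact, ← hw, coact_d, slice_rTensor])

theorem cohomologyCoact_cls (x : A.cocycles) :
    A.cohomologyCoact (A.cls x) = A.cls.toLinearMap.rTensor O (A.cocycleCoact x) := rfl

theorem isCoaction_cocycleCoact : IsCoaction A.cocycleCoact.toLinearMap :=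
  A.isCoaction.of_injective A.cocycles.val.toLinearMap
    (fun x => (A.cocycleCoact_spec x).symm) Subtype.val_injective

theorem isCoaction_cohomologyCoact : IsCoaction A.cohomologyCoact.toLinearMap :=
  A.isCoaction_cocycleCoact.of_surjective A.cls.toLinearMap
    (fun x => A.cohomologyCoact_cls x) A.cls_surjective

/-- The cohomology `H^*(A)` as a dg `G`-algebra with zero differential. -/
noncomputable def cohomology : DGGAlgebra k O where
  carrier := A.Cohomology
  gr := A.cohomologyGr
  isInternal := A.cohomology_isInternal
  gradedMonoid :=
    { one_mem := A.mem_cohomologyGr.2 ⟨1, A.one_mem, map_one _⟩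
      mul_mem := by
        intro m n x y hx hy
        obtain ⟨x, hx', rfl⟩ := A.mem_cohomologyGr.1 hx
        obtain ⟨y, hy', rfl⟩ := A.mem_cohomologyGr.1 hy
        exact A.mem_cohomologyGr.2 ⟨x * y, A.gradedMonoid.mul_mem hx' hy', map_mul _ _ _⟩ }
  d := 0
  d_mem _ := by simp
  d_d _ := by simp
  leibniz _ _ := by simp
  coact := A.cohomologyCoact
  isCoaction := A.isCoaction_cohomologyCoact
  coact_gr := by
    intro n y hy
    obtain ⟨x, hx, rfl⟩ := A.mem_cohomologyGr.1 hy
    rw [mem_range_rTensor_iff]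
    intro φ
    rw [cohomologyCoact_cls, slice_rTensor]
    refine A.mem_cohomologyGr.2 ⟨slice φ (A.cocycleCoact x), ?_, rfl⟩
    rw [slice_cocycleCoact]
    exact (mem_range_rTensor_iff _ _).1 (A.coact_gr hx) φ
  coact_d _ := by simp

/-- `A` is equivariantly formal: equivariantly homotopy isomorphic to its cohomology. -/
def EquivariantlyFormal : Prop := HomotopyIso A A.cohomology

end DGGAlgebra

/-! ### Algebras generated by a representation placed in one degree -/

section Generated

variable {k : Type u} [Field k] {O : Type u} [CommRing O] [HopfAlgebra k O]
  {V : Type u} [AddCommGroup V] [Module k V]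

/-- The grading on an algebra generated by `ι : V → R`, with the generators in degree `e`: the
piece of degree `i * e` is spanned by the products of `i` generators. -/
def genGr {R : Type*} [Ring R] [Algebra k R] (ι : V →ₗ[k] R) (e n : ℤ) : Submodule k R :=
  ⨆ (i : ℕ) (_ : (i : ℤ) * e = n), (LinearMap.range ι) ^ i

variable {R : Type u} [Ring R] [Algebra k R] {ι : V →ₗ[k] R} {e : ℤ}

theorem pow_le_genGr (i : ℕ) : (LinearMap.range ι) ^ i ≤ genGr ι e (i * e) :=
  le_iSup₂_of_le i rfl le_rfl

theorem genGr_induction {n : ℤ} {p : R → Prop} {x : R} (hx : x ∈ genGr ι e n)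
    (pow : ∀ i : ℕ, (i : ℤ) * e = n → ∀ x ∈ (LinearMap.range ι) ^ i, p x) (zero : p 0)
    (add : ∀ x y, p x → p y → p (x + y)) : p x := by
  refine Submodule.iSup_induction _ (motive := p) hx ?_ zero add
  intro i y hy
  exact Submodule.iSup_induction _ (motive := p) hy (fun h z hz => pow i h z hz) zero add

theorem ι_mem_genGr (v : V) : ι v ∈ genGr ι e e := by
  have := pow_le_genGr (ι := ι) (e := e) 1 (x := ι v) (by rw [pow_one]; exact ⟨v, rfl⟩)
  simpa using this

theorem genGr_gradedMonoid : SetLike.GradedMonoid (genGr ι e) where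
  one_mem := by
    have := pow_le_genGr (ι := ι) (e := e) 0 (x := 1) (by rw [pow_zero]; exact Submodule.one_le.1 le_rfl)
    simpa using this
  mul_mem := by
    intro m n x y hx hy
    refine genGr_induction (p := fun x => x * y ∈ genGr ι e (m + n)) hx ?_ (by simp)
      (fun a b ha hb => by rw [add_mul]; exact add_mem ha hb)
    intro i hi a ha
    refine genGr_induction (p := fun y => a * y ∈ genGr ι e (m + n)) hy ?_ (by simp)
      (fun a b ha hb => by rw [mul_add]; exact add_mem ha hb)
    intro j hj b hb
    have := pow_le_genGr (ι := ι) (e := e) (i + j) (x := a * b)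
      (by rw [pow_add]; exact Submodule.mul_mem_mul ha hb)
    rw [← hi, ← hj, ← add_mul, ← Nat.cast_add]
    exact this

theorem genGr_iSup (htop : Algebra.adjoin k (Set.range ι) = ⊤) : iSup (genGr ι e) = ⊤ := by
  have hm := genGr_gradedMonoid (ι := ι) (e := e)
  let S : Subalgebra k R := Submodule.toSubalgebra (iSup (genGr ι e))
    (Submodule.mem_iSup_of_mem 0 hm.one_mem) (by
      intro x y hx hy
      refine Submodule.iSup_induction _ (motive := fun x => x * y ∈ iSup (genGr ι e)) hx ?_ (by simp)
        (fun a b ha hb => by rw [add_mul]; exact add_mem ha hb)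
      intro i a ha
      refine Submodule.iSup_induction _ (motive := fun y => a * y ∈ iSup (genGr ι e)) hy ?_ (by simp)
        (fun a b ha hb => by rw [mul_add]; exact add_mem ha hb)
      intro j b hb
      exact Submodule.mem_iSup_of_mem (i + j) (hm.mul_mem ha hb))
  have : (⊤ : Subalgebra k R) ≤ S := by
    rw [← htop]
    refine Algebra.adjoin_le ?_
    rintro _ ⟨v, rfl⟩
    exact Submodule.mem_iSup_of_mem e (ι_mem_genGr v)
  rw [eq_top_iff]
  intro x _
  exact this (Algebra.mem_top (x := x))

theorem genGr_weight {w : R →ₐ[k] AddMonoidAlgebra R ℤ}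
    (hw : ∀ v, w (ι v) = AddMonoidAlgebra.single e (ι v)) {n : ℤ} {x : R} (hx : x ∈ genGr ι e n) :
    w x = AddMonoidAlgebra.single n x := by
  refine genGr_induction (p := fun x => w x = AddMonoidAlgebra.single n x) hx ?_ (by simp)
    (fun a b ha hb => by rw [map_add, ha, hb, AddMonoidAlgebra.single_add])
  intro i hi x hx'
  subst hi
  clear hx
  induction hx' using Submodule.pow_induction_on_left' with
  | algebraMap r =>
    rw [AlgHom.commutes]
    simp [AddMonoidAlgebra.coe_algebraMap]
  | add x y i hx hy ihx ihy => rw [map_add, ihx, ihy, AddMonoidAlgebra.single_add]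
  | mem_mul m hm i x hx ih =>
    obtain ⟨v, rfl⟩ := hm
    rw [map_mul, hw, ih, AddMonoidAlgebra.single_mul_single]
    congr 1
    push_cast
    ring

theorem genGr_isInternal (htop : Algebra.adjoin k (Set.range ι) = ⊤)
    {w : R →ₐ[k] AddMonoidAlgebra R ℤ} (hw : ∀ v, w (ι v) = AddMonoidAlgebra.single e (ι v)) :
    DirectSum.IsInternal (genGr ι e) := by
  let c : ∀ n : ℤ, R →ₗ[k] R := fun n =>
    { toFun := fun x => (w x).coeff n
      map_add' := by intro x y; simp
      map_smul' := by intro a x; simp }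
  refine isInternal_of_separating c ?_ ?_ (genGr_iSup htop)
  · intro n x hx h
    change (w x).coeff n = 0 at h
    rw [genGr_weight hw hx, AddMonoidAlgebra.coeff_single, Finsupp.single_eq_same] at h
    exact h
  · intro m n hmn x hx
    change (w x).coeff n = 0
    rw [genGr_weight hw hx, AddMonoidAlgebra.coeff_single, Finsupp.single_eq_of_ne (Ne.symm hmn)]

theorem gen_isCoaction (htop : Algebra.adjoin k (Set.range ι) = ⊤) {ρV : V →ₗ[k] V ⊗[k] O}
    (hV : IsCoaction ρV) {ρ : R →ₐ[k] R ⊗[k] O} (hρ : ∀ v, ρ (ι v) = ι.rTensor O (ρV v)) :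
    IsCoaction ρ.toLinearMap where
  counit := by
    have h1 : (((Algebra.TensorProduct.rid k k R).toAlgHom.comp
        (Algebra.TensorProduct.map (AlgHom.id k R) (Bialgebra.counitAlgHom k O))).comp ρ) =
        AlgHom.id k R := by
      apply AlgHom.ext_of_adjoin_eq_top htop
      rintro _ ⟨v, rfl⟩
      have h2 := hV.counit v
      have h3 : slice (Coalgebra.counit (R := k) (A := O)) (ρ (ι v)) = ι v := by
        rw [hρ, slice_rTensor, h2]
      exact h3
    intro m
    exact congrArg (fun f : R →ₐ[k] R => f m) h1
  coassoc := by
    have h1 : (((Algebra.TensorProduct.assoc k k k R O O).toAlgHom.comp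
        (Algebra.TensorProduct.map ρ (AlgHom.id k O))).comp ρ) =
        (Algebra.TensorProduct.map (AlgHom.id k R) (Bialgebra.comulAlgHom k O)).comp ρ := by
      apply AlgHom.ext_of_adjoin_eq_top htop
      rintro _ ⟨v, rfl⟩
      have h3 : TensorProduct.assoc k R O O (ρ.toLinearMap.rTensor O (ρ (ι v))) =
          (Coalgebra.comul (R := k) (A := O)).lTensor R (ρ (ι v)) := by
        rw [hρ, ← coassoc_natural ι hρ, hV.coassoc, comul_natural]
      exact h3
    intro m
    exact congrArg (fun f : R →ₐ[k] R ⊗[k] (O ⊗[k] O) => f m) h1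

theorem mul_mem_range_rTensor {X Y Z : Submodule k R} (h : X * Y ≤ Z) {s t : R ⊗[k] O}
    (hs : s ∈ LinearMap.range (X.subtype.rTensor O))
    (ht : t ∈ LinearMap.range (Y.subtype.rTensor O)) :
    s * t ∈ LinearMap.range (Z.subtype.rTensor O) := by
  obtain ⟨s, rfl⟩ := hs
  obtain ⟨t, rfl⟩ := ht
  induction s with
  | zero => simp
  | add x y hx hy => rw [map_add, add_mul]; exact add_mem hx hy
  | tmul x o =>
    induction t with
    | zero => simp
    | add x y hx hy => rw [map_add, mul_add]; exact add_mem hx hy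
    | tmul y o' =>
      refine ⟨⟨(x : R) * y, h (Submodule.mul_mem_mul x.2 y.2)⟩ ⊗ₜ (o * o'), ?_⟩
      simp

theorem gen_coact_gr {ρV : V →ₗ[k] V ⊗[k] O} {ρ : R →ₐ[k] R ⊗[k] O}
    (hρ : ∀ v, ρ (ι v) = ι.rTensor O (ρV v)) {n : ℤ} {x : R} (hx : x ∈ genGr ι e n) :
    ρ x ∈ LinearMap.range ((genGr ι e n).subtype.rTensor O) := by
  refine genGr_induction
    (p := fun x => ρ x ∈ LinearMap.range ((genGr ι e n).subtype.rTensor O)) hx ?_ (by simp)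
    (fun a b ha hb => by rw [map_add]; exact add_mem ha hb)
  intro i hi x hx'
  subst hi
  clear hx
  induction hx' using Submodule.pow_induction_on_left' with
  | algebraMap r =>
    rw [AlgHom.commutes]
    have := (genGr_gradedMonoid (ι := ι) (e := e)).one_mem
    refine ⟨⟨algebraMap k R r, ?_⟩ ⊗ₜ 1, ?_⟩
    · rw [Algebra.algebraMap_eq_smul_one]
      refine Submodule.smul_mem _ _ ?_
      simpa using this
    · simp
  | add x y i hx hy ihx ihy => rw [map_add]; exact add_mem ihx ihy
  | mem_mul m hm i x hx ih =>
    obtain ⟨v, rfl⟩ := hm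
    rw [map_mul]
    refine mul_mem_range_rTensor (X := genGr ι e e) (Y := genGr ι e (i * e)) ?_ ?_ ih
    · rw [Submodule.mul_le]
      intro a ha b hb
      have := (genGr_gradedMonoid (ι := ι) (e := e)).mul_mem ha hb
      have h : ((i.succ : ℕ) : ℤ) * e = e + i * e := by push_cast; ring
      rw [h]
      exact this
    · rw [hρ]
      refine ⟨(ι.codRestrict (genGr ι e e) ι_mem_genGr).rTensor O (ρV v), ?_⟩
      rw [← LinearMap.rTensor_comp_apply]
      rfl

/-- The dg `G`-algebra with zero differential whose underlying algebra is generated by a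
representation `V` placed in degree `e`. The map `w` witnesses that the grading exists. -/
noncomputable def genAlgebra (ι : V →ₗ[k] R) (e : ℤ)
    (htop : Algebra.adjoin k (Set.range ι) = ⊤) (w : R →ₐ[k] AddMonoidAlgebra R ℤ)
    (hw : ∀ v, w (ι v) = AddMonoidAlgebra.single e (ι v)) (ρV : V →ₗ[k] V ⊗[k] O)
    (hV : IsCoaction ρV) (ρ : R →ₐ[k] R ⊗[k] O) (hρ : ∀ v, ρ (ι v) = ι.rTensor O (ρV v)) :
    DGGAlgebra k O where
  carrier := R
  gr := genGr ι e
  isInternal := genGr_isInternal htop hw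
  gradedMonoid := genGr_gradedMonoid
  d := 0
  d_mem _ := by simp
  d_d _ := by simp
  leibniz _ _ := by simp
  coact := ρ
  isCoaction := gen_isCoaction htop hV hρ
  coact_gr hx := gen_coact_gr hρ hx
  coact_d _ := by simp

/-- The coaction on the symmetric algebra of a representation. -/
noncomputable def symCoact (ρV : V →ₗ[k] V ⊗[k] O) :
    SymmetricAlgebra k V →ₐ[k] SymmetricAlgebra k V ⊗[k] O :=
  SymmetricAlgebra.lift ((SymmetricAlgebra.ι k V).rTensor O ∘ₗ ρV)

theorem sym_adjoin : Algebra.adjoin k (Set.range (SymmetricAlgebra.ι k V)) = ⊤ := by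
  rw [eq_top_iff]
  rintro x -
  induction x using SymmetricAlgebra.induction with
  | algebraMap r => exact Subalgebra.algebraMap_mem _ r
  | ι v => exact Algebra.subset_adjoin ⟨v, rfl⟩
  | mul x y hx hy => exact mul_mem hx hy
  | add x y hx hy => exact add_mem hx hy

/-- `Sym(V)` with `V` in an even degree `e`, as a dg `G`-algebra with zero differential. -/
noncomputable def symAlgebra (e : ℤ) (ρV : V →ₗ[k] V ⊗[k] O) (hV : IsCoaction ρV) :
    DGGAlgebra k O :=
  genAlgebra (SymmetricAlgebra.ι k V) e sym_adjoin
    (SymmetricAlgebra.lift (AddMonoidAlgebra.lsingle e ∘ₗ SymmetricAlgebra.ι k V))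
    (fun v => SymmetricAlgebra.lift_ι_apply _ v) ρV hV (symCoact ρV)
    (fun v => SymmetricAlgebra.lift_ι_apply _ v)

theorem ext_square_zero (t : V ⊗[k] O) :
    (ExteriorAlgebra.ι k (M := V)).rTensor O t * (ExteriorAlgebra.ι k).rTensor O t = 0 := by
  have anti : ∀ t s : V ⊗[k] O, (ExteriorAlgebra.ι k (M := V)).rTensor O t *
      (ExteriorAlgebra.ι k).rTensor O s + (ExteriorAlgebra.ι k (M := V)).rTensor O s *
      (ExteriorAlgebra.ι k).rTensor O t = 0 := by
    intro t s
    induction t with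
    | zero => simp
    | add x y hx hy =>
      rw [map_add, add_mul, mul_add, add_add_add_comm, hx, hy, add_zero]
    | tmul v o =>
      induction s with
      | zero => simp
      | add x y hx hy =>
        rw [map_add, add_mul, mul_add, add_add_add_comm, hx, hy, add_zero]
      | tmul v' o' =>
        simp only [LinearMap.rTensor_tmul, Algebra.TensorProduct.tmul_mul_tmul]
        rw [mul_comm o' o, ← TensorProduct.add_tmul, ExteriorAlgebra.ι_add_mul_swap,
          TensorProduct.zero_tmul]
  induction t with
  | zero => simp
  | tmul v o => simp
  | add x y hx hy =>
    rw [map_add, add_mul, mul_add, mul_add, hx, hy, zero_add, add_zero, anti]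

/-- The coaction on the exterior algebra of a representation. -/
noncomputable def extCoact (ρV : V →ₗ[k] V ⊗[k] O) :
    ExteriorAlgebra k V →ₐ[k] ExteriorAlgebra k V ⊗[k] O :=
  ExteriorAlgebra.lift k ⟨(ExteriorAlgebra.ι k).rTensor O ∘ₗ ρV, fun v => ext_square_zero (ρV v)⟩

theorem ext_adjoin : Algebra.adjoin k (Set.range (ExteriorAlgebra.ι k (M := V))) = ⊤ := by
  rw [eq_top_iff]
  rintro x -
  induction x using ExteriorAlgebra.induction with
  | algebraMap r => exact Subalgebra.algebraMap_mem _ r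
  | ι v => exact Algebra.subset_adjoin ⟨v, rfl⟩
  | mul x y hx hy => exact mul_mem hx hy
  | add x y hx hy => exact add_mem hx hy

/-- `∧(V)` with `V` in an odd degree `e`, as a dg `G`-algebra with zero differential. -/
noncomputable def extAlgebra (e : ℤ) (ρV : V →ₗ[k] V ⊗[k] O) (hV : IsCoaction ρV) :
    DGGAlgebra k O :=
  genAlgebra (ExteriorAlgebra.ι k) e ext_adjoin
    (ExteriorAlgebra.lift k ⟨AddMonoidAlgebra.lsingle e ∘ₗ ExteriorAlgebra.ι k, fun v => by
      change AddMonoidAlgebra.single e _ * AddMonoidAlgebra.single e _ = 0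
      rw [AddMonoidAlgebra.single_mul_single, ExteriorAlgebra.ι_sq_zero, AddMonoidAlgebra.single_zero]⟩)
    (fun v => ExteriorAlgebra.lift_ι_apply k _ _ v) ρV hV (extCoact ρV)
    (fun v => ExteriorAlgebra.lift_ι_apply k _ _ v)

end Generated

/-! ### The parametrization algebra `Z` and its cotangent space -/

section Contragredient

variable {k : Type*} [Field k] {O : Type*} [CommRing O] [HopfAlgebra k O]
  {V : Type*} [AddCommGroup V] [Module k V]

/-- The coaction of the trivial representation. -/
noncomputable def trivialCoact (k O : Type*) [Field k] [CommRing O] [HopfAlgebra k O] :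
    k →ₗ[k] k ⊗[k] O := (TensorProduct.mk k k O).flip 1

theorem isCoaction_trivialCoact : IsCoaction (trivialCoact k O) where
  counit m := by simp [trivialCoact]
  coassoc m := by simp [trivialCoact, Algebra.TensorProduct.one_def]

theorem dual_isIntegrable [Module.Finite k V] (ρV : V →ₗ[k] V ⊗[k] O) :
    IsIntegrable ρV (trivialCoact k O) (LinearMap.id : Module.Dual k V →ₗ[k] _) := by
  intro ξ
  let g : V →ₗ[k] O := (TensorProduct.lid k O).toLinearMap ∘ₗ conj ρV (trivialCoact k O) ξ
  refine ⟨(dualTensorHomEquiv k V O).symm g, fun m => ?_⟩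
  have h : ∀ t : Module.Dual k V ⊗[k] O, TensorProduct.lid k O
      (act O (LinearMap.id : Module.Dual k V →ₗ[k] _) t (m ⊗ₜ 1)) = dualTensorHomEquiv k V O t m := by
    intro t
    induction t with
    | zero => simp
    | add x y hx hy => simp [hx, hy]
    | tmul x o => simp
  apply (TensorProduct.lid k O).injective
  rw [h, LinearEquiv.apply_symm_apply]
  rfl

/-- The contragredient representation `V^*`, with the coaction `ξ ↦ (v ↦ ξ(v₀) S(v₁))`. -/
noncomputable def dualCoact [Module.Finite k V] (ρV : V →ₗ[k] V ⊗[k] O) :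
    Module.Dual k V →ₗ[k] Module.Dual k V ⊗[k] O :=
  homCoact (fun _ _ h => h) (dual_isIntegrable ρV)

theorem isCoaction_dualCoact [Module.Finite k V] {ρV : V →ₗ[k] V ⊗[k] O} (hV : IsCoaction ρV) :
    IsCoaction (dualCoact ρV) :=
  isCoaction_homCoact hV isCoaction_trivialCoact _ _

end Contragredient

/-- A commutative augmented `G`-algebra `Z` which is isomorphic, as an algebra, to a ring of power
series in finitely many variables; the augmentation `Z → k` is `G`-linear. -/
structure ParamAlgebra (k : Type u) [Field k] (O : Type u) [CommRing O] [HopfAlgebra k O] where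
  carrier : Type u
  [commRing : CommRing carrier]
  [algebra : Algebra k carrier]
  coact : carrier →ₐ[k] carrier ⊗[k] O
  isCoaction : IsCoaction coact.toLinearMap
  aug : carrier →ₐ[k] k
  aug_coact : ∀ z, aug.toLinearMap.rTensor O (coact z) = aug z ⊗ₜ 1
  exists_powerSeries : ∃ n : ℕ, Nonempty (carrier ≃ₐ[k] MvPowerSeries (Fin n) k)

attribute [instance] ParamAlgebra.commRing ParamAlgebra.algebra

namespace ParamAlgebra

variable {k : Type u} [Field k] {O : Type u} [CommRing O] [HopfAlgebra k O] (P : ParamAlgebra k O)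

/-- The maximal ideal `m_Z`. -/
def maxIdeal : Ideal P.carrier := RingHom.ker P.aug

/-- The cotangent space `m_Z / m_Z²`. -/
abbrev Cot : Type u := P.maxIdeal.Cotangent

instance : IsNoetherianRing P.carrier := by
  obtain ⟨n, ⟨f⟩⟩ := P.exists_powerSeries
  exact isNoetherianRing_of_ringEquiv _ f.symm.toRingEquiv

/-- The class in `m_Z / m_Z²` of `z - aug z`. -/
noncomputable def diff : P.carrier →ₗ[k] P.Cot :=
  (P.maxIdeal.toCotangent.restrictScalars k) ∘ₗ
    ((LinearMap.id - (Algebra.linearMap k P.carrier) ∘ₗ P.aug.toLinearMap).codRestrict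
      (P.maxIdeal.restrictScalars k) (fun z => by
        change P.aug _ = 0
        simp))

theorem diff_of_mem (z : P.maxIdeal) : P.diff z = P.maxIdeal.toCotangent z := by
  have hz : P.aug z = 0 := z.2
  refine congrArg P.maxIdeal.toCotangent (Subtype.ext ?_)
  change (z : P.carrier) - algebraMap k P.carrier (P.aug z) = z
  rw [hz, map_zero, sub_zero]

theorem diff_surjective : Function.Surjective P.diff := by
  intro v
  obtain ⟨z, rfl⟩ := P.maxIdeal.toCotangent_surjective v
  exact ⟨z, P.diff_of_mem z⟩

/-- `z ↦ z - aug z` is an `aug`-derivation into the cotangent space. -/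
theorem diff_mul (x y : P.carrier) :
    P.diff (x * y) = P.aug x • P.diff y + P.aug y • P.diff x := by
  have hd : ∀ z (hz : z ∈ P.maxIdeal), P.diff z = P.maxIdeal.toCotangent ⟨z, hz⟩ :=
    fun z hz => P.diff_of_mem ⟨z, hz⟩
  have h1 : P.diff 1 = 0 := by
    change P.maxIdeal.toCotangent _ = 0
    have : ∀ w : P.maxIdeal, (w : P.carrier) = 0 → P.maxIdeal.toCotangent w = 0 := by
      intro w hw
      rw [show w = 0 from Subtype.ext hw, map_zero]
    apply this
    change (1 : P.carrier) - algebraMap k P.carrier (P.aug 1) = 0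
    simp
  have hc : ∀ c : k, P.diff (algebraMap k P.carrier c) = 0 := by
    intro c
    rw [Algebra.algebraMap_eq_smul_one, map_smul, h1, smul_zero]
  have hm : ∀ z, z - algebraMap k P.carrier (P.aug z) ∈ P.maxIdeal := by
    intro z
    change P.aug _ = 0
    simp
  have key : P.diff ((x - algebraMap k P.carrier (P.aug x)) *
      (y - algebraMap k P.carrier (P.aug y))) = 0 := by
    rw [hd _ (Ideal.mul_mem_left _ _ (hm y)), Ideal.toCotangent_eq_zero]
    rw [pow_two]
    exact Ideal.mul_mem_mul (hm x) (hm y)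
  have e : (x - algebraMap k P.carrier (P.aug x)) * (y - algebraMap k P.carrier (P.aug y)) =
      x * y - (P.aug x) • y - (P.aug y) • x + algebraMap k P.carrier (P.aug x * P.aug y) := by
    rw [Algebra.smul_def, Algebra.smul_def, map_mul]
    ring
  rw [e, map_add, map_sub, map_sub, hc, map_smul, map_smul] at key
  rw [add_zero, sub_sub, sub_eq_zero] at key
  exact key

theorem diff_mul_tensor (s t : P.carrier ⊗[k] O) :
    P.diff.rTensor O (s * t) =
      mulR P.Cot (TensorProduct.lid k O (P.aug.toLinearMap.rTensor O s)) (P.diff.rTensor O t) +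
      mulR P.Cot (TensorProduct.lid k O (P.aug.toLinearMap.rTensor O t)) (P.diff.rTensor O s) := by
  have ha : ∀ (r r' : O) (y : P.Cot ⊗[k] O), mulR P.Cot (r + r') y = mulR P.Cot r y + mulR P.Cot r' y := by
    intro r r' y
    induction y with
    | zero => simp
    | add x y hx hy => simp only [map_add, hx, hy]; abel
    | tmul v o => simp [mul_add, TensorProduct.tmul_add]
  induction s with
  | zero =>
    have h0 : ∀ y : P.Cot ⊗[k] O, mulR P.Cot 0 y = 0 := by intro y; simp [mulR]
    simp [h0]
  | add x y hx hy =>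
    rw [add_mul, map_add, hx, hy]
    simp only [map_add, ha]
    abel
  | tmul z o =>
    induction t with
    | zero =>
      have h0 : ∀ y : P.Cot ⊗[k] O, mulR P.Cot 0 y = 0 := by intro y; simp [mulR]
      simp [h0]
    | add x y hx hy =>
      rw [mul_add, map_add, hx, hy]
      simp only [map_add, ha]
      abel
    | tmul z' o' =>
      simp only [Algebra.TensorProduct.tmul_mul_tmul, LinearMap.rTensor_tmul, diff_mul,
        AlgHom.toLinearMap_apply, TensorProduct.lid_tmul, mulR_tmul, TensorProduct.add_tmul]
      rw [mul_smul_comm, mul_smul_comm, mul_comm o' o]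
      exact congrArg₂ (· + ·) (TensorProduct.smul_tmul _ _ _) (TensorProduct.smul_tmul _ _ _)

/-- The representation `m_Z / m_Z²`: `[z] ↦ [z₀] ⊗ z₁`. -/
noncomputable def cotCoact : P.Cot →ₗ[k] P.Cot ⊗[k] O :=
  ((LinearMap.ker P.diff).liftQ (P.diff.rTensor O ∘ₗ P.coact.toLinearMap) (by
    intro z hz
    -- `z = aug z + (element of m²)`
    have hz' : P.maxIdeal.toCotangent ⟨z - algebraMap k P.carrier (P.aug z), by
      change P.aug _ = 0; simp⟩ = 0 := hz
    rw [Ideal.toCotangent_eq_zero] at hz'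
    have hm : ∀ w ∈ P.maxIdeal ^ 2, P.diff.rTensor O (P.coact w) = 0 := by
      intro w hw
      rw [pow_two] at hw
      refine Submodule.mul_induction_on hw ?_ ?_
      · intro a ha b hb
        have ha' : P.aug a = 0 := ha
        have hb' : P.aug b = 0 := hb
        rw [map_mul, diff_mul_tensor, aug_coact, aug_coact, ha', hb']
        simp [mulR]
      · intro a b ha hb
        rw [map_add, map_add, ha, hb, add_zero]
    have h1 := hm _ hz'
    have h2 : P.diff.rTensor O (P.coact (algebraMap k P.carrier (P.aug z))) = 0 := by
      rw [AlgHom.commutes, Algebra.TensorProduct.algebraMap_apply, LinearMap.rTensor_tmul]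
      have : P.diff (algebraMap k P.carrier (P.aug z)) = 0 := by
        have := P.diff_mul (algebraMap k P.carrier (P.aug z)) 1
        have h1 : P.diff 1 = 0 := by
          have := P.diff_mul 1 1
          simpa using this
        rw [Algebra.algebraMap_eq_smul_one, map_smul, h1, smul_zero]
      rw [this, TensorProduct.zero_tmul]
    rw [map_sub, map_sub, h2, sub_zero] at h1
    exact h1)) ∘ₗ (P.diff.quotKerEquivOfSurjective P.diff_surjective).symm.toLinearMap

theorem cotCoact_diff (z : P.carrier) : P.cotCoact (P.diff z) = P.diff.rTensor O (P.coact z) := by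
  have : (P.diff.quotKerEquivOfSurjective P.diff_surjective).symm (P.diff z) =
      Submodule.Quotient.mk z := by
    rw [LinearEquiv.symm_apply_eq]
    rfl
  simp only [cotCoact, LinearMap.comp_apply, LinearEquiv.coe_coe, this]
  rfl

theorem isCoaction_cotCoact : IsCoaction P.cotCoact :=
  P.isCoaction.of_surjective P.diff P.cotCoact_diff P.diff_surjective

instance : Module.Finite k P.Cot := by
  have h0 : Module.Finite P.carrier P.maxIdeal :=
    Module.Finite.iff_fg.2 (IsNoetherian.noetherian P.maxIdeal)
  have h1 : Module.Finite P.carrier P.Cot :=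
    Module.Finite.of_surjective P.maxIdeal.toCotangent P.maxIdeal.toCotangent_surjective
  obtain ⟨s, hs⟩ := h1
  refine ⟨s, ?_⟩
  rw [eq_top_iff]
  rintro v -
  have hv : v ∈ Submodule.span P.carrier (s : Set P.Cot) := by rw [hs]; trivial
  induction hv using Submodule.span_induction with
  | mem x hx => exact Submodule.subset_span hx
  | zero => exact zero_mem _
  | add x y _ _ hx hy => exact add_mem hx hy
  | smul z x _ hx =>
    have : z • x = P.aug z • x := by
      obtain ⟨w, rfl⟩ := P.maxIdeal.toCotangent_surjective x
      have hz : z - algebraMap k P.carrier (P.aug z) ∈ P.maxIdeal := by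
        change P.aug _ = 0
        simp
      have h0 := Ideal.Cotangent.smul_eq_zero_of_mem hz (P.maxIdeal.toCotangent w)
      rw [sub_smul, algebraMap_smul, sub_eq_zero] at h0
      exact h0
    rw [this]
    exact Submodule.smul_mem _ _ hx

/-- `A_Z = Sym(Σ⁻² (m_Z / m_Z²)^*)`: the symmetric algebra of the contragredient representation
in degree `2`, with zero differential. -/
noncomputable def A : DGGAlgebra k O :=
  symAlgebra 2 (dualCoact P.cotCoact) (isCoaction_dualCoact P.isCoaction_cotCoact)

/-- `Sym(Σ m_Z / m_Z²) = ∧^*(m_Z / m_Z²)`: the exterior algebra on the cotangent representation in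
degree `-1`, with zero differential. -/
noncomputable def B : DGGAlgebra k O :=
  extAlgebra (-1) P.cotCoact P.isCoaction_cotCoact

end ParamAlgebra

/-! ### Equivariant Koszul resolutions -/

section Koszul

variable {k : Type u} [Field k] {O : Type u} [CommRing O] [HopfAlgebra k O]

/-- A `G`-equivariant dg `Z`-algebra: a dg `G`-algebra `K` with a `G`-linear map of dg algebras from
`Z` (in degree `0`) to the centre of `K`. -/
structure EquivariantDGAlgebra (P : ParamAlgebra k O) extends DGGAlgebra k O where
  unit : P.carrier →ₐ[k] carrier
  unit_central : ∀ z x, unit z * x = x * unit z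
  unit_mem : ∀ z, unit z ∈ gr 0
  d_unit : ∀ z, d (unit z) = 0
  coact_unit : ∀ z, coact (unit z) = unit.toLinearMap.rTensor O (P.coact z)

namespace EquivariantDGAlgebra

variable {P : ParamAlgebra k O} (K : EquivariantDGAlgebra P)

noncomputable instance : Algebra P.carrier K.carrier :=
  RingHom.toAlgebra' K.unit.toRingHom K.unit_central

theorem smul_eq (z : P.carrier) (x : K.carrier) : z • x = K.unit z * x := rfl

theorem d_unit_mul (z : P.carrier) (x : K.carrier) : K.d (K.unit z * x) = K.unit z * K.d x := by
  rw [K.leibniz x (K.unit_mem z), K.d_unit]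
  simp

/-- The subspace `m_Z K`. -/
def maxMul : Submodule k K.carrier :=
  Submodule.span k {y | ∃ z ∈ P.maxIdeal, ∃ x, y = K.unit z * x}

/-- `K` is a finitely generated `Z`-module. -/
def IsFinite : Prop := Module.Finite P.carrier K.carrier

/-- `K` is a flat `Z`-module. -/
def IsFlat : Prop := Module.Flat P.carrier K.carrier

/-- The reduction `k ⊗_Z K = K / m_Z K`. -/
abbrev Red : Type u := K.carrier ⧸ K.maxMul

/-- The differential of `k ⊗_Z K`. -/
def redD : K.Red →ₗ[k] K.Red :=
  K.maxMul.mapQ K.maxMul K.d (by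
    refine Submodule.span_le.2 ?_
    rintro _ ⟨z, hz, x, rfl⟩
    exact Submodule.subset_span ⟨z, hz, K.d x, K.d_unit_mul z x⟩)

/-- The map `k ⊗_Z K → B` induced by a map of `Z`-algebras `K → B`, where `Z` acts on `B` through
its augmentation. -/
def redMap {B : Type u} [Ring B] [Algebra k B] (f : K.carrier →ₐ[k] B)
    (hf : ∀ z, f (K.unit z) = algebraMap k B (P.aug z)) : K.Red →ₗ[k] B :=
  K.maxMul.liftQ f.toLinearMap (by
    refine Submodule.span_le.2 ?_
    rintro _ ⟨z, hz, x, rfl⟩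
    have hz' : P.aug z = 0 := hz
    change f _ = 0
    rw [map_mul, hf, hz', map_zero, zero_mul])

end EquivariantDGAlgebra

/-- An equivariant Koszul resolution of `k` over `Z`: an equivariant dg `Z`-algebra `K`, finite and
flat over `Z`, with an equivariant dg algebra quasi-isomorphism `eps : K → k` and an equivariant dg
algebra map `pi : K → Sym(Σ m_Z / m_Z²)` which reduces to a quasi-isomorphism on `k ⊗_Z K`. -/
structure EquivariantKoszulResolution (P : ParamAlgebra k O) extends EquivariantDGAlgebra P where
  finite : toEquivariantDGAlgebra.IsFinite
  flat : toEquivariantDGAlgebra.IsFlat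
  eps : carrier →ₐ[k] k
  eps_unit : ∀ z, eps (unit z) = P.aug z
  eps_gr : ∀ {n x}, n ≠ 0 → x ∈ gr n → eps x = 0
  eps_d : ∀ x, eps (d x) = 0
  eps_coact : ∀ x, eps.toLinearMap.rTensor O (coact x) = eps x ⊗ₜ 1
  eps_quasiIso : IsQuasiIso d 0 eps.toLinearMap
  pi : DGGAlgebra.Hom toDGGAlgebra P.B
  pi_unit : ∀ z, pi.toAlgHom (unit z) = algebraMap k P.B.carrier (P.aug z)
  pi_quasiIso : IsQuasiIso toEquivariantDGAlgebra.redD P.B.d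
    (toEquivariantDGAlgebra.redMap pi.toAlgHom pi_unit)

end Koszul

/-! ### dg modules over `K ⊗_Z K`

A dg module over the enveloping algebra `K ⊗_Z K` (formed with the opposite multiplication on the
second factor, which for graded commutative `K` is the multiplication of `K`) is the same thing as a
`Z`-central dg `K`-bimodule, via `(a ⊗ b) m = (-1)^(|b| |m|) a m b`. -/

section Bimodules

variable {k : Type u} [Field k] {O : Type u} [CommRing O] [HopfAlgebra k O]
  {P : ParamAlgebra k O}

/-- A (non-equivariant) dg module over `K ⊗_Z K`, as a `Z`-central dg `K`-bimodule with
`left a m = a m` and `right b m = m b`. -/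
structure DGBimodule (K : EquivariantDGAlgebra P) where
  carrier : Type u
  [addCommGroup : AddCommGroup carrier]
  [module : Module k carrier]
  gr : ℤ → Submodule k carrier
  isInternal : DirectSum.IsInternal gr
  d : carrier →ₗ[k] carrier
  d_mem : ∀ {n x}, x ∈ gr n → d x ∈ gr (n + 1)
  d_d : ∀ x, d (d x) = 0
  left : K.carrier →ₗ[k] carrier →ₗ[k] carrier
  left_one : ∀ m, left 1 m = m
  left_mul : ∀ a b m, left (a * b) m = left a (left b m)
  right : K.carrier →ₗ[k] carrier →ₗ[k] carrier
  right_one : ∀ m, right 1 m = m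
  right_mul : ∀ a b m, right (a * b) m = right b (right a m)
  left_right : ∀ a b m, left a (right b m) = right b (left a m)
  central : ∀ z m, left (K.unit z) m = right (K.unit z) m
  left_mem : ∀ {p q a m}, a ∈ K.gr p → m ∈ gr q → left a m ∈ gr (p + q)
  right_mem : ∀ {p q b m}, b ∈ K.gr p → m ∈ gr q → right b m ∈ gr (q + p)
  d_left : ∀ {p a} (m), a ∈ K.gr p → d (left a m) = left (K.d a) m + p.negOnePow • left a (d m)
  d_right : ∀ {q m} (b), m ∈ gr q → d (right b m) = right b (d m) + q.negOnePow • right (K.d b) m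

attribute [instance] DGBimodule.addCommGroup DGBimodule.module

namespace DGBimodule

variable {K : EquivariantDGAlgebra P}

/-- Morphisms of dg modules over `K ⊗_Z K`. -/
structure Hom (X Y : DGBimodule K) where
  toLinearMap : X.carrier →ₗ[k] Y.carrier
  map_gr : ∀ {n x}, x ∈ X.gr n → toLinearMap x ∈ Y.gr n
  map_d : ∀ x, toLinearMap (X.d x) = Y.d (toLinearMap x)
  map_left : ∀ a x, toLinearMap (X.left a x) = Y.left a (toLinearMap x)
  map_right : ∀ b x, toLinearMap (X.right b x) = Y.right b (toLinearMap x)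

variable (X : DGBimodule K)

/-- The map `K ⊗_Z K → X`, `a ⊗ b ↦ a e b`, determined by an element `e`. -/
noncomputable def orbit (e : X.carrier) : K.carrier ⊗[P.carrier] K.carrier →+ X.carrier :=
  TensorProduct.liftAddHom
    (AddMonoidHom.mk' (fun a => AddMonoidHom.mk' (fun b => X.left a (X.right b e))
      (by intro b b'; simp)) (by intro a a'; ext b; simp))
    (by
      intro z a b
      change X.left (z • a) (X.right b e) = X.left a (X.right (z • b) e)
      rw [K.smul_eq, K.smul_eq, K.unit_central, X.left_mul, K.unit_central, X.right_mul,
        X.central])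

@[simp] theorem orbit_tmul (e : X.carrier) (a b : K.carrier) :
    X.orbit e (a ⊗ₜ b) = X.left a (X.right b e) := rfl

/-- `X` is a free dg module `⊕_j Σ^(n_j) (K ⊗_Z K)`: it has a basis over `K ⊗_Z K` which consists
of homogeneous cocycles. -/
def IsFree : Prop :=
  ∃ (J : Type u) (deg : J → ℤ) (e : J → X.carrier),
    (∀ j, e j ∈ X.gr (deg j)) ∧ (∀ j, X.d (e j) = 0) ∧
    Function.Bijective
      (Finsupp.liftAddHom (fun j => X.orbit (e j)) :
        (J →₀ K.carrier ⊗[P.carrier] K.carrier) →+ X.carrier)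

/-- `X` is a direct summand of a free dg module. -/
def IsSummandOfFree : Prop :=
  ∃ (Y : DGBimodule K) (i : Hom X Y) (r : Hom Y X), Y.IsFree ∧
    ∀ x, r.toLinearMap (i.toLinearMap x) = x

/-- `X` is semi-projective: it has an exhaustive filtration `F(0) ⊆ F(1) ⊆ ⋯` by dg submodules such
that each `F(i) / F(i - 1)` (where `F(-1) = 0`) is isomorphic to a summand of a free dg module. -/
def IsSemiprojective : Prop :=
  ∃ (F : ℕ → DGBimodule K) (ι : ∀ i, Hom (F i) X),
    (∀ i, Function.Injective (ι i).toLinearMap) ∧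
    (∀ i, LinearMap.range (ι i).toLinearMap ≤ LinearMap.range (ι (i + 1)).toLinearMap) ∧
    (∀ x, ∃ i, x ∈ LinearMap.range (ι i).toLinearMap) ∧
    (∃ (Q : DGBimodule K) (p : Hom (F 0) Q), Q.IsSummandOfFree ∧
      Function.Bijective p.toLinearMap) ∧
    ∀ i, ∃ (Q : DGBimodule K) (p : Hom (F (i + 1)) Q), Q.IsSummandOfFree ∧
      Function.Surjective p.toLinearMap ∧
      ∀ x, p.toLinearMap x = 0 ↔
        (ι (i + 1)).toLinearMap x ∈ LinearMap.range (ι i).toLinearMap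

/-- The `K ⊗_Z K`-linear maps `X → X` of degree `n`: for `f` of degree `n`,
`f(a m) = (-1)^(n |a|) a f(m)` and `f(m b) = f(m) b`. -/
def endDeg (n : ℤ) : Submodule k (Module.End k X.carrier) where
  carrier := {f | (∀ q, ∀ m ∈ X.gr q, f m ∈ X.gr (q + n)) ∧
    (∀ p, ∀ a ∈ K.gr p, ∀ m, f (X.left a m) = (n * p).negOnePow • X.left a (f m)) ∧
    (∀ b m, f (X.right b m) = X.right b (f m))}
  add_mem' := by
    rintro f g ⟨h1, h2, h3⟩ ⟨h1', h2', h3'⟩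
    refine ⟨fun q m hm => add_mem (h1 q m hm) (h1' q m hm), fun p a ha m => ?_, fun b m => ?_⟩
    · simp only [LinearMap.add_apply, h2 p a ha, h2' p a ha, map_add, smul_add]
    · simp only [LinearMap.add_apply, h3, h3', map_add]
  zero_mem' := by
    refine ⟨fun q m hm => ?_, fun p a ha m => ?_, fun b m => ?_⟩ <;> simp
  smul_mem' := by
    rintro c f ⟨h1, h2, h3⟩
    refine ⟨fun q m hm => Submodule.smul_mem _ c (h1 q m hm), fun p a ha m => ?_, fun b m => ?_⟩
    · simp only [LinearMap.smul_apply, h2 p a ha, map_smul]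
      rw [smul_comm]
    · simp only [LinearMap.smul_apply, h3, map_smul]

variable {X}

theorem endDeg_one : (1 : Module.End k X.carrier) ∈ X.endDeg 0 := by
  refine ⟨fun q m hm => by simpa using hm, fun p a ha m => ?_, fun b m => rfl⟩
  simp

theorem endDeg_mul {m n : ℤ} {f g : Module.End k X.carrier} (hf : f ∈ X.endDeg m)
    (hg : g ∈ X.endDeg n) : f * g ∈ X.endDeg (m + n) := by
  refine ⟨fun q x hx => ?_, fun p a ha x => ?_, fun b x => ?_⟩
  · have := hf.1 _ _ (hg.1 _ _ hx)
    rw [add_assoc, add_comm n m] at this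
    exact this
  · rw [Module.End.mul_apply, hg.2.1 p a ha, Units.smul_def, map_zsmul, ← Units.smul_def,
      hf.2.1 p a ha, smul_smul, ← Int.negOnePow_add, add_mul, add_comm (n * p)]
    rfl
  · rw [Module.End.mul_apply, hg.2.2, hf.2.2]
    rfl

theorem endDeg_sign {n : ℤ} {f : Module.End k X.carrier} (hf : f ∈ X.endDeg n) (x : X.carrier) :
    signMap X.isInternal (f (signMap X.isInternal x)) = n.negOnePow • f x := by
  refine gr_induction (p := fun x => signMap X.isInternal (f (signMap X.isInternal x)) =
    n.negOnePow • f x) X.isInternal x ?_ (by simp) ?_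
  · intro q x hx
    rw [signMap_of_mem _ hx, Units.smul_def, map_zsmul, map_zsmul, signMap_of_mem _ (hf.1 _ _ hx),
      ← Units.smul_def, smul_smul, Int.negOnePow_add, ← mul_assoc, Int.units_mul_self, one_mul]
  · intro x y hx hy
    simp only [map_add, hx, hy, smul_add]

variable (X)

/-- The differential on endomorphisms, `D f = d f - (-1)^n f d` for `f` of degree `n`. -/
noncomputable def endD : Module.End k X.carrier →ₗ[k] Module.End k X.carrier :=
  LinearMap.mulLeft k X.d - LinearMap.mulLeft k (signMap X.isInternal) ∘ₗ
    LinearMap.mulRight k (signMap X.isInternal * X.d)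

variable {X}

theorem endD_apply (f : Module.End k X.carrier) (x : X.carrier) : X.endD f x =
    X.d (f x) - signMap X.isInternal (f (signMap X.isInternal (X.d x))) := rfl

theorem endD_of_mem {n : ℤ} {f : Module.End k X.carrier} (hf : f ∈ X.endDeg n) (x : X.carrier) :
    X.endD f x = X.d (f x) - n.negOnePow • f (X.d x) := by
  rw [endD_apply, endDeg_sign hf]

theorem endD_mem {n : ℤ} {f : Module.End k X.carrier} (hf : f ∈ X.endDeg n) :
    X.endD f ∈ X.endDeg (n + 1) := by
  refine ⟨fun q m hm => ?_, fun p a ha m => ?_, fun b m => ?_⟩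
  · rw [endD_of_mem hf, Units.smul_def]
    refine sub_mem ?_ (zsmul_mem ?_ _)
    · have := X.d_mem (hf.1 _ _ hm)
      rwa [add_assoc] at this
    · have := hf.1 _ _ (X.d_mem hm)
      rwa [add_assoc, add_comm 1 n] at this
  · rw [endD_of_mem hf, endD_of_mem hf, hf.2.1 p a ha, X.d_left m ha, map_add,
      hf.2.1 _ _ (K.d_mem ha), Units.smul_def, map_zsmul, X.d_left _ ha]
    have h1 : (n * (p + 1)).negOnePow = (n * p).negOnePow * n.negOnePow := by
      rw [← Int.negOnePow_add]; congr 1; ring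
    have h2 : ((n + 1) * p).negOnePow = (n * p).negOnePow * p.negOnePow := by
      rw [← Int.negOnePow_add]; congr 1; ring
    have h3 : f (p.negOnePow • X.left a (X.d m)) =
        p.negOnePow • (n * p).negOnePow • X.left a (f (X.d m)) := by
      rw [Units.smul_def, map_zsmul, hf.2.1 p a ha, ← Units.smul_def]
    rw [h3, h1, h2]
    have h4 : X.left a (n.negOnePow • f (X.d m)) = n.negOnePow • X.left a (f (X.d m)) := by
      rw [Units.smul_def, map_zsmul, ← Units.smul_def]
    rw [map_sub, h4]
    rcases Int.units_eq_one_or n.negOnePow with hn | hn <;>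
    rcases Int.units_eq_one_or p.negOnePow with hp | hp <;>
    rcases Int.units_eq_one_or (n * p).negOnePow with hnp | hnp <;>
    rw [hn, hp, hnp] <;> simp <;> abel
  · refine gr_induction (p := fun m => X.endD f (X.right b m) = X.right b (X.endD f m))
      X.isInternal m ?_ (by simp) (fun x y hx hy => by simp only [map_add, hx, hy])
    intro q m hm
    rw [endD_of_mem hf, endD_of_mem hf, hf.2.2, X.d_right b (hf.1 _ _ hm), X.d_right b hm, map_add,
      hf.2.2]
    have h3 : f (q.negOnePow • X.right (K.d b) m) = q.negOnePow • X.right (K.d b) (f m) := by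
      rw [Units.smul_def, map_zsmul, hf.2.2, ← Units.smul_def]
    have h4 : X.right b (n.negOnePow • f (X.d m)) = n.negOnePow • X.right b (f (X.d m)) := by
      rw [Units.smul_def, map_zsmul, ← Units.smul_def]
    rw [h3, map_sub, h4, Int.negOnePow_add]
    rcases Int.units_eq_one_or n.negOnePow with hn | hn <;>
    rcases Int.units_eq_one_or q.negOnePow with hp | hp <;>
    rw [hn, hp] <;> simp

theorem endD_endD {n : ℤ} {f : Module.End k X.carrier} (hf : f ∈ X.endDeg n) :
    X.endD (X.endD f) = 0 := by
  ext x
  rw [endD_of_mem (endD_mem hf), endD_of_mem hf, endD_of_mem hf, map_sub, X.d_d, X.d_d,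
    Int.negOnePow_succ]
  simp only [Units.smul_def, map_zsmul, map_zero, smul_zero]
  simp

theorem endD_mul {n : ℤ} {f : Module.End k X.carrier} (hf : f ∈ X.endDeg n)
    {m : ℤ} {g : Module.End k X.carrier} (hg : g ∈ X.endDeg m) :
    X.endD (f * g) = X.endD f * g + n.negOnePow • (f * X.endD g) := by
  ext x
  have h1 : (n.negOnePow • (f * X.endD g)) x = n.negOnePow • f (X.endD g x) := rfl
  rw [endD_of_mem (endDeg_mul hf hg), LinearMap.add_apply, Module.End.mul_apply,
    Module.End.mul_apply, Module.End.mul_apply, endD_of_mem hf, h1, endD_of_mem hg, map_sub]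
  simp only [Units.smul_def, map_zsmul, smul_sub, smul_smul]
  rw [Int.negOnePow_add]
  push_cast
  abel

variable (X)

/-- The algebra `End_{K ⊗_Z K}(X)`, the sum of the spaces `endDeg n` of homogeneous endomorphisms. -/
def endSubalgebra : Subalgebra k (Module.End k X.carrier) :=
  Submodule.toSubalgebra (iSup X.endDeg) (Submodule.mem_iSup_of_mem 0 endDeg_one) (by
    intro f g hf hg
    refine Submodule.iSup_induction _ (motive := fun f => f * g ∈ iSup X.endDeg) hf ?_ (by simp)
      (fun a b ha hb => by rw [add_mul]; exact add_mem ha hb)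
    intro i a ha
    refine Submodule.iSup_induction _ (motive := fun g => a * g ∈ iSup X.endDeg) hg ?_ (by simp)
      (fun a b ha hb => by rw [mul_add]; exact add_mem ha hb)
    intro j b hb
    exact Submodule.mem_iSup_of_mem (i + j) (endDeg_mul ha hb))

/-- The endomorphisms of degree `n`, inside `End_{K ⊗_Z K}(X)`. -/
def endGr (n : ℤ) : Submodule k X.endSubalgebra :=
  (X.endDeg n).comap X.endSubalgebra.val.toLinearMap

theorem endSubalgebra_induction {p : X.endSubalgebra → Prop} (f : X.endSubalgebra)
    (hom : ∀ n, ∀ f ∈ X.endGr n, p f) (add : ∀ f g, p f → p g → p (f + g)) : p f := by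
  obtain ⟨f, hf⟩ := f
  have hf' : f ∈ iSup X.endDeg := hf
  refine Submodule.iSup_induction' (p := X.endDeg) (motive := fun f hf => p ⟨f, hf⟩) ?_ ?_ ?_ hf'
  · intro n f hf
    exact hom n _ hf
  · exact hom 0 0 (zero_mem _)
  · intro f g hf hg h h'
    exact add _ _ h h'

theorem endGr_isInternal : DirectSum.IsInternal X.endGr := by
  let p : ∀ n : ℤ, X.endSubalgebra →ₗ[k] (∀ q : ℤ, X.gr q → X.carrier) := fun n =>
    { toFun := fun f q m => component X.isInternal (q + n) ((f : Module.End k X.carrier) m)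
      map_add' := by intro f g; ext q m; simp
      map_smul' := by intro c f; ext q m; simp }
  refine isInternal_of_separating p ?_ ?_ ?_
  · intro n f hf h
    apply Subtype.ext
    apply linearMap_ext_gr X.isInternal
    intro q m hm
    have := congrFun (congrFun h q) ⟨m, hm⟩
    change component X.isInternal (q + n) ((f : Module.End k X.carrier) m) = 0 at this
    exact (component_of_mem X.isInternal (hf.1 q m hm)).symm.trans this
  · intro m n hmn f hf
    ext q x
    change component X.isInternal (q + n) ((f : Module.End k X.carrier) x) = 0
    exact component_of_ne _ (by omega) (hf.1 q x x.2)
  · rw [eq_top_iff]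
    rintro f -
    exact X.endSubalgebra_induction (p := fun f => f ∈ iSup X.endGr) f
      (fun n f hf => Submodule.mem_iSup_of_mem n hf) (fun f g hf hg => add_mem hf hg)

/-- The differential on `End_{K ⊗_Z K}(X)`. -/
noncomputable def endDiff : X.endSubalgebra →ₗ[k] X.endSubalgebra :=
  X.endD.restrict (p := Subalgebra.toSubmodule X.endSubalgebra)
    (q := Subalgebra.toSubmodule X.endSubalgebra) (fun f hf =>
      X.endSubalgebra_induction (p := fun f => X.endD f ∈ X.endSubalgebra) ⟨f, hf⟩
        (fun n f hf => Submodule.mem_iSup_of_mem (n + 1) (endD_mem hf))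
        (fun f g hf hg => by
          rw [AddMemClass.coe_add, map_add]
          exact add_mem hf hg))

@[simp] theorem coe_endDiff (f : X.endSubalgebra) :
    ((X.endDiff f : X.endSubalgebra) : Module.End k X.carrier) = X.endD f := rfl

end DGBimodule

/-- A `G`-equivariant dg module over `K ⊗_Z K`. -/
structure EquivariantDGBimodule (K : EquivariantDGAlgebra P) extends DGBimodule K where
  coact : carrier →ₗ[k] carrier ⊗[k] O
  isCoaction : IsCoaction coact
  coact_gr : ∀ {n x}, x ∈ gr n → coact x ∈ LinearMap.range ((gr n).subtype.rTensor O)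
  coact_d : ∀ x, coact (d x) = d.rTensor O (coact x)
  coact_left : ∀ a x, coact (left a x) = act O left (K.coact a) (coact x)
  coact_right : ∀ b x, coact (right b x) = act O right (K.coact b) (coact x)

/-- The regular dg `K`-bimodule. -/
noncomputable def regularBimodule (K : EquivariantDGAlgebra P) : EquivariantDGBimodule K where
  carrier := K.carrier
  gr := K.gr
  isInternal := K.isInternal
  d := K.d
  d_mem := K.d_mem
  d_d := K.d_d
  left := LinearMap.mul k K.carrier
  left_one m := by simp
  left_mul a b m := by simp [mul_assoc]
  right := (LinearMap.mul k K.carrier).flip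
  right_one m := by simp
  right_mul a b m := by simp [mul_assoc]
  left_right a b m := by simp [mul_assoc]
  central z m := by simp [K.unit_central]
  left_mem ha hm := K.gradedMonoid.mul_mem ha hm
  right_mem hb hm := K.gradedMonoid.mul_mem hm hb
  d_left m ha := by simpa using K.leibniz m ha
  d_right b hm := by simpa using K.leibniz b hm
  coact := K.coact.toLinearMap
  isCoaction := K.isCoaction
  coact_gr := K.coact_gr
  coact_d := K.coact_d
  coact_left a x := by
    have : ∀ s t : K.carrier ⊗[k] O, s * t = act O (LinearMap.mul k K.carrier) s t := by
      intro s t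
      induction s with
      | zero => simp
      | add x y hx hy => simp only [add_mul, hx, hy, map_add, LinearMap.add_apply]
      | tmul x o =>
        induction t with
        | zero => simp
        | add x y hx hy => simp only [mul_add, hx, hy, map_add]
        | tmul y o' => simp
    simp [this]
  coact_right b x := by
    have : ∀ s t : K.carrier ⊗[k] O, t * s = act O (LinearMap.mul k K.carrier).flip s t := by
      intro s t
      induction s with
      | zero => simp
      | add x y hx hy => simp only [mul_add, hx, hy, map_add, LinearMap.add_apply]
      | tmul x o =>
        induction t with
        | zero => simp
        | add x y hx hy => simp only [add_mul, hx, hy, map_add]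
        | tmul y o' => simp [mul_comm o]
    simp [this]

namespace EquivariantDGBimodule

variable {K : EquivariantDGAlgebra P} (X : EquivariantDGBimodule K)

/-- The spaces `Hom^n_{K ⊗_Z K}(X, X)` are integrable representations for the action
`(x · f)(m) = x₁ f(S(x₂) m)`, so that `End_{K ⊗_Z K}(X)` is a dg `G`-algebra. This is automatic when
`G` is a finite group scheme, see `endIntegrable_of_finite`. -/
def EndIntegrable : Prop :=
  ∀ n, IsIntegrable X.coact X.coact (X.endDeg n).subtype

variable {X}

theorem EndIntegrable.isIntegrable (h : X.EndIntegrable) :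
    IsIntegrable X.coact X.coact X.endSubalgebra.val.toLinearMap := by
  intro f
  refine X.endSubalgebra_induction (p := fun f => ∃ t : X.endSubalgebra ⊗[k] O, ∀ m,
    act O X.endSubalgebra.val.toLinearMap t (m ⊗ₜ 1) =
      conj X.coact X.coact (X.endSubalgebra.val.toLinearMap f) m) f ?_ ?_
  · intro n f hf
    obtain ⟨t, ht⟩ := h n ⟨f, hf⟩
    refine ⟨((X.endDeg n).subtype.codRestrict (Subalgebra.toSubmodule X.endSubalgebra)
      (fun g => Submodule.mem_iSup_of_mem n g.2)).rTensor O t, fun m => ?_⟩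
    refine Eq.trans ?_ (ht m)
    clear ht
    induction t with
    | zero => simp
    | add x y hx hy => simp only [map_add, LinearMap.add_apply, hx, hy]
    | tmul g o => simp; rfl
  · rintro f g ⟨t, ht⟩ ⟨s, hs⟩
    exact ⟨t + s, fun m => by simp only [map_add, LinearMap.add_apply, ht, hs]⟩

theorem val_injective : Function.Injective X.endSubalgebra.val.toLinearMap := Subtype.val_injective

/-- The coaction on `End_{K ⊗_Z K}(X)`. -/
noncomputable def endCoact (h : X.EndIntegrable) : X.endSubalgebra →ₗ[k] X.endSubalgebra ⊗[k] O :=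
  homCoact val_injective h.isIntegrable

theorem endCoact_eval (h : X.EndIntegrable) (f : X.endSubalgebra) (m : X.carrier) :
    act O X.endSubalgebra.val.toLinearMap (endCoact h f) (X.coact m) =
      X.coact ((f : Module.End k X.carrier) m) :=
  homCoact_eval X.isCoaction val_injective h.isIntegrable f m

theorem endCoact_ext {t t' : X.endSubalgebra ⊗[k] O}
    (h : ∀ m, act O X.endSubalgebra.val.toLinearMap t (X.coact m) =
      act O X.endSubalgebra.val.toLinearMap t' (X.coact m)) : t = t' := by
  refine act_ext_coaction X.isCoaction (AlgHom.id k O) val_injective (fun m => ?_)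
  simpa using h m

theorem act_mul (t s : X.endSubalgebra ⊗[k] O) (y : X.carrier ⊗[k] O) :
    act O X.endSubalgebra.val.toLinearMap (t * s) y =
      act O X.endSubalgebra.val.toLinearMap t (act O X.endSubalgebra.val.toLinearMap s y) := by
  induction t with
  | zero => simp
  | add x y hx hy => simp only [add_mul, map_add, LinearMap.add_apply, hx, hy]
  | tmul f o =>
    induction s with
    | zero => simp
    | add x y hx hy => simp only [mul_add, map_add, LinearMap.add_apply, hx, hy]
    | tmul g o' =>
      induction y with
      | zero => simp
      | add x y hx hy => simp only [map_add, hx, hy]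
      | tmul m o'' => simp [mul_assoc]

theorem coact_sign (x : X.carrier) : X.coact (signMap X.isInternal x) =
    (signMap X.isInternal).rTensor O (X.coact x) := by
  refine gr_induction (p := fun x => X.coact (signMap X.isInternal x) =
    (signMap X.isInternal).rTensor O (X.coact x)) X.isInternal x ?_ (by simp)
    (fun x y hx hy => by simp only [map_add, hx, hy])
  intro n x hx
  obtain ⟨t, ht⟩ := X.coact_gr hx
  rw [signMap_of_mem _ hx, Units.smul_def, map_zsmul, ← ht]
  clear ht
  induction t with
  | zero => simp
  | add x y hx hy => simp only [map_add, hx, hy, smul_add]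
  | tmul y o =>
    simp only [LinearMap.rTensor_tmul, Submodule.subtype_apply]
    rw [signMap_of_mem _ y.2, Units.smul_def, TensorProduct.smul_tmul']

theorem act_endDiff (t : X.endSubalgebra ⊗[k] O) (y : X.carrier ⊗[k] O) :
    act O X.endSubalgebra.val.toLinearMap (X.endDiff.rTensor O t) y =
      X.d.rTensor O (act O X.endSubalgebra.val.toLinearMap t y) -
      (signMap X.isInternal).rTensor O (act O X.endSubalgebra.val.toLinearMap t
        ((signMap X.isInternal).rTensor O (X.d.rTensor O y))) := by
  induction t with
  | zero => simp
  | add x y hx hy => simp only [map_add, LinearMap.add_apply, hx, hy]; abel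
  | tmul f o =>
    induction y with
    | zero => simp
    | add x y hx hy => simp only [map_add, hx, hy]; abel
    | tmul m o' =>
      simp [DGBimodule.endD_apply, TensorProduct.sub_tmul]

/-- The coaction on `End_{K ⊗_Z K}(X)`, as a map of algebras. -/
noncomputable def endCoactHom (h : X.EndIntegrable) :
    X.endSubalgebra →ₐ[k] X.endSubalgebra ⊗[k] O :=
  AlgHom.ofLinearMap (endCoact h)
    (by
      apply endCoact_ext
      intro m
      rw [endCoact_eval, Algebra.TensorProduct.one_def]
      change X.coact m = _
      induction X.coact m with
      | zero => simp
      | add x y hx hy => rw [map_add, ← hx, ← hy]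
      | tmul m o => simp)
    (by
      intro f g
      apply endCoact_ext
      intro m
      rw [act_mul, endCoact_eval, endCoact_eval, endCoact_eval]
      rfl)

theorem endCoact_d (h : X.EndIntegrable) (f : X.endSubalgebra) :
    endCoact h (X.endDiff f) = X.endDiff.rTensor O (endCoact h f) := by
  apply endCoact_ext
  intro m
  rw [endCoact_eval, act_endDiff, endCoact_eval, ← X.coact_d, ← X.coact_d, ← coact_sign,
    endCoact_eval, ← coact_sign, ← map_sub]
  rfl

/-- The identity, as a map from `endDeg n` to `endGr n`. -/
def toEndGr (X : EquivariantDGBimodule K) (n : ℤ) : X.endDeg n →ₗ[k] X.endGr n where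
  toFun g := ⟨⟨g.1, Submodule.mem_iSup_of_mem n g.2⟩, g.2⟩
  map_add' _ _ := rfl
  map_smul' _ _ := rfl

theorem endCoact_spec (h : X.EndIntegrable) (f : X.endSubalgebra) (m : X.carrier) :
    act O X.endSubalgebra.val.toLinearMap (endCoact h f) (m ⊗ₜ 1) =
      conj X.coact X.coact (f : Module.End k X.carrier) m :=
  homCoact_spec val_injective h.isIntegrable f m

theorem endCoact_gr (h : X.EndIntegrable) {n : ℤ} {f : X.endSubalgebra} (hf : f ∈ X.endGr n) :
    endCoact h f ∈ LinearMap.range ((X.endGr n).subtype.rTensor O) := by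
  obtain ⟨t, ht⟩ := h n ⟨(f : Module.End k X.carrier), hf⟩
  refine ⟨(toEndGr X n).rTensor O t, act_ext val_injective fun m => ?_⟩
  rw [endCoact_spec]
  refine Eq.trans ?_ (ht m)
  generalize (m ⊗ₜ[k] (1 : O)) = y
  clear ht
  induction t with
  | zero => rw [LinearMap.map_zero, LinearMap.map_zero, LinearMap.map_zero, LinearMap.map_zero]
  | add x y hx hy =>
    rw [LinearMap.map_add, LinearMap.map_add, LinearMap.map_add, LinearMap.map_add,
      LinearMap.add_apply, LinearMap.add_apply, hx, hy]
  | tmul g o => rfl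

/-- `End_{K ⊗_Z K}(X)` as a dg `G`-algebra. -/
noncomputable def endAlgebra (h : X.EndIntegrable) : DGGAlgebra k O where
  carrier := X.endSubalgebra
  gr := X.endGr
  isInternal := X.endGr_isInternal
  gradedMonoid :=
    { one_mem := DGBimodule.endDeg_one
      mul_mem := fun _ _ _ _ hf hg => DGBimodule.endDeg_mul hf hg }
  d := X.endDiff
  d_mem hf := DGBimodule.endD_mem hf
  d_d f := by
    refine X.endSubalgebra_induction (p := fun f => X.endDiff (X.endDiff f) = 0) f
      (fun n f hf => Subtype.ext (DGBimodule.endD_endD hf))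
      (fun f g hf hg => by rw [map_add, map_add, hf, hg, add_zero])
  leibniz := by
    intro n f g hf
    refine X.endSubalgebra_induction (p := fun g => X.endDiff (f * g) = X.endDiff f * g +
      n.negOnePow • (f * X.endDiff g)) g
      (fun m g hg => Subtype.ext (DGBimodule.endD_mul hf hg))
      (fun g g' hg hg' => by
        simp only [mul_add, map_add, hg, hg', smul_add]
        abel)
  coact := endCoactHom h
  isCoaction := isCoaction_homCoact X.isCoaction X.isCoaction val_injective h.isIntegrable
  coact_gr hf := endCoact_gr h hf
  coact_d f := endCoact_d h f

theorem extendO_act {M N : Type*} [AddCommGroup M] [Module k M] [AddCommGroup N] [Module k N]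
    {ρM : M →ₗ[k] M ⊗[k] O} {ρN : N →ₗ[k] N ⊗[k] O} (j : N →ₗ[k] M →ₗ[k] M)
    (hj : ∀ a m, ρM (j a m) = act O j (ρN a) (ρM m)) (s : N ⊗[k] O) (y : M ⊗[k] O) :
    extendO ρM (act O j s y) = act O j (extendO ρN s) (extendO ρM y) := by
  induction s with
  | zero => simp
  | add x y hx hy => simp only [map_add, LinearMap.add_apply, hx, hy]
  | tmul a o =>
    induction y with
    | zero => simp
    | add x y hx hy => simp only [map_add, hx, hy]
    | tmul m o' =>
      rw [act_tmul, extendO_tmul, extendO_tmul, extendO_tmul, hj, act_mulR]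
      induction ρN a with
      | zero => simp
      | add x y hx hy => simp only [map_add, LinearMap.add_apply, hx, hy]
      | tmul a o =>
        induction ρM m with
        | zero => simp
        | add x y hx hy => simp only [map_add, hx, hy]
        | tmul m o =>
          simp only [act_tmul, mulR_tmul]
          congr 1
          ring

theorem conj_act {M N : Type*} [AddCommGroup M] [Module k M] [AddCommGroup N] [Module k N]
    {ρM : M →ₗ[k] M ⊗[k] O} {ρN : N →ₗ[k] N ⊗[k] O} (hN : IsCoaction ρN)
    (j : N →ₗ[k] M →ₗ[k] M) (hj : ∀ a m, ρM (j a m) = act O j (ρN a) (ρM m))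
    (f : M →ₗ[k] M) (c : ℤˣ) (a : N) (W : Submodule k N)
    (hf : ∀ b ∈ W, ∀ m, f (j b m) = c • j b (f m))
    (ha : ρN a ∈ LinearMap.range (W.subtype.rTensor O)) (m : M) :
    conj ρM ρM f (j a m) = c • act O j (a ⊗ₜ 1) (conj ρM ρM f m) := by
  rw [conj_eq_extendO, conj_eq_extendO, hj]
  have h1 : ∀ y : M ⊗[k] O, TensorProduct.map f (HopfAlgebra.antipode k) (act O j (ρN a) y) =
      c • act O j ((HopfAlgebra.antipode k (A := O)).lTensor N (ρN a))
        (TensorProduct.map f (HopfAlgebra.antipode k) y) := by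
    obtain ⟨t, ht⟩ := ha
    rw [← ht]
    clear ht
    intro y
    induction t with
    | zero => simp
    | add x y hx hy => simp only [map_add, LinearMap.add_apply, hx, hy, smul_add]
    | tmul b o =>
      induction y with
      | zero => simp
      | add x y hx hy => simp only [map_add, hx, hy, smul_add]
      | tmul m o' =>
        simp only [LinearMap.rTensor_tmul, Submodule.subtype_apply, act_tmul, TensorProduct.map_tmul,
          LinearMap.lTensor_tmul, HopfAlgebra.antipode_mul_distrib, hf b b.2]
        rw [Units.smul_def, Units.smul_def, TensorProduct.smul_tmul']
  rw [h1, Units.smul_def, map_zsmul, extendO_act j hj, extendO_antipode hN, ← Units.smul_def]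

theorem slice_act_tmul_one {M N : Type*} [AddCommGroup M] [Module k M] [AddCommGroup N] [Module k N]
    (j : N →ₗ[k] M →ₗ[k] M) (a : N) (y : M ⊗[k] O) (φ : O →ₗ[k] k) :
    slice φ (act O j (a ⊗ₜ 1) y) = j a (slice φ y) := by
  induction y with
  | zero => simp
  | add x y hx hy => simp only [map_add, hx, hy]
  | tmul m o => simp

theorem slice_conj_mem (X : EquivariantDGBimodule K) (n : ℤ) {f : Module.End k X.carrier}
    (hf : f ∈ X.endDeg n) (φ : O →ₗ[k] k) :
    slice φ ∘ₗ conj X.coact X.coact f ∈ X.endDeg n := by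
  refine ⟨fun q m hm => ?_, fun p a ha m => ?_, fun b m => ?_⟩
  · change slice φ (conj X.coact X.coact f m) ∈ _
    rw [conj_eq_extendO]
    obtain ⟨t, ht⟩ := X.coact_gr hm
    rw [← ht]
    clear ht
    induction t with
    | zero => simp
    | add x y hx hy => simp only [map_add]; exact add_mem hx hy
    | tmul x o =>
      simp only [LinearMap.rTensor_tmul, Submodule.subtype_apply, TensorProduct.map_tmul,
        extendO_tmul]
      obtain ⟨t, ht⟩ := X.coact_gr (hf.1 q x x.2)
      rw [← ht]
      clear ht
      induction t with
      | zero => simp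
      | add x y hx hy => simp only [map_add]; exact add_mem hx hy
      | tmul y o' =>
        simp only [LinearMap.rTensor_tmul, Submodule.subtype_apply, mulR_tmul, slice_tmul]
        exact Submodule.smul_mem _ _ y.2
  · change slice φ (conj X.coact X.coact f (X.left a m)) = _
    rw [conj_act K.isCoaction X.left X.coact_left f _ a (K.gr p) (hf.2.1 p) (K.coact_gr ha),
      Units.smul_def, map_zsmul, slice_act_tmul_one, ← Units.smul_def]
    rfl
  · change slice φ (conj X.coact X.coact f (X.right b m)) = _
    rw [conj_act K.isCoaction X.right X.coact_right f 1 b ⊤ (fun b _ m => by rw [hf.2.2, one_smul])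
      ((mem_range_rTensor_iff _ _).2 (fun _ => trivial)), one_smul, slice_act_tmul_one]
    rfl

/-- If `G` is a finite group scheme, then `End_{K ⊗_Z K}(X)` is always integrable. -/
theorem endIntegrable_of_finite [Module.Finite k O] (X : EquivariantDGBimodule K) :
    X.EndIntegrable := by
  intro n f
  let b := Module.Free.chooseBasis k O
  refine ⟨∑ i, (⟨slice (b.coord i) ∘ₗ conj X.coact X.coact f, X.slice_conj_mem n f.2 _⟩ :
    X.endDeg n) ⊗ₜ b i, fun m => ?_⟩
  have h1 : ∀ y : X.carrier ⊗[k] O, ∑ i, slice (b.coord i) y ⊗ₜ[k] b i = y := by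
    intro y
    induction y with
    | zero => simp
    | add x y hx hy => simp only [map_add, TensorProduct.add_tmul, Finset.sum_add_distrib, hx, hy]
    | tmul m o =>
      simp only [slice_tmul, TensorProduct.smul_tmul, ← TensorProduct.tmul_sum]
      rw [show ∑ i, (b.coord i) o • b i = o from b.sum_repr o]
  refine Eq.trans ?_ (h1 _)
  simp only [map_sum, LinearMap.sum_apply, act_tmul, mul_one]
  rfl

/-- Morphisms of equivariant dg modules over `K ⊗_Z K`. -/
structure Hom (X Y : EquivariantDGBimodule K) extends DGBimodule.Hom X.toDGBimodule Y.toDGBimodule where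
  map_coact : ∀ x, Y.coact (toLinearMap x) = toLinearMap.rTensor O (X.coact x)

/-- An equivariant semi-projective resolution of `M`: a `G`-linear quasi-isomorphism `F → M` of
equivariant dg modules, with `F` non-equivariantly semi-projective. -/
structure SemiprojectiveResolution (M : EquivariantDGBimodule K) where
  F : EquivariantDGBimodule K
  map : Hom F M
  quasiIso : IsQuasiIso F.d M.d map.toLinearMap
  semiprojective : F.IsSemiprojective

end EquivariantDGBimodule

end Bimodules

end EqFormality

/-! Why the theorem holds. The augmentation of `K` is a quasi-isomorphism and `K` is flat over `Z`,
so `K ⊗_Z K → k ⊗_Z K → B`, `a ⊗ b ↦ aug(a) π(b)`, is a quasi-isomorphism. Hence `REnd_{K ⊗_Z K}(K)`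
computes `REnd_B(k)` for the exterior algebra `B`, and Koszul duality identifies the latter with `A
= A_Z`. The difficulty is to make this comparison multiplicative and `G`-linear: `F` is
semi-projective only non-equivariantly and representations of `G` need not split, so no step may
rest on an equivariant choice. The comparison therefore runs through a canonical bimodule.

Let `E = End(F)`, and let `T` be the complex of maps `φ : F → A` which factor through `k ⊗_K F ⊗_K
B` (that is, vanish on `augSub`) and vanish in large degrees of `F`, with differential `(Dφ)(m) = ±
φ(d m) + ∑ x_i φ(m b_i)` for dual bases `x_i`, `b_i`. The algebra `A` acts on `T` by multiplication
of values, `E` acts by composition, and the composite `t : F → K → k → A` is an invariant cocycle.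
If `a ↦ a t` and `e ↦ t e` are quasi-isomorphisms `A → T ← E`, then the triangular algebra with
entries `A`, `Σ⁻¹ T`, `E`, with differential twisted by `t`, projects quasi-isomorphically to both
`A` and `E` (`PointedBimodule.homotopyIso`). This is the zig-zag.

The map from `E`. Without the boundedness condition `T` is the complex of bimodule maps from `F` to
the Koszul complex `Hom(B, A)`, which resolves `k` (`exists_of_koszulD_eq_zero`). Maps out of a
semi-projective bimodule preserve quasi-isomorphisms (`homD_injective`, `homD_surjective`). Bounded
cochains land in a truncation of the Koszul complex, which resolves `k` too
(`exists_eq_scalar_comp_add`).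

The map from `A`. The subspace `augSub` of `F` is acyclic (`IsSemiprojective.augSub_acyclic`), so `F
/ augSub` has cohomology `k` in degree `0`. Obstruction theory along the degree in `F` then brings
every cocycle to the form `a t` (`exists_eq_mulLeft_scalar_add`).

The group action. `D` is `G`-linear because `∑ x_i ⊗ b_i` is the invariant canonical element
(`sum_act_dualCoact`). That `T` is a comodule is not automatic for infinite `G`. Boundedness makes a
cochain a finite sum of maps `m ↦ ξ(m) a`; the functionals `ξ` are combinations of finitely many
fixed ones composed with elements of `E` (`exists_eq_sum_comp`); and the assumption on `E` confines
the resulting matrix coefficients to a finite-dimensional space (`bddCochain_isIntegrable`).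

Formality follows because `A` has zero differential and a zig-zag of quasi-isomorphisms passes to
cohomology (`HomotopyIso.equivariantlyFormal`). -/

namespace EqFormality

/-! ### Graded complexes -/

section GradedComplexes

variable {k : Type*} [Field k] {M N : Type*} [AddCommGroup M] [Module k M]
  [AddCommGroup N] [Module k N] {gr : ℤ → Submodule k M} {grN : ℤ → Submodule k N}

theorem exists_sum_component (h : DirectSum.IsInternal gr) (x : M) :
    ∃ s : Finset ℤ, x = ∑ n ∈ s, component h n x := by
  -- Asking for the identity on every larger finite set makes the claim stable under addition.
  refine gr_induction (p := fun x => ∃ s : Finset ℤ, ∀ t, s ⊆ t → x = ∑ n ∈ t, component h n x)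
    h x ?_ ⟨∅, fun t _ => by simp⟩ ?_ |>.imp (fun s hs => hs s (Finset.Subset.refl s))
  · intro n x hx
    refine ⟨{n}, fun t ht => ?_⟩
    rw [Finset.sum_eq_single n, component_of_mem h hx]
    · intro m _ hm
      exact component_of_ne h (Ne.symm hm) hx
    · intro hn
      exact absurd (ht (Finset.mem_singleton_self n)) hn
  · rintro x y ⟨s, hs⟩ ⟨t, ht⟩
    refine ⟨s ∪ t, fun r hr => ?_⟩
    simp only [map_add, Finset.sum_add_distrib]
    rw [← hs r (Finset.union_subset_left hr), ← ht r (Finset.union_subset_right hr)]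

theorem component_natural (h : DirectSum.IsInternal gr) (hN : DirectSum.IsInternal grN)
    {f : M →ₗ[k] N} {e : ℤ} (hf : ∀ n x, x ∈ gr n → f x ∈ grN (n + e)) (n : ℤ) (x : M) :
    f (component h n x) = component hN (n + e) (f x) := by
  refine gr_induction (p := fun x => f (component h n x) = component hN (n + e) (f x)) h x ?_
    (by simp) (fun x y hx hy => by simp only [map_add, hx, hy])
  intro m x hx
  by_cases hmn : m = n
  · subst hmn
    rw [component_of_mem h hx, component_of_mem hN (hf _ _ hx)]
  · rw [component_of_ne h hmn hx, component_of_ne hN (by omega) (hf _ _ hx), map_zero]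

theorem component_natural_zero (h : DirectSum.IsInternal gr) (hN : DirectSum.IsInternal grN)
    {f : M →ₗ[k] N} (hf : ∀ n x, x ∈ gr n → f x ∈ grN n) (n : ℤ) (x : M) :
    f (component h n x) = component hN n (f x) := by
  simpa using component_natural h hN (e := 0) (by simpa using hf) n x

/-- A homogeneous element is its own component. This form serves maps which are defined on
generators of a free bimodule, where commutation with the projections can be checked by induction
but membership cannot. -/
theorem mem_of_component_natural (h : DirectSum.IsInternal gr) {f : M →ₗ[k] N}
    (hN : DirectSum.IsInternal grN) {e : ℤ}
    (hf : ∀ n x, f (component h n x) = component hN (n + e) (f x)) {n : ℤ} {x : M}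
    (hx : x ∈ gr n) : f x ∈ grN (n + e) := by
  rw [← component_of_mem h hx, hf]
  exact component_mem _ _ _

/-- A graded chain map is a quasi-isomorphism as soon as it is one on homogeneous elements. -/
theorem isQuasiIso_of_homogeneous (h : DirectSum.IsInternal gr) (hN : DirectSum.IsInternal grN)
    {dM : M →ₗ[k] M} {dN : N →ₗ[k] N} {f : M →ₗ[k] N}
    (hdM : ∀ n x, x ∈ gr n → dM x ∈ gr (n + 1)) (hdN : ∀ n x, x ∈ grN n → dN x ∈ grN (n + 1))
    (hf : ∀ n x, x ∈ gr n → f x ∈ grN n)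
    (inj : ∀ n, ∀ x ∈ gr n, dM x = 0 → ∀ w ∈ grN (n - 1), f x = dN w → ∃ v, x = dM v)
    (surj : ∀ n, ∀ y ∈ grN n, dN y = 0 → ∃ x, dM x = 0 ∧ ∃ w, y = f x + dN w) :
    IsQuasiIso dM dN f := by
  constructor
  · rintro x hx ⟨w, hw⟩
    have key : ∀ n, ∃ v, component h n x = dM v := by
      intro n
      refine inj n _ (component_mem h n x) ?_ (component hN (n - 1) w) (component_mem _ _ _) ?_
      · rw [component_natural h h hdM, hx, map_zero]
      · rw [component_natural_zero h hN hf, hw, component_natural hN hN hdN, sub_add_cancel]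
    choose v hv using key
    obtain ⟨s, hs⟩ := exists_sum_component h x
    refine ⟨∑ n ∈ s, v n, ?_⟩
    rw [map_sum]
    conv_lhs => rw [hs]
    exact Finset.sum_congr rfl (fun n _ => hv n)
  · intro y hy
    have key : ∀ n, ∃ x w, dM x = 0 ∧ component hN n y = f x + dN w := by
      intro n
      obtain ⟨x, hx, w, hw⟩ := surj n _ (component_mem hN n y)
        (by rw [component_natural hN hN hdN, hy, map_zero])
      exact ⟨x, w, hx, hw⟩
    choose x w hx hw using key
    obtain ⟨s, hs⟩ := exists_sum_component hN y
    refine ⟨∑ n ∈ s, x n, ?_, ∑ n ∈ s, w n, ?_⟩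
    · rw [map_sum]
      exact Finset.sum_eq_zero (fun n _ => hx n)
    · rw [map_sum, map_sum, ← Finset.sum_add_distrib]
      conv_lhs => rw [hs]
      exact Finset.sum_congr rfl (fun n _ => hw n)

end GradedComplexes

/-! ### Direct sums of graded spaces and of comodules -/

section Prod

variable {k : Type*} [Field k] {M N : Type*} [AddCommGroup M] [Module k M]
  [AddCommGroup N] [Module k N] {gr : ℤ → Submodule k M} {grN : ℤ → Submodule k N}

theorem isInternal_shift (h : DirectSum.IsInternal gr) (e : ℤ) :
    DirectSum.IsInternal (fun n => gr (n + e)) := by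
  refine isInternal_of_separating (fun n => component h (n + e)) ?_ ?_ ?_
  · intro n x hx h0
    rwa [component_of_mem h hx] at h0
  · intro m n hmn x hx
    exact component_of_ne h (by omega) hx
  · rw [eq_top_iff, ← h.submodule_iSup_eq_top]
    refine iSup_le fun n => ?_
    have := le_iSup (fun n => gr (n + e)) (n - e)
    simpa using this

theorem isInternal_prod (h : DirectSum.IsInternal gr) (hN : DirectSum.IsInternal grN) :
    DirectSum.IsInternal (fun n => (gr n).prod (grN n)) := by
  refine isInternal_of_separating
    (fun n => (component h n).prodMap (component hN n)) ?_ ?_ ?_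
  · rintro n ⟨x, y⟩ ⟨hx, hy⟩ h0
    simp only [LinearMap.prodMap_apply, Prod.mk_eq_zero] at h0
    rw [component_of_mem h hx, component_of_mem hN hy] at h0
    exact Prod.ext h0.1 h0.2
  · rintro m n hmn ⟨x, y⟩ ⟨hx, hy⟩
    simp only [LinearMap.prodMap_apply]
    rw [component_of_ne h hmn hx, component_of_ne hN hmn hy]
    rfl
  · rw [eq_top_iff]
    rintro ⟨x, y⟩ -
    have e : (x, y) = LinearMap.inl k M N x + LinearMap.inr k M N y := by simp
    rw [e]
    refine add_mem ?_ ?_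
    · exact gr_induction (p := fun x => LinearMap.inl k M N x ∈ _) h x
        (fun n x hx => Submodule.mem_iSup_of_mem n ⟨hx, zero_mem _⟩)
        (by rw [map_zero]; exact zero_mem _)
        (fun a b ha hb => by rw [map_add]; exact add_mem ha hb)
    · exact gr_induction (p := fun x => LinearMap.inr k M N x ∈ _) hN y
        (fun n x hx => Submodule.mem_iSup_of_mem n ⟨zero_mem _, hx⟩)
        (by rw [map_zero]; exact zero_mem _)
        (fun a b ha hb => by rw [map_add]; exact add_mem ha hb)

end Prod

section Coactions

variable {k : Type*} [Field k] {O : Type*} [CommRing O] [HopfAlgebra k O]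
  {M N : Type*} [AddCommGroup M] [Module k M] [AddCommGroup N] [Module k N]

/-- The coaction on a direct sum of two comodules. -/
noncomputable def prodCoact (ρM : M →ₗ[k] M ⊗[k] O) (ρN : N →ₗ[k] N ⊗[k] O) :
    M × N →ₗ[k] (M × N) ⊗[k] O :=
  ((LinearMap.inl k M N).rTensor O ∘ₗ ρM).coprod ((LinearMap.inr k M N).rTensor O ∘ₗ ρN)

theorem prodCoact_apply (ρM : M →ₗ[k] M ⊗[k] O) (ρN : N →ₗ[k] N ⊗[k] O) (x : M × N) :
    prodCoact ρM ρN x = (LinearMap.inl k M N).rTensor O (ρM x.1) +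
      (LinearMap.inr k M N).rTensor O (ρN x.2) := rfl

theorem fst_prodCoact (ρM : M →ₗ[k] M ⊗[k] O) (ρN : N →ₗ[k] N ⊗[k] O) (x : M × N) :
    (LinearMap.fst k M N).rTensor O (prodCoact ρM ρN x) = ρM x.1 := by
  rw [prodCoact_apply, map_add, ← LinearMap.rTensor_comp_apply, ← LinearMap.rTensor_comp_apply]
  simp [LinearMap.fst_comp_inl, LinearMap.fst_comp_inr]

theorem snd_prodCoact (ρM : M →ₗ[k] M ⊗[k] O) (ρN : N →ₗ[k] N ⊗[k] O) (x : M × N) :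
    (LinearMap.snd k M N).rTensor O (prodCoact ρM ρN x) = ρN x.2 := by
  rw [prodCoact_apply, map_add, ← LinearMap.rTensor_comp_apply, ← LinearMap.rTensor_comp_apply]
  simp [LinearMap.snd_comp_inl, LinearMap.snd_comp_inr]

theorem IsCoaction.prod {ρM : M →ₗ[k] M ⊗[k] O} {ρN : N →ₗ[k] N ⊗[k] O} (hM : IsCoaction ρM)
    (hN : IsCoaction ρN) : IsCoaction (prodCoact ρM ρN) where
  counit x := by
    refine Prod.ext ?_ ?_
    · have := slice_rTensor (Coalgebra.counit (R := k) (A := O)) (LinearMap.fst k M N)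
        (prodCoact ρM ρN x)
      rw [fst_prodCoact, hM.counit] at this
      exact this.symm
    · have := slice_rTensor (Coalgebra.counit (R := k) (A := O)) (LinearMap.snd k M N)
        (prodCoact ρM ρN x)
      rw [snd_prodCoact, hN.counit] at this
      exact this.symm
  coassoc x := by
    have hl : ∀ m, prodCoact ρM ρN (LinearMap.inl k M N m) =
        (LinearMap.inl k M N).rTensor O (ρM m) := fun m => by simp [prodCoact_apply]
    have hr : ∀ n, prodCoact ρM ρN (LinearMap.inr k M N n) =
        (LinearMap.inr k M N).rTensor O (ρN n) := fun m => by simp [prodCoact_apply]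
    rw [prodCoact_apply, map_add, map_add, map_add, ← coassoc_natural _ hl, ← coassoc_natural _ hr,
      hM.coassoc, hN.coassoc, comul_natural, comul_natural]

end Coactions

/-- Lets the multiplicativity of a coaction be verified block by block, as is done for triangular
matrices in `triCoact_mul`. -/
theorem rTensor_mul_rTensor {k : Type*} [Field k] {X Y Z R O : Type*} [AddCommGroup X] [Module k X]
    [AddCommGroup Y] [Module k Y] [AddCommGroup Z] [Module k Z] [Ring R] [Algebra k R]
    [CommRing O] [Algebra k O] {f : X →ₗ[k] R} {g : Y →ₗ[k] R} {h : Z →ₗ[k] R}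
    (μ : X →ₗ[k] Y →ₗ[k] Z) (H : ∀ x y, f x * g y = h (μ x y)) (s : X ⊗[k] O) (t : Y ⊗[k] O) :
    f.rTensor O s * g.rTensor O t = h.rTensor O (act O μ s t) := by
  induction s with
  | zero => simp
  | add x y hx hy => simp only [map_add, add_mul, hx, hy, LinearMap.add_apply]
  | tmul x o =>
    induction t with
    | zero => simp
    | add x y hx hy => simp only [map_add, mul_add, hx, hy]
    | tmul y o' => simp [H]

/-! ### Formality from a zig-zag to an algebra with zero differential -/

namespace DGGAlgebra

variable {k : Type u} [Field k] {O : Type u} [CommRing O] [HopfAlgebra k O]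
  {A B : DGGAlgebra k O}

/-- The map induced on cocycles. -/
noncomputable def Hom.cocyclesMap (f : Hom A B) : A.cocycles →ₐ[k] B.cocycles :=
  (f.toAlgHom.comp A.cocycles.val).codRestrict _ (fun x => by
    have hx : A.d x = 0 := x.2
    change B.d (f.toAlgHom x) = 0
    rw [← f.map_d, hx, map_zero])

@[simp] theorem Hom.coe_cocyclesMap (f : Hom A B) (x : A.cocycles) :
    (f.cocyclesMap x : B.carrier) = f.toAlgHom x := rfl

/-- The map induced on cohomology, as a map of algebras. -/
noncomputable def Hom.cohomologyAlgHom (f : Hom A B) : A.Cohomology →ₐ[k] B.Cohomology :=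
  Ideal.Quotient.liftₐ A.coboundaries (B.cls.comp f.cocyclesMap) (by
    rintro x ⟨w, hw⟩
    rw [AlgHom.comp_apply, cls_eq_zero]
    exact ⟨f.toAlgHom w, by rw [← f.map_d, hw]; rfl⟩)

theorem Hom.cohomologyAlgHom_cls (f : Hom A B) (x : A.cocycles) :
    f.cohomologyAlgHom (A.cls x) = B.cls (f.cocyclesMap x) := rfl

/-- The map induced on cohomology. -/
noncomputable def Hom.cohomologyMap (f : Hom A B) : Hom A.cohomology B.cohomology where
  toAlgHom := f.cohomologyAlgHom
  map_gr := by
    intro n y hy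
    obtain ⟨x, hx, rfl⟩ := A.mem_cohomologyGr.1 hy
    exact B.mem_cohomologyGr.2 ⟨f.cocyclesMap x, f.map_gr hx, rfl⟩
  map_d x := map_zero f.cohomologyAlgHom
  map_coact y := by
    obtain ⟨x, rfl⟩ := A.cls_surjective y
    refine slice_ext fun φ => ?_
    refine Eq.trans ?_ (slice_rTensor φ f.cohomologyAlgHom.toLinearMap _).symm
    have h1 : slice φ (A.cohomologyCoact (A.cls x)) = A.cls (slice φ (A.cocycleCoact x)) := by
      rw [cohomologyCoact_cls, slice_rTensor]; rfl
    have h2 : slice φ (B.cohomologyCoact (B.cls (f.cocyclesMap x))) =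
        B.cls (slice φ (B.cocycleCoact (f.cocyclesMap x))) := by
      rw [cohomologyCoact_cls, slice_rTensor]; rfl
    change slice φ (B.cohomologyCoact (f.cohomologyAlgHom (A.cls x))) =
      f.cohomologyAlgHom (slice φ (A.cohomologyCoact (A.cls x)))
    rw [h1, f.cohomologyAlgHom_cls, f.cohomologyAlgHom_cls, h2]
    refine congrArg B.cls (Subtype.ext ?_)
    rw [slice_cocycleCoact, f.coe_cocyclesMap, f.coe_cocyclesMap, slice_cocycleCoact, f.map_coact,
      slice_rTensor]
    rfl

theorem Hom.quasiIso_cohomologyMap {f : Hom A B} (hf : f.QuasiIso) :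
    f.cohomologyMap.QuasiIso := by
  constructor
  · rintro y - ⟨w, hw⟩
    obtain ⟨x, rfl⟩ := A.cls_surjective y
    refine ⟨0, ?_⟩
    have h0 : B.cls (f.cocyclesMap x) = 0 := hw
    obtain ⟨w, hw⟩ := (B.cls_eq_zero _).1 h0
    obtain ⟨v, hv⟩ := hf.1 x x.2 ⟨w, hw.symm⟩
    exact (A.cls_eq_zero x).2 ⟨v, hv.symm⟩
  · rintro y -
    obtain ⟨z, rfl⟩ := B.cls_surjective y
    obtain ⟨x, hx, w, hw⟩ := hf.2 z z.2
    refine ⟨A.cls ⟨x, hx⟩, rfl, 0, ?_⟩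
    refine Eq.trans ?_ (add_zero _).symm
    change B.cls z = B.cls (f.cocyclesMap ⟨x, hx⟩)
    rw [← sub_eq_zero, ← map_sub, cls_eq_zero]
    refine ⟨w, ?_⟩
    rw [Subalgebra.coe_sub, hw, f.coe_cocyclesMap]
    simp

/-- If the differential is zero, then every element is a cocycle. -/
noncomputable def toCocycles (hA : A.d = 0) : A.carrier →ₐ[k] A.cocycles :=
  (AlgHom.id k A.carrier).codRestrict A.cocycles (fun x => by
    change A.d x = 0
    rw [hA, LinearMap.zero_apply])

/-- The class map, for an algebra with zero differential. -/
noncomputable def toCohomology (hA : A.d = 0) : Hom A A.cohomology where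
  toAlgHom := A.cls.comp (toCocycles hA)
  map_gr hx := A.mem_cohomologyGr.2 ⟨_, hx, rfl⟩
  map_d x := by
    have : A.d x = 0 := by rw [hA, LinearMap.zero_apply]
    refine Eq.trans (congrArg _ this) (map_zero _)
  map_coact x := by
    refine slice_ext fun φ => ?_
    have h1 : slice φ (A.cohomologyCoact (A.cls (toCocycles hA x))) =
        A.cls (slice φ (A.cocycleCoact (toCocycles hA x))) := by
      rw [cohomologyCoact_cls, slice_rTensor]; rfl
    have h2 : slice φ (A.cocycleCoact (toCocycles hA x)) =
        toCocycles hA (slice φ (A.coact x)) := Subtype.ext (slice_cocycleCoact A φ _)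
    refine Eq.trans h1 ?_
    rw [h2, slice_rTensor]
    rfl

theorem quasiIso_toCohomology (hA : A.d = 0) : (toCohomology hA).QuasiIso := by
  constructor
  · rintro x hx ⟨w, hw⟩
    have h0 : A.cls ⟨x, hx⟩ = 0 := hw
    obtain ⟨v, hv⟩ := (A.cls_eq_zero _).1 h0
    exact ⟨v, hv.symm⟩
  · rintro y -
    obtain ⟨x, rfl⟩ := A.cls_surjective y
    exact ⟨x, x.2, 0, (add_zero _).symm⟩

theorem HomotopyIso.cohomology (h : HomotopyIso A B) :
    HomotopyIso A.cohomology B.cohomology := by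
  induction h with
  | rel A B h =>
    obtain ⟨f, hf⟩ := h
    exact .rel _ _ ⟨f.cohomologyMap, Hom.quasiIso_cohomologyMap hf⟩
  | refl A => exact .refl _
  | symm A B _ ih => exact .symm _ _ ih
  | trans A B C _ _ h1 h2 => exact .trans _ _ _ h1 h2

/-- Chain `A ~ B ~ H(B) ~ H(A)`: the class map of `B` is a quasi-isomorphism as its differential is
zero, and the given zig-zag, applied to cohomology, is run backwards. -/
theorem HomotopyIso.equivariantlyFormal (h : HomotopyIso A B) (hB : B.d = 0) :
    A.EquivariantlyFormal :=
  .trans _ _ _ h (.trans _ _ _ (.rel _ _ ⟨toCohomology hB, quasiIso_toCohomology hB⟩)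
    (.symm _ _ h.cohomology))

end DGGAlgebra

end EqFormality

/-! ### Triangular algebras: from a pointed bimodule to a zig-zag -/

namespace EqFormality

variable {k : Type u} [Field k] {O : Type u} [CommRing O] [HopfAlgebra k O]

/-- A `G`-equivariant dg `A`-`E`-bimodule with an invariant cocycle of degree `0`, for `A` a
`G`-algebra concentrated in even degrees with zero differential. -/
structure PointedBimodule (A E : DGGAlgebra k O) where
  carrier : Type u
  [addCommGroup : AddCommGroup carrier]
  [module : Module k carrier]
  gr : ℤ → Submodule k carrier
  isInternal : DirectSum.IsInternal gr
  d : carrier →ₗ[k] carrier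
  d_mem : ∀ {n x}, x ∈ gr n → d x ∈ gr (n + 1)
  d_d : ∀ x, d (d x) = 0
  left : A.carrier →ₗ[k] carrier →ₗ[k] carrier
  left_one : ∀ m, left 1 m = m
  left_mul : ∀ a b m, left (a * b) m = left a (left b m)
  right : E.carrier →ₗ[k] carrier →ₗ[k] carrier
  right_one : ∀ m, right 1 m = m
  right_mul : ∀ a b m, right (a * b) m = right b (right a m)
  left_right : ∀ a b m, left a (right b m) = right b (left a m)
  left_mem : ∀ {p q a m}, a ∈ A.gr p → m ∈ gr q → left a m ∈ gr (p + q)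
  right_mem : ∀ {p q b m}, b ∈ E.gr p → m ∈ gr q → right b m ∈ gr (q + p)
  d_left : ∀ a m, d (left a m) = left a (d m)
  d_right : ∀ {q m} (b), m ∈ gr q → d (right b m) = right b (d m) + q.negOnePow • right (E.d b) m
  coact : carrier →ₗ[k] carrier ⊗[k] O
  isCoaction : IsCoaction coact
  coact_gr : ∀ {n x}, x ∈ gr n → coact x ∈ LinearMap.range ((gr n).subtype.rTensor O)
  coact_d : ∀ x, coact (d x) = d.rTensor O (coact x)
  coact_left : ∀ a x, coact (left a x) = act O left (A.coact a) (coact x)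
  coact_right : ∀ b x, coact (right b x) = act O right (E.coact b) (coact x)
  pt : carrier
  pt_mem : pt ∈ gr 0
  d_pt : d pt = 0
  coact_pt : coact pt = pt ⊗ₜ 1

attribute [instance] PointedBimodule.addCommGroup PointedBimodule.module

namespace PointedBimodule

variable {A E : DGGAlgebra k O} (T : PointedBimodule A E)

/-- The underlying space `A ⊕ T ⊕ E` of the triangular algebra. -/
def Tri : Type u := A.carrier × T.carrier × E.carrier

noncomputable instance : AddCommGroup T.Tri :=
  inferInstanceAs (AddCommGroup (A.carrier × T.carrier × E.carrier))

noncomputable instance : Module k T.Tri :=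
  inferInstanceAs (Module k (A.carrier × T.carrier × E.carrier))

variable {T} in
@[ext] theorem Tri.ext {x y : T.Tri} (h1 : x.1 = y.1) (h2 : x.2.1 = y.2.1) (h3 : x.2.2 = y.2.2) :
    x = y := Prod.ext h1 (Prod.ext h2 h3)

/-- Multiplication of upper triangular matrices with diagonal entries in `A` and `E` and corner in
`T`. Associativity of the corner is the compatibility of the two actions. -/
noncomputable instance : Mul T.Tri :=
  ⟨fun x y => (x.1 * y.1, T.left x.1 y.2.1 + T.right y.2.2 x.2.1, x.2.2 * y.2.2)⟩

instance : One T.Tri := ⟨(1, 0, 1)⟩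

theorem mul_fst (x y : T.Tri) : (x * y).1 = x.1 * y.1 := rfl
theorem mul_mid (x y : T.Tri) : (x * y).2.1 = T.left x.1 y.2.1 + T.right y.2.2 x.2.1 := rfl
theorem mul_snd (x y : T.Tri) : (x * y).2.2 = x.2.2 * y.2.2 := rfl
theorem one_fst : (1 : T.Tri).1 = 1 := rfl
theorem one_mid : (1 : T.Tri).2.1 = 0 := rfl
theorem one_snd : (1 : T.Tri).2.2 = 1 := rfl
theorem add_fst (x y : T.Tri) : (x + y).1 = x.1 + y.1 := rfl
theorem add_mid (x y : T.Tri) : (x + y).2.1 = x.2.1 + y.2.1 := rfl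
theorem add_snd (x y : T.Tri) : (x + y).2.2 = x.2.2 + y.2.2 := rfl
theorem zero_fst : (0 : T.Tri).1 = 0 := rfl
theorem zero_mid : (0 : T.Tri).2.1 = 0 := rfl
theorem zero_snd : (0 : T.Tri).2.2 = 0 := rfl
theorem smul_fst (c : k) (x : T.Tri) : (c • x).1 = c • x.1 := rfl
theorem smul_mid (c : k) (x : T.Tri) : (c • x).2.1 = c • x.2.1 := rfl
theorem smul_snd (c : k) (x : T.Tri) : (c • x).2.2 = c • x.2.2 := rfl

noncomputable instance : Ring T.Tri :=
  { (inferInstance : AddCommGroup T.Tri) with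
    mul := (· * ·)
    one := 1
    left_distrib := fun x y z => by
      ext
      · simp only [mul_fst, add_fst, mul_add]
      · simp only [mul_mid, add_mid, add_snd, map_add, LinearMap.add_apply]; abel
      · simp only [mul_snd, add_snd, mul_add]
    right_distrib := fun x y z => by
      ext
      · simp only [mul_fst, add_fst, add_mul]
      · simp only [mul_mid, add_mid, add_fst, map_add, LinearMap.add_apply]; abel
      · simp only [mul_snd, add_snd, add_mul]
    zero_mul := fun x => by
      ext
      · simp only [mul_fst, zero_fst, zero_mul]
      · simp only [mul_mid, zero_mid, zero_fst, map_zero, LinearMap.zero_apply, add_zero]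
      · simp only [mul_snd, zero_snd, zero_mul]
    mul_zero := fun x => by
      ext
      · simp only [mul_fst, zero_fst, mul_zero]
      · simp only [mul_mid, zero_mid, zero_snd, map_zero, LinearMap.zero_apply, add_zero]
      · simp only [mul_snd, zero_snd, mul_zero]
    mul_assoc := fun x y z => by
      ext
      · simp only [mul_fst, mul_assoc]
      · simp only [mul_mid, mul_fst, mul_snd, map_add, T.left_mul, T.right_mul, T.left_right,
          add_assoc]
      · simp only [mul_snd, mul_assoc]
    one_mul := fun x => by
      ext
      · simp only [mul_fst, one_fst, one_mul]
      · simp only [mul_mid, one_mid, one_fst, T.left_one, map_zero, add_zero]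
      · simp only [mul_snd, one_snd, one_mul]
    mul_one := fun x => by
      ext
      · simp only [mul_fst, one_fst, mul_one]
      · simp only [mul_mid, one_mid, one_snd, T.right_one, map_zero, zero_add]
      · simp only [mul_snd, one_snd, mul_one] }

noncomputable instance : Algebra k T.Tri :=
  Algebra.ofModule
    (fun c x y => by
      ext
      · simp only [mul_fst, smul_fst, smul_mul_assoc]
      · simp only [mul_mid, smul_mid, smul_fst, map_smul, LinearMap.smul_apply, smul_add]
      · simp only [mul_snd, smul_snd, smul_mul_assoc])
    (fun c x y => by
      ext
      · simp only [mul_fst, smul_fst, mul_smul_comm]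
      · simp only [mul_mid, smul_mid, smul_snd, map_smul, LinearMap.smul_apply, smul_add]
      · simp only [mul_snd, smul_snd, mul_smul_comm])

/-- The grading on the triangular algebra, with `T` shifted by one. -/
def triGr (n : ℤ) : Submodule k T.Tri :=
  (A.gr n).prod ((T.gr (n + -1)).prod (E.gr n))

theorem triGr_isInternal : DirectSum.IsInternal T.triGr :=
  isInternal_prod A.isInternal (isInternal_prod (isInternal_shift T.isInternal (-1)) E.isInternal)

/-- The differential `(a, s, e) ↦ (0, a t - t e - d s, d e)` of the triangular algebra. -/
noncomputable def triD : T.Tri →ₗ[k] T.Tri where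
  toFun x := (0, T.left x.1 T.pt - T.right x.2.2 T.pt - T.d x.2.1, E.d x.2.2)
  map_add' x y := by
    ext
    · exact (add_zero _).symm
    · change T.left (x.1 + y.1) T.pt - T.right (x.2.2 + y.2.2) T.pt - T.d (x.2.1 + y.2.1) =
        (T.left x.1 T.pt - T.right x.2.2 T.pt - T.d x.2.1) +
        (T.left y.1 T.pt - T.right y.2.2 T.pt - T.d y.2.1)
      simp only [map_add, LinearMap.add_apply]
      abel
    · exact map_add E.d _ _
  map_smul' c x := by
    ext
    · exact (smul_zero _).symm
    · change T.left (c • x.1) T.pt - T.right (c • x.2.2) T.pt - T.d (c • x.2.1) =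
        c • (T.left x.1 T.pt - T.right x.2.2 T.pt - T.d x.2.1)
      simp only [map_smul, LinearMap.smul_apply, smul_sub]
    · exact map_smul E.d _ _

theorem triD_fst (x : T.Tri) : (T.triD x).1 = 0 := rfl
theorem triD_mid (x : T.Tri) : (T.triD x).2.1 =
    T.left x.1 T.pt - T.right x.2.2 T.pt - T.d x.2.1 := rfl
theorem triD_snd (x : T.Tri) : (T.triD x).2.2 = E.d x.2.2 := rfl

theorem d_right_pt (e : E.carrier) : T.d (T.right e T.pt) = T.right (E.d e) T.pt := by
  rw [T.d_right e T.pt_mem, T.d_pt]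
  simp

theorem d_left_pt (a : A.carrier) : T.d (T.left a T.pt) = 0 := by
  rw [T.d_left, T.d_pt, map_zero]

/-- The inclusion of `A` in the triangular algebra. -/
noncomputable def inA : A.carrier →ₗ[k] T.Tri := LinearMap.inl k A.carrier (T.carrier × E.carrier)

/-- The inclusion of the bimodule in the triangular algebra. -/
noncomputable def inT : T.carrier →ₗ[k] T.Tri :=
  LinearMap.inr k A.carrier (T.carrier × E.carrier) ∘ₗ LinearMap.inl k T.carrier E.carrier

/-- The inclusion of `E` in the triangular algebra. -/
noncomputable def inE : E.carrier →ₗ[k] T.Tri :=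
  LinearMap.inr k A.carrier (T.carrier × E.carrier) ∘ₗ LinearMap.inr k T.carrier E.carrier

theorem inA_mul_inA (a b : A.carrier) : T.inA a * T.inA b = T.inA (LinearMap.mul k _ a b) := by
  refine Tri.ext rfl ?_ (mul_zero _)
  change T.left a 0 + T.right 0 0 = 0
  simp

theorem inA_mul_inT (a : A.carrier) (s : T.carrier) : T.inA a * T.inT s = T.inT (T.left a s) := by
  refine Tri.ext (mul_zero _) ?_ (mul_zero _)
  change T.left a s + T.right 0 0 = T.left a s
  simp

theorem inT_mul_inE (s : T.carrier) (e : E.carrier) :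
    T.inT s * T.inE e = T.inT (T.right.flip s e) := by
  refine Tri.ext (mul_zero _) ?_ (zero_mul _)
  change T.left 0 0 + T.right e s = T.right e s
  simp

theorem inE_mul_inE (a b : E.carrier) : T.inE a * T.inE b = T.inE (LinearMap.mul k _ a b) := by
  refine Tri.ext (mul_zero _) ?_ rfl
  change T.left 0 0 + T.right b 0 = 0
  simp

theorem inA_mul_inE (a : A.carrier) (e : E.carrier) : T.inA a * T.inE e = 0 := by
  refine Tri.ext (mul_zero _) ?_ (zero_mul _)
  change T.left a 0 + T.right e 0 = 0
  simp

theorem inT_mul_inA (s : T.carrier) (a : A.carrier) : T.inT s * T.inA a = 0 := by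
  refine Tri.ext (zero_mul _) ?_ (zero_mul _)
  change T.left 0 0 + T.right 0 s = 0
  simp

theorem inT_mul_inT (s s' : T.carrier) : T.inT s * T.inT s' = 0 := by
  refine Tri.ext (zero_mul _) ?_ (zero_mul _)
  change T.left 0 s' + T.right 0 s = 0
  simp

theorem inE_mul_inA (e : E.carrier) (a : A.carrier) : T.inE e * T.inA a = 0 := by
  refine Tri.ext (zero_mul _) ?_ (mul_zero _)
  change T.left 0 0 + T.right 0 0 = 0
  simp

theorem inE_mul_inT (e : E.carrier) (s : T.carrier) : T.inE e * T.inT s = 0 := by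
  refine Tri.ext (zero_mul _) ?_ (mul_zero _)
  change T.left 0 s + T.right 0 0 = 0
  simp

/-- The coaction on the triangular algebra. -/
noncomputable def triCoact : T.Tri →ₗ[k] T.Tri ⊗[k] O :=
  prodCoact A.coact.toLinearMap (prodCoact T.coact E.coact.toLinearMap)

theorem triCoact_apply (x : T.Tri) : T.triCoact x = T.inA.rTensor O (A.coact x.1) +
    (T.inT.rTensor O (T.coact x.2.1) + T.inE.rTensor O (E.coact x.2.2)) := by
  refine Eq.trans (prodCoact_apply _ _ _) ?_
  rw [prodCoact_apply, map_add, ← LinearMap.rTensor_comp_apply, ← LinearMap.rTensor_comp_apply]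
  rfl

theorem act_zero {X Y Z : Type*} [AddCommGroup X] [Module k X] [AddCommGroup Y] [Module k Y]
    [AddCommGroup Z] [Module k Z] (s : X ⊗[k] O) (t : Y ⊗[k] O) :
    act O (0 : X →ₗ[k] Y →ₗ[k] Z) s t = 0 := by
  induction s with
  | zero => simp
  | add x y hx hy => simp only [map_add, hx, hy, LinearMap.add_apply, add_zero]
  | tmul x o =>
    induction t with
    | zero => simp
    | add x y hx hy => simp only [map_add, hx, hy, add_zero]
    | tmul y o' => simp

theorem act_flip {X Y Z : Type*} [AddCommGroup X] [Module k X] [AddCommGroup Y] [Module k Y]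
    [AddCommGroup Z] [Module k Z] (j : X →ₗ[k] Y →ₗ[k] Z) (s : X ⊗[k] O) (t : Y ⊗[k] O) :
    act O j.flip t s = act O j s t := by
  induction s with
  | zero => simp
  | add x y hx hy => simp only [map_add, hx, hy, LinearMap.add_apply]
  | tmul x o =>
    induction t with
    | zero => simp
    | add x y hx hy => simp only [map_add, hx, hy, LinearMap.add_apply]
    | tmul y o' => simp [mul_comm]

theorem act_mul' {R : Type*} [Ring R] [Algebra k R] (s t : R ⊗[k] O) :
    act O (LinearMap.mul k R) s t = s * t := by
  have := rTensor_mul_rTensor (f := LinearMap.id) (g := LinearMap.id) (h := LinearMap.id)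
    (LinearMap.mul k R) (fun x y => rfl) s t
  simpa using this.symm

theorem triCoact_mul (x y : T.Tri) : T.triCoact (x * y) = T.triCoact x * T.triCoact y := by
  -- Of the nine products of blocks five vanish; the remaining four are governed by the products of
  -- `A` and `E` and by the two actions on `T`.
  have zero : ∀ {X Y : Type u} [AddCommGroup X] [Module k X] [AddCommGroup Y] [Module k Y]
      (f : X →ₗ[k] T.Tri) (g : Y →ₗ[k] T.Tri) (_ : ∀ x y, f x * g y = 0) (s : X ⊗[k] O)
      (t : Y ⊗[k] O), f.rTensor O s * g.rTensor O t = 0 := by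
    intro X Y _ _ _ _ f g H s t
    rw [rTensor_mul_rTensor (h := (0 : T.Tri →ₗ[k] T.Tri)) 0 (fun x y => by simpa using H x y),
      act_zero, map_zero]
  rw [triCoact_apply, triCoact_apply, triCoact_apply]
  simp only [mul_add, add_mul]
  rw [zero _ _ T.inA_mul_inE, zero _ _ T.inT_mul_inA, zero _ _ T.inT_mul_inT,
    zero _ _ T.inE_mul_inA, zero _ _ T.inE_mul_inT,
    rTensor_mul_rTensor _ T.inA_mul_inA, rTensor_mul_rTensor _ T.inA_mul_inT,
    rTensor_mul_rTensor _ T.inT_mul_inE, rTensor_mul_rTensor _ T.inE_mul_inE, act_mul', act_mul',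
    act_flip, ← T.coact_left, ← T.coact_right, mul_fst, mul_mid, mul_snd, map_mul A.coact,
    map_mul E.coact, map_add T.coact, map_add]
  abel

theorem triCoact_one : T.triCoact 1 = 1 := by
  rw [triCoact_apply, one_fst, one_mid, one_snd, map_one A.coact, map_one E.coact, map_zero,
    map_zero, zero_add,
    Algebra.TensorProduct.one_def, Algebra.TensorProduct.one_def, Algebra.TensorProduct.one_def,
    LinearMap.rTensor_tmul, LinearMap.rTensor_tmul, ← TensorProduct.add_tmul]
  congr 1
  refine Tri.ext (add_zero _) (add_zero _) (zero_add _)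

theorem slice_triCoact (φ : O →ₗ[k] k) (x : T.Tri) : slice φ (T.triCoact x) =
    (slice φ (A.coact x.1), slice φ (T.coact x.2.1), slice φ (E.coact x.2.2)) := by
  rw [triCoact_apply, map_add, map_add, slice_rTensor, slice_rTensor, slice_rTensor]
  refine Tri.ext ?_ ?_ ?_
  · exact (congrArg _ (add_zero _)).trans (add_zero _)
  · exact (zero_add _).trans (add_zero _)
  · exact (zero_add _).trans (zero_add _)

variable {T} in
theorem triCoact_d (x : T.Tri) : T.triCoact (T.triD x) = T.triD.rTensor O (T.triCoact x) := by
  refine slice_ext fun φ => ?_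
  rw [slice_rTensor, slice_triCoact, slice_triCoact]
  have h1 : ∀ a, slice φ (T.coact (T.left a T.pt)) = T.left (slice φ (A.coact a)) T.pt := by
    intro a
    rw [T.coact_left, T.coact_pt]
    induction A.coact a with
    | zero => simp
    | add x y hx hy => simp only [map_add, LinearMap.add_apply, hx, hy]
    | tmul x o => simp
  have h2 : ∀ a, slice φ (T.coact (T.right a T.pt)) = T.right (slice φ (E.coact a)) T.pt := by
    intro a
    rw [T.coact_right, T.coact_pt]
    induction E.coact a with
    | zero => simp
    | add x y hx hy => simp only [map_add, LinearMap.add_apply, hx, hy]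
    | tmul x o => simp
  refine Tri.ext ?_ ?_ ?_
  · change slice φ (A.coact (T.triD x).1) = 0
    rw [triD_fst, map_zero, map_zero]
  · change slice φ (T.coact (T.triD x).2.1) = T.left (slice φ (A.coact x.1)) T.pt -
      T.right (slice φ (E.coact x.2.2)) T.pt - T.d (slice φ (T.coact x.2.1))
    rw [triD_mid, map_sub, map_sub, map_sub, map_sub, h1, h2, T.coact_d, slice_rTensor]
  · change slice φ (E.coact (T.triD x).2.2) = E.d (slice φ (E.coact x.2.2))
    rw [triD_snd, E.coact_d, slice_rTensor]

/-- The triangular dg `G`-algebra with entries `A`, `Σ⁻¹ T` and `E`, whose differential is twisted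
by the point of `T`. -/
noncomputable def tri (hA : ∀ n, ∀ x ∈ A.gr n, n.negOnePow • x = x) : DGGAlgebra k O where
  carrier := T.Tri
  gr := T.triGr
  isInternal := T.triGr_isInternal
  gradedMonoid :=
    { one_mem := ⟨A.one_mem, zero_mem _, E.one_mem⟩
      mul_mem := by
        rintro m n x y ⟨h1, h2, h3⟩ ⟨h1', h2', h3'⟩
        refine ⟨A.gradedMonoid.mul_mem h1 h1', ?_, E.gradedMonoid.mul_mem h3 h3'⟩
        refine add_mem ?_ ?_
        · have := T.left_mem h1 h2'
          rwa [← add_assoc] at this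
        · have := T.right_mem h3' h2
          rwa [add_right_comm] at this }
  d := T.triD
  d_mem := by
    rintro n x ⟨h1, h2, h3⟩
    refine ⟨zero_mem _, ?_, E.d_mem h3⟩
    have e : n + 1 + -1 = n := by ring
    change _ ∈ T.gr (n + 1 + -1)
    rw [e]
    refine sub_mem (sub_mem ?_ ?_) ?_
    · simpa using T.left_mem h1 T.pt_mem
    · simpa using T.right_mem h3 T.pt_mem
    · simpa using T.d_mem h2
  d_d x := by
    refine Tri.ext rfl ?_ ?_
    · rw [triD_mid, triD_fst, triD_snd, triD_mid, map_sub, map_sub, d_left_pt, d_right_pt, T.d_d,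
        map_zero, LinearMap.zero_apply, zero_sub, sub_zero, sub_neg_eq_add, neg_add_cancel]
      rfl
    · rw [triD_snd, triD_snd, E.d_d]
      rfl
  leibniz := by
    rintro n x y ⟨h1, h2, h3⟩
    refine Tri.ext ?_ ?_ ?_
    · change 0 = 0 * y.1 + n.negOnePow • (x.1 * 0)
      simp
    · change T.left (x.1 * y.1) T.pt - T.right (x.2.2 * y.2.2) T.pt -
          T.d (T.left x.1 y.2.1 + T.right y.2.2 x.2.1) =
        (T.left 0 y.2.1 + T.right y.2.2 (T.left x.1 T.pt - T.right x.2.2 T.pt - T.d x.2.1)) +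
        n.negOnePow • (T.left x.1 (T.left y.1 T.pt - T.right y.2.2 T.pt - T.d y.2.1) +
          T.right (E.d y.2.2) x.2.1)
      -- Evenness of `A` is what allows a left action without signs.
      have hs : ∀ s, n.negOnePow • T.left x.1 s = T.left x.1 s := by
        intro s
        have := congrArg (fun a => T.left a s) (hA n x.1 h1)
        simp only [Units.smul_def, map_zsmul, LinearMap.smul_apply] at this ⊢
        exact this
      -- A corner of degree `n` lies in degree `n - 1` of `T`; the resulting sign matches the minus
      -- in front of `T.d` in `triD`.
      have hn : (n + -1).negOnePow = - n.negOnePow := by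
        rw [Int.negOnePow_add]; simp
      rw [smul_add, hs, T.left_mul, T.right_mul, map_add, T.d_left, T.d_right _ h2, hn, map_sub,
        map_sub, map_sub, map_sub, T.left_right]
      simp only [map_zero, LinearMap.zero_apply, Units.smul_def, Units.val_neg, neg_smul]
      abel
    · exact E.leibniz y.2.2 h3
  coact := AlgHom.ofLinearMap T.triCoact T.triCoact_one T.triCoact_mul
  isCoaction := A.isCoaction.prod (T.isCoaction.prod E.isCoaction)
  coact_gr := by
    rintro n x ⟨h1, h2, h3⟩
    rw [mem_range_rTensor_iff]
    intro φ
    change slice φ (T.triCoact x) ∈ _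
    rw [slice_triCoact]
    exact ⟨(mem_range_rTensor_iff _ _).1 (A.coact_gr h1) φ,
      (mem_range_rTensor_iff _ _).1 (T.coact_gr h2) φ,
      (mem_range_rTensor_iff _ _).1 (E.coact_gr h3) φ⟩
  coact_d x := triCoact_d x

variable (hA : ∀ n, ∀ x ∈ A.gr n, n.negOnePow • x = x)

/-- The projection of the triangular algebra to `A`. -/
noncomputable def projA (hd : A.d = 0) : DGGAlgebra.Hom (T.tri hA) A where
  toAlgHom := AlgHom.ofLinearMap (LinearMap.fst k A.carrier (T.carrier × E.carrier)) rfl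
    (fun _ _ => rfl)
  map_gr hx := hx.1
  map_d x := by rw [hd]; rfl
  map_coact x := (fst_prodCoact A.coact.toLinearMap (prodCoact T.coact E.coact.toLinearMap) x).symm

/-- The projection of the triangular algebra to `E`, as a map of algebras. -/
noncomputable def projEAlgHom : T.Tri →ₐ[k] E.carrier where
  toFun x := x.2.2
  map_one' := rfl
  map_mul' _ _ := rfl
  map_zero' := rfl
  map_add' _ _ := rfl
  commutes' c := by
    rw [Algebra.algebraMap_eq_smul_one, Algebra.algebraMap_eq_smul_one]
    rfl

theorem projEAlgHom_triCoact (x : T.Tri) :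
    T.projEAlgHom.toLinearMap.rTensor O (T.triCoact x) = E.coact x.2.2 := by
  refine slice_ext fun φ => ?_
  rw [slice_rTensor, slice_triCoact]
  rfl

/-- The projection of the triangular algebra to `E`. -/
noncomputable def projE : DGGAlgebra.Hom (T.tri hA) E where
  toAlgHom := T.projEAlgHom
  map_gr hx := hx.2.2
  map_d _ := rfl
  map_coact x := (T.projEAlgHom_triCoact x).symm

/-- If `a ↦ a t` and `e ↦ t e` are quasi-isomorphisms `A → T ← E`, then `E` and `A` are
equivariantly homotopy isomorphic. -/
theorem homotopyIso (hA : ∀ n, ∀ x ∈ A.gr n, n.negOnePow • x = x) (hd : A.d = 0)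
    (h1 : IsQuasiIso A.d T.d (T.left.flip T.pt))
    (h2 : IsQuasiIso E.d T.d (T.right.flip T.pt)) : DGGAlgebra.HomotopyIso E A := by
  have hA0 : ∀ a, A.d a = 0 := fun a => by rw [hd, LinearMap.zero_apply]
  -- The kernel of the projection to `E` is a shifted cone of `a ↦ a t`, the kernel of the
  -- projection to `A` is one of `e ↦ t e`. Acyclicity of these cones is unwound into the four
  -- goals: injectivity and surjectivity for `projE` by `h1`, then for `projA`, mainly by `h2`.
  refine .trans _ (T.tri hA) _ (.symm _ _ (.rel _ _ ⟨T.projE hA, ?_, ?_⟩))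
    (.rel _ _ ⟨T.projA hA hd, ?_, ?_⟩)
  · rintro ⟨a, s, e⟩ hx ⟨e', he⟩
    change e = E.d e' at he
    have hm : T.left a T.pt - T.right e T.pt - T.d s = 0 :=
      congrArg (fun y : T.Tri => y.2.1) hx
    have ha : T.left a T.pt = T.d (T.right e' T.pt + s) := by
      rw [map_add, d_right_pt, ← he]
      rw [sub_sub, sub_eq_zero] at hm
      exact hm
    -- The middle entry of the cocycle equation says that `a t` is a coboundary; hence `a` is one,
    -- so `a = 0` because `A` has zero differential.
    obtain ⟨v, hv⟩ := h1.1 a (hA0 a) ⟨_, ha⟩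
    rw [hA0] at hv
    subst hv
    rw [map_zero, LinearMap.zero_apply] at ha
    obtain ⟨a', -, w, hw⟩ := h1.2 _ ha.symm
    refine ⟨((a', -w, e') : T.Tri), Tri.ext rfl ?_ he⟩
    change s = T.left a' T.pt - T.right e' T.pt - T.d (-w)
    rw [LinearMap.flip_apply] at hw
    rw [map_neg, ← add_sub_cancel_left (T.right e' T.pt) s, hw]
    abel
  · intro e he
    obtain ⟨a, -, w, hw⟩ := h1.2 (T.right e T.pt) (by rw [d_right_pt, he]; simp)
    refine ⟨((a, -w, e) : T.Tri), Tri.ext rfl ?_ he, 0, ?_⟩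
    · change T.left a T.pt - T.right e T.pt - T.d (-w) = 0
      rw [hw, map_neg, LinearMap.flip_apply]
      abel
    · rw [map_zero, add_zero]
      rfl
  · rintro ⟨a, s, e⟩ hx ⟨w, hw⟩
    change a = A.d w at hw
    rw [hA0] at hw
    subst hw
    have hm : T.left (0 : A.carrier) T.pt - T.right e T.pt - T.d s = 0 :=
      congrArg (fun y : T.Tri => y.2.1) hx
    have he : E.d e = 0 := congrArg (fun y : T.Tri => y.2.2) hx
    rw [map_zero, LinearMap.zero_apply, zero_sub, ← neg_add', neg_eq_zero] at hm
    obtain ⟨e', he'⟩ := h2.1 e he ⟨-s, by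
      rw [map_neg]; exact eq_neg_of_add_eq_zero_left hm⟩
    have : T.d (T.right e' T.pt + s) = 0 := by
      rw [map_add, d_right_pt, ← he', hm]
    obtain ⟨e'', he'', w, hw⟩ := h2.2 _ this
    refine ⟨((0, -w, e' - e'') : T.Tri), Tri.ext rfl ?_ ?_⟩
    · change s = T.left 0 T.pt - T.right (e' - e'') T.pt - T.d (-w)
      rw [LinearMap.flip_apply] at hw
      rw [map_zero, LinearMap.zero_apply, map_sub, LinearMap.sub_apply, map_neg]
      have : s = T.right e'' T.pt + T.d w - T.right e' T.pt := by rw [← hw]; abel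
      rw [this]; abel
    · change e = E.d (e' - e'')
      rw [map_sub, he'', ← he', sub_zero]
  · intro a _
    obtain ⟨e, he, w, hw⟩ := h2.2 (T.left a T.pt) (T.d_left_pt a)
    refine ⟨((a, w, e) : T.Tri), Tri.ext rfl ?_ he, 0, ?_⟩
    · change T.left a T.pt - T.right e T.pt - T.d w = 0
      rw [hw, LinearMap.flip_apply]
      abel
    · rw [map_zero, add_zero]
      rfl

end PointedBimodule

end EqFormality

/-! ### Signs and homogeneous maps of bimodules -/

namespace EqFormality

theorem map_units_zsmul {k M N : Type*} [Field k] [AddCommGroup M] [Module k M] [AddCommGroup N]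
    [Module k N] (f : M →ₗ[k] N) (c : ℤˣ) (x : M) : f (c • x) = c • f x := by
  rw [Units.smul_def, map_zsmul, Units.smul_def]

/-- The map `x ↦ (-1) ^ (n p) x` for `x` of degree `p`. -/
noncomputable def signPow {k M : Type*} [Field k] [AddCommGroup M] [Module k M]
    {gr : ℤ → Submodule k M} (h : DirectSum.IsInternal gr) (n : ℤ) : M →ₗ[k] M :=
  DirectSum.toModule k ℤ M (fun p => (n * p).negOnePow • (gr p).subtype) ∘ₗ
    (decompEquiv h).toLinearMap

theorem signPow_of_mem {k M : Type*} [Field k] [AddCommGroup M] [Module k M]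
    {gr : ℤ → Submodule k M} (h : DirectSum.IsInternal gr) (n : ℤ) {p : ℤ} {x : M}
    (hx : x ∈ gr p) : signPow h n x = (n * p).negOnePow • x := by
  simp only [signPow, LinearMap.comp_apply, LinearEquiv.coe_coe, decompEquiv_of_mem h hx,
    DirectSum.toModule_lof]
  rfl

variable {k : Type u} [Field k] {O : Type u} [CommRing O] [HopfAlgebra k O]
  {P : ParamAlgebra k O}

theorem EquivariantDGAlgebra.signPow_mul (K : EquivariantDGAlgebra P) (n : ℤ) (a b : K.carrier) :
    signPow K.isInternal n (a * b) = signPow K.isInternal n a * signPow K.isInternal n b := by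
  refine gr_induction (p := fun a => signPow K.isInternal n (a * b) =
    signPow K.isInternal n a * signPow K.isInternal n b) K.isInternal a ?_ (by simp)
    (fun x y hx hy => by simp only [add_mul, map_add, hx, hy])
  intro p a ha
  refine gr_induction (p := fun b => signPow K.isInternal n (a * b) =
    signPow K.isInternal n a * signPow K.isInternal n b) K.isInternal b ?_ (by simp)
    (fun x y hx hy => by simp only [mul_add, map_add, hx, hy])
  intro q b hb
  rw [signPow_of_mem _ _ (K.gradedMonoid.mul_mem ha hb), signPow_of_mem _ _ ha,
    signPow_of_mem _ _ hb, mul_add, Int.negOnePow_add, smul_mul_smul_comm]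

theorem EquivariantDGAlgebra.signPow_unit (K : EquivariantDGAlgebra P) (n : ℤ) (z : P.carrier) :
    signPow K.isInternal n (K.unit z) = K.unit z := by
  rw [signPow_of_mem _ _ (K.unit_mem z)]
  simp

namespace DGBimodule

variable {K : EquivariantDGAlgebra P}

/-! ### Homogeneous linear maps between bimodules -/

/-- The `K ⊗_Z K`-linear maps `X → Y` of degree `n`. -/
def homDeg (X Y : DGBimodule K) (n : ℤ) : Submodule k (X.carrier →ₗ[k] Y.carrier) where
  carrier := {f | (∀ q, ∀ m ∈ X.gr q, f m ∈ Y.gr (q + n)) ∧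
    (∀ p, ∀ a ∈ K.gr p, ∀ m, f (X.left a m) = (n * p).negOnePow • Y.left a (f m)) ∧
    (∀ b m, f (X.right b m) = Y.right b (f m))}
  add_mem' := by
    rintro f g ⟨h1, h2, h3⟩ ⟨h1', h2', h3'⟩
    refine ⟨fun q m hm => add_mem (h1 q m hm) (h1' q m hm), fun p a ha m => ?_, fun b m => ?_⟩
    · simp only [LinearMap.add_apply, h2 p a ha, h2' p a ha, map_add, smul_add]
    · simp only [LinearMap.add_apply, h3, h3', map_add]
  zero_mem' := by
    refine ⟨fun q m hm => ?_, fun p a ha m => ?_, fun b m => ?_⟩ <;> simp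
  smul_mem' := by
    rintro c f ⟨h1, h2, h3⟩
    refine ⟨fun q m hm => Submodule.smul_mem _ c (h1 q m hm), fun p a ha m => ?_, fun b m => ?_⟩
    · simp only [LinearMap.smul_apply, h2 p a ha, map_smul]
      rw [smul_comm]
    · simp only [LinearMap.smul_apply, h3, map_smul]

variable {X Y Z : DGBimodule K}

theorem Hom.mem_homDeg (u : Hom X Y) : u.toLinearMap ∈ homDeg X Y 0 :=
  ⟨fun q m hm => by simpa using u.map_gr hm, fun p a _ m => by simpa using u.map_left a m,
    u.map_right⟩

theorem homDeg_comp {m n : ℤ} {f : Y.carrier →ₗ[k] Z.carrier} {g : X.carrier →ₗ[k] Y.carrier}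
    (hf : f ∈ homDeg Y Z m) (hg : g ∈ homDeg X Y n) : f ∘ₗ g ∈ homDeg X Z (n + m) := by
  refine ⟨fun q x hx => ?_, fun p a ha x => ?_, fun b x => ?_⟩
  · have := hf.1 _ _ (hg.1 _ _ hx)
    rwa [add_assoc] at this
  · rw [LinearMap.comp_apply, hg.2.1 p a ha, map_units_zsmul, hf.2.1 p a ha, smul_smul,
      ← Int.negOnePow_add, add_mul]
    rfl
  · rw [LinearMap.comp_apply, hg.2.2, hf.2.2]
    rfl

theorem homDeg_comp_hom {n : ℤ} {f : Y.carrier →ₗ[k] Z.carrier} (hf : f ∈ homDeg Y Z n)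
    (u : Hom X Y) : f ∘ₗ u.toLinearMap ∈ homDeg X Z n := by
  simpa using homDeg_comp hf u.mem_homDeg

theorem hom_comp_homDeg {n : ℤ} {f : X.carrier →ₗ[k] Y.carrier} (hf : f ∈ homDeg X Y n)
    (u : Hom Y Z) : u.toLinearMap ∘ₗ f ∈ homDeg X Z n := by
  simpa using homDeg_comp u.mem_homDeg hf

/-- The differential `f ↦ d f - (-1) ^ n f d` on maps of degree `n`. -/
def homD (X Y : DGBimodule K) (n : ℤ) :
    (X.carrier →ₗ[k] Y.carrier) →ₗ[k] (X.carrier →ₗ[k] Y.carrier) where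
  toFun f := Y.d ∘ₗ f - n.negOnePow • (f ∘ₗ X.d)
  map_add' f g := by
    ext x
    simp only [LinearMap.sub_apply, LinearMap.comp_apply, LinearMap.add_apply, map_add,
      LinearMap.smul_apply, smul_add]
    abel
  map_smul' c f := by
    ext x
    simp only [LinearMap.sub_apply, LinearMap.comp_apply, LinearMap.smul_apply, map_smul,
      RingHom.id_apply, smul_sub]
    rw [smul_comm]

theorem homD_apply (n : ℤ) (f : X.carrier →ₗ[k] Y.carrier) (x : X.carrier) :
    homD X Y n f x = Y.d (f x) - n.negOnePow • f (X.d x) := rfl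

theorem homD_comp_hom (n : ℤ) (f : Y.carrier →ₗ[k] Z.carrier) (u : Hom X Y) :
    homD Y Z n f ∘ₗ u.toLinearMap = homD X Z n (f ∘ₗ u.toLinearMap) := by
  ext x
  simp only [LinearMap.comp_apply, homD_apply, u.map_d]

theorem hom_comp_homD (n : ℤ) (f : X.carrier →ₗ[k] Y.carrier) (u : Hom Y Z) :
    u.toLinearMap ∘ₗ homD X Y n f = homD X Z n (u.toLinearMap ∘ₗ f) := by
  ext x
  simp only [LinearMap.comp_apply, homD_apply, map_sub, map_units_zsmul, u.map_d]

theorem homD_mem {n : ℤ} {f : X.carrier →ₗ[k] Y.carrier} (hf : f ∈ homDeg X Y n) :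
    homD X Y n f ∈ homDeg X Y (n + 1) := by
  refine ⟨fun q m hm => ?_, fun p a ha m => ?_, fun b m => ?_⟩
  · rw [homD_apply, Units.smul_def]
    refine sub_mem ?_ (zsmul_mem ?_ _)
    · have := Y.d_mem (hf.1 _ _ hm)
      rwa [add_assoc] at this
    · have := hf.1 _ _ (X.d_mem hm)
      rwa [add_assoc, add_comm 1 n] at this
  · rw [homD_apply, homD_apply, hf.2.1 p a ha, X.d_left m ha, map_add,
      hf.2.1 _ _ (K.d_mem ha), map_units_zsmul, Y.d_left _ ha, map_units_zsmul f,
      hf.2.1 p a ha, map_sub, map_units_zsmul]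
    have h1 : (n * (p + 1)).negOnePow = (n * p).negOnePow * n.negOnePow := by
      rw [← Int.negOnePow_add]; congr 1; ring
    have h2 : ((n + 1) * p).negOnePow = (n * p).negOnePow * p.negOnePow := by
      rw [← Int.negOnePow_add]; congr 1; ring
    rw [h1, h2]
    rcases Int.units_eq_one_or n.negOnePow with hn | hn <;>
    rcases Int.units_eq_one_or p.negOnePow with hp | hp <;>
    rcases Int.units_eq_one_or (n * p).negOnePow with hnp | hnp <;>
    rw [hn, hp, hnp] <;> simp <;> abel
  · refine gr_induction (p := fun m => homD X Y n f (X.right b m) = Y.right b (homD X Y n f m))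
      X.isInternal m ?_ (by simp) (fun x y hx hy => by simp only [map_add, hx, hy])
    intro q m hm
    rw [homD_apply, homD_apply, hf.2.2, Y.d_right b (hf.1 _ _ hm), X.d_right b hm, map_add,
      hf.2.2, map_units_zsmul, hf.2.2, map_sub, map_units_zsmul, Int.negOnePow_add]
    rcases Int.units_eq_one_or n.negOnePow with hn | hn <;>
    rcases Int.units_eq_one_or q.negOnePow with hp | hp <;>
    rw [hn, hp] <;> simp

theorem homD_homD (n : ℤ) (f : X.carrier →ₗ[k] Y.carrier) :
    homD X Y (n + 1) (homD X Y n f) = 0 := by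
  ext x
  rw [homD_apply, homD_apply, homD_apply, map_sub, X.d_d, Y.d_d, Int.negOnePow_succ,
    map_units_zsmul]
  simp

/-- A morphism commutes with the projections to components, so homogeneous elements have homogeneous
preimages. Together with `exists_factor_surjective` this produces homogeneous maps on quotients. -/
theorem homDeg_of_comp_surjective {n : ℤ} (p : Hom X Y) (hp : Function.Surjective p.toLinearMap)
    {f : Y.carrier →ₗ[k] Z.carrier} (hf : f ∘ₗ p.toLinearMap ∈ homDeg X Z n) :
    f ∈ homDeg Y Z n := by
  refine ⟨fun q y hy => ?_, fun r a ha y => ?_, fun b y => ?_⟩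
  · obtain ⟨x, rfl⟩ := hp y
    rw [← component_of_mem Y.isInternal hy,
      ← component_natural_zero X.isInternal Y.isInternal (fun _ _ h => p.map_gr h)]
    exact hf.1 q _ (component_mem _ _ _)
  · obtain ⟨x, rfl⟩ := hp y
    rw [← p.map_left]
    exact hf.2.1 r a ha x
  · obtain ⟨x, rfl⟩ := hp y
    rw [← p.map_right]
    exact hf.2.2 b x

theorem Hom.component (u : Hom X Y) (n : ℤ) (x : X.carrier) :
    u.toLinearMap (component X.isInternal n x) = component Y.isInternal n (u.toLinearMap x) :=
  component_natural_zero X.isInternal Y.isInternal (fun _ _ h => u.map_gr h) n x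

theorem Hom.exists_mem_gr (p : Hom X Y) (hp : Function.Surjective p.toLinearMap) {n : ℤ}
    {y : Y.carrier} (hy : y ∈ Y.gr n) : ∃ x ∈ X.gr n, p.toLinearMap x = y := by
  obtain ⟨x, rfl⟩ := hp y
  exact ⟨_, component_mem X.isInternal n x, by rw [p.component, component_of_mem _ hy]⟩

theorem Hom.mem_gr_of_injective (u : Hom X Y) (hu : Function.Injective u.toLinearMap) {n : ℤ}
    {x : X.carrier} (hx : u.toLinearMap x ∈ Y.gr n) : x ∈ X.gr n := by
  have : DGBimodule.Hom.toLinearMap u (EqFormality.component X.isInternal n x) =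
      u.toLinearMap x := by
    rw [u.component, component_of_mem _ hx]
  rw [← hu this]
  exact component_mem _ _ _

/-- A bimodule map into `X` whose image lies in a sub-bimodule factors through it, compatibly with
all the structure which the map respects. -/
theorem homDeg_of_comp_injective {n : ℤ} (u : Hom Y Z) (hu : Function.Injective u.toLinearMap)
    {f : X.carrier →ₗ[k] Y.carrier} (hf : u.toLinearMap ∘ₗ f ∈ homDeg X Z n) :
    f ∈ homDeg X Y n := by
  refine ⟨fun q x hx => u.mem_gr_of_injective hu (hf.1 q x hx), fun r a ha x => hu ?_,
    fun b x => hu ?_⟩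
  · rw [map_units_zsmul, u.map_left]
    exact hf.2.1 r a ha x
  · rw [u.map_right]
    exact hf.2.2 b x

theorem exists_factor {V W W' : Type*} [AddCommGroup V] [Module k V] [AddCommGroup W] [Module k W]
    [AddCommGroup W'] [Module k W'] {f : V →ₗ[k] W} {g : W' →ₗ[k] W} (hg : Function.Injective g)
    (h : ∀ x, f x ∈ LinearMap.range g) : ∃ l : V →ₗ[k] W', g ∘ₗ l = f := by
  refine ⟨(LinearEquiv.ofInjective g hg).symm.toLinearMap ∘ₗ f.codRestrict _ h, ?_⟩
  ext x
  exact congrArg Subtype.val ((LinearEquiv.ofInjective g hg).apply_symm_apply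
    (f.codRestrict (LinearMap.range g) h x))

/-- Over a field it suffices to compose with a linear section. Compatibility with degrees and
actions is not lost: surjectivity of `p` forces it afterwards. -/
theorem exists_factor_surjective {V W W' : Type*} [AddCommGroup V] [Module k V] [AddCommGroup W]
    [Module k W] [AddCommGroup W'] [Module k W'] {f : V →ₗ[k] W} {p : V →ₗ[k] W'}
    (hp : Function.Surjective p) (h : ∀ x, p x = 0 → f x = 0) : ∃ l : W' →ₗ[k] W, l ∘ₗ p = f := by
  obtain ⟨s, hs⟩ := p.exists_rightInverse_of_surjective (LinearMap.range_eq_top.2 hp)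
  refine ⟨f ∘ₗ s, ?_⟩
  ext x
  have : p (s (p x) - x) = 0 := by
    rw [map_sub, ← LinearMap.comp_apply p s, hs]
    simp
  have := h _ this
  rw [map_sub, sub_eq_zero] at this
  exact this

theorem Hom.exists_factor (u : Hom Y Z) (hu : Function.Injective u.toLinearMap) (v : Hom X Z)
    (h : LinearMap.range v.toLinearMap ≤ LinearMap.range u.toLinearMap) :
    ∃ w : Hom X Y, u.toLinearMap ∘ₗ w.toLinearMap = v.toLinearMap := by
  obtain ⟨l, hl⟩ := DGBimodule.exists_factor hu (fun x => h ⟨x, rfl⟩)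
  have hl' : ∀ x, u.toLinearMap (l x) = v.toLinearMap x := fun x => LinearMap.congr_fun hl x
  exact ⟨{ toLinearMap := l
           map_gr := fun hx => u.mem_gr_of_injective hu (by rw [hl']; exact v.map_gr hx)
           map_d := fun x => hu (by rw [u.map_d, hl', hl', v.map_d])
           map_left := fun a x => hu (by rw [u.map_left, hl', hl', v.map_left])
           map_right := fun a x => hu (by rw [u.map_right, hl', hl', v.map_right]) }, hl⟩

/-! ### Free bimodules -/

/-- A homogeneous basis over `K ⊗_Z K`. -/
structure IsBasis (X : DGBimodule K) {J : Type u} (deg : J → ℤ) (e : J → X.carrier) : Prop where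
  mem : ∀ j, e j ∈ X.gr (deg j)
  bijective : Function.Bijective (Finsupp.liftAddHom (fun j => X.orbit (e j)) :
    (J →₀ K.carrier ⊗[P.carrier] K.carrier) →+ X.carrier)

namespace IsBasis

variable {J : Type u} {deg : J → ℤ} {e : J → X.carrier}

theorem induction (h : IsBasis X deg e) {p : X.carrier → Prop} (x : X.carrier)
    (hom : ∀ j m n, ∀ a ∈ K.gr m, ∀ b ∈ K.gr n, p (X.left a (X.right b (e j)))) (zero : p 0)
    (add : ∀ x y, p x → p y → p (x + y)) : p x := by
  obtain ⟨w, rfl⟩ := h.bijective.2 x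
  induction w using Finsupp.induction_linear with
  | zero => rw [map_zero]; exact zero
  | add f g hf hg => rw [map_add]; exact add _ _ hf hg
  | single j t =>
    rw [Finsupp.liftAddHom_apply_single]
    induction t with
    | zero => rw [map_zero]; exact zero
    | add f g hf hg => rw [map_add]; exact add _ _ hf hg
    | tmul a b =>
      rw [orbit_tmul]
      refine gr_induction (p := fun a => p (X.left a (X.right b (e j)))) K.isInternal a ?_
        (by rw [map_zero]; exact zero)
        (fun x y hx hy => by rw [map_add]; exact add _ _ hx hy)
      intro m a ha
      refine gr_induction (p := fun b => p (X.left a (X.right b (e j)))) K.isInternal b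
        (fun n b hb => hom j m n a ha b hb) (by rw [map_zero]; simpa using zero)
        (fun x y hx hy => by
          rw [map_add, LinearMap.add_apply, map_add]; exact add _ _ hx hy)

theorem ext (h : IsBasis X deg e) {n : ℤ} {f g : X.carrier →ₗ[k] Y.carrier}
    (hf : f ∈ homDeg X Y n) (hg : g ∈ homDeg X Y n) (hfg : ∀ j, f (e j) = g (e j)) : f = g := by
  ext x
  refine h.induction (p := fun x => f x = g x) x ?_ (by simp) (fun x y hx hy => by simp [hx, hy])
  intro j p q a ha b hb
  rw [hf.2.1 p a ha, hf.2.2, hg.2.1 p a ha, hg.2.2, hfg]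

/-- The additive map `a ⊗ b ↦ (-1) ^ (n |a|) a y b`. -/
noncomputable def twistedOrbit (Y : DGBimodule K) (n : ℤ) (y : Y.carrier) :
    K.carrier ⊗[P.carrier] K.carrier →+ Y.carrier :=
  TensorProduct.liftAddHom
    (AddMonoidHom.mk' (fun a => AddMonoidHom.mk' (fun b =>
        Y.left (signPow K.isInternal n a) (Y.right b y))
      (by intro b b'; simp)) (by intro a a'; ext b; simp))
    (by
      intro z a b
      change Y.left (signPow K.isInternal n (z • a)) (Y.right b y) =
        Y.left (signPow K.isInternal n a) (Y.right (z • b) y)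
      rw [K.smul_eq, K.smul_eq, K.signPow_mul, K.signPow_unit, K.unit_central, Y.left_mul,
        K.unit_central, Y.right_mul, Y.central])

/-- Homogeneous linear maps out of a free bimodule are determined by arbitrary homogeneous values
on the basis. -/
theorem exists_lift (h : IsBasis X deg e) (n : ℤ) (y : J → Y.carrier)
    (hy : ∀ j, y j ∈ Y.gr (deg j + n)) :
    ∃ f ∈ homDeg X Y n, ∀ j, f (e j) = y j := by
  -- A basis over `K ⊗_Z K` only gives an additive isomorphism. The lift is therefore defined
  -- additively on coordinates, and `k`-linearity, degree and compatibility with both actions are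
  -- checked on the generators `a e_j b`.
  let Φ := AddEquiv.ofBijective (Finsupp.liftAddHom (fun j => X.orbit (e j)) :
    (J →₀ K.carrier ⊗[P.carrier] K.carrier) →+ X.carrier) h.bijective
  let Ψ : (J →₀ K.carrier ⊗[P.carrier] K.carrier) →+ Y.carrier :=
    Finsupp.liftAddHom (fun j => twistedOrbit Y n (y j))
  let f₀ : X.carrier →+ Y.carrier := Ψ.comp Φ.symm.toAddMonoidHom
  have hf₀ : ∀ a b j, f₀ (X.left a (X.right b (e j))) =
      Y.left (signPow K.isInternal n a) (Y.right b (y j)) := by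
    intro a b j
    have : Φ.symm (X.left a (X.right b (e j))) = Finsupp.single j (a ⊗ₜ b) := by
      rw [AddEquiv.symm_apply_eq]
      exact (Finsupp.liftAddHom_apply_single (fun j => X.orbit (e j)) j (a ⊗ₜ b)).symm
    change Ψ (Φ.symm _) = _
    rw [this]
    exact Finsupp.liftAddHom_apply_single (fun j => twistedOrbit Y n (y j)) j (a ⊗ₜ b)
  let f : X.carrier →ₗ[k] Y.carrier :=
    { f₀ with
      map_smul' := by
        intro c x
        change f₀ (c • x) = c • f₀ x
        refine h.induction (p := fun x => f₀ (c • x) = c • f₀ x) x ?_ (by simp)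
          (fun x y hx hy => by rw [smul_add, map_add, map_add, hx, hy, smul_add])
        intro j p q a _ b _
        rw [← LinearMap.smul_apply, ← map_smul, hf₀, hf₀, map_smul, map_smul,
          LinearMap.smul_apply] }
  have hf : ∀ a b j, f (X.left a (X.right b (e j))) =
      Y.left (signPow K.isInternal n a) (Y.right b (y j)) := hf₀
  refine ⟨f, ⟨fun q m hm => ?_, fun p a ha m => ?_, fun b m => ?_⟩, fun j => ?_⟩
  · refine mem_of_component_natural X.isInternal Y.isInternal ?_ hm
    intro r x
    refine h.induction (p := fun x => f (component X.isInternal r x) =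
      component Y.isInternal (r + n) (f x)) x ?_ (by simp)
      (fun x y hx hy => by simp only [map_add, hx, hy])
    intro j p q a ha b hb
    have h1 := X.left_mem ha (X.right_mem hb (h.mem j))
    have h2 : f (X.left a (X.right b (e j))) ∈ Y.gr (p + (deg j + n + q)) := by
      rw [hf, signPow_of_mem _ _ ha, Units.smul_def, map_zsmul, LinearMap.smul_apply]
      exact zsmul_mem (Y.left_mem ha (Y.right_mem hb (hy j))) _
    by_cases hr : p + (deg j + q) = r
    · subst hr
      rw [component_of_mem _ h1, component_of_mem _]
      convert h2 using 2
      ring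
    · rw [component_of_ne _ hr h1, component_of_ne _ _ h2, map_zero]
      intro h3
      apply hr
      linarith
  · refine h.induction (p := fun m => f (X.left a m) = (n * p).negOnePow • Y.left a (f m)) m ?_
      (by simp) (fun x y hx hy => by simp only [map_add, hx, hy, smul_add])
    intro j p' q a' _ b _
    rw [← X.left_mul, hf, hf, K.signPow_mul, signPow_of_mem _ _ ha, smul_mul_assoc,
      Units.smul_def, map_zsmul, LinearMap.smul_apply, Y.left_mul, ← Units.smul_def]
  · refine h.induction (p := fun m => f (X.right b m) = Y.right b (f m)) m ?_
      (by simp) (fun x y hx hy => by simp only [map_add, hx, hy])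
    intro j p' q a' _ b' _
    rw [← X.left_right, ← X.right_mul, hf, hf, ← Y.left_right, ← Y.right_mul]
  · have := hf 1 1 j
    rw [X.left_one, X.right_one, signPow_of_mem _ _ K.one_mem] at this
    rw [this]
    simp [Y.left_one, Y.right_one]

end IsBasis

/-- Graded projectivity: the images of the basis elements lift to homogeneous elements, which define
a map on the free bimodule, and this is restricted to the summand. The section need not commute with
the differentials. -/
theorem IsSummandOfFree.exists_section {Q F : DGBimodule K} (hQ : Q.IsSummandOfFree)
    (p : Hom F Q) (hp : Function.Surjective p.toLinearMap) :
    ∃ s ∈ homDeg Q F 0, ∀ x, p.toLinearMap (s x) = x := by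
  obtain ⟨Y, i, r, ⟨J, deg, e, he, -, hbij⟩, hri⟩ := hQ
  have hb : IsBasis Y deg e := ⟨he, hbij⟩
  choose y hy hy' using fun j => p.exists_mem_gr hp (r.map_gr (he j))
  obtain ⟨s, hs, hs'⟩ := hb.exists_lift 0 y (fun j => by simpa using hy j)
  refine ⟨s ∘ₗ i.toLinearMap, homDeg_comp_hom hs i, fun x => ?_⟩
  have : p.toLinearMap ∘ₗ s = r.toLinearMap :=
    hb.ext (hom_comp_homDeg hs p) r.mem_homDeg (fun j => by
      rw [LinearMap.comp_apply, hs', hy'])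
  have := LinearMap.congr_fun this (i.toLinearMap x)
  rw [hri] at this
  exact this

end DGBimodule

end EqFormality

namespace EqFormality

variable {k : Type u} [Field k] {O : Type u} [CommRing O] [HopfAlgebra k O]
  {P : ParamAlgebra k O}

namespace DGBimodule

variable {K : EquivariantDGAlgebra P}

/-! ### Semi-projective bimodules -/

/-- For a section `s` of `p`, the map `id - s p` takes values in the kernel of `p`, which is the
image of `u`. Again only a splitting of graded bimodules, not of complexes. -/
theorem IsSummandOfFree.exists_retraction {F F' Q : DGBimodule K} (hQ : Q.IsSummandOfFree)
    (u : Hom F F') (hu : Function.Injective u.toLinearMap) (p : Hom F' Q)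
    (hp : Function.Surjective p.toLinearMap)
    (hpu : ∀ x, p.toLinearMap x = 0 ↔ x ∈ LinearMap.range u.toLinearMap) :
    ∃ r ∈ homDeg F' F 0, ∀ x, r (u.toLinearMap x) = x := by
  obtain ⟨s, hs, hs'⟩ := hQ.exists_section p hp
  obtain ⟨r, hr⟩ := DGBimodule.exists_factor (f := LinearMap.id - s ∘ₗ p.toLinearMap) hu
    (fun x => by
    rw [← hpu]
    simp [hs'])
  have hid : (LinearMap.id : F'.carrier →ₗ[k] F'.carrier) ∈ homDeg F' F' 0 :=
    ⟨fun q m hm => by simpa using hm, fun p a _ m => by simp, fun b m => rfl⟩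
  refine ⟨r, homDeg_of_comp_injective u hu ?_, fun x => hu ?_⟩
  · rw [hr]
    exact sub_mem hid (homDeg_comp_hom hs p)
  · have := LinearMap.congr_fun hr (u.toLinearMap x)
    rw [LinearMap.comp_apply] at this
    rw [this]
    simp [(hpu _).2 ⟨x, rfl⟩]

/-- Gluing of a compatible family of linear maps on an exhaustive filtration. -/
theorem exists_glue {V W : Type*} [AddCommGroup V] [Module k V] [AddCommGroup W] [Module k W]
    {F : ℕ → Type*} [∀ i, AddCommGroup (F i)] [∀ i, Module k (F i)] (ι : ∀ i, F i →ₗ[k] V)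
    (u : ∀ i, F i →ₗ[k] F (i + 1)) (hι : ∀ i, Function.Injective (ι i))
    (hu : ∀ i, ι (i + 1) ∘ₗ u i = ι i) (hex : ∀ x, ∃ i, x ∈ LinearMap.range (ι i))
    (g : ∀ i, F i →ₗ[k] W) (hg : ∀ i, g (i + 1) ∘ₗ u i = g i) :
    ∃ f : V →ₗ[k] W, ∀ i, f ∘ₗ ι i = g i := by
  have hstep : ∀ i d (x : F i), ∃ y : F (i + d), ι (i + d) y = ι i x ∧ g (i + d) y = g i x := by
    intro i d x
    induction d with
    | zero => exact ⟨x, rfl, rfl⟩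
    | succ d ih =>
      obtain ⟨y, hy, hy'⟩ := ih
      refine ⟨u _ y, ?_, ?_⟩
      · rw [← hy, ← hu (i + d)]; rfl
      · rw [← hy', ← hg (i + d)]; rfl
  have hle : ∀ i j, i ≤ j → ∀ x : F i, ∃ y : F j, ι j y = ι i x ∧ g j y = g i x := by
    intro i j hij x
    obtain ⟨d, rfl⟩ := Nat.exists_eq_add_of_le hij
    exact hstep i d x
  have hwd : ∀ i j (x : F i) (y : F j), ι i x = ι j y → g i x = g j y := by
    intro i j x y h
    obtain ⟨x', hx, hx'⟩ := hle i (max i j) (le_max_left _ _) x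
    obtain ⟨y', hy, hy'⟩ := hle j (max i j) (le_max_right _ _) y
    have : x' = y' := hι _ (by rw [hx, hy, h])
    rw [← hx', ← hy', this]
  choose i x hx using hex
  refine ⟨{ toFun := fun v => g (i v) (x v), map_add' := ?_, map_smul' := ?_ }, ?_⟩
  · intro v w
    obtain ⟨x', h1, h1'⟩ := hle (i v) (max (i v) (i w)) (le_max_left _ _) (x v)
    obtain ⟨y', h2, h2'⟩ := hle (i w) (max (i v) (i w)) (le_max_right _ _) (x w)
    rw [← h1', ← h2', ← map_add]
    apply hwd
    rw [hx, map_add, h1, h2, hx, hx]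
  · intro c v
    rw [RingHom.id_apply, ← map_smul]
    apply hwd
    rw [hx, map_smul, hx]
  · intro j
    ext y
    exact hwd _ _ _ _ (hx _)

/-- The structure of a semi-projective bimodule, with the transition maps made explicit. -/
theorem IsSemiprojective.exists_filtration {X : DGBimodule K} (hX : X.IsSemiprojective) :
    ∃ (F : ℕ → DGBimodule K) (ι : ∀ i, Hom (F i) X) (u : ∀ i, Hom (F i) (F (i + 1)))
      (Q : ℕ → DGBimodule K) (p : ∀ i, Hom (F (i + 1)) (Q i)),
      (∀ i, Function.Injective (ι i).toLinearMap) ∧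
      (∀ i, Function.Injective (u i).toLinearMap) ∧
      (∀ i, (ι (i + 1)).toLinearMap ∘ₗ (u i).toLinearMap = (ι i).toLinearMap) ∧
      (∀ x, ∃ i, x ∈ LinearMap.range (ι i).toLinearMap) ∧
      (∃ (Q : DGBimodule K) (p : Hom (F 0) Q), Q.IsSummandOfFree ∧
        Function.Bijective p.toLinearMap) ∧
      (∀ i, (Q i).IsSummandOfFree) ∧ (∀ i, Function.Surjective (p i).toLinearMap) ∧
      ∀ i x, (p i).toLinearMap x = 0 ↔ x ∈ LinearMap.range (u i).toLinearMap := by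
  obtain ⟨F, ι, hinj, hmono, hex, h0, hs⟩ := hX
  choose u hu using fun i => (ι (i + 1)).exists_factor (hinj (i + 1)) (ι i) (hmono i)
  choose Q p hQ hp hpu using hs
  refine ⟨F, ι, u, Q, p, hinj, fun i => ?_, hu, hex, h0, hQ, hp, fun i x => ?_⟩
  · intro x y h
    apply hinj i
    rw [← LinearMap.congr_fun (hu i) x, ← LinearMap.congr_fun (hu i) y]
    exact congrArg (ι (i + 1)).toLinearMap h
  · rw [hpu]
    constructor
    · rintro ⟨y, hy⟩
      refine ⟨y, hinj (i + 1) ?_⟩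
      rw [← hy]
      exact LinearMap.congr_fun (hu i) y
    · rintro ⟨y, rfl⟩
      exact ⟨y, (LinearMap.congr_fun (hu i) y).symm⟩

/-- Let `Θ` send families of maps `X → N s` to maps `X → W`, naturally in `X`. If the equation
`Θ h = c` can be solved by a family of homogeneous linear maps when `X` is a summand of a free
bimodule, then it can be solved when `X` is semi-projective. -/
theorem IsSemiprojective.exists_solution {σ : Type*} {N : σ → DGBimodule K} {n : σ → ℤ}
    {W : Type*} [AddCommGroup W] [Module k W]
    (Θ : ∀ X : DGBimodule K, (∀ s, X.carrier →ₗ[k] (N s).carrier) →+ (X.carrier →ₗ[k] W))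
    (C : ∀ X : DGBimodule K, (X.carrier →ₗ[k] W) → Prop)
    (hΘ : ∀ (X Y : DGBimodule K) (u : Hom X Y) h,
      Θ Y h ∘ₗ u.toLinearMap = Θ X (fun s => h s ∘ₗ u.toLinearMap))
    (hC : ∀ (X Y : DGBimodule K) (u : Hom X Y) c, C Y c → C X (c ∘ₗ u.toLinearMap))
    (hsub : ∀ (X : DGBimodule K) c h, (∀ s, h s ∈ homDeg X (N s) (n s)) → C X c → C X (c - Θ X h))
    (hdesc : ∀ (X Y : DGBimodule K) (p : Hom X Y), Function.Surjective p.toLinearMap →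
      ∀ c, C X (c ∘ₗ p.toLinearMap) → C Y c)
    (hsolve : ∀ Q : DGBimodule K, Q.IsSummandOfFree → ∀ c, C Q c →
      ∃ h, (∀ s, h s ∈ homDeg Q (N s) (n s)) ∧ Θ Q h = c)
    {X : DGBimodule K} (hX : X.IsSemiprojective) {c : X.carrier →ₗ[k] W} (hc : C X c) :
    ∃ h, (∀ s, h s ∈ homDeg X (N s) (n s)) ∧ Θ X h = c := by
  -- The predicate `C` singles out the admissible right-hand sides: it is stable under pullback and
  -- under subtracting values of `Θ`, and it descends along surjections. These are the closure
  -- properties which the induction over the filtration uses.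
  obtain ⟨F, ι, u, Q, p, hinj, huinj, hu, hex, ⟨Q0, p0, hQ0, hp0⟩, hQ, hp, hpu⟩ :=
    hX.exists_filtration
  let H : ℕ → Type _ := fun i => { h : ∀ s, (F i).carrier →ₗ[k] (N s).carrier //
    (∀ s, h s ∈ homDeg (F i) (N s) (n s)) ∧ Θ (F i) h = c ∘ₗ (ι i).toLinearMap }
  have zero : Nonempty (H 0) := by
    obtain ⟨c', hc'⟩ := exists_factor_surjective (f := c ∘ₗ (ι 0).toLinearMap) hp0.2 (fun x hx => by
      rw [hp0.1 (hx.trans (map_zero _).symm), map_zero])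
    obtain ⟨h, hh, hh'⟩ := hsolve Q0 hQ0 c' (hdesc _ _ p0 hp0.2 _ (by
      rw [hc']; exact hC _ _ _ _ hc))
    exact ⟨⟨fun s => h s ∘ₗ p0.toLinearMap, fun s => homDeg_comp_hom (hh s) p0, by
      rw [← hΘ, hh', hc']⟩⟩
  -- Extend `h` by the retraction. The error `c₁` vanishes on `F i`, hence factors through the
  -- quotient `Q i`, where the equation is solvable. The correction pulled back from `Q i` vanishes
  -- on `F i`, so the new solution extends the old one strictly and the solutions can be glued.
  have step : ∀ i (h : H i), ∃ h' : H (i + 1), ∀ s, h'.1 s ∘ₗ (u i).toLinearMap = h.1 s := by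
    rintro i ⟨h, hh, hh'⟩
    obtain ⟨r, hr, hr'⟩ := (hQ i).exists_retraction (u i) (huinj i) (p i) (hp i) (hpu i)
    have hru : r ∘ₗ (u i).toLinearMap = LinearMap.id := LinearMap.ext hr'
    have h1 : ∀ s, h s ∘ₗ r ∈ homDeg (F (i + 1)) (N s) (n s) := fun s => by
      simpa using homDeg_comp (hh s) hr
    let c₁ := c ∘ₗ (ι (i + 1)).toLinearMap - Θ (F (i + 1)) (fun s => h s ∘ₗ r)
    have hc₁ : C _ c₁ := hsub _ _ _ h1 (hC _ _ _ _ hc)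
    have hc₁u : c₁ ∘ₗ (u i).toLinearMap = 0 := by
      rw [LinearMap.sub_comp, hΘ]
      simp only [LinearMap.comp_assoc, hru, hu, LinearMap.comp_id]
      rw [hh', sub_self]
    obtain ⟨c₂, hc₂⟩ := exists_factor_surjective (f := c₁) (hp i) (fun x hx => by
      obtain ⟨y, rfl⟩ := (hpu i x).1 hx
      exact LinearMap.congr_fun hc₁u y)
    obtain ⟨g, hg, hg'⟩ := hsolve (Q i) (hQ i) c₂ (hdesc _ _ (p i) (hp i) _ (by rwa [hc₂]))
    refine ⟨⟨(fun s => h s ∘ₗ r) + (fun s => g s ∘ₗ (p i).toLinearMap),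
      fun s => add_mem (h1 s) (homDeg_comp_hom (hg s) (p i)), ?_⟩, fun s => ?_⟩
    · rw [map_add, ← hΘ, hg', hc₂]
      simp [c₁]
    · have hpu0 : (p i).toLinearMap ∘ₗ (u i).toLinearMap = 0 :=
        LinearMap.ext fun x => (hpu i _).2 ⟨x, rfl⟩
      simp only [Pi.add_apply, LinearMap.add_comp, LinearMap.comp_assoc, hru, hpu0,
        LinearMap.comp_id, LinearMap.comp_zero, add_zero]
  choose nx hnx using step
  obtain ⟨h0⟩ := zero
  let seq : ∀ i, H i := fun i => Nat.rec h0 (fun i h => nx i h) i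
  have hseq : ∀ i s, (seq (i + 1)).1 s ∘ₗ (u i).toLinearMap = (seq i).1 s :=
    fun i s => hnx i (seq i) s
  choose h hh using fun s => exists_glue (W := (N s).carrier) (fun i => (ι i).toLinearMap)
    (fun i => (u i).toLinearMap) hinj hu hex (fun i => (seq i).1 s) (fun i => hseq i s)
  have hh' : ∀ s i x, h s ((ι i).toLinearMap x) = (seq i).1 s x :=
    fun s i x => LinearMap.congr_fun (hh s i) x
  refine ⟨h, fun s => ⟨fun q x hx => ?_, fun q a ha x => ?_, fun b x => ?_⟩, ?_⟩
  · obtain ⟨i, y, rfl⟩ := hex x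
    rw [hh']
    exact ((seq i).2.1 s).1 q y ((ι i).mem_gr_of_injective (hinj i) hx)
  · obtain ⟨i, y, rfl⟩ := hex x
    rw [← (ι i).map_left, hh', hh']
    exact ((seq i).2.1 s).2.1 q a ha y
  · obtain ⟨i, y, rfl⟩ := hex x
    rw [← (ι i).map_right, hh', hh']
    exact ((seq i).2.1 s).2.2 b y
  · ext x
    obtain ⟨i, y, rfl⟩ := hex x
    have h1 := LinearMap.congr_fun (hΘ _ _ (ι i) h) y
    have h2 : (fun s => h s ∘ₗ (ι i).toLinearMap) = (seq i).1 := funext fun s => hh s i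
    rw [h2, (seq i).2.2] at h1
    exact h1

/-- Cocycles in the complex of maps from a semi-projective to an acyclic bimodule are
coboundaries. -/
theorem IsSemiprojective.exists_homD_eq {X N : DGBimodule K} (hX : X.IsSemiprojective)
    (hN : ∀ x, N.d x = 0 → ∃ w, x = N.d w) (n : ℤ) {f : X.carrier →ₗ[k] N.carrier}
    (hf : f ∈ homDeg X N (n + 1)) (hf' : homD X N (n + 1) f = 0) :
    ∃ h ∈ homDeg X N n, homD X N n h = f := by
  have hNgr : ∀ q, ∀ x ∈ N.gr (q + 1), N.d x = 0 → ∃ w ∈ N.gr q, x = N.d w := by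
    intro q x hx h
    obtain ⟨w, rfl⟩ := hN x h
    refine ⟨component N.isInternal q w, component_mem _ _ _, ?_⟩
    rw [component_natural N.isInternal N.isInternal (fun _ _ h => N.d_mem h),
      component_of_mem _ hx]
  obtain ⟨h, hh, hh'⟩ := hX.exists_solution (σ := Unit) (N := fun _ => N) (n := fun _ => n)
    (fun X => (homD X N n).toAddMonoidHom.comp (Pi.evalAddMonoidHom _ ()))
    (fun X c => c ∈ homDeg X N (n + 1) ∧ homD X N (n + 1) c = 0)
    (fun X Y u h => homD_comp_hom n (h ()) u)
    (fun X Y u c hc => ⟨homDeg_comp_hom hc.1 u, by rw [← homD_comp_hom, hc.2, LinearMap.zero_comp]⟩)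
    (fun X c h hh hc => ⟨sub_mem hc.1 (homD_mem (hh ())), by
      rw [map_sub, hc.2]
      exact sub_eq_zero.2 (homD_homD n (h ())).symm⟩)
    (fun X Y p hp c hc => ⟨homDeg_of_comp_surjective p hp hc.1, by
      have := hc.2
      rw [← homD_comp_hom] at this
      ext y
      obtain ⟨x, rfl⟩ := hp y
      exact LinearMap.congr_fun this x⟩)
    (by
      rintro Q ⟨Y, i, r, ⟨J, deg, e, he, hde, hbij⟩, hri⟩ c ⟨hc, hc'⟩
      have hb : IsBasis Y deg e := ⟨he, hbij⟩
      have hcr : homD Y N (n + 1) (c ∘ₗ r.toLinearMap) = 0 := by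
        rw [← homD_comp_hom, hc', LinearMap.zero_comp]
      have hcr' := homDeg_comp_hom hc r
      -- As the `e j` are cocycles, the equation on the basis reads `d (h (e j)) = c (r (e j))`, and
      -- the right-hand side is a cocycle of the acyclic complex `N`.
      choose y hy hy' using fun j => hNgr (deg j + n) (c (r.toLinearMap (e j)))
        (by rw [add_assoc]; exact hcr'.1 _ _ (he j)) (by
          have := LinearMap.congr_fun hcr (e j)
          rw [homD_apply, hde, map_zero, smul_zero, sub_zero] at this
          exact this)
      obtain ⟨h, hh, hh'⟩ := hb.exists_lift n y hy
      refine ⟨fun _ => h ∘ₗ i.toLinearMap, fun _ => homDeg_comp_hom hh i, ?_⟩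
      have h1 : homD Y N n h = c ∘ₗ r.toLinearMap := hb.ext (homD_mem hh) hcr' (fun j => by
        rw [homD_apply, hde, map_zero, smul_zero, sub_zero, hh', ← hy']
        rfl)
      change homD Q N n (h ∘ₗ i.toLinearMap) = c
      rw [← homD_comp_hom, h1]
      ext x
      rw [LinearMap.comp_apply, LinearMap.comp_apply, hri])
    (c := f) ⟨hf, hf'⟩
  exact ⟨h (), hh (), hh'⟩

/-! ### The cone of a morphism -/

/-- The cone of a morphism of dg bimodules. -/
noncomputable def cone {M N : DGBimodule K} (g : Hom M N) : DGBimodule K where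
  carrier := M.carrier × N.carrier
  gr n := (M.gr (n + 1)).prod (N.gr n)
  isInternal := isInternal_prod (isInternal_shift M.isInternal 1) N.isInternal
  d := ((-M.d) ∘ₗ LinearMap.fst k _ _).prod
    (g.toLinearMap ∘ₗ LinearMap.fst k _ _ + N.d ∘ₗ LinearMap.snd k _ _)
  d_mem := by
    rintro n ⟨x, y⟩ ⟨hx, hy⟩
    exact ⟨neg_mem (M.d_mem hx), add_mem (g.map_gr hx) (N.d_mem hy)⟩
  d_d := by
    rintro ⟨x, y⟩
    simp [M.d_d, N.d_d, g.map_d]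
  -- The left action on the shifted copy of `M` carries the sign `(-1)^|a|`, as the Leibniz rule for
  -- the differential `-M.d` demands; the right action needs none.
  left := LinearMap.mk₂ k (fun a x => (M.left (signMap K.isInternal a) x.1, N.left a x.2))
    (by intros; simp) (by intros; simp) (by intros; simp) (by intros; simp)
  left_one := by
    rintro ⟨x, y⟩
    simp [signMap_of_mem K.isInternal K.one_mem, M.left_one, N.left_one]
  left_mul a b := by
    rintro ⟨x, y⟩
    have : signMap K.isInternal (a * b) = signMap K.isInternal a * signMap K.isInternal b := by
      have h1 : ∀ a, signMap K.isInternal a = signPow K.isInternal 1 a := fun a => by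
        simp [signMap, signPow]
      rw [h1, h1, h1, K.signPow_mul]
    simp [this, M.left_mul, N.left_mul]
  right := LinearMap.mk₂ k (fun a x => (M.right a x.1, N.right a x.2))
    (by intros; simp) (by intros; simp) (by intros; simp) (by intros; simp)
  right_one := by rintro ⟨x, y⟩; simp [M.right_one, N.right_one]
  right_mul a b := by rintro ⟨x, y⟩; simp [M.right_mul, N.right_mul]
  left_right a b := by rintro ⟨x, y⟩; simp [M.left_right, N.left_right]
  central z := by
    rintro ⟨x, y⟩
    simp [signMap_of_mem K.isInternal (K.unit_mem z), M.central, N.central]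
  left_mem := by
    rintro p q a ⟨x, y⟩ ha ⟨hx, hy⟩
    refine ⟨?_, N.left_mem ha hy⟩
    rw [LinearMap.mk₂_apply, signMap_of_mem _ ha, Units.smul_def, map_zsmul, LinearMap.smul_apply,
      add_assoc]
    exact zsmul_mem (M.left_mem ha hx) _
  right_mem := by
    rintro p q b ⟨x, y⟩ hb ⟨hx, hy⟩
    refine ⟨?_, N.right_mem hb hy⟩
    rw [add_right_comm]
    exact M.right_mem hb hx
  d_left := by
    rintro p a ⟨x, y⟩ ha
    refine Prod.ext ?_ ?_
    · change -M.d (M.left (signMap K.isInternal a) x) =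
        M.left (signMap K.isInternal (K.d a)) x +
          p.negOnePow • M.left (signMap K.isInternal a) (-M.d x)
      rw [signMap_of_mem _ ha, signMap_of_mem _ (K.d_mem ha), Int.negOnePow_succ, map_neg]
      rcases Int.units_eq_one_or p.negOnePow with hp | hp <;>
        simp [hp, M.d_left x ha, add_comm]
    · change g.toLinearMap (M.left (signMap K.isInternal a) x) + N.d (N.left a y) =
        N.left (K.d a) y + p.negOnePow • N.left a (g.toLinearMap x + N.d y)
      rw [signMap_of_mem _ ha, Units.smul_def, map_zsmul, LinearMap.smul_apply, map_zsmul,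
        g.map_left, N.d_left y ha, map_add, smul_add, Units.smul_def, Units.smul_def]
      abel
  d_right := by
    rintro q ⟨x, y⟩ b ⟨hx, hy⟩
    refine Prod.ext ?_ ?_
    · change -M.d (M.right b x) = M.right b (-M.d x) + q.negOnePow • M.right (K.d b) x
      rw [M.d_right b hx, Int.negOnePow_succ, map_neg, Units.smul_def, Units.smul_def]
      simp [add_comm]
    · change g.toLinearMap (M.right b x) + N.d (N.right b y) =
        N.right b (g.toLinearMap x + N.d y) + q.negOnePow • N.right (K.d b) y
      rw [map_add, N.d_right b hy, g.map_right]
      abel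

theorem cone_acyclic {M N : DGBimodule K} {g : Hom M N} (hg : IsQuasiIso M.d N.d g.toLinearMap)
    (x : (cone g).carrier) (hx : (cone g).d x = 0) : ∃ w, x = (cone g).d w := by
  obtain ⟨x, y⟩ := x
  have h1 : -M.d x = 0 := congrArg Prod.fst hx
  have h2 : g.toLinearMap x + N.d y = 0 := congrArg Prod.snd hx
  rw [neg_eq_zero] at h1
  obtain ⟨v, hv⟩ := hg.1 x h1 ⟨-y, by rw [map_neg]; exact eq_neg_of_add_eq_zero_left h2⟩
  obtain ⟨v', hv', w, hw⟩ := hg.2 (y + g.toLinearMap v) (by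
    rw [map_add, ← g.map_d, ← hv, add_comm, h2])
  refine ⟨(v' - v, w), Prod.ext ?_ ?_⟩
  · change x = -M.d (v' - v)
    rw [map_sub, hv', ← hv]; abel
  · change y = g.toLinearMap (v' - v) + N.d w
    rw [map_sub, sub_add_eq_add_sub, ← hw]; abel

/-- The sign twist of the left action on the shifted copy is absorbed by the change of degree:
`(-1)^(n p) (-1)^p = (-1)^((n + 1) p)`. -/
theorem prod_mem_homDeg_cone {X M N : DGBimodule K} {g : Hom M N} {n : ℤ}
    {β : X.carrier →ₗ[k] M.carrier} {γ : X.carrier →ₗ[k] N.carrier} :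
    β.prod γ ∈ homDeg X (cone g) n ↔ β ∈ homDeg X M (n + 1) ∧ γ ∈ homDeg X N n := by
  have hs : ∀ (p : ℤ), ∀ a ∈ K.gr p, ∀ m,
      (n * p).negOnePow • M.left (signMap K.isInternal a) m =
        ((n + 1) * p).negOnePow • M.left a m := by
    intro p a ha m
    rw [signMap_of_mem _ ha, Units.smul_def p.negOnePow, map_zsmul, LinearMap.smul_apply,
      ← Units.smul_def, smul_smul, ← Int.negOnePow_add]
    congr 2
    ring
  constructor
  · rintro ⟨h1, h2, h3⟩
    refine ⟨⟨fun q m hm => ?_, fun p a ha m => ?_, fun b m => congrArg Prod.fst (h3 b m)⟩,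
      ⟨fun q m hm => (h1 q m hm).2, fun p a ha m => congrArg Prod.snd (h2 p a ha m),
        fun b m => congrArg Prod.snd (h3 b m)⟩⟩
    · have := (h1 q m hm).1
      rwa [add_assoc] at this
    · rw [← hs p a ha]
      exact congrArg Prod.fst (h2 p a ha m)
  · rintro ⟨⟨h1, h2, h3⟩, ⟨h1', h2', h3'⟩⟩
    refine ⟨fun q m hm => ⟨?_, h1' q m hm⟩, fun p a ha m => Prod.ext ?_ (h2' p a ha m),
      fun b m => Prod.ext (h3 b m) (h3' b m)⟩
    · have := h1 q m hm
      rwa [← add_assoc] at this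
    · refine (h2 p a ha m).trans (hs p a ha _).symm

theorem homD_cone {X M N : DGBimodule K} {g : Hom M N} (n : ℤ)
    (β : X.carrier →ₗ[k] M.carrier) (γ : X.carrier →ₗ[k] N.carrier) :
    homD X (cone g) n (β.prod γ) =
      (-homD X M (n + 1) β).prod (g.toLinearMap ∘ₗ β + homD X N n γ) := by
  refine LinearMap.ext fun x => Prod.ext ?_ ?_
  · change -M.d (β x) - n.negOnePow • β (X.d x) = -(M.d (β x) - (n + 1).negOnePow • β (X.d x))
    rw [Int.negOnePow_succ, Units.smul_def, Units.smul_def]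
    simp
    abel
  · change g.toLinearMap (β x) + N.d (γ x) - n.negOnePow • γ (X.d x) =
      g.toLinearMap (β x) + (N.d (γ x) - n.negOnePow • γ (X.d x))
    abel

/-- The pair `(β, γ)` is a cocycle of maps into the cone of `g`, which is acyclic, so it is a
coboundary. The two halves of the statement that maps out of `X` preserve quasi-isomorphisms are the
case of a general `β` and the case `β = 0`. -/
theorem IsSemiprojective.exists_of_cone {X M N : DGBimodule K} (hX : X.IsSemiprojective)
    {g : Hom M N} (hg : IsQuasiIso M.d N.d g.toLinearMap) (n : ℤ)
    {β : X.carrier →ₗ[k] M.carrier} {γ : X.carrier →ₗ[k] N.carrier}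
    (hβ : β ∈ homDeg X M (n + 1 + 1)) (hγ : γ ∈ homDeg X N (n + 1))
    (hβd : homD X M (n + 1 + 1) β = 0) (hβγ : g.toLinearMap ∘ₗ β + homD X N (n + 1) γ = 0) :
    ∃ δ ∈ homDeg X M (n + 1), ∃ η ∈ homDeg X N n, -homD X M (n + 1) δ = β ∧
      g.toLinearMap ∘ₗ δ + homD X N n η = γ := by
  obtain ⟨h, hh, hh'⟩ := hX.exists_homD_eq (cone_acyclic hg) n (f := β.prod γ)
    (prod_mem_homDeg_cone.2 ⟨hβ, hγ⟩) (by
      rw [homD_cone, hβd, hβγ]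
      simp
      rfl)
  obtain ⟨δ, η, rfl⟩ : ∃ (δ : X.carrier →ₗ[k] M.carrier) (η : X.carrier →ₗ[k] N.carrier),
      h = δ.prod η := ⟨LinearMap.fst k M.carrier N.carrier ∘ₗ h,
    LinearMap.snd k M.carrier N.carrier ∘ₗ h, rfl⟩
  have hh1 := prod_mem_homDeg_cone.1 hh
  have hh2 := (homD_cone n δ η).symm.trans hh'
  refine ⟨δ, hh1.1, η, hh1.2, LinearMap.ext fun x => ?_, LinearMap.ext fun x => ?_⟩
  · exact congrArg Prod.fst (LinearMap.congr_fun hh2 x)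
  · exact congrArg Prod.snd (LinearMap.congr_fun hh2 x)

/-- Composition with a quasi-isomorphism is injective on cohomology of maps out of a
semi-projective bimodule. -/
theorem IsSemiprojective.homD_injective {X M N : DGBimodule K} (hX : X.IsSemiprojective)
    {g : Hom M N} (hg : IsQuasiIso M.d N.d g.toLinearMap) (n : ℤ)
    {β : X.carrier →ₗ[k] M.carrier} {γ : X.carrier →ₗ[k] N.carrier}
    (hβ : β ∈ homDeg X M n) (hγ : γ ∈ homDeg X N (n - 1)) (hβd : homD X M n β = 0)
    (hβγ : g.toLinearMap ∘ₗ β = homD X N (n - 1) γ) :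
    ∃ δ ∈ homDeg X M (n - 1), β = homD X M (n - 1) δ := by
  -- As a map to the cone `β` has degree `n - 1`, so that its primitive has degree `n - 2`.
  obtain ⟨m, rfl⟩ : ∃ m, n = m + 1 + 1 := ⟨n - 2, by ring⟩
  rw [add_sub_cancel_right] at hγ hβγ ⊢
  obtain ⟨δ, hδ, η, -, h1, -⟩ := hX.exists_of_cone hg m hβ (neg_mem hγ) hβd (by
    rw [map_neg, hβγ, add_neg_cancel])
  exact ⟨-δ, neg_mem hδ, by rw [map_neg, h1]⟩

/-- Composition with a quasi-isomorphism is surjective on cohomology of maps out of a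
semi-projective bimodule. -/
theorem IsSemiprojective.homD_surjective {X M N : DGBimodule K} (hX : X.IsSemiprojective)
    {g : Hom M N} (hg : IsQuasiIso M.d N.d g.toLinearMap) (n : ℤ)
    {γ : X.carrier →ₗ[k] N.carrier} (hγ : γ ∈ homDeg X N n) (hγd : homD X N n γ = 0) :
    ∃ δ ∈ homDeg X M n, homD X M n δ = 0 ∧ ∃ η ∈ homDeg X N (n - 1),
      γ = g.toLinearMap ∘ₗ δ + homD X N (n - 1) η := by
  obtain ⟨m, rfl⟩ : ∃ m, n = m + 1 := ⟨n - 1, by ring⟩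
  rw [add_sub_cancel_right]
  obtain ⟨δ, hδ, η, hη, h1, h2⟩ := hX.exists_of_cone hg m (β := 0) (zero_mem _) hγ (map_zero _) (by
    rw [hγd, LinearMap.comp_zero, add_zero])
  exact ⟨δ, hδ, neg_eq_zero.1 h1, η, hη, h2.symm⟩

end DGBimodule

end EqFormality

/-! ### Coordinates on the symmetric and the exterior algebra -/

namespace EqFormality

theorem exists_homogeneous_basis {k M : Type*} [Field k] [AddCommGroup M] [Module k M]
    [Module.Finite k M] {gr : ℤ → Submodule k M} (h : DirectSum.IsInternal gr) :
    ∃ (n : ℕ) (deg : Fin n → ℤ) (b : Module.Basis (Fin n) k M), (∀ s, b s ∈ gr (deg s)) ∧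
      ∀ s q, q ≠ deg s → ∀ x ∈ gr q, b.coord s x = 0 := by
  classical
  let v : ∀ i, Module.Basis (Fin (Module.finrank k (gr i))) k (gr i) :=
    fun i => Module.finBasis k (gr i)
  let b := h.collectedBasis v
  have : Finite (Σ i, Fin (Module.finrank k (gr i))) := Module.Finite.finite_basis b
  have := Fintype.ofFinite (Σ i, Fin (Module.finrank k (gr i)))
  let e := Fintype.equivFin (Σ i, Fin (Module.finrank k (gr i)))
  refine ⟨_, fun s => (e.symm s).1, b.reindex e, fun s => ?_, fun s q hq x hx => ?_⟩
  · rw [Module.Basis.reindex_apply]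
    exact h.collectedBasis_mem v _
  · rw [Module.Basis.coord_apply, Module.Basis.repr_reindex_apply]
    exact h.collectedBasis_repr_of_mem_ne v hq hx

variable {k : Type u} [Field k] {O : Type u} [CommRing O] [HopfAlgebra k O]

theorem symCoact_ι {V : Type u} [AddCommGroup V] [Module k V] (ρ : V →ₗ[k] V ⊗[k] O) (v : V) :
    symCoact ρ (SymmetricAlgebra.ι k V v) = (SymmetricAlgebra.ι k V).rTensor O (ρ v) :=
  SymmetricAlgebra.lift_ι_apply _ v

theorem extCoact_ι {V : Type u} [AddCommGroup V] [Module k V] (ρ : V →ₗ[k] V ⊗[k] O) (v : V) :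
    extCoact ρ (ExteriorAlgebra.ι k v) = (ExteriorAlgebra.ι k).rTensor O (ρ v) :=
  ExteriorAlgebra.lift_ι_apply k _ _ v

namespace ParamAlgebra

variable (P : ParamAlgebra k O)

/-! ### The symmetric algebra -/

/-- The generators of `A_Z`. -/
noncomputable def ιA : Module.Dual k P.Cot →ₗ[k] P.A.carrier := SymmetricAlgebra.ι k _

/-- The augmentation of `A_Z`. -/
noncomputable def augA : P.A.carrier →ₐ[k] k := SymmetricAlgebra.algebraMapInv

theorem A_mul_comm (a b : P.A.carrier) : a * b = b * a :=
  mul_comm (G := SymmetricAlgebra k (Module.Dual k P.Cot)) a b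

theorem A_d : P.A.d = 0 := rfl

theorem augA_ιA (ξ : Module.Dual k P.Cot) : P.augA (P.ιA ξ) = 0 :=
  SymmetricAlgebra.algebraMapInv_ι ξ

theorem ιA_mem (ξ : Module.Dual k P.Cot) : P.ιA ξ ∈ P.A.gr 2 := ι_mem_genGr (e := 2) ξ

theorem coact_ιA (ξ : Module.Dual k P.Cot) :
    P.A.coact (P.ιA ξ) = P.ιA.rTensor O (dualCoact P.cotCoact ξ) :=
  symCoact_ι _ ξ

/-- The generators have degree `2`, so `A` is concentrated in even degrees. This is the sign
hypothesis of the triangular algebra, and the reason why signs in front of `A`-valued maps can be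
traded below. -/
theorem A_negOnePow_smul (n : ℤ) (x : P.A.carrier) (hx : x ∈ P.A.gr n) : n.negOnePow • x = x := by
  refine genGr_induction (p := fun x : P.A.carrier => n.negOnePow • x = x) hx ?_ (smul_zero _)
    (fun x y hx hy => by rw [smul_add, hx, hy])
  intro i hi x _
  rw [← hi, Int.negOnePow_even _ ⟨i, by ring⟩, one_smul]

theorem A_eq_zero_of_neg {n : ℤ} (hn : n < 0) {x : P.A.carrier} (hx : x ∈ P.A.gr n) : x = 0 := by
  refine genGr_induction (p := fun x : P.A.carrier => x = 0) hx ?_ rfl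
    (fun x y hx hy => by rw [hx, hy, add_zero])
  intro i hi
  omega

theorem A_gr_finite (n : ℤ) : Module.Finite k (P.A.gr n) := by
  have key : ∀ i : ℕ, ((LinearMap.range P.ιA) ^ i).FG := fun i =>
    Submodule.FG.pow (Module.Finite.iff_fg.1 inferInstance) i
  -- Only the power `i = n / 2` can contribute. For odd or negative `n` the left side is an empty
  -- supremum, so the truncated exponent is harmless.
  have hle : P.A.gr n ≤ (LinearMap.range P.ιA) ^ (n / 2).toNat := by
    refine iSup₂_le fun i hi => ?_
    have : (n / 2).toNat = i := by omega
    rw [this]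
    exact le_rfl
  have := Module.Finite.iff_fg.2 (key (n / 2).toNat)
  exact Submodule.finiteDimensional_of_le hle

/-- The rank of the cotangent space. -/
noncomputable abbrev dim : ℕ := Module.finrank k P.Cot

/-- A basis of the cotangent space. -/
noncomputable def cotBasis : Module.Basis (Fin P.dim) k P.Cot := Module.finBasis k P.Cot

/-- The generators of `A_Z` dual to the basis of the cotangent space. -/
noncomputable def xA (i : Fin P.dim) : P.A.carrier := P.ιA (P.cotBasis.coord i)

/-- `A_Z` is a polynomial ring. -/
noncomputable def polyEquiv : P.A.carrier ≃ₐ[k] MvPolynomial (Fin P.dim) k :=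
  SymmetricAlgebra.equivMvPolynomial P.cotBasis.dualBasis

theorem polyEquiv_xA (i : Fin P.dim) : P.polyEquiv (P.xA i) = MvPolynomial.X i := by
  have : P.xA i = SymmetricAlgebra.ι k _ (P.cotBasis.dualBasis i) := by
    rw [Module.Basis.coe_dualBasis]
    rfl
  rw [this]
  exact SymmetricAlgebra.equivMvPolynomial_ι_apply _ i

/-- Division by a generator, killing the monomials which it does not divide. -/
noncomputable def divA (i : Fin P.dim) : P.A.carrier →ₗ[k] P.A.carrier where
  toFun a := P.polyEquiv.symm ((P.polyEquiv a).divMonomial (Finsupp.single i 1))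
  map_add' a b := by rw [map_add, MvPolynomial.add_divMonomial, map_add]
  map_smul' c a := by
    have h : (c • P.polyEquiv a).divMonomial (Finsupp.single i 1) =
        c • (P.polyEquiv a).divMonomial (Finsupp.single i 1) :=
      MvPolynomial.ext _ _ fun s => by simp [MvPolynomial.coeff_divMonomial]
    rw [map_smul P.polyEquiv, h, map_smul, RingHom.id_apply]

theorem polyEquiv_divA (i : Fin P.dim) (a : P.A.carrier) :
    P.polyEquiv (P.divA i a) = (P.polyEquiv a).divMonomial (Finsupp.single i 1) :=
  P.polyEquiv.apply_symm_apply _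

theorem divA_mul_self (i : Fin P.dim) (a : P.A.carrier) : P.divA i (P.xA i * a) = a := by
  apply P.polyEquiv.injective
  rw [polyEquiv_divA, map_mul, polyEquiv_xA, MvPolynomial.X_mul_divMonomial]

theorem divA_mul_of_ne {i j : Fin P.dim} (hij : i ≠ j) (a : P.A.carrier) :
    P.divA j (P.xA i * a) = P.xA i * P.divA j a := by
  apply P.polyEquiv.injective
  rw [polyEquiv_divA, map_mul, map_mul, polyEquiv_divA, polyEquiv_xA]
  refine MvPolynomial.ext _ _ fun s => ?_
  rw [MvPolynomial.coeff_divMonomial, MvPolynomial.coeff_X_mul', MvPolynomial.coeff_X_mul']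
  have h1 : i ∈ (Finsupp.single j 1 + s).support ↔ i ∈ s.support := by
    simp [Finsupp.single_eq_of_ne hij]
  by_cases hi : i ∈ s.support
  · rw [if_pos hi, if_pos (h1.2 hi), MvPolynomial.coeff_divMonomial]
    congr 1
    ext l
    have : 1 ≤ s i := Nat.one_le_iff_ne_zero.2 (by simpa using hi)
    by_cases hl : l = i
    · subst hl
      simp [Finsupp.single_eq_of_ne hij]
    · simp [Finsupp.single_eq_of_ne hl]
  · rw [if_neg hi, if_neg (fun h => hi (h1.1 h))]

theorem divA_comm (i j : Fin P.dim) (a : P.A.carrier) :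
    P.divA i (P.divA j a) = P.divA j (P.divA i a) := by
  apply P.polyEquiv.injective
  rw [polyEquiv_divA, polyEquiv_divA, polyEquiv_divA, polyEquiv_divA,
    ← MvPolynomial.divMonomial_add, ← MvPolynomial.divMonomial_add, add_comm]

/-- A nonconstant monomial is divisible by some generator, and dividing by that generator keeps its
coefficient visible. -/
theorem exists_eq_algebraMap_of_divA {a : P.A.carrier} (h : ∀ i, P.divA i a = 0) :
    ∃ c : k, a = algebraMap k P.A.carrier c := by
  refine ⟨MvPolynomial.coeff 0 (P.polyEquiv a), P.polyEquiv.injective ?_⟩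
  rw [AlgEquiv.commutes, MvPolynomial.algebraMap_eq]
  refine MvPolynomial.ext _ _ fun s => ?_
  rw [MvPolynomial.coeff_C]
  split_ifs with hs
  · rw [hs]
  · obtain ⟨i, hi⟩ : ∃ i, s i ≠ 0 := by
      by_contra hcon
      push Not at hcon
      exact hs (Finsupp.ext fun i => by simp [hcon i])
    have h1 := congrArg P.polyEquiv (h i)
    rw [polyEquiv_divA, map_zero] at h1
    have h2 := congrArg (MvPolynomial.coeff (s - Finsupp.single i 1)) h1
    rw [MvPolynomial.coeff_divMonomial, MvPolynomial.coeff_zero] at h2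
    rw [← h2]
    congr 1
    rw [add_comm, tsub_add_cancel_of_le]
    rw [Finsupp.single_le_iff]
    omega

/-! ### The exterior algebra -/

/-- The generators of `∧(m_Z / m_Z²)`. -/
noncomputable def ιB : P.Cot →ₗ[k] P.B.carrier := ExteriorAlgebra.ι k

/-- The augmentation of `∧(m_Z / m_Z²)`. -/
noncomputable def augB : P.B.carrier →ₐ[k] k := ExteriorAlgebra.algebraMapInv

theorem B_d : P.B.d = 0 := rfl

theorem ιB_mem (v : P.Cot) : P.ιB v ∈ P.B.gr (-1) := ι_mem_genGr (e := -1) v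

theorem ιB_sq (v : P.Cot) : P.ιB v * P.ιB v = 0 := ExteriorAlgebra.ι_sq_zero v

theorem ιB_add_swap (v w : P.Cot) : P.ιB v * P.ιB w + P.ιB w * P.ιB v = 0 :=
  ExteriorAlgebra.ι_add_mul_swap v w

theorem augB_ιB (v : P.Cot) : P.augB (P.ιB v) = 0 := by
  refine (ExteriorAlgebra.lift_ι_apply k _ _ v).trans ?_
  simp

theorem coact_ιB (v : P.Cot) : P.B.coact (P.ιB v) = P.ιB.rTensor O (P.cotCoact v) :=
  extCoact_ι _ v

theorem B_induction {p : P.B.carrier → Prop} (b : P.B.carrier)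
    (algebraMap : ∀ r, p (algebraMap k P.B.carrier r)) (ι : ∀ v, p (P.ιB v))
    (mul : ∀ a b, p a → p b → p (a * b)) (add : ∀ a b, p a → p b → p (a + b)) : p b :=
  ExteriorAlgebra.induction (C := p) algebraMap ι mul add b

theorem augB_coact (b : P.B.carrier) :
    P.augB.toLinearMap.rTensor O (P.B.coact b) = P.augB b ⊗ₜ 1 := by
  refine P.B_induction (p := fun b => P.augB.toLinearMap.rTensor O (P.B.coact b) =
    P.augB b ⊗ₜ 1) b ?_ ?_ ?_ ?_
  · intro r
    rw [AlgHom.commutes, AlgHom.commutes, Algebra.TensorProduct.algebraMap_apply]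
    simp
  · intro v
    rw [coact_ιB, ← LinearMap.rTensor_comp_apply, augB_ιB, TensorProduct.zero_tmul]
    have : P.augB.toLinearMap ∘ₗ P.ιB = 0 := LinearMap.ext P.augB_ιB
    rw [this, LinearMap.rTensor_zero, LinearMap.zero_apply]
  · intro a b ha hb
    have h : ∀ x y : P.B.carrier ⊗[k] O, P.augB.toLinearMap.rTensor O (x * y) =
        P.augB.toLinearMap.rTensor O x * P.augB.toLinearMap.rTensor O y :=
      fun x y => map_mul (Algebra.TensorProduct.map P.augB (AlgHom.id k O)) x y
    rw [map_mul, h, ha, hb, Algebra.TensorProduct.tmul_mul_tmul, map_mul, one_mul]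
  · intro a b ha hb
    rw [map_add, map_add, ha, hb, map_add, TensorProduct.add_tmul]

theorem augB_gr {n : ℤ} (hn : n ≠ 0) {b : P.B.carrier} (hb : b ∈ P.B.gr n) : P.augB b = 0 := by
  refine genGr_induction (p := fun b : P.B.carrier => P.augB b = 0) hb ?_ (map_zero _)
    (fun x y hx hy => by rw [map_add, hx, hy, add_zero])
  intro i hi x hx
  obtain ⟨j, rfl⟩ : ∃ j, i = j + 1 := Nat.exists_eq_succ_of_ne_zero
    (by rintro rfl; simp at hi; omega)
  replace hx : x ∈ LinearMap.range P.ιB ^ (j + 1) := hx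
  rw [pow_succ] at hx
  refine Submodule.mul_induction_on hx ?_ (fun x y hx hy => (map_add P.augB x y).trans (by
    rw [hx, hy, add_zero]))
  rintro a - _ ⟨v, rfl⟩
  have h := map_mul P.augB a (P.ιB v)
  rw [augB_ιB, mul_zero] at h
  exact h

/-- The basis of `m_Z / m_Z²` in the exterior algebra. -/
noncomputable def xB (i : Fin P.dim) : P.B.carrier := P.ιB (P.cotBasis i)

theorem ιB_eq_sum (v : P.Cot) : P.ιB v = ∑ i, P.cotBasis.coord i v • P.xB i := by
  conv_lhs => rw [← P.cotBasis.sum_repr v]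
  rw [map_sum]
  simp only [map_smul]
  rfl

/-- A linear map on the exterior algebra which kills the augmentation ideal. -/
theorem eq_augB_smul {W : Type*} [AddCommGroup W] [Module k W] {f : P.B.carrier →ₗ[k] W}
    (hf : ∀ b i, f (b * P.xB i) = 0) (b : P.B.carrier) : f b = P.augB b • f 1 := by
  have hf' : ∀ b v, f (b * P.ιB v) = 0 := by
    intro b v
    rw [ιB_eq_sum, Finset.mul_sum, map_sum]
    refine Finset.sum_eq_zero fun i _ => ?_
    rw [mul_smul_comm, map_smul, hf, smul_zero]
  -- The free left factor `c` is what carries the induction through products.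
  suffices h : ∀ c, f (c * b) = P.augB b • f c by simpa using h 1
  refine P.B_induction (p := fun b => ∀ c, f (c * b) = P.augB b • f c) b ?_ ?_ ?_ ?_
  · intro r c
    rw [AlgHom.commutes, Algebra.algebraMap_eq_smul_one, mul_smul_comm, map_smul, mul_one]
    rfl
  · intro v c
    rw [hf', augB_ιB, zero_smul]
  · intro a b ha hb c
    rw [← mul_assoc, hb, ha, map_mul, smul_smul, mul_comm (P.augB b)]
  · intro a b ha hb c
    rw [mul_add, map_add, ha, hb, map_add, add_smul]

/-- Contraction by an element of the dual basis. -/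
noncomputable def contrB (i : Fin P.dim) : P.B.carrier →ₗ[k] P.B.carrier :=
  CliffordAlgebra.contractRight.flip (P.cotBasis.coord i)

theorem contrB_mul_ιB (i : Fin P.dim) (b : P.B.carrier) (v : P.Cot) :
    P.contrB i (b * P.ιB v) = P.cotBasis.coord i v • b - P.contrB i b * P.ιB v :=
  CliffordAlgebra.contractRight_mul_ι (d := P.cotBasis.coord i) v b

theorem contrB_mul_self (i : Fin P.dim) (b : P.B.carrier) :
    P.contrB i (b * P.xB i) = b - P.contrB i b * P.xB i := by
  rw [xB, contrB_mul_ιB]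
  simp

theorem contrB_mul_of_ne {i j : Fin P.dim} (hij : i ≠ j) (b : P.B.carrier) :
    P.contrB j (b * P.xB i) = -(P.contrB j b * P.xB i) := by
  rw [xB, contrB_mul_ιB]
  simp [Finsupp.single_eq_of_ne (Ne.symm hij)]

theorem contrB_contrB (i : Fin P.dim) (b : P.B.carrier) : P.contrB i (P.contrB i b) = 0 :=
  CliffordAlgebra.contractRight_contractRight (d := P.cotBasis.coord i) b

theorem contrB_comm (i j : Fin P.dim) (b : P.B.carrier) :
    P.contrB i (P.contrB j b) = -P.contrB j (P.contrB i b) :=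
  CliffordAlgebra.contractRight_comm (d := P.cotBasis.coord j) (d' := P.cotBasis.coord i) b

end ParamAlgebra

/-! ### The augmentation of a Koszul resolution through the exterior algebra -/

namespace EquivariantKoszulResolution

variable {P : ParamAlgebra k O} (K : EquivariantKoszulResolution P)

theorem pi_d (x : K.carrier) : K.pi.toAlgHom (K.d x) = 0 := by
  rw [K.pi.map_d, P.B_d, LinearMap.zero_apply]

/-- The differential of `B` is zero, so surjectivity of the reduced map on cohomology is already
surjectivity of `π`. -/
theorem pi_surjective : Function.Surjective K.pi.toAlgHom := by
  intro y
  obtain ⟨x, -, w, hw⟩ := K.pi_quasiIso.2 y (by rw [P.B_d, LinearMap.zero_apply])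
  rw [P.B_d, LinearMap.zero_apply, add_zero] at hw
  obtain ⟨x, rfl⟩ := Submodule.mkQ_surjective _ x
  exact ⟨x, hw.symm⟩

theorem pi_gr_surjective {n : ℤ} {y : P.B.carrier} (hy : y ∈ P.B.gr n) :
    ∃ x ∈ K.gr n, K.pi.toAlgHom x = y := by
  obtain ⟨x, rfl⟩ := K.pi_surjective y
  refine ⟨component K.isInternal n x, component_mem _ _ _, ?_⟩
  have := component_natural_zero K.isInternal P.B.isInternal (f := K.pi.toAlgHom.toLinearMap)
    (fun _ _ h => K.pi.map_gr h) n x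
  refine this.trans ?_
  exact component_of_mem _ hy

/-- `Z` acts on `B` through `k`, so the images under `π` of generators of `K` over `Z` span `B` over
`k`. -/
theorem finite_B (K : EquivariantKoszulResolution P) : Module.Finite k P.B.carrier := by
  obtain ⟨s, hs⟩ := K.finite
  classical
  refine ⟨s.image K.pi.toAlgHom, ?_⟩
  rw [eq_top_iff]
  rintro y -
  obtain ⟨x, rfl⟩ := K.pi_surjective y
  have hx : x ∈ Submodule.span P.carrier (s : Set K.carrier) := by rw [hs]; trivial
  induction hx using Submodule.span_induction with
  | mem x hx => exact Submodule.subset_span (Finset.mem_coe.2 (Finset.mem_image_of_mem _ hx))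
  | zero => rw [map_zero]; exact zero_mem _
  | add x y _ _ hx hy => rw [map_add]; exact add_mem hx hy
  | smul z x _ hx =>
    have : K.pi.toAlgHom (z • x) = P.aug z • K.pi.toAlgHom x := by
      rw [EquivariantDGAlgebra.smul_eq, map_mul, K.pi_unit, Algebra.smul_def]
    rw [this]
    exact Submodule.smul_mem _ _ hx

/-- The augmentation of `K` through `B`. It agrees with `eps` on cocycles. -/
noncomputable def aug : K.carrier →ₐ[k] k := P.augB.comp K.pi.toAlgHom

theorem aug_apply (x : K.carrier) : K.aug x = P.augB (K.pi.toAlgHom x) := rfl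

theorem aug_gr {n : ℤ} (hn : n ≠ 0) {x : K.carrier} (hx : x ∈ K.gr n) : K.aug x = 0 :=
  P.augB_gr hn (K.pi.map_gr hx)

theorem aug_d (x : K.carrier) : K.aug (K.d x) = 0 := by
  rw [aug_apply, pi_d, map_zero]

theorem aug_unit (z : P.carrier) : K.aug (K.unit z) = P.aug z := by
  rw [aug_apply, K.pi_unit, AlgHom.commutes]
  rfl

theorem aug_coact (x : K.carrier) : K.aug.toLinearMap.rTensor O (K.coact x) = K.aug x ⊗ₜ 1 := by
  have h : K.aug.toLinearMap = P.augB.toLinearMap ∘ₗ K.pi.toAlgHom.toLinearMap := rfl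
  rw [h, LinearMap.rTensor_comp_apply, ← K.pi.map_coact, P.augB_coact]
  rfl

/-- `x - ε(x)` is a cocycle killed by `ε`, hence a coboundary; applying `aug`, which kills
coboundaries, shows that `ε(x) = 0`. So `aug` can replace `eps` throughout. The gain is that `aug`
factors through `π`, hence is compatible with an action of `K` through `B`. -/
theorem exists_of_aug_eq_zero {x : K.carrier} (hx : K.d x = 0) (h : K.aug x = 0) :
    ∃ v, x = K.d v := by
  have h1 : K.d (x - algebraMap k K.carrier (K.eps x)) = 0 := by
    rw [map_sub, hx, K.d_algebraMap, sub_zero]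
  obtain ⟨v, hv⟩ := K.eps_quasiIso.1 _ h1 ⟨0, by simp⟩
  have h2 : K.eps x = 0 := by
    have := congrArg K.aug hv
    rw [aug_d, map_sub, h, AlgHom.commutes, zero_sub, neg_eq_zero] at this
    exact this
  refine ⟨v, ?_⟩
  rw [← hv, h2, map_zero, sub_zero]

end EquivariantKoszulResolution

end EqFormality

namespace EqFormality

variable {k : Type u} [Field k] {O : Type u} [CommRing O] [HopfAlgebra k O]

namespace ParamAlgebra

variable (P : ParamAlgebra k O)

/-! ### The Koszul complex `Hom(∧V, Sym V^*)` -/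

/-- The `i`-th summand `Φ ↦ x_i^* Φ(- x_i)` of the Koszul differential. -/
noncomputable def koszulTerm (i : Fin P.dim) :
    (P.B.carrier →ₗ[k] P.A.carrier) →ₗ[k] (P.B.carrier →ₗ[k] P.A.carrier) where
  toFun Φ := LinearMap.mulLeft k (P.xA i) ∘ₗ Φ ∘ₗ LinearMap.mulRight k (P.xB i)
  map_add' Φ Ψ := by rw [LinearMap.add_comp, LinearMap.comp_add]
  map_smul' c Φ := by rw [LinearMap.smul_comp, LinearMap.comp_smul, RingHom.id_apply]

theorem koszulTerm_apply (i : Fin P.dim) (Φ : P.B.carrier →ₗ[k] P.A.carrier) (b : P.B.carrier) :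
    P.koszulTerm i Φ b = P.xA i * Φ (b * P.xB i) := rfl

/-- The Koszul differential on `Hom(∧V, Sym V^*)`. -/
noncomputable def koszulD :
    (P.B.carrier →ₗ[k] P.A.carrier) →ₗ[k] (P.B.carrier →ₗ[k] P.A.carrier) :=
  ∑ i, P.koszulTerm i

theorem koszulD_apply (Φ : P.B.carrier →ₗ[k] P.A.carrier) (b : P.B.carrier) :
    P.koszulD Φ b = ∑ i, P.xA i * Φ (b * P.xB i) := by
  simp only [koszulD, LinearMap.sum_apply, koszulTerm_apply]

/-- The partial homotopy `Φ ↦ ∂_i Φ(- ⌊ x_i^*)`. -/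
noncomputable def koszulH (i : Fin P.dim) (Φ : P.B.carrier →ₗ[k] P.A.carrier) :
    P.B.carrier →ₗ[k] P.A.carrier := P.divA i ∘ₗ Φ ∘ₗ P.contrB i

theorem koszulH_apply (i : Fin P.dim) (Φ : P.B.carrier →ₗ[k] P.A.carrier) (b : P.B.carrier) :
    P.koszulH i Φ b = P.divA i (Φ (P.contrB i b)) := rfl

theorem xB_mul_swap (b : P.B.carrier) (i j : Fin P.dim) :
    b * P.xB i * P.xB j = -(b * P.xB j * P.xB i) := by
  rw [mul_assoc, mul_assoc, ← mul_neg]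
  congr 1
  exact eq_neg_of_add_eq_zero_left (P.ιB_add_swap _ _)

theorem mul_xB_mul_xB (b : P.B.carrier) (i : Fin P.dim) : b * P.xB i * P.xB i = 0 := by
  rw [mul_assoc, xB, ιB_sq, mul_zero]

theorem koszulTerm_sq (i : Fin P.dim) (Φ : P.B.carrier →ₗ[k] P.A.carrier) :
    P.koszulTerm i (P.koszulTerm i Φ) = 0 := by
  ext b
  rw [koszulTerm_apply, koszulTerm_apply, mul_xB_mul_xB, map_zero, mul_zero, mul_zero]
  rfl

theorem koszulTerm_comm (i j : Fin P.dim) (Φ : P.B.carrier →ₗ[k] P.A.carrier) :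
    P.koszulTerm i (P.koszulTerm j Φ) = -P.koszulTerm j (P.koszulTerm i Φ) := by
  ext b
  rw [LinearMap.neg_apply, koszulTerm_apply, koszulTerm_apply, koszulTerm_apply, koszulTerm_apply,
    xB_mul_swap, map_neg, mul_neg, mul_neg, ← mul_assoc, ← mul_assoc, P.A_mul_comm (P.xA i)]

theorem koszulTerm_koszulH (i j : Fin P.dim) (hij : i ≠ j) (Φ : P.B.carrier →ₗ[k] P.A.carrier) :
    P.koszulTerm i (P.koszulH j Φ) = -P.koszulH j (P.koszulTerm i Φ) := by
  ext b
  rw [LinearMap.neg_apply, koszulTerm_apply, koszulH_apply, koszulH_apply, koszulTerm_apply,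
    P.contrB_mul_of_ne hij, map_neg, map_neg, mul_neg, P.divA_mul_of_ne hij]

theorem koszulH_koszulH (i j : Fin P.dim) (Φ : P.B.carrier →ₗ[k] P.A.carrier) :
    P.koszulH i (P.koszulH j Φ) = -P.koszulH j (P.koszulH i Φ) := by
  ext b
  rw [LinearMap.neg_apply, koszulH_apply, koszulH_apply, koszulH_apply, koszulH_apply,
    P.contrB_comm, map_neg, map_neg, map_neg, P.divA_comm]

/-- With the next identity and the vanishing of the squares: if `d_i`, `h_i` denote the two
operators, then `d_i h_i + h_i d_i` is idempotent, and its complement is killed by both `d_i` and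
`h_i`. -/
theorem koszulTerm_koszulH_koszulTerm (i : Fin P.dim) (Φ : P.B.carrier →ₗ[k] P.A.carrier) :
    P.koszulTerm i (P.koszulH i (P.koszulTerm i Φ)) = P.koszulTerm i Φ := by
  ext b
  rw [koszulTerm_apply, koszulH_apply, koszulTerm_apply, P.divA_mul_self, P.contrB_mul_self,
    sub_mul, mul_xB_mul_xB, sub_zero, koszulTerm_apply]

theorem koszulH_koszulTerm_koszulH (i : Fin P.dim) (Φ : P.B.carrier →ₗ[k] P.A.carrier) :
    P.koszulH i (P.koszulTerm i (P.koszulH i Φ)) = P.koszulH i Φ := by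
  ext b
  rw [koszulH_apply, koszulTerm_apply, P.divA_mul_self, koszulH_apply, P.contrB_mul_self,
    P.contrB_contrB, zero_mul, sub_zero, koszulH_apply]

theorem koszulH_sq (i : Fin P.dim) (Φ : P.B.carrier →ₗ[k] P.A.carrier) :
    P.koszulH i (P.koszulH i Φ) = 0 := by
  ext b
  rw [koszulH_apply, koszulH_apply, P.contrB_contrB, map_zero, map_zero, map_zero]
  rfl

theorem koszulH_add (i : Fin P.dim) (Φ Ψ : P.B.carrier →ₗ[k] P.A.carrier) :
    P.koszulH i (Φ + Ψ) = P.koszulH i Φ + P.koszulH i Ψ := by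
  rw [koszulH, LinearMap.add_comp, LinearMap.comp_add]
  rfl

theorem koszulH_neg (i : Fin P.dim) (Φ : P.B.carrier →ₗ[k] P.A.carrier) :
    P.koszulH i (-Φ) = -P.koszulH i Φ := by
  rw [koszulH, LinearMap.neg_comp, LinearMap.comp_neg]
  rfl

theorem koszulH_sub (i : Fin P.dim) (Φ Ψ : P.B.carrier →ₗ[k] P.A.carrier) :
    P.koszulH i (Φ - Ψ) = P.koszulH i Φ - P.koszulH i Ψ := by
  rw [sub_eq_add_neg, koszulH_add, koszulH_neg, sub_eq_add_neg]

theorem koszulH_zero (i : Fin P.dim) : P.koszulH i 0 = 0 := by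
  rw [koszulH, LinearMap.zero_comp, LinearMap.comp_zero]

theorem koszulD_koszulD (Φ : P.B.carrier →ₗ[k] P.A.carrier) : P.koszulD (P.koszulD Φ) = 0 := by
  have h : ∀ j, P.koszulD (P.koszulTerm j Φ) = -P.koszulTerm j (P.koszulD Φ) := by
    intro j
    simp only [koszulD, LinearMap.sum_apply, map_sum]
    rw [← Finset.sum_neg_distrib]
    exact Finset.sum_congr rfl fun i _ => P.koszulTerm_comm i j Φ
  ext b
  rw [koszulD_apply, LinearMap.zero_apply]
  simp only [koszulD_apply, Finset.mul_sum]
  rw [← Finset.sum_product']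
  refine Finset.sum_involution (fun p _ => (p.2, p.1)) ?_ ?_ (by simp) (by simp)
  · rintro ⟨i, j⟩ -
    change P.xA i * (P.xA j * Φ (b * P.xB i * P.xB j)) +
      P.xA j * (P.xA i * Φ (b * P.xB j * P.xB i)) = 0
    rw [P.xB_mul_swap b j i, map_neg, mul_neg, mul_neg, ← mul_assoc, ← mul_assoc,
      P.A_mul_comm (P.xA j), add_neg_cancel]
  · rintro ⟨i, j⟩ - hne heq
    obtain rfl : j = i := congrArg Prod.fst heq
    apply hne
    change P.xA j * (P.xA j * Φ (b * P.xB j * P.xB j)) = 0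
    rw [mul_xB_mul_xB, map_zero, mul_zero, mul_zero]

/-- `d h_i + h_i d = d_i h_i + h_i d_i`. -/
theorem koszulD_koszulH (i : Fin P.dim) (Φ : P.B.carrier →ₗ[k] P.A.carrier) :
    P.koszulD (P.koszulH i Φ) + P.koszulH i (P.koszulD Φ) =
      P.koszulTerm i (P.koszulH i Φ) + P.koszulH i (P.koszulTerm i Φ) := by
  have hs : ∀ s : Finset (Fin P.dim), P.koszulH i (∑ j ∈ s, P.koszulTerm j Φ) =
      ∑ j ∈ s, P.koszulH i (P.koszulTerm j Φ) := by
    intro s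
    induction s using Finset.cons_induction with
    | empty => rw [Finset.sum_empty, Finset.sum_empty, koszulH_zero]
    | cons a s ha ih => rw [Finset.sum_cons, Finset.sum_cons, koszulH_add, ih]
  simp only [koszulD, LinearMap.sum_apply]
  rw [hs, ← Finset.sum_add_distrib]
  refine Finset.sum_eq_single i (fun j _ hj => ?_) (by simp)
  rw [P.koszulTerm_koszulH j i hj, neg_add_cancel]

/-- The Koszul complex is treated one variable at a time. Replacing `Ψ` by the cohomologous `Ψ - d
h_i Ψ` kills `d_i` and `h_i`, and what was achieved for earlier variables persists because the
operators for distinct variables anticommute. The familiar Euler homotopy is avoided: it divides by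
total degrees, which may vanish in characteristic `p`. -/
theorem exists_koszul_reduction (s : Finset (Fin P.dim)) {Φ : P.B.carrier →ₗ[k] P.A.carrier}
    (hΦ : P.koszulD Φ = 0) : ∃ Ψ Θ, Φ = Ψ + P.koszulD Θ ∧ P.koszulD Ψ = 0 ∧
      ∀ i ∈ s, P.koszulTerm i Ψ = 0 ∧ P.koszulH i Ψ = 0 := by
  induction s using Finset.cons_induction with
  | empty => exact ⟨Φ, 0, by simp, hΦ, by simp⟩
  | cons i s hi ih =>
    obtain ⟨Ψ, Θ, h1, h2, h3⟩ := ih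
    have key : P.koszulD (P.koszulH i Ψ) =
        P.koszulTerm i (P.koszulH i Ψ) + P.koszulH i (P.koszulTerm i Ψ) := by
      rw [← koszulD_koszulH, h2, koszulH_zero, add_zero]
    refine ⟨Ψ - P.koszulD (P.koszulH i Ψ), Θ + P.koszulH i Ψ, ?_, ?_, fun j hj => ?_⟩
    · rw [map_add, h1]
      abel
    · rw [map_sub, h2, koszulD_koszulD, sub_zero]
    · rw [key]
      rcases Finset.mem_cons.1 hj with rfl | hj
      · constructor
        · rw [map_sub, map_add, koszulTerm_sq, koszulTerm_koszulH_koszulTerm, zero_add, sub_self]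
        · rw [koszulH_sub, koszulH_add, koszulH_koszulTerm_koszulH, koszulH_sq, add_zero, sub_self]
      · have hij : j ≠ i := fun h => hi (h ▸ hj)
        obtain ⟨h3, h4⟩ := h3 j hj
        constructor
        · rw [map_sub, map_add, P.koszulTerm_comm j i, P.koszulTerm_koszulH j i hij, h3,
            P.koszulTerm_koszulH j i hij, P.koszulTerm_comm j i, h3]
          simp [koszulH_zero]
        · have h5 : P.koszulH j (P.koszulTerm i (P.koszulH i Ψ)) =
              -P.koszulTerm i (P.koszulH j (P.koszulH i Ψ)) := by
            rw [P.koszulTerm_koszulH i j hij.symm, neg_neg]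
          have h6 : P.koszulH j (P.koszulTerm i Ψ) = -P.koszulTerm i (P.koszulH j Ψ) := by
            rw [P.koszulTerm_koszulH i j hij.symm, neg_neg]
          rw [koszulH_sub, koszulH_add, h5, P.koszulH_koszulH j i, P.koszulH_koszulH j i, h6, h4]
          simp [koszulH_zero]

/-- The augmentation of `∧V`, as an element of `Hom(∧V, Sym V^*)`. -/
noncomputable def koszulPt : P.B.carrier →ₗ[k] P.A.carrier :=
  Algebra.linearMap k P.A.carrier ∘ₗ P.augB.toLinearMap

theorem koszulPt_apply (b : P.B.carrier) :
    P.koszulPt b = algebraMap k P.A.carrier (P.augB b) := rfl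

theorem koszulD_koszulPt : P.koszulD P.koszulPt = 0 := by
  ext b
  rw [koszulD_apply]
  refine Finset.sum_eq_zero fun i _ => ?_
  rw [koszulPt_apply, map_mul, xB, augB_ιB, mul_zero, map_zero, mul_zero]

/-- All values of the Koszul differential lie in the ideal generated by the `x_i`, so evaluating at
`1` and augmenting kills them, whereas the point has value `1`. -/
theorem eq_zero_of_smul_koszulPt {c : k} {Θ : P.B.carrier →ₗ[k] P.A.carrier}
    (h : c • P.koszulPt = P.koszulD Θ) : c = 0 := by
  have h1 := congrArg P.augA (LinearMap.congr_fun h 1)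
  rw [koszulD_apply, map_sum, LinearMap.smul_apply, map_smul, koszulPt_apply, map_one, map_one,
    map_one, Finset.sum_eq_zero] at h1
  · simpa using h1
  · intro i _
    rw [map_mul, xA, augA_ιA, zero_mul]

/-- Exactness of the Koszul complex. -/
theorem exists_of_koszulD_eq_zero {Φ : P.B.carrier →ₗ[k] P.A.carrier} (hΦ : P.koszulD Φ = 0) :
    ∃ (c : k) (Θ : P.B.carrier →ₗ[k] P.A.carrier), Φ = c • P.koszulPt + P.koszulD Θ := by
  obtain ⟨Ψ, Θ, h1, -, h2⟩ := P.exists_koszul_reduction Finset.univ hΦ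
  -- Multiplication by `x_i` is injective, so `d_i Ψ = 0` says that `Ψ` kills the augmentation
  -- ideal. Evaluating `h_i Ψ = 0` at the `i`-th basis vector, whose contraction is `1`, says in
  -- `h4` that `x_i` divides no monomial of `Ψ 1`. Thus `Ψ` is a scalar multiple of the point.
  have h3 : ∀ b i, Ψ (b * P.xB i) = 0 := by
    intro b i
    have := congrArg (P.divA i) (LinearMap.congr_fun (h2 i (Finset.mem_univ i)).1 b)
    rw [koszulTerm_apply, P.divA_mul_self] at this
    exact this.trans (map_zero _)
  have h4 : ∀ i, P.divA i (Ψ 1) = 0 := by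
    intro i
    have := LinearMap.congr_fun (h2 i (Finset.mem_univ i)).2 (1 * P.xB i)
    have h0 : P.contrB i 1 = 0 := CliffordAlgebra.contractRight_one (d := P.cotBasis.coord i) _
    rw [koszulH_apply, P.contrB_mul_self, h0, zero_mul, sub_zero] at this
    exact this
  obtain ⟨c, hc⟩ := P.exists_eq_algebraMap_of_divA h4
  refine ⟨c, Θ, h1.trans ?_⟩
  congr 1
  ext b
  rw [P.eq_augB_smul h3 b, hc, LinearMap.smul_apply, koszulPt_apply,
    Algebra.algebraMap_eq_smul_one, Algebra.algebraMap_eq_smul_one, smul_comm]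

end ParamAlgebra

end EqFormality

namespace EqFormality

variable {k : Type u} [Field k] {O : Type u} [CommRing O] [HopfAlgebra k O]
  {P : ParamAlgebra k O}

namespace EquivariantKoszulResolution

variable (K : EquivariantKoszulResolution P)

/-! ### The reduction of a bimodule along `aug` and `pi` -/

/-- The bimodule `B`, on which `K` acts through `aug` on the left and through `pi` on the right. -/
noncomputable def extBimodule : DGBimodule K.toEquivariantDGAlgebra where
  carrier := P.B.carrier
  gr := P.B.gr
  isInternal := P.B.isInternal
  d := 0
  d_mem _ := zero_mem _
  d_d _ := rfl
  left := LinearMap.lsmul k P.B.carrier ∘ₗ K.aug.toLinearMap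
  left_one m := by
    change K.aug 1 • m = m
    rw [map_one, one_smul]
  left_mul a b m := by
    change K.aug (a * b) • m = K.aug a • K.aug b • m
    rw [map_mul, smul_smul]
  right := (LinearMap.mul k P.B.carrier).flip ∘ₗ K.pi.toAlgHom.toLinearMap
  right_one m := by
    change m * K.pi.toAlgHom 1 = m
    rw [map_one, mul_one]
  right_mul a b m := by
    change m * K.pi.toAlgHom (a * b) = m * K.pi.toAlgHom a * K.pi.toAlgHom b
    rw [map_mul, mul_assoc]
  left_right a b m := by
    change K.aug a • (m * K.pi.toAlgHom b) = (K.aug a • m) * K.pi.toAlgHom b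
    rw [smul_mul_assoc]
  central z m := by
    change K.aug (K.unit z) • m = m * K.pi.toAlgHom (K.unit z)
    rw [K.aug_unit, K.pi_unit, Algebra.algebraMap_eq_smul_one, mul_smul_comm, mul_one]
  left_mem := by
    intro p q a m ha hm
    change K.aug a • m ∈ _
    by_cases hp : p = 0
    · subst hp
      rw [zero_add]
      exact Submodule.smul_mem _ _ hm
    · rw [K.aug_gr hp ha, zero_smul]
      exact zero_mem _
  right_mem hb hm := P.B.gradedMonoid.mul_mem hm (K.pi.map_gr hb)
  d_left {p a} m _ := by
    change (0 : P.B.carrier) = K.aug (K.d a) • m + p.negOnePow • (K.aug a • (0 : P.B.carrier))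
    rw [K.aug_d, zero_smul, smul_zero, smul_zero, add_zero]
  d_right {q m} b _ := by
    change (0 : P.B.carrier) = (0 : P.B.carrier) * K.pi.toAlgHom b +
      q.negOnePow • (m * K.pi.toAlgHom (K.d b))
    rw [K.pi_d, zero_mul, mul_zero, smul_zero, add_zero]

end EquivariantKoszulResolution

namespace DGBimodule

variable {K : EquivariantKoszulResolution P} (X Y : DGBimodule K.toEquivariantDGAlgebra)

/-- The kernel of `X → k ⊗_K X ⊗_K B`. -/
def augSub : Submodule k X.carrier :=
  Submodule.span k ({y | ∃ a m, y = X.left a m - K.aug a • m} ∪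
    {y | ∃ b m, K.pi.toAlgHom b = 0 ∧ y = X.right b m})

variable {X Y}

theorem left_sub_mem_augSub (a : K.carrier) (m : X.carrier) :
    X.left a m - K.aug a • m ∈ X.augSub := Submodule.subset_span (Or.inl ⟨a, m, rfl⟩)

theorem left_mem_augSub {a : K.carrier} (ha : K.aug a = 0) (m : X.carrier) :
    X.left a m ∈ X.augSub := by
  simpa [ha] using left_sub_mem_augSub a m

theorem right_mem_augSub {b : K.carrier} (hb : K.pi.toAlgHom b = 0) (m : X.carrier) :
    X.right b m ∈ X.augSub := Submodule.subset_span (Or.inr ⟨b, m, hb, rfl⟩)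

/-- The kernel of `π` is a graded subspace and both kinds of generators of `augSub` are additive in
the element of `K`, so that it suffices to test homogeneous elements. -/
theorem map_mem_of_mem_augSub {W : Type*} [AddCommGroup W] [Module k W] {f : X.carrier →ₗ[k] W}
    {N : Submodule k W} (h1 : ∀ n, ∀ a ∈ K.gr n, ∀ m, f (X.left a m - K.aug a • m) ∈ N)
    (h2 : ∀ n, ∀ b ∈ K.gr n, ∀ m, K.pi.toAlgHom b = 0 → f (X.right b m) ∈ N) {x : X.carrier}
    (hx : x ∈ X.augSub) : f x ∈ N := by
  revert hx x
  change X.augSub ≤ N.comap f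
  refine Submodule.span_le.2 ?_
  rintro _ (⟨a, m, rfl⟩ | ⟨b, m, hb, rfl⟩)
  · refine gr_induction (p := fun a => f (X.left a m - K.aug a • m) ∈ N) K.isInternal a
      (fun n a ha => h1 n a ha m) (by simp) (fun x y hx hy => ?_)
    have : X.left (x + y) m - K.aug (x + y) • m =
        (X.left x m - K.aug x • m) + (X.left y m - K.aug y • m) := by
      rw [map_add, map_add, add_smul, LinearMap.add_apply]
      abel
    rw [this, map_add]
    exact add_mem hx hy
  · obtain ⟨s, hs⟩ := exists_sum_component K.isInternal b
    rw [hs, map_sum, LinearMap.sum_apply]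
    change f (∑ n ∈ s, X.right (component K.isInternal n b) m) ∈ N
    rw [map_sum]
    refine sum_mem fun n _ => h2 n _ (component_mem _ _ _) m ?_
    have := component_natural_zero K.isInternal P.B.isInternal (f := K.pi.toAlgHom.toLinearMap)
      (fun _ _ h => K.pi.map_gr h) n b
    refine this.trans ?_
    rw [AlgHom.toLinearMap_apply, hb, map_zero]

theorem d_mem_augSub {x : X.carrier} (hx : x ∈ X.augSub) : X.d x ∈ X.augSub := by
  refine map_mem_of_mem_augSub (f := X.d) ?_ ?_ hx
  · intro n a ha m
    rw [map_sub, X.d_left m ha, map_smul]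
    -- In degree zero the sign is trivial; in all other degrees `aug` vanishes. The same dichotomy
    -- settles the signs in the lemmas that follow.
    by_cases hn : n = 0
    · subst hn
      rw [Int.negOnePow_zero, one_smul, add_sub_assoc]
      exact add_mem (left_mem_augSub (K.aug_d a) m) (left_sub_mem_augSub a _)
    · rw [K.aug_gr hn ha, zero_smul, sub_zero, Units.smul_def]
      exact add_mem (left_mem_augSub (K.aug_d a) m)
        (zsmul_mem (left_mem_augSub (K.aug_gr hn ha) _) _)
  · intro n b _ m hb
    refine gr_induction (p := fun m => X.d (X.right b m) ∈ X.augSub) X.isInternal m ?_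
      (by simp) (fun x y hx hy => by rw [map_add, map_add]; exact add_mem hx hy)
    intro q m hm
    rw [X.d_right b hm, Units.smul_def]
    exact add_mem (right_mem_augSub hb _) (zsmul_mem (right_mem_augSub (K.pi_d b) _) _)

theorem left_mem_augSub_of_mem (c : K.carrier) {x : X.carrier} (hx : x ∈ X.augSub) :
    X.left c x ∈ X.augSub := by
  have h := left_sub_mem_augSub c x
  have := add_mem h (Submodule.smul_mem _ (K.aug c) hx)
  rwa [sub_add_cancel] at this

theorem right_mem_augSub_of_mem (c : K.carrier) {x : X.carrier} (hx : x ∈ X.augSub) :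
    X.right c x ∈ X.augSub := by
  refine map_mem_of_mem_augSub (f := X.right c) ?_ ?_ hx
  · intro n a _ m
    rw [map_sub, map_smul, ← X.left_right]
    exact left_sub_mem_augSub a _
  · intro n b _ m hb
    rw [← X.right_mul]
    exact right_mem_augSub (by rw [map_mul, hb, zero_mul]) m

theorem component_left {p : ℤ} {a : K.carrier} (ha : a ∈ K.gr p) (n : ℤ) (m : X.carrier) :
    component X.isInternal n (X.left a m) = X.left a (component X.isInternal (n - p) m) := by
  have := component_natural X.isInternal X.isInternal (f := X.left a) (e := p)
    (fun q x hx => by rw [add_comm]; exact X.left_mem ha hx) (n - p) m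
  rw [sub_add_cancel] at this
  exact this.symm

theorem component_right {p : ℤ} {b : K.carrier} (hb : b ∈ K.gr p) (n : ℤ) (m : X.carrier) :
    component X.isInternal n (X.right b m) = X.right b (component X.isInternal (n - p) m) := by
  have := component_natural X.isInternal X.isInternal (f := X.right b) (e := p)
    (fun q x hx => X.right_mem hb hx) (n - p) m
  rw [sub_add_cancel] at this
  exact this.symm

theorem component_mem_augSub (n : ℤ) {x : X.carrier} (hx : x ∈ X.augSub) :
    component X.isInternal n x ∈ X.augSub := by
  refine map_mem_of_mem_augSub (f := component X.isInternal n) ?_ ?_ hx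
  · intro p a ha m
    rw [map_sub, map_smul, component_left ha]
    by_cases hp : p = 0
    · subst hp
      rw [sub_zero]
      exact left_sub_mem_augSub a _
    · rw [K.aug_gr hp ha, zero_smul, sub_zero]
      exact left_mem_augSub (K.aug_gr hp ha) _
  · intro p b hb m hb'
    rw [component_right hb]
    exact right_mem_augSub hb' _

theorem homDeg_mem_augSub {n : ℤ} {f : X.carrier →ₗ[k] Y.carrier} (hf : f ∈ homDeg X Y n)
    {x : X.carrier} (hx : x ∈ X.augSub) : f x ∈ Y.augSub := by
  refine map_mem_of_mem_augSub (f := f) ?_ ?_ hx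
  · intro p a ha m
    rw [map_sub, map_smul, hf.2.1 p a ha]
    by_cases hp : p = 0
    · subst hp
      rw [mul_zero, Int.negOnePow_zero, one_smul]
      exact left_sub_mem_augSub a _
    · rw [K.aug_gr hp ha, zero_smul, sub_zero, Units.smul_def]
      exact zsmul_mem (left_mem_augSub (K.aug_gr hp ha) _) _
  · intro p b _ m hb
    rw [hf.2.2]
    exact right_mem_augSub hb _

theorem Hom.mem_augSub (u : Hom X Y) {x : X.carrier} (hx : x ∈ X.augSub) :
    u.toLinearMap x ∈ Y.augSub := homDeg_mem_augSub u.mem_homDeg hx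

/-- Homogeneous maps to `B` therefore kill `augSub`; such maps serve to detect elements modulo
`augSub`. -/
theorem augSub_extBimodule : K.extBimodule.augSub = ⊥ := by
  refine le_bot_iff.1 (Submodule.span_le.2 ?_)
  rintro _ (⟨a, m, rfl⟩ | ⟨b, m, hb, rfl⟩)
  · exact sub_self (K.aug a • m)
  · have h : ∀ m : P.B.carrier, m * K.pi.toAlgHom b = 0 := fun m => by rw [hb, mul_zero]
    exact h m

/-- A linear map which vanishes on `augSub` is compatible with the left action through `aug`. -/
theorem map_left_of_augSub {W : Type*} [AddCommGroup W] [Module k W] {f : X.carrier →ₗ[k] W}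
    (hf : ∀ x ∈ X.augSub, f x = 0) (a : K.carrier) (m : X.carrier) :
    f (X.left a m) = K.aug a • f m := by
  have := hf _ (left_sub_mem_augSub a m)
  rwa [map_sub, map_smul, sub_eq_zero] at this

/-- A linear map which vanishes on `augSub` is compatible with the right action through `pi`. -/
theorem map_right_of_augSub {W : Type*} [AddCommGroup W] [Module k W] {f : X.carrier →ₗ[k] W}
    (hf : ∀ x ∈ X.augSub, f x = 0) {b b' : K.carrier} (h : K.pi.toAlgHom b = K.pi.toAlgHom b')
    (m : X.carrier) : f (X.right b m) = f (X.right b' m) := by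
  have := hf _ (right_mem_augSub (b := b - b') (by rw [map_sub, h, sub_self]) m)
  rwa [map_sub, LinearMap.sub_apply, map_sub, sub_eq_zero] at this

end DGBimodule

/-! ### The complex `K ⊗_Z K` -/

namespace EquivariantDGAlgebra

variable (K : EquivariantDGAlgebra P)

/-- The differential, as a `Z`-linear map. -/
noncomputable def dZ : K.carrier →ₗ[P.carrier] K.carrier where
  toFun := K.d
  map_add' := map_add _
  map_smul' z x := K.d_unit_mul z x

/-- The sign involution, as a `Z`-linear map. -/
noncomputable def signZ : K.carrier →ₗ[P.carrier] K.carrier where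
  toFun := signMap K.isInternal
  map_add' := map_add _
  map_smul' z x := by
    rw [RingHom.id_apply, smul_eq, smul_eq]
    refine gr_induction (p := fun x => signMap K.isInternal (K.unit z * x) =
      K.unit z * signMap K.isInternal x) K.isInternal x ?_ (by simp)
      (fun x y hx hy => by rw [mul_add, map_add, hx, hy, map_add, mul_add])
    intro n x hx
    have h := K.gradedMonoid.mul_mem (K.unit_mem z) hx
    rw [zero_add] at h
    rw [signMap_of_mem _ h, signMap_of_mem _ hx, Units.smul_def, Units.smul_def, mul_smul_comm]

/-- The projection to the component of degree `n`, as a `Z`-linear map. -/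
noncomputable def componentZ (n : ℤ) : K.carrier →ₗ[P.carrier] K.carrier where
  toFun := component K.isInternal n
  map_add' := map_add _
  map_smul' z x := by
    rw [RingHom.id_apply, smul_eq, smul_eq]
    refine (component_natural_zero K.isInternal K.isInternal
      (f := LinearMap.mulLeft k (K.unit z)) ?_ n x).symm
    intro n x hx
    have h := K.gradedMonoid.mul_mem (K.unit_mem z) hx
    rwa [zero_add] at h

theorem dZ_apply (x : K.carrier) : K.dZ x = K.d x := rfl

theorem componentZ_apply (n : ℤ) (x : K.carrier) :
    K.componentZ n x = component K.isInternal n x := rfl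

/-- If `K` is finite over `Z`, then it is bounded. -/
theorem IsFinite.exists_bounded (hK : K.IsFinite) :
    ∃ s : Finset ℤ, ∀ n ∉ s, ∀ x ∈ K.gr n, x = 0 := by
  have hK' : Module.Finite P.carrier K.carrier := hK
  have : IsNoetherian P.carrier K.carrier := isNoetherian_of_isNoetherianRing_of_finite _ _
  obtain ⟨s, hs⟩ := hK'
  choose t ht using fun x => exists_sum_component K.isInternal x
  classical
  refine ⟨s.biUnion t, fun n hn x hx => ?_⟩
  have key : K.componentZ n = 0 := by
    refine LinearMap.ext_on hs fun y hy => ?_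
    rw [LinearMap.zero_apply, componentZ_apply, ht y, map_sum]
    refine Finset.sum_eq_zero fun m hm => component_of_ne _ ?_ (component_mem _ _ _)
    rintro rfl
    exact hn (Finset.mem_biUnion.2 ⟨y, hy, hm⟩)
  rw [← component_of_mem K.isInternal hx, ← componentZ_apply, key, LinearMap.zero_apply]

/-- The differential `d ⊗ 1 + c σ ⊗ d` on `K ⊗_Z K`. -/
noncomputable def envD (c : ℤˣ) :
    K.carrier ⊗[P.carrier] K.carrier →ₗ[P.carrier] K.carrier ⊗[P.carrier] K.carrier :=
  -- The unit `c` will be `(-1)^|e|` for an element `e` between the two factors, see `d_orbit`.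
  K.dZ.rTensor K.carrier + (c : ℤ) • TensorProduct.map K.signZ K.dZ

theorem envD_tmul (c : ℤˣ) (a b : K.carrier) :
    K.envD c (a ⊗ₜ b) = K.d a ⊗ₜ b + (c : ℤ) • (signMap K.isInternal a ⊗ₜ K.d b) := rfl

theorem envD_envD (c : ℤˣ) (w : K.carrier ⊗[P.carrier] K.carrier) : K.envD c (K.envD c w) = 0 := by
  induction w with
  | zero => simp
  | add x y hx hy => rw [map_add, map_add, hx, hy, add_zero]
  | tmul a b =>
    refine gr_induction (p := fun a => K.envD c (K.envD c (a ⊗ₜ b)) = 0) K.isInternal a ?_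
      (by simp) (fun x y hx hy => by rw [TensorProduct.add_tmul, map_add, map_add, hx, hy,
        add_zero])
    intro n a ha
    rw [envD_tmul, map_add, map_zsmul, envD_tmul, envD_tmul, K.d_d, K.d_d,
      signMap_of_mem _ (K.d_mem ha), signMap_of_mem _ ha, Int.negOnePow_succ,
      map_units_zsmul K.d]
    rcases Int.units_eq_one_or n.negOnePow with hn | hn <;> rw [hn] <;>
      simp [TensorProduct.neg_tmul]

/-- The map `K ⊗_Z K → k ⊗_Z K`, for an algebra map `ε : K → k` compatible with `Z → k`. -/
noncomputable def envRed (ε : K.carrier →ₐ[k] k) (hε : ∀ z, ε (K.unit z) = P.aug z) :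
    K.carrier ⊗[P.carrier] K.carrier →+ K.Red :=
  TensorProduct.liftAddHom
    (AddMonoidHom.mk' (fun a => AddMonoidHom.mk' (fun b => ε a • K.maxMul.mkQ b)
      (by intro b b'; rw [map_add, smul_add])) (by intro a a'; ext b; simp [add_smul]))
    (by
      intro z a b
      change ε (z • a) • K.maxMul.mkQ b = ε a • K.maxMul.mkQ (z • b)
      have h : K.maxMul.mkQ (K.unit z * b) = P.aug z • K.maxMul.mkQ b := by
        rw [← map_smul, ← sub_eq_zero, ← map_sub, Submodule.mkQ_apply,
          Submodule.Quotient.mk_eq_zero]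
        refine Submodule.subset_span ⟨z - algebraMap k P.carrier (P.aug z), ?_, b, ?_⟩
        · change P.aug _ = 0
          simp
        · rw [map_sub, AlgHom.commutes, sub_mul, Algebra.smul_def]
      rw [smul_eq, smul_eq, h, map_mul, hε, mul_comm, smul_smul])

theorem envRed_tmul (ε : K.carrier →ₐ[k] k) (hε : ∀ z, ε (K.unit z) = P.aug z) (a b : K.carrier) :
    K.envRed ε hε (a ⊗ₜ b) = ε a • K.maxMul.mkQ b := rfl

end EquivariantDGAlgebra

end EqFormality

/-! ### Acyclicity of the kernel of `K ⊗_Z K → k ⊗_Z K` -/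

namespace EqFormality

variable {k : Type u} [Field k] {O : Type u} [CommRing O] [HopfAlgebra k O]
  {P : ParamAlgebra k O}

namespace EquivariantDGAlgebra

variable (K : EquivariantDGAlgebra P)

theorem envRed_surjective (ε : K.carrier →ₐ[k] k) (hε : ∀ z, ε (K.unit z) = P.aug z) (r : K.Red) :
    ∃ x, K.envRed ε hε (1 ⊗ₜ x) = r := by
  obtain ⟨x, rfl⟩ := Submodule.mkQ_surjective _ r
  exact ⟨x, by rw [envRed_tmul, map_one, one_smul]⟩

theorem envRed_envD (ε : K.carrier →ₐ[k] k) (hε : ∀ z, ε (K.unit z) = P.aug z)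
    (hgr : ∀ n, n ≠ 0 → ∀ x ∈ K.gr n, ε x = 0) (hd : ∀ x, ε (K.d x) = 0) (c : ℤˣ)
    (w : K.carrier ⊗[P.carrier] K.carrier) :
    K.envRed ε hε (K.envD c w) = (c : ℤ) • K.redD (K.envRed ε hε w) := by
  have hs : ∀ x, ε (signMap K.isInternal x) = ε x := by
    intro x
    refine gr_induction (p := fun x => ε (signMap K.isInternal x) = ε x) K.isInternal x ?_
      (by simp) (fun x y hx hy => by rw [map_add, map_add, hx, hy, map_add])
    intro n x hx
    rw [signMap_of_mem _ hx]
    by_cases hn : n = 0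
    · subst hn
      rw [Int.negOnePow_zero, one_smul]
    · rw [Units.smul_def, map_zsmul, hgr n hn x hx, smul_zero]
  induction w with
  | zero => simp
  | add x y hx hy => rw [map_add, map_add, hx, hy, map_add, map_add, smul_add]
  | tmul a b =>
    rw [envD_tmul, map_add, map_zsmul, envRed_tmul, envRed_tmul, envRed_tmul, hd, zero_smul,
      zero_add, hs, map_smul]
    rfl

/-- Projection of `K ⊗_Z K` to a component of the second factor. -/
noncomputable def envComponent (q : ℤ) :
    K.carrier ⊗[P.carrier] K.carrier →ₗ[P.carrier] K.carrier ⊗[P.carrier] K.carrier :=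
  (K.componentZ q).lTensor K.carrier

theorem envComponent_tmul (q : ℤ) (a b : K.carrier) :
    K.envComponent q (a ⊗ₜ b) = a ⊗ₜ component K.isInternal q b := rfl

theorem envComponent_envComponent (p q : ℤ) (w : K.carrier ⊗[P.carrier] K.carrier) :
    K.envComponent p (K.envComponent q w) = if p = q then K.envComponent q w else 0 := by
  induction w with
  | zero => simp
  | add x y hx hy =>
    rw [map_add, map_add, hx, hy]
    split_ifs <;> simp
  | tmul a b =>
    rw [envComponent_tmul, envComponent_tmul]
    split_ifs with h
    · rw [h, component_of_mem _ (component_mem _ _ _)]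
    · rw [component_of_ne _ (Ne.symm h) (component_mem _ _ _), TensorProduct.tmul_zero]

theorem envComponent_envD (c : ℤˣ) (q : ℤ) (w : K.carrier ⊗[P.carrier] K.carrier) :
    K.envComponent q (K.envD c w) = K.dZ.rTensor K.carrier (K.envComponent q w) +
      (c : ℤ) • TensorProduct.map K.signZ K.dZ (K.envComponent (q - 1) w) := by
  induction w with
  | zero => simp
  | add x y hx hy =>
    rw [map_add, map_add, hx, hy, map_add, map_add, map_add, map_add, smul_add]
    abel
  | tmul a b =>
    have h := component_natural K.isInternal K.isInternal (fun _ _ h => K.d_mem h) (q - 1) b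
    rw [sub_add_cancel] at h
    rw [envD_tmul, map_add, map_zsmul, envComponent_tmul, envComponent_tmul, envComponent_tmul,
      envComponent_tmul, ← h]
    rfl

theorem envComponent_dZ (q : ℤ) (w : K.carrier ⊗[P.carrier] K.carrier) :
    K.envComponent q (K.dZ.rTensor K.carrier w) = K.dZ.rTensor K.carrier (K.envComponent q w) := by
  induction w with
  | zero => simp
  | add x y hx hy => rw [map_add, map_add, hx, hy, map_add, map_add]
  | tmul a b => rfl

theorem envRed_envComponent (ε : K.carrier →ₐ[k] k) (hε : ∀ z, ε (K.unit z) = P.aug z)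
    (q : ℤ) {w : K.carrier ⊗[P.carrier] K.carrier} (hw : K.envRed ε hε w = 0) :
    K.envRed ε hε (K.envComponent q w) = 0 := by
  have h : K.maxMul ≤ K.maxMul.comap (component K.isInternal q) := by
    refine Submodule.span_le.2 ?_
    rintro _ ⟨z, hz, x, rfl⟩
    exact Submodule.subset_span ⟨z, hz, component K.isInternal q x, (K.componentZ q).map_smul z x⟩
  have key : K.envRed ε hε (K.envComponent q w) =
      K.maxMul.mapQ K.maxMul (component K.isInternal q) h (K.envRed ε hε w) := by
    clear hw
    induction w with
    | zero => simp
    | add x y hx hy => rw [map_add, map_add, hx, hy, map_add, map_add]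
    | tmul a b =>
      rw [envComponent_tmul, envRed_tmul, envRed_tmul, map_smul]
      rfl
  rw [key, hw, map_zero]

/-- Exactness of `K ⊗_Z K → K ⊗_Z K → (K × k) ⊗_Z K`. -/
theorem exists_of_dZ_eq_zero (hK : K.IsFlat) (ε : K.carrier →ₐ[k] k)
    (hε : ∀ z, ε (K.unit z) = P.aug z) (hd : ∀ x, ε (K.d x) = 0)
    (hex : ∀ x, K.d x = 0 → ε x = 0 → ∃ v, x = K.d v) {w : K.carrier ⊗[P.carrier] K.carrier}
    (h1 : K.dZ.rTensor K.carrier w = 0) (h2 : K.envRed ε hε w = 0) :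
    ∃ v, K.envRed ε hε v = 0 ∧ w = K.dZ.rTensor K.carrier v := by
  let _ : Module P.carrier k := Module.compHom k P.aug.toRingHom
  have hsmul : ∀ (z : P.carrier) (c : k), z • c = P.aug z * c := fun z c => rfl
  let εZ : K.carrier →ₗ[P.carrier] k :=
    { toFun := ε
      map_add' := map_add ε
      map_smul' := fun z x => by rw [smul_eq, map_mul, hε, RingHom.id_apply, hsmul] }
  have hflat : Module.Flat P.carrier K.carrier := hK
  -- A cocycle killed by `ε` is a coboundary. Combining cocycle condition and `ε` in a single
  -- `Z`-linear map turns this into exactness at one spot, which flatness of `K` preserves under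
  -- tensoring.
  have ex : Function.Exact K.dZ (K.dZ.prod εZ) := by
    intro x
    constructor
    · intro hx
      obtain ⟨v, hv⟩ := hex x (congrArg Prod.fst hx) (congrArg Prod.snd hx)
      exact ⟨v, hv.symm⟩
    · rintro ⟨v, rfl⟩
      exact Prod.ext (K.d_d v) (hd v)
  have ex' := Module.Flat.rTensor_exact K.carrier ex
  have h3 : εZ.rTensor K.carrier w = 0 := by
    -- The comparison `K / m_Z K → k ⊗_Z K`; only its existence is needed, to pass from the
    -- vanishing of the reduction to that of `ε ⊗ 1`.
    let g : K.Red →+ k ⊗[P.carrier] K.carrier := QuotientAddGroup.lift K.maxMul.toAddSubgroup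
      (TensorProduct.mk P.carrier k K.carrier 1).toAddMonoidHom (by
        intro x hx
        have hx' : x ∈ K.maxMul := hx
        change (1 : k) ⊗ₜ[P.carrier] x = 0
        refine Submodule.span_induction (p := fun x _ => (1 : k) ⊗ₜ[P.carrier] x = 0) ?_
          (TensorProduct.tmul_zero _ _)
          (fun x y _ _ hx hy => by rw [TensorProduct.tmul_add, hx, hy, add_zero]) ?_ hx'
        · rintro _ ⟨z, hz, x, rfl⟩
          have hz' : P.aug z = 0 := hz
          rw [← smul_eq, TensorProduct.tmul_smul, TensorProduct.smul_tmul', hsmul, hz', zero_mul,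
            TensorProduct.zero_tmul]
        · intro c x _ hx
          have h0 : c • x = algebraMap k P.carrier c • x := by
            rw [smul_eq, AlgHom.commutes, Algebra.smul_def]
          rw [h0, TensorProduct.tmul_smul, hx, smul_zero])
    have key : ∀ w, g (K.envRed ε hε w) = εZ.rTensor K.carrier w := by
      intro w
      induction w with
      | zero => simp
      | add x y hx hy => rw [map_add, map_add, hx, hy, map_add]
      | tmul a b =>
        rw [envRed_tmul, ← map_smul]
        change (1 : k) ⊗ₜ[P.carrier] (ε a • b) = ε a ⊗ₜ[P.carrier] b
        have h0 : ε a • b = algebraMap k P.carrier (ε a) • b := by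
          rw [smul_eq, AlgHom.commutes, Algebra.smul_def]
        rw [h0, TensorProduct.tmul_smul, TensorProduct.smul_tmul', hsmul, AlgHom.commutes, mul_one]
        rfl
    rw [← key, h2, map_zero]
  have h4 : (K.dZ.prod εZ).rTensor K.carrier w = 0 := by
    have : K.dZ.prod εZ = LinearMap.inl P.carrier K.carrier k ∘ₗ K.dZ +
        LinearMap.inr P.carrier K.carrier k ∘ₗ εZ := by
      ext x <;> simp
    rw [this, LinearMap.rTensor_add, LinearMap.add_apply, LinearMap.rTensor_comp_apply,
      LinearMap.rTensor_comp_apply, h1, h3, map_zero, map_zero, add_zero]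
  obtain ⟨v, rfl⟩ := (ex' w).1 h4
  -- Elements `1 ⊗ x` are killed by `d ⊗ 1` and realize every reduction, so they correct `v` without
  -- changing its boundary.
  obtain ⟨x, hx⟩ := K.envRed_surjective ε hε (K.envRed ε hε v)
  refine ⟨v - 1 ⊗ₜ x, by rw [map_sub, hx, sub_self], ?_⟩
  rw [map_sub, LinearMap.rTensor_tmul, dZ_apply, K.d_one, TensorProduct.zero_tmul, sub_zero]

/-- The kernel of `K ⊗_Z K → k ⊗_Z K` is acyclic. -/
theorem exists_of_envD_eq_zero (hf : K.IsFinite) (hK : K.IsFlat) (ε : K.carrier →ₐ[k] k)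
    (hε : ∀ z, ε (K.unit z) = P.aug z) (hgr : ∀ n, n ≠ 0 → ∀ x ∈ K.gr n, ε x = 0)
    (hd : ∀ x, ε (K.d x) = 0) (hex : ∀ x, K.d x = 0 → ε x = 0 → ∃ v, x = K.d v) (c : ℤˣ)
    {w : K.carrier ⊗[P.carrier] K.carrier} (h1 : K.envD c w = 0) (h2 : K.envRed ε hε w = 0) :
    ∃ v, K.envRed ε hε v = 0 ∧ w = K.envD c v := by
  -- Finiteness over `Z` bounds `K`, so the filtration by the degree of the second factor is finite.
  obtain ⟨s, hs⟩ := hf.exists_bounded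
  have hs0 : ∀ q ∉ s, ∀ w, K.envComponent q w = 0 := by
    intro q hq w
    induction w with
    | zero => simp
    | add x y hx hy => rw [map_add, hx, hy, add_zero]
    | tmul a b => rw [envComponent_tmul, hs q hq _ (component_mem _ _ _), TensorProduct.tmul_zero]
  have hsum : ∀ w, w = ∑ q ∈ s, K.envComponent q w := by
    intro w
    induction w with
    | zero => simp
    | add x y hx hy => simp only [map_add, Finset.sum_add_distrib, ← hx, ← hy]
    | tmul a b =>
      simp only [envComponent_tmul]
      rw [← TensorProduct.tmul_sum]
      congr 1
      obtain ⟨t, ht⟩ := exists_sum_component K.isInternal b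
      conv_lhs => rw [ht]
      classical
      refine (Finset.sum_subset (Finset.subset_union_left (s₁ := t) (s₂ := s)) ?_).trans
        (Finset.sum_subset (Finset.subset_union_right (s₁ := t) (s₂ := s)) ?_).symm
      rotate_left
      · intro q _ hq
        exact hs q hq _ (component_mem _ _ _)
      · intro q _ hq
        have h0 := congrArg (component K.isInternal q) ht
        rw [map_sum, Finset.sum_eq_zero] at h0
        · exact h0
        · intro p hp
          exact component_of_ne (m := p) _ (by rintro rfl; exact hq hp) (component_mem _ _ _)
  obtain ⟨M, hM⟩ : ∃ M : ℤ, ∀ q ∈ s, q < M := by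
    obtain ⟨M, hM⟩ := s.exists_le
    exact ⟨M + 1, fun q hq => Int.lt_add_one_iff.2 (hM q hq)⟩
  obtain ⟨m, hm⟩ : ∃ m : ℤ, ∀ q ∈ s, m ≤ q := by
    obtain ⟨M, hM⟩ := (s.image (fun q => -q)).exists_le
    exact ⟨-M, fun q hq => by have := hM (-q) (Finset.mem_image_of_mem _ hq); omega⟩
  -- Induction along that filtration. The component of `w` of lowest degree `q` in the second factor
  -- is a cocycle for `d ⊗ 1`, hence `(d ⊗ 1) v`. Subtracting the full differential of the `q`-th
  -- component of `v` clears degree `q` and otherwise touches only degree `q + 1`.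
  have main : ∀ (n : ℕ) (w : K.carrier ⊗[P.carrier] K.carrier), K.envD c w = 0 →
      K.envRed ε hε w = 0 → (∀ q < M - n, K.envComponent q w = 0) →
      ∃ v, K.envRed ε hε v = 0 ∧ w = K.envD c v := by
    intro n
    induction n with
    | zero =>
      intro w _ _ h
      refine ⟨0, map_zero _, ?_⟩
      rw [map_zero, hsum w]
      exact Finset.sum_eq_zero fun q hq => h q (by simpa using hM q hq)
    | succ n ih =>
      intro w h1 h2 h3
      let q : ℤ := M - (n + 1 : ℕ)
      have hq : K.dZ.rTensor K.carrier (K.envComponent q w) = 0 := by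
        have := K.envComponent_envD c q w
        rwa [h1, map_zero, h3 (q - 1) (by simp only [q]; omega), map_zero, smul_zero, add_zero,
          eq_comm] at this
      obtain ⟨v, hv, hv'⟩ := K.exists_of_dZ_eq_zero hK ε hε hd hex hq
        (K.envRed_envComponent ε hε q h2)
      have hvq := K.envRed_envComponent ε hε q hv
      have hvq' : K.dZ.rTensor K.carrier (K.envComponent q v) = K.envComponent q w := by
        rw [← envComponent_dZ, ← hv', envComponent_envComponent, if_pos rfl]
      obtain ⟨v', hv1, hv2⟩ := ih (w - K.envD c (K.envComponent q v))
        (by rw [map_sub, h1, envD_envD, sub_zero])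
        (by rw [map_sub, h2, K.envRed_envD ε hε hgr hd, hvq, map_zero, smul_zero, sub_zero]) (by
          intro p hp
          rw [map_sub, envComponent_envD, envComponent_envComponent, envComponent_envComponent]
          rw [if_neg (show p - 1 ≠ q by simp only [q]; omega), map_zero, smul_zero, add_zero]
          by_cases hpq : p = q
          · rw [if_pos hpq, hpq, hvq', sub_self]
          · rw [if_neg hpq, map_zero, sub_zero, h3 p (by simp only [q] at hpq; omega)])
      exact ⟨v' + K.envComponent q v, by rw [map_add, hv1, hvq, add_zero],
        by rw [map_add, ← hv2, sub_add_cancel]⟩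
  refine main (M - m).toNat w h1 h2 fun q hq => hs0 q (fun h => ?_) w
  have := hm q h
  have := hM q h
  omega

end EquivariantDGAlgebra

end EqFormality

/-! ### Acyclicity of the kernel of `X → k ⊗_K X ⊗_K B` -/

namespace EqFormality

variable {k : Type u} [Field k] {O : Type u} [CommRing O] [HopfAlgebra k O]
  {P : ParamAlgebra k O}

namespace EquivariantKoszulResolution

variable (K : EquivariantKoszulResolution P)

/-- The map `K ⊗_Z K → B`, `a ⊗ b ↦ aug(a) pi(b)`. -/
noncomputable def envAug : K.carrier ⊗[P.carrier] K.carrier →+ P.B.carrier :=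
  (K.redMap K.pi.toAlgHom K.pi_unit).toAddMonoidHom.comp (K.envRed K.aug K.aug_unit)

theorem envAug_apply (w : K.carrier ⊗[P.carrier] K.carrier) :
    K.envAug w = K.redMap K.pi.toAlgHom K.pi_unit (K.envRed K.aug K.aug_unit w) := rfl

theorem redMap_mkQ (x : K.carrier) :
    K.redMap K.pi.toAlgHom K.pi_unit (K.maxMul.mkQ x) = K.pi.toAlgHom x := rfl

theorem envAug_tmul (a b : K.carrier) : K.envAug (a ⊗ₜ b) = K.aug a • K.pi.toAlgHom b := by
  rw [envAug_apply, EquivariantDGAlgebra.envRed_tmul, map_smul, redMap_mkQ]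

/-- The kernel of `K ⊗_Z K → B` is acyclic. -/
theorem exists_of_envAug_eq_zero (c : ℤˣ) {w : K.carrier ⊗[P.carrier] K.carrier}
    (h1 : K.envD c w = 0) (h2 : K.envAug w = 0) : ∃ v, K.envAug v = 0 ∧ w = K.envD c v := by
  have hgr : ∀ n, n ≠ 0 → ∀ x ∈ K.gr n, K.aug x = 0 := fun n hn x hx => K.aug_gr hn hx
  have hcc : ∀ {M : Type u} [AddCommGroup M] (x : M), (c : ℤ) • (c : ℤ) • x = x := by
    intro M _ x
    rw [smul_smul]
    rcases Int.units_eq_one_or c with rfl | rfl <;> simp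
  have hred : ∀ w, K.envRed K.aug K.aug_unit (K.envD c w) =
      (c : ℤ) • K.redD (K.envRed K.aug K.aug_unit w) :=
    K.envRed_envD K.aug K.aug_unit hgr K.aug_d c
  have h3 : K.redD (K.envRed K.aug K.aug_unit w) = 0 := by
    have := hred w
    rw [h1, map_zero] at this
    rw [← hcc (K.redD _), ← this, smul_zero]
  -- The reduction of `w` is a cocycle which dies in `B`, hence the differential of some `r`.
  -- Subtracting a cocycle `r'` with the same image in `B` gives a primitive `r - r'` which dies in
  -- `B` as well. A lift `1 ⊗ x` of it reduces the claim to elements with zero reduction.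
  obtain ⟨r, hr⟩ := K.pi_quasiIso.1 _ h3 ⟨0, by rw [map_zero]; exact h2⟩
  obtain ⟨r', hr', y, hy⟩ := K.pi_quasiIso.2 (K.redMap K.pi.toAlgHom K.pi_unit r) rfl
  rw [P.B_d, LinearMap.zero_apply, add_zero] at hy
  obtain ⟨x, hx⟩ := K.envRed_surjective K.aug K.aug_unit (r - r')
  have hx' : K.envAug (1 ⊗ₜ x) = 0 := by
    rw [envAug_apply, hx, map_sub, hy, sub_self]
  obtain ⟨v, hv, hv'⟩ := K.exists_of_envD_eq_zero K.finite K.flat K.aug K.aug_unit hgr K.aug_d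
    (fun x => K.exists_of_aug_eq_zero) c (w := w - (c : ℤ) • K.envD c (1 ⊗ₜ x))
    (by rw [map_sub, map_zsmul, h1, EquivariantDGAlgebra.envD_envD, smul_zero, sub_zero])
    (by rw [map_sub, map_zsmul, hred, hcc, hx, map_sub, hr', sub_zero, ← hr, sub_self])
  refine ⟨v + (c : ℤ) • (1 ⊗ₜ x), ?_, ?_⟩
  · rw [map_add, map_zsmul, hx', smul_zero, add_zero, envAug_apply, hv, map_zero]
  · rw [map_add, ← hv', map_zsmul, sub_add_cancel]

end EquivariantKoszulResolution

namespace DGBimodule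

variable {K : EquivariantKoszulResolution P}

/-- Leibniz rule for `a e b` with a cocycle `e`: carrying `d` past `e` costs `(-1)^|e|`. -/
theorem d_orbit {X : DGBimodule K.toEquivariantDGAlgebra} {n : ℤ} {e : X.carrier} (he : e ∈ X.gr n)
    (hd : X.d e = 0) (w : K.carrier ⊗[P.carrier] K.carrier) :
    X.d (X.orbit e w) = X.orbit e (K.envD n.negOnePow w) := by
  induction w with
  | zero => simp
  | add x y hx hy => simp only [map_add, hx, hy]
  | tmul a b =>
    refine gr_induction (p := fun a => X.d (X.orbit e (a ⊗ₜ b)) =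
      X.orbit e (K.envD n.negOnePow (a ⊗ₜ b))) K.isInternal a ?_ (by simp)
      (fun x y hx hy => by simp only [TensorProduct.add_tmul, map_add, hx, hy])
    intro p a ha
    rw [EquivariantDGAlgebra.envD_tmul, map_add, map_zsmul, orbit_tmul, orbit_tmul, orbit_tmul,
      X.d_left _ ha, X.d_right b he, hd, map_zero, zero_add, signMap_of_mem _ ha,
      map_units_zsmul, map_units_zsmul, LinearMap.smul_apply, smul_comm]
    rfl

/-- Modulo `augSub` the element `a e b` depends only on `aug(a) π(b)`, so the orbit map factors
through `envAug`. -/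
theorem orbit_mem_augSub {X : DGBimodule K.toEquivariantDGAlgebra} (e : X.carrier)
    {w : K.carrier ⊗[P.carrier] K.carrier} (hw : K.envAug w = 0) : X.orbit e w ∈ X.augSub := by
  obtain ⟨l, hl⟩ := exists_factor_surjective (f := X.augSub.mkQ ∘ₗ X.right.flip e)
    (p := K.pi.toAlgHom.toLinearMap) K.pi_surjective (fun b hb => by
      rw [LinearMap.comp_apply, Submodule.mkQ_apply, Submodule.Quotient.mk_eq_zero]
      exact right_mem_augSub hb e)
  have key : ∀ w, X.augSub.mkQ (X.orbit e w) = l (K.envAug w) := by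
    intro w
    induction w with
    | zero => simp
    | add x y hx hy => simp only [map_add, hx, hy]
    | tmul a b =>
      rw [orbit_tmul, K.envAug_tmul, map_smul,
        map_left_of_augSub (f := X.augSub.mkQ) (fun x hx => by
          rwa [Submodule.mkQ_apply, Submodule.Quotient.mk_eq_zero])]
      congr 1
      exact (LinearMap.congr_fun hl b).symm
  have := key w
  rwa [hw, map_zero, Submodule.mkQ_apply, Submodule.Quotient.mk_eq_zero] at this

/-- Along a basis of cocycles `augSub` splits into shifted copies of the kernel of `K ⊗_Z K → B`,
which is acyclic by `exists_of_envAug_eq_zero`. -/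
theorem IsFree.augSub_acyclic {X : DGBimodule K.toEquivariantDGAlgebra} (hX : X.IsFree)
    {x : X.carrier} (hx : x ∈ X.augSub) (hd : X.d x = 0) : ∃ w ∈ X.augSub, x = X.d w := by
  classical
  obtain ⟨J, deg, e, he, hde, hbij⟩ := hX
  have hb : IsBasis X deg e := ⟨he, hbij⟩
  obtain ⟨f, rfl⟩ := hbij.2 x
  have hΦ : ∀ f : J →₀ K.carrier ⊗[P.carrier] K.carrier,
      Finsupp.liftAddHom (fun j => X.orbit (e j)) f = ∑ j ∈ f.support, X.orbit (e j) (f j) :=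
    fun f => rfl
  -- The map `ψ` to `B` with `e_j ↦ 1` and `e_i ↦ 0` otherwise kills `augSub` and reads off the
  -- image in `B` of the `j`-th coordinate.
  have h1 : ∀ j, K.envAug (f j) = 0 := by
    intro j
    obtain ⟨one, hone⟩ : ∃ one : K.extBimodule.carrier, one = (1 : P.B.carrier) := ⟨_, rfl⟩
    obtain ⟨ψ, hψ, hψ'⟩ := hb.exists_lift (Y := K.extBimodule) (-deg j)
      (fun i => if i = j then one else 0) (fun i => by
        by_cases h : i = j
        · rw [if_pos h, h, add_neg_cancel, hone]
          exact P.B.one_mem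
        · rw [if_neg h]
          exact zero_mem _)
    have hψ0 : ∀ x ∈ X.augSub, ψ x = 0 := fun x hx => by
      have := homDeg_mem_augSub hψ hx
      rwa [augSub_extBimodule, Submodule.mem_bot] at this
    have key : ∀ f : J →₀ K.carrier ⊗[P.carrier] K.carrier,
        ψ (Finsupp.liftAddHom (fun j => X.orbit (e j)) f) = K.envAug (f j) := by
      intro f
      induction f using Finsupp.induction_linear with
      | zero => rw [map_zero, map_zero, Finsupp.zero_apply, map_zero]; rfl
      | add f g hf hg => rw [map_add, map_add, hf, hg, Finsupp.add_apply, map_add]; rfl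
      | single i w =>
        rw [Finsupp.liftAddHom_apply_single]
        induction w with
        | zero => rw [map_zero, map_zero, Finsupp.single_zero, Finsupp.zero_apply, map_zero]; rfl
        | add x y hx hy =>
          rw [map_add, map_add, hx, hy, Finsupp.single_add, Finsupp.add_apply, map_add]; rfl
        | tmul a b =>
          rw [orbit_tmul, map_left_of_augSub hψ0, hψ.2.2, hψ']
          by_cases h : i = j
          · subst h
            rw [if_pos rfl, Finsupp.single_eq_same, K.envAug_tmul]
            rw [hone]
            exact congrArg (K.aug a • ·) (one_mul (K.pi.toAlgHom b))
          · rw [if_neg h, Finsupp.single_eq_of_ne (Ne.symm h), map_zero, map_zero, smul_zero]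
            rfl
    rw [← key]
    exact hψ0 _ hx
  have h2 : ∀ j, K.envD (deg j).negOnePow (f j) = 0 := by
    intro j
    by_cases hj : j ∈ f.support
    · let g : J →₀ K.carrier ⊗[P.carrier] K.carrier :=
        ∑ j ∈ f.support, Finsupp.single j (K.envD (deg j).negOnePow (f j))
      have h0 : g = 0 := by
        apply hbij.1
        rw [map_zero, map_sum, ← hd, hΦ, map_sum]
        refine Finset.sum_congr rfl fun j _ => ?_
        rw [Finsupp.liftAddHom_apply_single, d_orbit (he j) (hde j)]
      have h3 := DFunLike.congr_fun h0 j
      rw [Finsupp.finsetSum_apply, Finset.sum_eq_single j (fun i _ hi =>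
        Finsupp.single_eq_of_ne (Ne.symm hi)) (fun h => absurd hj h), Finsupp.single_eq_same] at h3
      exact h3
    · rw [Finsupp.notMem_support_iff.1 hj, map_zero]
  choose v hv hv' using fun j => K.exists_of_envAug_eq_zero (deg j).negOnePow (h2 j) (h1 j)
  refine ⟨∑ j ∈ f.support, X.orbit (e j) (v j),
    sum_mem fun j _ => orbit_mem_augSub _ (hv j), ?_⟩
  rw [map_sum, hΦ]
  refine Finset.sum_congr rfl fun j _ => ?_
  rw [d_orbit (he j) (hde j), ← hv']

theorem IsSummandOfFree.augSub_acyclic {X : DGBimodule K.toEquivariantDGAlgebra}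
    (hX : X.IsSummandOfFree) {x : X.carrier} (hx : x ∈ X.augSub) (hd : X.d x = 0) :
    ∃ w ∈ X.augSub, x = X.d w := by
  obtain ⟨Y, i, r, hY, hri⟩ := hX
  obtain ⟨w, hw, hw'⟩ := hY.augSub_acyclic (i.mem_augSub hx) (by rw [← i.map_d, hd, map_zero])
  exact ⟨r.toLinearMap w, r.mem_augSub hw, by rw [← r.map_d, ← hw', hri]⟩

/-- The kernel of `X → k ⊗_K X ⊗_K B` is acyclic for semi-projective `X`. -/
theorem IsSemiprojective.augSub_acyclic {X : DGBimodule K.toEquivariantDGAlgebra}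
    (hX : X.IsSemiprojective) {x : X.carrier} (hx : x ∈ X.augSub) (hd : X.d x = 0) :
    ∃ w ∈ X.augSub, x = X.d w := by
  obtain ⟨F, ι, u, Q, p, hinj, huinj, hu, hex, ⟨Q0, p0, hQ0, hp0⟩, hQ, hp, hpu⟩ :=
    hX.exists_filtration
  have hF : ∀ i, ∀ x ∈ (F i).augSub, (F i).d x = 0 → ∃ w ∈ (F i).augSub, x = (F i).d w := by
    intro i
    induction i with
    | zero =>
      intro x hx hd
      obtain ⟨s, hs, hs'⟩ := hQ0.exists_section p0 hp0.2
      obtain ⟨w, hw, hw'⟩ := hQ0.augSub_acyclic (p0.mem_augSub hx)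
        (by rw [← p0.map_d, hd, map_zero])
      exact ⟨s w, homDeg_mem_augSub hs hw, hp0.1 (by rw [p0.map_d, hs', hw'])⟩
    | succ i ih =>
      intro x hx hd
      obtain ⟨r, hr, hr'⟩ := (hQ i).exists_retraction (u i) (huinj i) (p i) (hp i) (hpu i)
      obtain ⟨s, hs, hs'⟩ := (hQ i).exists_section (p i) (hp i)
      obtain ⟨w, hw, hw'⟩ := (hQ i).augSub_acyclic ((p i).mem_augSub hx)
        (by rw [← (p i).map_d, hd, map_zero])
      have h1 : x - (F (i + 1)).d (s w) ∈ (F (i + 1)).augSub :=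
        sub_mem hx (d_mem_augSub (homDeg_mem_augSub hs hw))
      obtain ⟨y, hy⟩ := (hpu i (x - (F (i + 1)).d (s w))).1 (by
        rw [map_sub, (p i).map_d, hs', hw', sub_self])
      -- An element of `F i` lying in `augSub` of `F (i + 1)` must be shown to lie in the smaller
      -- `augSub`. The retraction does this, since homogeneous bimodule maps preserve `augSub`.
      have hyS : y ∈ (F i).augSub := by
        rw [← hr' y, hy]
        exact homDeg_mem_augSub hr h1
      obtain ⟨z, hz, hz'⟩ := ih y hyS (huinj i (by
        rw [(u i).map_d, hy, map_sub, hd, (F (i + 1)).d_d, sub_zero, map_zero]))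
      refine ⟨s w + (u i).toLinearMap z, add_mem (homDeg_mem_augSub hs hw) ((u i).mem_augSub hz),
        ?_⟩
      rw [map_add, ← (u i).map_d, ← hz', hy]
      abel
  have hmono : Monotone fun i => ((F i).augSub).map (ι i).toLinearMap := by
    refine monotone_nat_of_le_succ fun i => ?_
    rintro _ ⟨y, hy, rfl⟩
    exact ⟨(u i).toLinearMap y, (u i).mem_augSub hy, LinearMap.congr_fun (hu i) y⟩
  have hS : X.augSub ≤ ⨆ i, ((F i).augSub).map (ι i).toLinearMap := by
    refine Submodule.span_le.2 ?_
    rintro _ (⟨a, m, rfl⟩ | ⟨b, m, hb, rfl⟩)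
    · obtain ⟨i, m, rfl⟩ := hex m
      exact Submodule.mem_iSup_of_mem i ⟨_, left_sub_mem_augSub a m, by
        rw [map_sub, map_smul, (ι i).map_left]⟩
    · obtain ⟨i, m, rfl⟩ := hex m
      exact Submodule.mem_iSup_of_mem i ⟨_, right_mem_augSub hb m, (ι i).map_right b m⟩
  obtain ⟨i, y, hy, rfl⟩ := (Submodule.mem_iSup_of_directed _ hmono.directed_le).1 (hS hx)
  obtain ⟨w, hw, hw'⟩ := hF i y hy (hinj i (by rw [(ι i).map_d, hd, map_zero]))
  exact ⟨(ι i).toLinearMap w, (ι i).mem_augSub hw, by rw [← (ι i).map_d, ← hw']⟩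

end DGBimodule

end EqFormality

/-! ### The Koszul complex as a dg bimodule, and its truncations -/

namespace EqFormality

variable {k : Type u} [Field k]

theorem isInternal_comap {M : Type*} [AddCommGroup M] [Module k M] {gr : ℤ → Submodule k M}
    (h : DirectSum.IsInternal gr) (S : Submodule k M)
    (hS : ∀ n, ∀ x ∈ S, component h n x ∈ S) :
    DirectSum.IsInternal (fun n => (gr n).comap S.subtype) := by
  refine isInternal_of_separating (fun n => component h n ∘ₗ S.subtype) ?_ ?_ ?_
  · intro n x hx h0
    exact Subtype.ext ((component_of_mem h hx).symm.trans h0)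
  · intro m n hmn x hx
    exact component_of_ne h hmn hx
  · rw [eq_top_iff]
    rintro x -
    obtain ⟨s, hs⟩ := exists_sum_component h (x : M)
    have : x = ∑ n ∈ s, ⟨component h n x, hS n x x.2⟩ := Subtype.ext (hs.trans (by
      rw [AddSubmonoidClass.coe_finsetSum]))
    rw [this]
    exact sum_mem fun n _ => Submodule.mem_iSup_of_mem n (component_mem h n (x : M))

/-- The linear maps `M → N` of degree `n`. -/
def linHomGr {M N : Type*} [AddCommGroup M] [Module k M] [AddCommGroup N] [Module k N]
    (grM : ℤ → Submodule k M) (grN : ℤ → Submodule k N) (n : ℤ) : Submodule k (M →ₗ[k] N) where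
  carrier := {f | ∀ q, ∀ m ∈ grM q, f m ∈ grN (q + n)}
  add_mem' hf hg _ _ hm := add_mem (hf _ _ hm) (hg _ _ hm)
  zero_mem' _ _ _ := zero_mem _
  smul_mem' c _ hf _ _ hm := Submodule.smul_mem _ c (hf _ _ hm)

/-- Since `M` is finite-dimensional, a linear map is a finite sum of homogeneous ones: one for each
vector of a homogeneous basis and each component of its image. -/
theorem linHomGr_isInternal {M N : Type*} [AddCommGroup M] [Module k M] [AddCommGroup N]
    [Module k N] [Module.Finite k M] {grM : ℤ → Submodule k M} {grN : ℤ → Submodule k N}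
    (hM : DirectSum.IsInternal grM) (hN : DirectSum.IsInternal grN) :
    DirectSum.IsInternal (linHomGr grM grN) := by
  let p : ∀ n : ℤ, (M →ₗ[k] N) →ₗ[k] (∀ q : ℤ, grM q → N) := fun n =>
    { toFun := fun f q m => component hN (q + n) (f m)
      map_add' := by intro f g; ext q m; simp
      map_smul' := by intro c f; ext q m; simp }
  refine isInternal_of_separating p ?_ ?_ ?_
  · intro n f hf h
    refine linearMap_ext_gr hM fun q m hm => ?_
    exact (component_of_mem hN (hf q m hm)).symm.trans (congrFun (congrFun h q) ⟨m, hm⟩)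
  · intro m n hmn f hf
    ext q x
    exact component_of_ne hN (by omega) (hf q x x.2)
  · rw [eq_top_iff]
    rintro f -
    obtain ⟨r, deg, b, hb, hb'⟩ := exists_homogeneous_basis hM
    have hf : f = ∑ s, (b.coord s).smulRight (f (b s)) := by
      ext m
      conv_lhs => rw [← b.sum_repr m, map_sum]
      simp only [LinearMap.sum_apply, LinearMap.smulRight_apply, map_smul]
      rfl
    rw [hf]
    refine sum_mem fun s _ => ?_
    obtain ⟨t, ht⟩ := exists_sum_component hN (f (b s))
    have : (b.coord s).smulRight (f (b s)) =
        ∑ q ∈ t, (b.coord s).smulRight (component hN q (f (b s))) := by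
      ext m
      conv_lhs => rw [ht]
      simp [Finset.smul_sum]
    rw [this]
    refine sum_mem fun q _ => Submodule.mem_iSup_of_mem (q - deg s) fun l m hm => ?_
    rw [LinearMap.smulRight_apply]
    by_cases hl : l = deg s
    · subst hl
      rw [add_sub_cancel]
      exact Submodule.smul_mem _ _ (component_mem _ _ _)
    · rw [hb' s l hl m hm, zero_smul]
      exact zero_mem _

variable {O : Type u} [CommRing O] [HopfAlgebra k O] {P : ParamAlgebra k O}

namespace DGBimodule

/-- A graded subspace which is stable under the differential and both actions, as a bimodule. -/
def sub {K : EquivariantDGAlgebra P} (X : DGBimodule K) (S : Submodule k X.carrier)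
    (hS : ∀ n, ∀ x ∈ S, component X.isInternal n x ∈ S) (hd : ∀ x ∈ S, X.d x ∈ S)
    (hl : ∀ a, ∀ x ∈ S, X.left a x ∈ S) (hr : ∀ b, ∀ x ∈ S, X.right b x ∈ S) : DGBimodule K where
  carrier := S
  gr n := (X.gr n).comap S.subtype
  isInternal := isInternal_comap X.isInternal S hS
  d := X.d.restrict hd
  d_mem hx := X.d_mem hx
  d_d x := Subtype.ext (X.d_d x)
  left := LinearMap.mk₂ k (fun a x => ⟨X.left a x, hl a x x.2⟩)
    (fun a b x => Subtype.ext (by simp)) (fun c a x => Subtype.ext (by simp))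
    (fun a x y => Subtype.ext (by simp)) (fun c a x => Subtype.ext (by simp))
  left_one m := Subtype.ext (X.left_one m)
  left_mul a b m := Subtype.ext (X.left_mul a b m)
  right := LinearMap.mk₂ k (fun b x => ⟨X.right b x, hr b x x.2⟩)
    (fun a b x => Subtype.ext (by simp)) (fun c a x => Subtype.ext (by simp))
    (fun a x y => Subtype.ext (by simp)) (fun c a x => Subtype.ext (by simp))
  right_one m := Subtype.ext (X.right_one m)
  right_mul a b m := Subtype.ext (X.right_mul a b m)
  left_right a b m := Subtype.ext (X.left_right a b m)
  central z m := Subtype.ext (X.central z m)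
  left_mem ha hm := X.left_mem ha hm
  right_mem hb hm := X.right_mem hb hm
  d_left m ha := Subtype.ext (by
    refine (X.d_left (m : X.carrier) ha).trans ?_
    rw [Units.smul_def, Units.smul_def]
    rfl)
  d_right b hm := Subtype.ext (by
    refine (X.d_right b hm).trans ?_
    rw [Units.smul_def, Units.smul_def]
    rfl)

end DGBimodule

namespace ParamAlgebra

theorem B_eq_zero_of_pos {n : ℤ} (hn : 0 < n) {b : P.B.carrier} (hb : b ∈ P.B.gr n) : b = 0 := by
  refine genGr_induction (p := fun b : P.B.carrier => b = 0) hb ?_ rfl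
    (fun x y hx hy => by rw [hx, hy, add_zero])
  intro i hi
  omega

end ParamAlgebra

namespace EquivariantKoszulResolution

variable (K : EquivariantKoszulResolution P)

/-- The Koszul complex `Hom(∧V, Sym V^*)`, a resolution of `k` by a dg bimodule over `K`. -/
noncomputable def koszulBimodule : DGBimodule K.toEquivariantDGAlgebra where
  carrier := P.B.carrier →ₗ[k] P.A.carrier
  gr := linHomGr P.B.gr P.A.gr
  isInternal := by
    have := K.finite_B
    exact linHomGr_isInternal P.B.isInternal P.A.isInternal
  d := P.koszulD
  d_mem := by
    intro n Φ hΦ q b hb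
    rw [P.koszulD_apply]
    refine sum_mem fun i _ => ?_
    have h := P.A.gradedMonoid.mul_mem (P.ιA_mem (P.cotBasis.coord i))
      (hΦ _ _ (P.B.gradedMonoid.mul_mem hb (P.ιB_mem (P.cotBasis i))))
    have e : 2 + (q + -1 + n) = q + (n + 1) := by ring
    rw [e] at h
    exact h
  d_d := P.koszulD_koszulD
  left := LinearMap.lsmul k _ ∘ₗ K.aug.toLinearMap
  left_one Φ := by
    change K.aug 1 • Φ = Φ
    rw [map_one, one_smul]
  left_mul a b Φ := by
    change K.aug (a * b) • Φ = K.aug a • K.aug b • Φ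
    rw [map_mul, smul_smul]
  -- `K` multiplies the argument on the left, whereas the Koszul differential multiplies it on the
  -- right; so the two commute without signs.
  right := LinearMap.mk₂ k (fun c Φ => Φ ∘ₗ LinearMap.mulLeft k (K.pi.toAlgHom c))
    (fun a b Φ => by ext; simp [add_mul]) (fun c a Φ => by ext; simp)
    (fun a Φ Ψ => rfl) (fun c a Φ => rfl)
  right_one Φ := by
    ext b
    change Φ (K.pi.toAlgHom 1 * b) = Φ b
    rw [map_one, one_mul]
  right_mul a c Φ := by
    ext b
    change Φ (K.pi.toAlgHom (a * c) * b) = Φ (K.pi.toAlgHom a * (K.pi.toAlgHom c * b))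
    rw [map_mul K.pi.toAlgHom, mul_assoc]
  left_right a b Φ := rfl
  central z Φ := by
    ext b
    change K.aug (K.unit z) • Φ b = Φ (K.pi.toAlgHom (K.unit z) * b)
    rw [K.aug_unit, K.pi_unit, ← Algebra.smul_def, map_smul]
  left_mem := by
    intro p q a Φ ha hΦ
    change K.aug a • Φ ∈ _
    by_cases hp : p = 0
    · subst hp
      rw [zero_add]
      exact Submodule.smul_mem _ _ hΦ
    · rw [K.aug_gr hp ha, zero_smul]
      exact zero_mem _
  right_mem := by
    intro p q c Φ hc hΦ l b hb
    have h := hΦ _ _ (P.B.gradedMonoid.mul_mem (K.pi.map_gr hc) hb)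
    have e : p + l + q = l + (q + p) := by ring
    rw [e] at h
    exact h
  d_left {p a} Φ ha := by
    change P.koszulD (K.aug a • Φ) = K.aug (K.d a) • Φ + p.negOnePow • (K.aug a • P.koszulD Φ)
    rw [K.aug_d, zero_smul, zero_add, map_smul]
    by_cases hp : p = 0
    · subst hp
      rw [Int.negOnePow_zero, one_smul]
    · rw [K.aug_gr hp ha, zero_smul, smul_zero]
  d_right {q Φ} c _ := by
    have h0 : Φ ∘ₗ LinearMap.mulLeft k (K.pi.toAlgHom (K.d c)) = 0 := by
      ext b
      simp [K.pi_d]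
    change P.koszulD (Φ ∘ₗ LinearMap.mulLeft k (K.pi.toAlgHom c)) =
      P.koszulD Φ ∘ₗ LinearMap.mulLeft k (K.pi.toAlgHom c) +
        q.negOnePow • (Φ ∘ₗ LinearMap.mulLeft k (K.pi.toAlgHom (K.d c)))
    rw [h0, smul_zero, add_zero]
    ext b
    rw [P.koszulD_apply, LinearMap.comp_apply, P.koszulD_apply]
    simp only [LinearMap.comp_apply, LinearMap.mulLeft_apply, mul_assoc]

theorem koszulBimodule_d_right (c : K.carrier) (Φ : K.koszulBimodule.carrier) :
    K.koszulBimodule.d (K.koszulBimodule.right c Φ) =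
      K.koszulBimodule.right c (K.koszulBimodule.d Φ) := by
  refine LinearMap.ext fun b => ?_
  refine (P.koszulD_apply _ b).trans (Eq.trans ?_ (P.koszulD_apply Φ (K.pi.toAlgHom c * b)).symm)
  refine Finset.sum_congr rfl fun i _ => ?_
  rw [mul_assoc]
  rfl

/-- The augmentation of `∧V`, as an element of the Koszul complex. -/
noncomputable def pt : K.koszulBimodule.carrier := P.koszulPt

theorem koszulPt_mem : K.pt ∈ K.koszulBimodule.gr 0 := by
  intro q b hb
  rw [pt, P.koszulPt_apply]
  by_cases hq : q = 0
  · subst hq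
    rw [Algebra.algebraMap_eq_smul_one]
    exact Submodule.smul_mem _ _ P.A.one_mem
  · rw [P.augB_gr hq hb, map_zero]
    exact zero_mem _

/-- The truncation of the Koszul complex in degrees `≤ N`. -/
def koszulTrunc (N : ℤ) : Submodule k K.koszulBimodule.carrier where
  -- In the top degree `N` only cocycles are kept, so no cohomology is created there.
  carrier := {Φ | (∀ n, N < n → component K.koszulBimodule.isInternal n Φ = 0) ∧
    K.koszulBimodule.d (component K.koszulBimodule.isInternal N Φ) = 0}
  add_mem' := by
    rintro Φ Ψ ⟨h1, h2⟩ ⟨h1', h2'⟩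
    exact ⟨fun n hn => by rw [map_add, h1 n hn, h1' n hn, add_zero],
      by rw [map_add, map_add, h2, h2', add_zero]⟩
  zero_mem' := ⟨fun n _ => map_zero _, by rw [map_zero, map_zero]⟩
  smul_mem' := by
    rintro c Φ ⟨h1, h2⟩
    exact ⟨fun n hn => by rw [map_smul, h1 n hn, smul_zero],
      by rw [map_smul, map_smul, h2, smul_zero]⟩

theorem koszul_component_d (n : ℤ) (Φ : K.koszulBimodule.carrier) :
    component K.koszulBimodule.isInternal n (K.koszulBimodule.d Φ) =
      K.koszulBimodule.d (component K.koszulBimodule.isInternal (n - 1) Φ) := by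
  have := component_natural K.koszulBimodule.isInternal K.koszulBimodule.isInternal
    (fun _ _ h => K.koszulBimodule.d_mem h) (n - 1) Φ
  rw [sub_add_cancel] at this
  exact this.symm

theorem mem_koszulTrunc_of_mem {N n : ℤ} (hn : n < N) {Φ : K.koszulBimodule.carrier}
    (hΦ : Φ ∈ K.koszulBimodule.gr n) : Φ ∈ K.koszulTrunc N :=
  ⟨fun m hm => component_of_ne _ (by omega) hΦ, by rw [component_of_ne _ (by omega) hΦ, map_zero]⟩

/-- The truncation of the Koszul complex in degrees `≤ N`, as a dg bimodule. -/
noncomputable def truncBimodule (N : ℤ) : DGBimodule K.toEquivariantDGAlgebra :=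
  K.koszulBimodule.sub (K.koszulTrunc N)
    (by
      rintro n Φ ⟨h1, h2⟩
      refine ⟨fun m hm => ?_, ?_⟩
      · by_cases hmn : n = m
        · subst hmn
          rw [h1 n hm, map_zero]
        · exact component_of_ne _ hmn (component_mem _ _ _)
      · by_cases hmn : n = N
        · subst hmn
          rwa [component_of_mem _ (component_mem _ _ _)]
        · rw [component_of_ne _ hmn (component_mem _ _ _), map_zero])
    (by
      rintro Φ ⟨h1, h2⟩
      refine ⟨fun n hn => ?_, ?_⟩
      · rw [koszul_component_d]
        by_cases hnN : n - 1 = N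
        · rw [hnN, h2]
        · rw [h1 _ (by omega), map_zero]
      · rw [koszul_component_d, K.koszulBimodule.d_d])
    (fun a Φ hΦ => Submodule.smul_mem (K.koszulTrunc N) (K.aug a) hΦ)
    (by
      rintro c Φ ⟨h1, h2⟩
      obtain ⟨s, hs⟩ := exists_sum_component K.isInternal c
      rw [hs, map_sum, LinearMap.sum_apply]
      refine sum_mem fun q _ => ?_
      have hc := component_mem K.isInternal q c
      generalize component K.isInternal q c = c' at hc
      -- `B` lives in nonpositive degrees. Elements of positive degree thus act by zero, and the
      -- others do not raise degrees.
      by_cases hq : 0 < q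
      · have h0 : K.koszulBimodule.right c' Φ = 0 := by
          have hpi : K.pi.toAlgHom c' = 0 := P.B_eq_zero_of_pos hq (K.pi.map_gr hc)
          have h : ∀ (Φ : P.B.carrier →ₗ[k] P.A.carrier) b, Φ (K.pi.toAlgHom c' * b) = 0 :=
            fun Φ b => by rw [hpi, zero_mul, map_zero]
          exact LinearMap.ext fun b => h Φ b
        rw [h0]
        exact zero_mem _
      · refine ⟨fun n hn => ?_, ?_⟩
        · rw [DGBimodule.component_right hc, h1 _ (by omega), map_zero]
        · rw [DGBimodule.component_right hc, koszulBimodule_d_right]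
          by_cases hq' : q = 0
          · rw [hq', sub_zero, h2, map_zero]
          · rw [h1 _ (by omega), map_zero, map_zero])

/-- Exactness of the Koszul complex: its cohomology is `k`, spanned by the class of `pt`. -/
theorem isQuasiIso_koszulPt {M : Type u} [AddCommGroup M] [Module k M] {d : M →ₗ[k] M}
    {f : M →ₗ[k] k} (hf : IsQuasiIso d 0 f) : IsQuasiIso d K.koszulBimodule.d
      (f.smulRight K.pt) := by
  constructor
  · rintro x hx ⟨w, hw⟩
    have h0 : f x = 0 := P.eq_zero_of_smul_koszulPt (c := f x) (Θ := w) hw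
    exact hf.1 x hx ⟨0, h0⟩
  · intro Φ hΦ
    obtain ⟨c, Θ, h⟩ := P.exists_of_koszulD_eq_zero (Φ := Φ) hΦ
    obtain ⟨x, hx, w, hw⟩ := hf.2 c rfl
    rw [LinearMap.zero_apply, add_zero] at hw
    refine ⟨x, hx, Θ, ?_⟩
    rw [LinearMap.smulRight_apply, ← hw]
    exact h

theorem right_koszulPt (c : K.carrier) :
    K.koszulBimodule.right c K.pt =
      K.aug c • K.pt := by
  refine LinearMap.ext fun b => ?_
  refine (P.koszulPt_apply (K.pi.toAlgHom c * b)).trans ?_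
  refine Eq.trans ?_ (congrArg (K.aug c • ·) (P.koszulPt_apply b)).symm
  rw [map_mul, map_mul, ← Algebra.smul_def]
  rfl

theorem koszulPt_mem_trunc {N : ℤ} (hN : 0 < N) : K.pt ∈ K.koszulTrunc N :=
  K.mem_koszulTrunc_of_mem hN K.koszulPt_mem

end EquivariantKoszulResolution

namespace DGBimodule

variable {K : EquivariantKoszulResolution P} {X : DGBimodule K.toEquivariantDGAlgebra}

variable (X) in
/-- A morphism of dg bimodules from `X` to `k`. -/
structure Augmentation where
  toLinearMap : X.carrier →ₗ[k] k
  map_gr : ∀ n, n ≠ 0 → ∀ x ∈ X.gr n, toLinearMap x = 0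
  map_d : ∀ x, toLinearMap (X.d x) = 0
  map_left : ∀ a x, toLinearMap (X.left a x) = K.aug a * toLinearMap x
  map_right : ∀ a x, toLinearMap (X.right a x) = K.aug a * toLinearMap x

/-- The morphism `X → Hom(∧V, Sym V^*)` which corresponds to a `k`-valued morphism. -/
noncomputable def Augmentation.toKoszul (f : X.Augmentation) : Hom X K.koszulBimodule where
  toLinearMap := f.toLinearMap.smulRight K.pt
  map_gr := by
    intro n x hx
    rw [LinearMap.smulRight_apply]
    by_cases hn : n = 0
    · subst hn
      exact Submodule.smul_mem _ _ K.koszulPt_mem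
    · rw [f.map_gr n hn x hx, zero_smul]
      exact zero_mem _
  map_d x := by
    rw [LinearMap.smulRight_apply, LinearMap.smulRight_apply, f.map_d, zero_smul, map_smul]
    exact ((congrArg (f.toLinearMap x • ·) P.koszulD_koszulPt).trans (smul_zero _)).symm
  map_left a x := by
    rw [LinearMap.smulRight_apply, LinearMap.smulRight_apply, f.map_left, mul_smul, map_smul,
      smul_comm]
    rfl
  map_right c x := by
    rw [LinearMap.smulRight_apply, LinearMap.smulRight_apply, f.map_right, mul_comm, mul_smul,
      map_smul, K.right_koszulPt]

/-- The corestriction of `toKoszul` to a truncation. -/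
noncomputable def Augmentation.toTrunc (f : X.Augmentation) {N : ℤ} (hN : 0 < N) :
    Hom X (K.truncBimodule N) where
  toLinearMap := f.toKoszul.toLinearMap.codRestrict (K.koszulTrunc N)
    fun _ => Submodule.smul_mem _ _ (K.koszulPt_mem_trunc hN)
  map_gr hx := f.toKoszul.map_gr hx
  map_d x := Subtype.ext (f.toKoszul.map_d x)
  map_left a x := Subtype.ext (f.toKoszul.map_left a x)
  map_right a x := Subtype.ext (f.toKoszul.map_right a x)

/-- Above degree `N` the truncation is zero; in degrees `n ≤ N` a primitive has degree `n - 1 < N`,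
so it lies in the truncation automatically. -/
theorem Augmentation.toTrunc_isQuasiIso (f : X.Augmentation) {N : ℤ} (hN : 0 < N)
    (h : IsQuasiIso X.d 0 f.toLinearMap) :
    IsQuasiIso X.d (K.truncBimodule N).d (f.toTrunc hN).toLinearMap := by
  have hq := K.isQuasiIso_koszulPt h
  refine isQuasiIso_of_homogeneous X.isInternal (K.truncBimodule N).isInternal
    (fun _ _ h => X.d_mem h) (fun _ _ h => (K.truncBimodule N).d_mem h)
    (fun _ _ h => (f.toTrunc hN).map_gr h) ?_ ?_
  · rintro n x hx hdx w - hw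
    exact hq.1 x hdx ⟨w.1, congrArg Subtype.val hw⟩
  · rintro n ⟨y, hy⟩ hyn hdy
    by_cases hn : N < n
    · have h0 : y = 0 := (component_of_mem K.koszulBimodule.isInternal hyn).symm.trans (hy.1 n hn)
      exact ⟨0, map_zero _, 0, Subtype.ext (h0.trans (by rw [map_zero, map_zero, add_zero]; rfl))⟩
    · obtain ⟨x, hx, w, hw⟩ := hq.2 y (congrArg Subtype.val hdy)
      refine ⟨component X.isInternal n x, ?_,
        ⟨component K.koszulBimodule.isInternal (n - 1) w,
          K.mem_koszulTrunc_of_mem (n := n - 1) (by omega) (component_mem _ _ _)⟩,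
        Subtype.ext ?_⟩
      · rw [component_natural X.isInternal X.isInternal (fun _ _ h => X.d_mem h), hx, map_zero]
      · have h1 := congrArg (component K.koszulBimodule.isInternal n) hw
        rw [component_of_mem K.koszulBimodule.isInternal (x := y) hyn, map_add,
          K.koszul_component_d] at h1
        refine h1.trans (congrArg (· + _) ?_)
        exact (component_natural_zero X.isInternal K.koszulBimodule.isInternal
          (fun _ _ h => f.toKoszul.map_gr h) n x).symm

end DGBimodule

namespace EquivariantKoszulResolution

variable (K : EquivariantKoszulResolution P)

theorem aug_isQuasiIso : IsQuasiIso K.d 0 K.aug.toLinearMap := by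
  constructor
  · rintro x hx ⟨w, hw⟩
    exact K.exists_of_aug_eq_zero hx (by simpa using hw)
  · intro y _
    exact ⟨algebraMap k _ y, K.d_algebraMap y, 0, by simp⟩

end EquivariantKoszulResolution

end EqFormality

/-! ### Cochains: maps to the Koszul complex as `A`-valued maps -/

namespace EqFormality

variable {k : Type u} [Field k] {O : Type u} [CommRing O] [HopfAlgebra k O] {P : ParamAlgebra k O}
  {K : EquivariantKoszulResolution P}

theorem EquivariantKoszulResolution.exists_section (K : EquivariantKoszulResolution P) :
    ∃ s : P.B.carrier →ₗ[k] K.carrier, ∀ b, K.pi.toAlgHom (s b) = b := by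
  obtain ⟨s, hs⟩ := K.pi.toAlgHom.toLinearMap.exists_rightInverse_of_surjective
    (LinearMap.range_eq_top.2 K.pi_surjective)
  exact ⟨s, fun b => LinearMap.congr_fun hs b⟩

/-- A linear section of `π : K → B`. -/
noncomputable def EquivariantKoszulResolution.piSection (K : EquivariantKoszulResolution P) :
    P.B.carrier →ₗ[k] K.carrier := K.exists_section.choose

theorem EquivariantKoszulResolution.pi_piSection (b : P.B.carrier) :
    K.pi.toAlgHom (K.piSection b) = b := K.exists_section.choose_spec b

namespace DGBimodule

variable (X : DGBimodule K.toEquivariantDGAlgebra)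

/-- The maps `X → A` of degree `n` which vanish on `augSub X`. -/
def cochain (n : ℤ) : Submodule k (X.carrier →ₗ[k] P.A.carrier) where
  carrier := {φ | (∀ q, ∀ m ∈ X.gr q, φ m ∈ P.A.gr (q + n)) ∧ ∀ x ∈ X.augSub, φ x = 0}
  add_mem' hf hg := ⟨fun q m hm => add_mem (hf.1 q m hm) (hg.1 q m hm), fun x hx => by
    rw [LinearMap.add_apply, hf.2 x hx, hg.2 x hx, add_zero]⟩
  zero_mem' := ⟨fun _ _ _ => zero_mem _, fun _ _ => rfl⟩
  smul_mem' c _ hf := ⟨fun q m hm => Submodule.smul_mem _ c (hf.1 q m hm), fun x hx => by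
    rw [LinearMap.smul_apply, hf.2 x hx, smul_zero]⟩

/-- The differential `(Dφ)(m) = ± φ(d m) + ∑ xᵢ φ(m bᵢ)`. -/
noncomputable def cochainD :
    (X.carrier →ₗ[k] P.A.carrier) →ₗ[k] (X.carrier →ₗ[k] P.A.carrier) where
  toFun φ := φ ∘ₗ X.d ∘ₗ signMap X.isInternal +
    -- On cochains every lift along `π` gives the same value, as they vanish on `augSub`. So the
    -- differential does not depend on the section, which is neither graded nor equivariant.
    ∑ i, LinearMap.mulLeft k (P.xA i) ∘ₗ φ ∘ₗ X.right (K.piSection (P.xB i))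
  map_add' φ ψ := by
    ext m
    simp [mul_add, Finset.sum_add_distrib]
    abel
  map_smul' c φ := by
    ext m
    simp [smul_add, Finset.smul_sum]

variable {X}

theorem cochainD_apply (φ : X.carrier →ₗ[k] P.A.carrier) (m : X.carrier) :
    X.cochainD φ m = φ (X.d (signMap X.isInternal m)) +
      ∑ i, P.xA i * φ (X.right (K.piSection (P.xB i)) m) := by
  simp [cochainD]

theorem cochainD_of_mem (φ : X.carrier →ₗ[k] P.A.carrier) {q : ℤ} {m : X.carrier}
    (hm : m ∈ X.gr q) : X.cochainD φ m = q.negOnePow • φ (X.d m) +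
      ∑ i, P.xA i * φ (X.right (K.piSection (P.xB i)) m) := by
  rw [cochainD_apply, signMap_of_mem _ hm, map_units_zsmul, map_units_zsmul]

/-- The cochain `m ↦ Φ(m)(1)` which corresponds to a map `Φ` to the Koszul complex. -/
noncomputable def toCochain : (X.carrier →ₗ[k] K.koszulBimodule.carrier) →ₗ[k]
    (X.carrier →ₗ[k] P.A.carrier) where
  toFun Φ := LinearMap.applyₗ (R := k) (M₂ := P.A.carrier) (1 : P.B.carrier) ∘ₗ Φ
  map_add' _ _ := rfl
  map_smul' _ _ := rfl

theorem augSub_koszulBimodule : K.koszulBimodule.augSub = ⊥ := by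
  refine le_bot_iff.1 (Submodule.span_le.2 ?_)
  rintro _ (⟨a, m, rfl⟩ | ⟨b, m, hb, rfl⟩)
  · exact sub_self (K.aug a • m)
  · have h : ∀ (m : P.B.carrier →ₗ[k] P.A.carrier) b', m (K.pi.toAlgHom b * b') = 0 :=
      fun m b' => by rw [hb, zero_mul, map_zero]
    exact LinearMap.ext (h m)

theorem toCochain_mem {n : ℤ} {Φ : X.carrier →ₗ[k] K.koszulBimodule.carrier}
    (hΦ : Φ ∈ homDeg X K.koszulBimodule n) : toCochain Φ ∈ X.cochain n := by
  refine ⟨fun q m hm => ?_, fun x hx => ?_⟩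
  · have := hΦ.1 q m hm 0 1 P.B.one_mem
    rwa [zero_add] at this
  · have := homDeg_mem_augSub hΦ hx
    rw [augSub_koszulBimodule, Submodule.mem_bot] at this
    exact LinearMap.congr_fun this 1

/-- The map to the Koszul complex which corresponds to a cochain. -/
noncomputable def ofCochain (φ : X.carrier →ₗ[k] P.A.carrier) :
    X.carrier →ₗ[k] K.koszulBimodule.carrier where
  toFun m := φ ∘ₗ X.right.flip m ∘ₗ K.piSection
  map_add' m m' := by
    refine LinearMap.ext fun b => ?_
    change φ (X.right _ (m + m')) = φ (X.right _ m) + φ (X.right _ m')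
    rw [map_add, map_add]
  map_smul' c m := by
    refine LinearMap.ext fun b => ?_
    change φ (X.right _ (c • m)) = c • φ (X.right _ m)
    rw [map_smul, map_smul]

theorem ofCochain_apply {φ : X.carrier →ₗ[k] P.A.carrier} (hφ : ∀ x ∈ X.augSub, φ x = 0)
    (m : X.carrier) (c : K.carrier) :
    (show P.B.carrier →ₗ[k] P.A.carrier from ofCochain φ m) (K.pi.toAlgHom c) =
      φ (X.right c m) :=
  map_right_of_augSub hφ (K.pi_piSection _) m

/-- `Hom(B, A)` is coinduced, so bimodule maps into it correspond to `A`-valued maps which kill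
`augSub`: `m ↦ (b ↦ φ(m b))` is inverse to evaluation at `1`. -/
theorem ofCochain_mem {n : ℤ} {φ : X.carrier →ₗ[k] P.A.carrier} (hφ : φ ∈ X.cochain n) :
    ofCochain φ ∈ homDeg X K.koszulBimodule n := by
  refine ⟨fun q m hm l b hb => ?_, fun p a ha m => ?_, fun c m => ?_⟩
  · obtain ⟨c, hc, rfl⟩ := K.pi_gr_surjective hb
    rw [ofCochain_apply hφ.2]
    have := hφ.1 _ _ (X.right_mem hc hm)
    rwa [add_comm q l, add_assoc] at this
  · refine LinearMap.ext fun b => ?_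
    obtain ⟨c, rfl⟩ := K.pi_surjective b
    refine (ofCochain_apply hφ.2 _ c).trans ?_
    rw [← X.left_right, map_left_of_augSub hφ.2, ← ofCochain_apply hφ.2]
    by_cases hp : p = 0
    · subst hp
      rw [mul_zero, Int.negOnePow_zero, one_smul]
      rfl
    · have h : K.koszulBimodule.left a (ofCochain φ m) = 0 := by
        change K.aug a • ofCochain φ m = 0
        rw [K.aug_gr hp ha, zero_smul]
      rw [h, smul_zero, K.aug_gr hp ha, zero_smul]
      rfl
  · refine LinearMap.ext fun b => ?_
    obtain ⟨c', rfl⟩ := K.pi_surjective b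
    refine (ofCochain_apply hφ.2 _ c').trans ?_
    rw [← X.right_mul, ← ofCochain_apply hφ.2, map_mul]
    rfl

theorem toCochain_ofCochain {φ : X.carrier →ₗ[k] P.A.carrier} (hφ : ∀ x ∈ X.augSub, φ x = 0) :
    toCochain (ofCochain φ) = φ := by
  ext m
  have := ofCochain_apply hφ m 1
  rwa [map_one, X.right_one] at this

theorem toCochain_injective {n : ℤ} {Φ Ψ : X.carrier →ₗ[k] K.koszulBimodule.carrier}
    (hΦ : Φ ∈ homDeg X K.koszulBimodule n) (hΨ : Ψ ∈ homDeg X K.koszulBimodule n)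
    (h : toCochain Φ = toCochain Ψ) : Φ = Ψ := by
  refine LinearMap.ext fun m => LinearMap.ext fun b => ?_
  obtain ⟨c, rfl⟩ := K.pi_surjective b
  have key : ∀ {Φ : X.carrier →ₗ[k] K.koszulBimodule.carrier},
      Φ ∈ homDeg X K.koszulBimodule n → toCochain Φ (X.right c m) =
      (show P.B.carrier →ₗ[k] P.A.carrier from Φ m) (K.pi.toAlgHom c) := by
    intro Φ hΦ
    have h1 := LinearMap.congr_fun (hΦ.2.2 c m) (1 : P.B.carrier)
    refine h1.trans ?_
    change (show P.B.carrier →ₗ[k] P.A.carrier from Φ m) (K.pi.toAlgHom c * 1) = _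
    rw [mul_one]
  exact (key hΦ).symm.trans ((LinearMap.congr_fun h _).trans (key hΨ))

/-- The Koszul differential evaluated at `1` is the sum over `i`. For the other term, `A` is even,
so on elements of degree `q` a nonzero value forces `q + 1 + n` to be even, and then `-(-1)^n =
(-1)^q`. This rids `cochainD` of the degree of the cochain. -/
theorem toCochain_homD {n : ℤ} {Φ : X.carrier →ₗ[k] K.koszulBimodule.carrier}
    (hΦ : Φ ∈ homDeg X K.koszulBimodule n) :
    toCochain (homD X K.koszulBimodule n Φ) = X.cochainD (toCochain Φ) := by
  refine linearMap_ext_gr X.isInternal fun q m hm => ?_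
  rw [cochainD_of_mem _ hm]
  have h1 : toCochain (homD X K.koszulBimodule n Φ) m =
      P.koszulD (Φ m) 1 - n.negOnePow • toCochain Φ (X.d m) := by
    refine (LinearMap.congr_fun (homD_apply n Φ m) (1 : P.B.carrier)).trans ?_
    refine (LinearMap.sub_apply (σ₁₂ := RingHom.id k) _ _ (1 : P.B.carrier)).trans ?_
    refine congrArg (P.koszulD (Φ m) 1 - ·) ?_
    exact map_units_zsmul (LinearMap.applyₗ (R := k) (M₂ := P.A.carrier) (1 : P.B.carrier)) _ _
  have h2 : P.koszulD (Φ m) 1 =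
      ∑ i, P.xA i * toCochain Φ (X.right (K.piSection (P.xB i)) m) := by
    refine (P.koszulD_apply _ _).trans ?_
    refine Finset.sum_congr rfl fun i _ => congrArg (P.xA i * ·) ?_
    refine Eq.trans ?_ (LinearMap.congr_fun (hΦ.2.2 (K.piSection (P.xB i)) m)
      (1 : P.B.carrier)).symm
    change (show P.B.carrier →ₗ[k] P.A.carrier from Φ m) _ =
      (show P.B.carrier →ₗ[k] P.A.carrier from Φ m) (K.pi.toAlgHom _ * 1)
    rw [K.pi_piSection, one_mul, mul_one]
  rw [h1, h2, add_comm, sub_eq_add_neg]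
  congr 1
  have h3 := P.A_negOnePow_smul _ _ ((toCochain_mem hΦ).1 _ _ (X.d_mem hm))
  have h4 : n.negOnePow * (q + 1 + n).negOnePow = -q.negOnePow := by
    rw [Int.negOnePow_add, Int.negOnePow_succ, mul_comm, mul_assoc, Int.units_mul_self, mul_one]
  nth_rw 1 [← h3]
  rw [smul_smul, h4, Units.neg_smul, neg_neg]

theorem cochainD_mem {n : ℤ} {φ : X.carrier →ₗ[k] P.A.carrier} (hφ : φ ∈ X.cochain n) :
    X.cochainD φ ∈ X.cochain (n + 1) := by
  rw [← toCochain_ofCochain hφ.2, ← toCochain_homD (ofCochain_mem hφ)]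
  exact toCochain_mem (homD_mem (ofCochain_mem hφ))

theorem cochainD_cochainD {n : ℤ} {φ : X.carrier →ₗ[k] P.A.carrier} (hφ : φ ∈ X.cochain n) :
    X.cochainD (X.cochainD φ) = 0 := by
  have h := ofCochain_mem hφ
  rw [← toCochain_ofCochain hφ.2, ← toCochain_homD h, ← toCochain_homD (homD_mem h), homD_homD]
  exact map_zero _

variable (X) in
/-- The cochains of degree `n` which vanish in large degrees. -/
def bddCochain (n : ℤ) : Submodule k (X.carrier →ₗ[k] P.A.carrier) where
  carrier := {φ | φ ∈ X.cochain n ∧ ∃ Q : ℤ, ∀ q, Q < q → ∀ m ∈ X.gr q, φ m = 0}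
  add_mem' := by
    rintro φ ψ ⟨h1, Q, hQ⟩ ⟨h1', Q', hQ'⟩
    refine ⟨add_mem h1 h1', max Q Q', fun q hq m hm => ?_⟩
    rw [LinearMap.add_apply, hQ q (by omega) m hm, hQ' q (by omega) m hm, add_zero]
  zero_mem' := ⟨zero_mem _, 0, fun _ _ _ _ => rfl⟩
  smul_mem' := by
    rintro c φ ⟨h1, Q, hQ⟩
    refine ⟨Submodule.smul_mem _ c h1, Q, fun q hq m hm => ?_⟩
    rw [LinearMap.smul_apply, hQ q hq m hm, smul_zero]

/-- The section of `π` need not respect degrees; on cochains it may be replaced by a homogeneous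
lift. -/
theorem mem_gr_of_pi_eq {l : ℤ} {b : P.B.carrier} (hb : b ∈ P.B.gr l)
    {φ : X.carrier →ₗ[k] P.A.carrier} (hφ : ∀ x ∈ X.augSub, φ x = 0) :
    ∃ c ∈ K.gr l, K.pi.toAlgHom c = b ∧ ∀ m, φ (X.right (K.piSection b) m) = φ (X.right c m) := by
  obtain ⟨c, hc, rfl⟩ := K.pi_gr_surjective hb
  exact ⟨c, hc, rfl, fun m => map_right_of_augSub hφ (K.pi_piSection _) m⟩

theorem cochainD_mem_bdd {n : ℤ} {φ : X.carrier →ₗ[k] P.A.carrier} (hφ : φ ∈ X.bddCochain n) :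
    X.cochainD φ ∈ X.bddCochain (n + 1) := by
  obtain ⟨h1, Q, hQ⟩ := hφ
  refine ⟨cochainD_mem h1, Q + 1, fun q hq m hm => ?_⟩
  rw [cochainD_of_mem _ hm, hQ _ (by omega) _ (X.d_mem hm), smul_zero, zero_add]
  refine Finset.sum_eq_zero fun i _ => ?_
  obtain ⟨c, hc, -, h⟩ := mem_gr_of_pi_eq (P.ιB_mem (P.cotBasis i)) h1.2
  rw [ParamAlgebra.xB, h, hQ _ (by omega) _ (X.right_mem hc hm), mul_zero]

/-- An augmentation, as an `A`-valued map. -/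
noncomputable def Augmentation.scalar (f : X.Augmentation) : X.carrier →ₗ[k] P.A.carrier :=
  Algebra.linearMap k P.A.carrier ∘ₗ f.toLinearMap

theorem Augmentation.scalar_apply (f : X.Augmentation) (m : X.carrier) :
    f.scalar m = algebraMap k P.A.carrier (f.toLinearMap m) := rfl

theorem toCochain_toKoszul_comp (f : X.Augmentation) (e : X.carrier →ₗ[k] X.carrier) :
    toCochain (f.toKoszul.toLinearMap ∘ₗ e) = f.scalar ∘ₗ e := by
  refine LinearMap.ext fun m => ?_
  change f.toLinearMap (e m) • P.koszulPt 1 = algebraMap k P.A.carrier (f.toLinearMap (e m))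
  rw [P.koszulPt_apply, map_one, map_one, Algebra.algebraMap_eq_smul_one]

/-- Injectivity of `e ↦ t e` on cohomology, from `homD_injective` for `X → k → Hom(B, A)`. The
cochain `ψ` is not assumed to be bounded, which is essential in `exists_eq_mulLeft_scalar_add_bdd`.
-/
theorem Augmentation.exists_of_scalar_comp_eq (f : X.Augmentation) (hX : X.IsSemiprojective)
    (hq : IsQuasiIso X.d 0 f.toLinearMap) {n : ℤ}
    {e : X.carrier →ₗ[k] X.carrier} (he : e ∈ homDeg X X n) (hd : homD X X n e = 0)
    {ψ : X.carrier →ₗ[k] P.A.carrier} (hψ : ψ ∈ X.cochain (n - 1))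
    (h : f.scalar ∘ₗ e = X.cochainD ψ) :
    ∃ e' ∈ homDeg X X (n - 1), e = homD X X (n - 1) e' := by
  refine hX.homD_injective (g := f.toKoszul) (K.isQuasiIso_koszulPt hq) n he
    (ofCochain_mem hψ) hd (toCochain_injective (n := n) (hom_comp_homDeg he _) ?_ ?_)
  · have := homD_mem (ofCochain_mem hψ)
    rwa [sub_add_cancel] at this
  · rw [toCochain_toKoszul_comp, toCochain_homD (ofCochain_mem hψ), toCochain_ofCochain hψ.2, h]

theorem exists_B_gr_bound (K : EquivariantKoszulResolution P) :
    ∃ r : ℤ, ∀ l < r, ∀ b ∈ P.B.gr l, b = 0 := by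
  have := K.finite_B
  obtain ⟨n, deg, b, -, h⟩ := exists_homogeneous_basis P.B.isInternal
  obtain ⟨r, hr⟩ := (Set.finite_range deg).bddBelow
  refine ⟨r, fun l hl x hx => b.ext_elem fun s => ?_⟩
  have h1 : r ≤ deg s := hr ⟨s, rfl⟩
  rw [map_zero, Finsupp.zero_apply]
  exact h s l (by omega) x hx

/-- The inclusion of the truncation into the Koszul complex. -/
noncomputable def truncIncl (K : EquivariantKoszulResolution P) (N : ℤ) :
    Hom (K.truncBimodule N) K.koszulBimodule where
  toLinearMap := (K.koszulTrunc N).subtype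
  map_gr h := h
  map_d _ := rfl
  map_left _ _ := rfl
  map_right _ _ := rfl

theorem ofCochain_mem_trunc {n : ℤ} {φ : X.carrier →ₗ[k] P.A.carrier} (hφ : φ ∈ X.bddCochain n) :
    ∃ N : ℤ, 0 < N ∧ ∀ m, ofCochain φ m ∈ K.koszulTrunc N := by
  obtain ⟨h1, Q, hQ⟩ := hφ
  obtain ⟨r, hr⟩ := exists_B_gr_bound K
  -- `φ(m b)` can be nonzero only if `q + |b| ≤ Q`, and `|b| ≥ r`, so nonzero values of `ofCochain
  -- φ` have degree at most `Q - r + n`. Going one degree higher avoids the cocycle condition in the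
  -- top degree, and positivity puts the point in the truncation.
  refine ⟨max 1 (Q - r + n + 1), by omega, fun m => ?_⟩
  refine gr_induction (p := fun m => ofCochain φ m ∈ K.koszulTrunc (max 1 (Q - r + n + 1)))
    X.isInternal m ?_ (by rw [map_zero]; exact zero_mem _)
    (fun x y hx hy => by rw [map_add]; exact add_mem hx hy)
  intro q m hm
  by_cases hq : q + n < max 1 (Q - r + n + 1)
  · exact K.mem_koszulTrunc_of_mem hq ((ofCochain_mem h1).1 q m hm)
  · have h0 : ofCochain φ m = 0 := by
      refine linearMap_ext_gr P.B.isInternal fun l b hb => ?_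
      by_cases hl : l < r
      · rw [hr l hl b hb]
        exact (map_zero (show P.B.carrier →ₗ[k] P.A.carrier from ofCochain φ m)).trans
          (map_zero (0 : P.B.carrier →ₗ[k] P.A.carrier)).symm
      · obtain ⟨c, hc, rfl⟩ := K.pi_gr_surjective hb
        exact (ofCochain_apply h1.2 m c).trans (hQ _ (by omega) _ (X.right_mem hc hm))
    rw [h0]
    exact zero_mem _

/-- Surjectivity of `e ↦ t e` on cohomology, within bounded cochains. The map attached to `φ` lands
in a truncation, which receives a quasi-isomorphism from `X`; the homotopy `η` has values in the
same truncation, hence gives a bounded cochain. -/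
theorem Augmentation.exists_eq_scalar_comp_add (f : X.Augmentation) (hX : X.IsSemiprojective)
    (hq : IsQuasiIso X.d 0 f.toLinearMap) {n : ℤ} {φ : X.carrier →ₗ[k] P.A.carrier}
    (hφ : φ ∈ X.bddCochain n) (hd : X.cochainD φ = 0) :
    ∃ e ∈ homDeg X X n, homD X X n e = 0 ∧ ∃ ψ ∈ X.bddCochain (n - 1),
      φ = f.scalar ∘ₗ e + X.cochainD ψ := by
  obtain ⟨N, hN, hN'⟩ := ofCochain_mem_trunc hφ
  have h1 := ofCochain_mem hφ.1
  let Φ : X.carrier →ₗ[k] (K.truncBimodule N).carrier := (ofCochain φ).codRestrict _ hN'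
  have hΦ : Φ ∈ homDeg X (K.truncBimodule N) n :=
    homDeg_of_comp_injective (truncIncl K N) Subtype.val_injective h1
  have hΦd : homD X (K.truncBimodule N) n Φ = 0 := by
    have h2 : homD X K.koszulBimodule n (ofCochain φ) = 0 := by
      refine toCochain_injective (homD_mem h1) (zero_mem _) ?_
      rw [toCochain_homD h1, toCochain_ofCochain hφ.1.2, hd, map_zero]
    have h3 := hom_comp_homD n Φ (truncIncl K N)
    refine LinearMap.ext fun m => Subtype.ext ?_
    exact (LinearMap.congr_fun (h3.trans h2) m)
  obtain ⟨e, he, hed, η, hη, h⟩ := hX.homD_surjective (g := f.toTrunc hN)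
    (f.toTrunc_isQuasiIso hN hq) n hΦ hΦd
  have hη' := hom_comp_homDeg hη (truncIncl K N)
  refine ⟨e, he, hed, toCochain ((truncIncl K N).toLinearMap ∘ₗ η),
    -- `η` has degree `n - 1`, so beyond this bound its values would have degree larger than `N`.
    ⟨toCochain_mem hη', N - n + 1, fun q hq m hm => ?_⟩, ?_⟩
  · have h4 : (truncIncl K N).toLinearMap (η m) = 0 := by
      have h5 : (truncIncl K N).toLinearMap (η m) ∈ K.koszulBimodule.gr (q + (n - 1)) :=
        hη.1 q m hm
      rw [← component_of_mem K.koszulBimodule.isInternal h5]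
      exact (η m).2.1 _ (by omega)
    exact LinearMap.congr_fun h4 (1 : P.B.carrier)
  · rw [← toCochain_homD hη', ← hom_comp_homD, ← toCochain_toKoszul_comp, ← map_add]
    rw [← toCochain_ofCochain hφ.1.2]
    refine congrArg _ ?_
    exact congrArg ((truncIncl K N).toLinearMap ∘ₗ ·) h

end DGBimodule

end EqFormality

/-! ### The cohomology of the complex of cochains -/

namespace EqFormality

theorem exists_comp_eq {k V W U : Type*} [Field k] [AddCommGroup V] [Module k V] [AddCommGroup W]
    [Module k W] [AddCommGroup U] [Module k U] {g : V →ₗ[k] W} {f : V →ₗ[k] U}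
    (h : ∀ x, g x = 0 → f x = 0) : ∃ l : W →ₗ[k] U, l ∘ₗ g = f := by
  obtain ⟨l, hl⟩ := DGBimodule.exists_factor_surjective (f := f) g.surjective_rangeRestrict
    (fun x hx => h x (congrArg Subtype.val hx))
  obtain ⟨l', hl'⟩ := l.exists_extend
  refine ⟨l', ?_⟩
  rw [← hl, ← hl']
  rfl

theorem exists_of_gr {k M N : Type*} [Field k] [AddCommGroup M] [Module k M] [AddCommGroup N]
    [Module k N] {gr : ℤ → Submodule k M} (h : DirectSum.IsInternal gr) (ψ : ℤ → M →ₗ[k] N) :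
    ∃ Ψ : M →ₗ[k] N, ∀ q, ∀ m ∈ gr q, Ψ m = ψ q m := by
  refine ⟨DirectSum.toModule k ℤ N (fun q => ψ q ∘ₗ (gr q).subtype) ∘ₗ
    (decompEquiv h).toLinearMap, fun q m hm => ?_⟩
  rw [LinearMap.comp_apply, LinearEquiv.coe_coe, decompEquiv_of_mem h hm, DirectSum.toModule_lof]
  rfl

variable {k : Type u} [Field k] {O : Type u} [CommRing O] [HopfAlgebra k O] {P : ParamAlgebra k O}
  {K : EquivariantKoszulResolution P}

namespace DGBimodule

variable {X : DGBimodule K.toEquivariantDGAlgebra}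

/-- `A` lives in nonnegative degrees. This starts the induction on degrees in
`exists_reduction_neg`. -/
theorem cochain_eq_zero {n q : ℤ} (h : q < -n) {φ : X.carrier →ₗ[k] P.A.carrier}
    (hφ : φ ∈ X.cochain n) {m : X.carrier} (hm : m ∈ X.gr q) : φ m = 0 :=
  P.A_eq_zero_of_neg (by omega) (hφ.1 q m hm)

/-- The Koszul part of the differential only sees values one degree lower, since the `b_i` have
degree `-1`. In the lowest degree where a cochain lives it is invisible. -/
theorem cochainD_eq_of_mem {n : ℤ} {φ : X.carrier →ₗ[k] P.A.carrier} (hφ : φ ∈ X.cochain n)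
    {q : ℤ} (h : ∀ m ∈ X.gr (q - 1), φ m = 0) {m : X.carrier} (hm : m ∈ X.gr q) :
    X.cochainD φ m = q.negOnePow • φ (X.d m) := by
  rw [cochainD_of_mem _ hm, Finset.sum_eq_zero, add_zero]
  intro i _
  obtain ⟨c, hc, -, hφc⟩ := mem_gr_of_pi_eq (P.ιB_mem (P.cotBasis i)) hφ.2
  rw [ParamAlgebra.xB, hφc, h _ (X.right_mem hc hm), mul_zero]

theorem cochainD_congr {n : ℤ} {φ ψ : X.carrier →ₗ[k] P.A.carrier} (hφ : φ ∈ X.cochain n)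
    (hψ : ψ ∈ X.cochain n) {q : ℤ} (h : ∀ m ∈ X.gr (q + 1), φ m = ψ m)
    (h' : ∀ m ∈ X.gr (q - 1), φ m = ψ m) {m : X.carrier} (hm : m ∈ X.gr q) :
    X.cochainD φ m = X.cochainD ψ m := by
  rw [← sub_eq_zero, ← LinearMap.sub_apply, ← map_sub, cochainD_eq_of_mem (sub_mem hφ hψ) _ hm,
    LinearMap.sub_apply, h _ (X.d_mem hm), sub_self, smul_zero]
  intro m hm
  rw [LinearMap.sub_apply, h' m hm, sub_self]

theorem mulLeft_comp_mem {n p : ℤ} {φ : X.carrier →ₗ[k] P.A.carrier} (hφ : φ ∈ X.cochain n)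
    {a : P.A.carrier} (ha : a ∈ P.A.gr p) : LinearMap.mulLeft k a ∘ₗ φ ∈ X.cochain (n + p) := by
  refine ⟨fun q m hm => ?_, fun x hx => ?_⟩
  · have := P.A.gradedMonoid.mul_mem ha (hφ.1 q m hm)
    have e : p + (q + n) = q + (n + p) := by ring
    rwa [e] at this
  · rw [LinearMap.comp_apply, hφ.2 x hx, map_zero]

theorem cochainD_mulLeft (a : P.A.carrier) (φ : X.carrier →ₗ[k] P.A.carrier) :
    X.cochainD (LinearMap.mulLeft k a ∘ₗ φ) = LinearMap.mulLeft k a ∘ₗ X.cochainD φ := by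
  ext m
  simp only [cochainD_apply, LinearMap.comp_apply, LinearMap.mulLeft_apply, mul_add,
    Finset.mul_sum]
  congr 1
  refine Finset.sum_congr rfl fun i _ => ?_
  rw [← mul_assoc, P.A_mul_comm (P.xA i), mul_assoc]

theorem Augmentation.map_augSub (f : X.Augmentation) {x : X.carrier} (hx : x ∈ X.augSub) :
    f.toLinearMap x = 0 := by
  refine (Submodule.mem_bot k).1 (map_mem_of_mem_augSub (f := f.toLinearMap) ?_ ?_ hx)
  · intro n a _ m
    rw [map_sub, f.map_left, map_smul, smul_eq_mul, sub_self]
    exact zero_mem _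
  · intro n b _ m hb
    rw [f.map_right, K.aug_apply, hb, map_zero, zero_mul]
    exact zero_mem _

theorem Augmentation.scalar_mem (f : X.Augmentation) : f.scalar ∈ X.cochain 0 := by
  refine ⟨fun q m hm => ?_, fun x hx => ?_⟩
  · by_cases hq : q = 0
    · subst hq
      rw [f.scalar_apply, Algebra.algebraMap_eq_smul_one]
      exact Submodule.smul_mem _ _ P.A.one_mem
    · rw [f.scalar_apply, f.map_gr q hq m hm, map_zero]
      exact zero_mem _
  · rw [f.scalar_apply, f.map_augSub hx, map_zero]

theorem Augmentation.cochainD_scalar (f : X.Augmentation) : X.cochainD f.scalar = 0 := by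
  ext m
  rw [cochainD_apply, f.scalar_apply, f.map_d, map_zero, zero_add, LinearMap.zero_apply]
  refine Finset.sum_eq_zero fun i _ => ?_
  rw [f.scalar_apply, f.map_right, K.aug_apply, K.pi_piSection, ParamAlgebra.xB, P.augB_ιB,
    zero_mul, map_zero, mul_zero]

theorem Augmentation.exists_unit {f : X.Augmentation} (hq : IsQuasiIso X.d 0 f.toLinearMap) :
    ∃ v ∈ X.gr 0, X.d v = 0 ∧ f.toLinearMap v = 1 := by
  obtain ⟨v, hv, w, hw⟩ := hq.2 1 rfl
  rw [LinearMap.zero_apply, add_zero] at hw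
  refine ⟨component X.isInternal 0 v, component_mem _ _ _, ?_, ?_⟩
  · rw [component_natural X.isInternal X.isInternal (fun _ _ h => X.d_mem h), hv, map_zero]
  · rw [hw]
    have h : f.toLinearMap ∘ₗ component X.isInternal 0 = f.toLinearMap := by
      refine linearMap_ext_gr X.isInternal fun n x hx => ?_
      by_cases hn : n = 0
      · subst hn
        rw [LinearMap.comp_apply, component_of_mem _ hx]
      · rw [LinearMap.comp_apply, component_of_ne _ hn hx, map_zero, f.map_gr n hn x hx]
    exact LinearMap.congr_fun h v

/-- `m` represents a cocycle of `X / augSub`. As `augSub` is acyclic and `X` has cohomology `k`, `m`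
is the sum of a multiple of `v`, an element of `augSub` and a coboundary, and `φ` kills the
degree-`q` part of each. -/
theorem Augmentation.eq_zero_of_d_mem_augSub {f : X.Augmentation} (hX : X.IsSemiprojective)
    (hq : IsQuasiIso X.d 0 f.toLinearMap) {v : X.carrier} (hv : v ∈ X.gr 0) (hvd : X.d v = 0)
    (hv1 : f.toLinearMap v = 1) {q : ℤ} {W : Type*} [AddCommGroup W] [Module k W]
    {φ : X.carrier →ₗ[k] W} (hS : ∀ x ∈ X.augSub, φ x = 0)
    (hd : ∀ m ∈ X.gr (q - 1), φ (X.d m) = 0) (h0 : q ≠ 0 ∨ φ v = 0) {m : X.carrier}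
    (hm : m ∈ X.gr q) (hdm : X.d m ∈ X.augSub) : φ m = 0 := by
  obtain ⟨w, hw, hmw⟩ := hX.augSub_acyclic hdm (X.d_d m)
  have hfv : f.toLinearMap m • φ v = 0 := by
    rcases h0 with h | h
    · rw [f.map_gr q h m hm, zero_smul]
    · rw [h, smul_zero]
  obtain ⟨u, hu⟩ := hq.1 (m - w - f.toLinearMap m • v)
    (by rw [map_sub, map_sub, hmw, sub_self, map_smul, hvd, smul_zero, sub_zero])
    ⟨0, by rw [map_sub, map_sub, f.map_augSub hw, map_smul, hv1]; simp⟩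
  have h1 := congrArg (component X.isInternal q) hu
  have h2 := component_natural X.isInternal X.isInternal (fun _ _ h => X.d_mem h) (q - 1) u
  rw [sub_add_cancel] at h2
  have h3 : φ (component X.isInternal q (f.toLinearMap m • v)) = 0 := by
    by_cases hq0 : q = 0
    · subst hq0
      rw [component_of_mem _ (Submodule.smul_mem _ _ hv), map_smul, hfv]
    · rw [component_of_ne _ (Ne.symm hq0) (Submodule.smul_mem _ _ hv), map_zero]
  rw [map_sub, map_sub, component_of_mem _ hm, ← h2] at h1
  have h4 := congrArg φ h1
  rwa [hd _ (component_mem _ _ _), map_sub, map_sub, h3, hS _ (component_mem_augSub q hw),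
    sub_zero, sub_zero] at h4

/-- One step of obstruction theory. The lowest part of `φ`, in degree `q`, kills the cocycles of `X
/ augSub`, so it factors as `l ∘ d`; up to sign `l`, placed in degree `q + 1`, is the correction.
The only obstruction is the value at `v` when `q = 0`. -/
theorem Augmentation.exists_reduction {f : X.Augmentation} (hX : X.IsSemiprojective)
    (hq : IsQuasiIso X.d 0 f.toLinearMap) {v : X.carrier} (hv : v ∈ X.gr 0) (hvd : X.d v = 0)
    (hv1 : f.toLinearMap v = 1) {n q : ℤ} {φ : X.carrier →ₗ[k] P.A.carrier}
    (hφ : φ ∈ X.cochain n) (hlow : ∀ p < q, ∀ m ∈ X.gr p, φ m = 0)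
    (hd : ∀ m ∈ X.gr (q - 1), X.cochainD φ m = 0) (h0 : q ≠ 0 ∨ φ v = 0) :
    ∃ χ ∈ X.cochain (n - 1), (∀ p, p ≠ q + 1 → ∀ m ∈ X.gr p, χ m = 0) ∧
      ∀ p < q + 1, ∀ m ∈ X.gr p, (φ - X.cochainD χ) m = 0 := by
  have hd' : ∀ m ∈ X.gr (q - 1), φ (X.d m) = 0 := by
    intro m hm
    have := hd m hm
    rwa [cochainD_eq_of_mem hφ (hlow _ (by omega)) hm, smul_eq_zero_iff_eq] at this
  obtain ⟨l, hl⟩ := exists_comp_eq (g := X.augSub.mkQ ∘ₗ X.d ∘ₗ (X.gr q).subtype)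
    (f := φ ∘ₗ (X.gr q).subtype) (by
      rintro ⟨m, hm⟩ h
      exact eq_zero_of_d_mem_augSub hX hq hv hvd hv1 hφ.2 hd' h0 hm
        ((Submodule.Quotient.mk_eq_zero _).1 h))
  have hl' : ∀ m ∈ X.gr q, l (X.augSub.mkQ (X.d m)) = φ m :=
    fun m hm => LinearMap.congr_fun hl ⟨m, hm⟩
  -- The two projections make `l` homogeneous and confine it to degree `q + 1`; the sign cancels the
  -- one in `cochainD_eq_of_mem`.
  let χ : X.carrier →ₗ[k] P.A.carrier := q.negOnePow • (component P.A.isInternal (q + n) ∘ₗ l ∘ₗ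
    X.augSub.mkQ ∘ₗ component X.isInternal (q + 1))
  have hχ : ∀ m, χ m = q.negOnePow • component P.A.isInternal (q + n)
    (l (X.augSub.mkQ (component X.isInternal (q + 1) m))) := fun _ => rfl
  have hχ0 : ∀ p, p ≠ q + 1 → ∀ m ∈ X.gr p, χ m = 0 := by
    intro p hp m hm
    rw [hχ, component_of_ne _ hp hm, map_zero, map_zero, map_zero, smul_zero]
  have hχm : χ ∈ X.cochain (n - 1) := by
    refine ⟨fun p m hm => ?_, fun x hx => ?_⟩
    · by_cases hp : p = q + 1
      · subst hp
        rw [hχ, Units.smul_def, show q + 1 + (n - 1) = q + n by ring]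
        exact zsmul_mem (component_mem _ _ _) _
      · rw [hχ0 p hp m hm]
        exact zero_mem _
    · have h : X.augSub.mkQ (component X.isInternal (q + 1) x) = 0 :=
        (Submodule.Quotient.mk_eq_zero _).2 (component_mem_augSub _ hx)
      rw [hχ, h, map_zero, map_zero, smul_zero]
  refine ⟨χ, hχm, hχ0, fun p hp m hm => ?_⟩
  rw [LinearMap.sub_apply, cochainD_eq_of_mem hχm (hχ0 _ (by omega)) hm]
  by_cases hpq : p = q
  · subst hpq
    rw [hχ, component_of_mem _ (X.d_mem hm), hl' m hm, component_of_mem _ (hφ.1 p m hm),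
      smul_smul, Int.units_mul_self, one_smul, sub_self]
  · rw [hlow p (by omega) m hm, hχ0 _ (by omega) _ (X.d_mem hm), smul_zero, sub_zero]

/-- In negative degrees there is no obstruction, and finitely many steps lead from `-n` to `0`.
Closedness is assumed in negative degrees only, because `eq_zero_of_mulLeft_scalar` applies this to
a primitive of `a t`, whose differential lives in degree `0`. -/
theorem Augmentation.exists_reduction_neg {f : X.Augmentation} (hX : X.IsSemiprojective)
    (hq : IsQuasiIso X.d 0 f.toLinearMap) {n : ℤ} {φ : X.carrier →ₗ[k] P.A.carrier}
    (hφ : φ ∈ X.cochain n) (hd : ∀ q < 0, ∀ m ∈ X.gr q, X.cochainD φ m = 0) :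
    ∃ ψ ∈ X.cochain (n - 1), ∀ q < 0, ∀ m ∈ X.gr q, (φ - X.cochainD ψ) m = 0 := by
  obtain ⟨v, hv, hvd, hv1⟩ := exists_unit hq
  have key : ∀ j : ℕ, -n + j ≤ 0 → ∃ ψ ∈ X.cochain (n - 1), ∀ q < -n + j, ∀ m ∈ X.gr q,
      (φ - X.cochainD ψ) m = 0 := by
    intro j
    induction j with
    | zero =>
      intro _
      refine ⟨0, zero_mem _, fun q hq m hm => ?_⟩
      rw [map_zero, sub_zero]
      exact cochain_eq_zero (by simpa using hq) hφ hm
    | succ j ih =>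
      intro hj
      push_cast at hj
      obtain ⟨ψ, hψ, h⟩ := ih (by omega)
      have hDψ := cochainD_mem hψ
      rw [sub_add_cancel] at hDψ
      obtain ⟨χ, hχ, -, h'⟩ := exists_reduction hX hq hv hvd hv1 (sub_mem hφ hDψ) h
        (by
          intro m hm
          rw [map_sub, cochainD_cochainD hψ, sub_zero]
          exact hd _ (by omega) m hm) (Or.inl (by omega))
      refine ⟨ψ + χ, add_mem hψ hχ, fun q hq m hm => ?_⟩
      rw [map_add, ← sub_sub]
      exact h' q (by push_cast at hq; omega) m hm
  by_cases hn : 0 ≤ n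
  · obtain ⟨ψ, hψ, h⟩ := key n.toNat (by omega)
    exact ⟨ψ, hψ, fun q hq => h q (by omega)⟩
  · refine ⟨0, zero_mem _, fun q hq m hm => ?_⟩
    rw [map_zero, sub_zero]
    exact cochain_eq_zero (by omega) hφ hm

/-- Injectivity of `a ↦ a t` on cohomology. Once the negative part of `ψ` is removed, its
differential takes the value `± ψ(d v) = 0` at the cocycle `v`, while `a t` takes the value `a`. -/
theorem Augmentation.eq_zero_of_mulLeft_scalar {f : X.Augmentation} (hX : X.IsSemiprojective)
    (hq : IsQuasiIso X.d 0 f.toLinearMap) {n : ℤ} {a : P.A.carrier}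
    {ψ : X.carrier →ₗ[k] P.A.carrier} (hψ : ψ ∈ X.cochain n)
    (h : LinearMap.mulLeft k a ∘ₗ f.scalar = X.cochainD ψ) : a = 0 := by
  obtain ⟨v, hv, hvd, hv1⟩ := exists_unit hq
  obtain ⟨ψ', hψ', h'⟩ := exists_reduction_neg hX hq hψ (by
    intro q hq m hm
    rw [← h, LinearMap.comp_apply, f.scalar_apply, f.map_gr q hq.ne m hm, map_zero, map_zero])
  have hDψ := cochainD_mem hψ'
  rw [sub_add_cancel] at hDψ
  have h1 : X.cochainD (ψ - X.cochainD ψ') v = 0 := by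
    rw [cochainD_eq_of_mem (sub_mem hψ hDψ) (h' _ (by omega)) hv, hvd, map_zero, smul_zero]
  rw [map_sub, cochainD_cochainD hψ', sub_zero, ← h, LinearMap.comp_apply, f.scalar_apply, hv1,
    map_one, LinearMap.mulLeft_apply, mul_one] at h1
  exact h1

/-- The reduction is iterated through the degrees `0, 1, 2, ...`. The correction at stage `j` lives
in the single degree `j + 1`, so the infinite sum makes sense degree by degree, but it need not be
bounded. -/
theorem Augmentation.exists_primitive {f : X.Augmentation} (hX : X.IsSemiprojective)
    (hq : IsQuasiIso X.d 0 f.toLinearMap) {v : X.carrier} (hv : v ∈ X.gr 0) (hvd : X.d v = 0)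
    (hv1 : f.toLinearMap v = 1) {n : ℤ} {φ : X.carrier →ₗ[k] P.A.carrier}
    (hφ : φ ∈ X.cochain n) (hlow : ∀ q < 0, ∀ m ∈ X.gr q, φ m = 0) (hd : X.cochainD φ = 0)
    (h0 : φ v = 0) : ∃ ψ ∈ X.cochain (n - 1), φ = X.cochainD ψ := by
  -- The hypotheses stand behind implications so that `χ` can be chosen as a total function of `j`
  -- and `ψ`. At `j = 0` one needs `ψ = 0`, since the vanishing at `v` is known for `φ` itself.
  have step : ∀ (j : ℕ) (ψ : X.carrier →ₗ[k] P.A.carrier), ∃ χ : X.carrier →ₗ[k] P.A.carrier,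
      ψ ∈ X.cochain (n - 1) → (∀ q < (j : ℤ), ∀ m ∈ X.gr q, (φ - X.cochainD ψ) m = 0) →
      (j = 0 → ψ = 0) → χ ∈ X.cochain (n - 1) ∧
      (∀ p, p ≠ (j : ℤ) + 1 → ∀ m ∈ X.gr p, χ m = 0) ∧
      ∀ q < (j : ℤ) + 1, ∀ m ∈ X.gr q, (φ - X.cochainD (ψ + χ)) m = 0 := by
    intro j ψ
    by_cases hψ : ψ ∈ X.cochain (n - 1) ∧
      (∀ q < (j : ℤ), ∀ m ∈ X.gr q, (φ - X.cochainD ψ) m = 0) ∧ (j = 0 → ψ = 0)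
    · obtain ⟨h1, h2, h3⟩ := hψ
      have hDψ := cochainD_mem h1
      rw [sub_add_cancel] at hDψ
      obtain ⟨χ, hχ, hχ', h'⟩ := exists_reduction hX hq hv hvd hv1 (sub_mem hφ hDψ) h2
        (by
          intro m hm
          rw [map_sub, cochainD_cochainD h1, sub_zero, hd, LinearMap.zero_apply])
        (by
          by_cases hj : j = 0
          · right
            rw [h3 hj, map_zero, sub_zero, h0]
          · left
            exact_mod_cast hj)
      refine ⟨χ, fun _ _ _ => ⟨hχ, hχ', ?_⟩⟩
      rw [map_add, ← sub_sub]
      exact h'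
    · exact ⟨0, fun h1 h2 h3 => (hψ ⟨h1, h2, h3⟩).elim⟩
  choose χ hχ using step
  let ψ : ℕ → X.carrier →ₗ[k] P.A.carrier := fun j => Nat.rec 0 (fun j ψ => ψ + χ j ψ) j
  have hψs : ∀ j, ψ (j + 1) = ψ j + χ j (ψ j) := fun _ => rfl
  have hgood : ∀ j : ℕ, ψ j ∈ X.cochain (n - 1) ∧
      (∀ q < (j : ℤ), ∀ m ∈ X.gr q, (φ - X.cochainD (ψ j)) m = 0) ∧ (j = 0 → ψ j = 0) := by
    intro j
    induction j with
    | zero =>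
      refine ⟨zero_mem _, fun q hq m hm => ?_, fun _ => rfl⟩
      change (φ - X.cochainD 0) m = 0
      rw [map_zero, sub_zero, hlow q hq m hm]
    | succ j ih =>
      obtain ⟨h1, -, h3⟩ := hχ j (ψ j) ih.1 ih.2.1 ih.2.2
      refine ⟨add_mem ih.1 h1, ?_, fun h => (Nat.succ_ne_zero j h).elim⟩
      push_cast
      exact h3
  have hstab : ∀ (q : ℤ) (j : ℕ), q ≤ j → ∀ m ∈ X.gr q, ψ (q.toNat) m = ψ j m := by
    intro q j hqj m hm
    have hj : q.toNat ≤ j := by omega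
    clear hqj
    induction j, hj using Nat.le_induction with
    | base => rfl
    | succ j hj ih =>
      obtain ⟨-, h2, -⟩ := hχ j (ψ j) (hgood j).1 (hgood j).2.1 (hgood j).2.2
      rw [hψs, LinearMap.add_apply, h2 q (by omega) m hm, add_zero, ih]
  -- By `hstab` the partial sums agree in degree `q` from stage `q` on, so the limit is assembled
  -- from them degreewise.
  obtain ⟨Ψ, hΨ⟩ := exists_of_gr X.isInternal (fun q => ψ q.toNat)
  have hΨm : Ψ ∈ X.cochain (n - 1) := by
    refine ⟨fun q m hm => ?_, fun x hx => ?_⟩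
    · rw [hΨ q m hm]
      exact (hgood _).1.1 q m hm
    · obtain ⟨s, hs⟩ := exists_sum_component X.isInternal x
      rw [hs, map_sum]
      refine Finset.sum_eq_zero fun q _ => ?_
      rw [hΨ q _ (component_mem _ _ _)]
      exact (hgood _).1.2 _ (component_mem_augSub q hx)
  refine ⟨Ψ, hΨm, linearMap_ext_gr X.isInternal fun q m hm => ?_⟩
  have h1 := (hgood (q + 1).toNat).2.1 q (by omega) m hm
  rw [LinearMap.sub_apply, sub_eq_zero] at h1
  rw [h1]
  refine (cochainD_congr hΨm (hgood _).1 (fun m hm => ?_) (fun m hm => ?_) hm).symm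
  · rw [hΨ _ m hm]
  · rw [hΨ _ m hm]
    exact hstab _ _ (by omega) m hm

/-- Surjectivity of `a ↦ a t` on cohomology. After the negative part has been cleared, `a` is the
value at `v`; subtracting `a t` removes the only obstruction. -/
theorem Augmentation.exists_eq_mulLeft_scalar_add {f : X.Augmentation} (hX : X.IsSemiprojective)
    (hq : IsQuasiIso X.d 0 f.toLinearMap) {n : ℤ} {φ : X.carrier →ₗ[k] P.A.carrier}
    (hφ : φ ∈ X.cochain n) (hd : X.cochainD φ = 0) :
    ∃ a ∈ P.A.gr n, ∃ ψ ∈ X.cochain (n - 1),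
      φ = LinearMap.mulLeft k a ∘ₗ f.scalar + X.cochainD ψ := by
  obtain ⟨v, hv, hvd, hv1⟩ := exists_unit hq
  obtain ⟨ψ₁, hψ₁, h₁⟩ := exists_reduction_neg hX hq hφ (fun q _ m _ => by rw [hd]; rfl)
  have hDψ := cochainD_mem hψ₁
  rw [sub_add_cancel] at hDψ
  have hφ₁ := sub_mem hφ hDψ
  have ha := hφ₁.1 0 v hv
  rw [zero_add] at ha
  have ht := mulLeft_comp_mem f.scalar_mem ha
  rw [zero_add] at ht
  obtain ⟨ψ₂, hψ₂, h₂⟩ := exists_primitive hX hq hv hvd hv1 (sub_mem hφ₁ ht)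
    (by
      intro q hq m hm
      rw [LinearMap.sub_apply, h₁ q hq m hm, LinearMap.comp_apply, f.scalar_apply,
        f.map_gr q hq.ne m hm, map_zero, map_zero, sub_zero])
    (by
      rw [map_sub, map_sub, hd, cochainD_cochainD hψ₁, cochainD_mulLeft, f.cochainD_scalar,
        LinearMap.comp_zero, sub_zero, sub_zero])
    (by
      rw [LinearMap.sub_apply, LinearMap.comp_apply, f.scalar_apply, hv1, map_one,
        LinearMap.mulLeft_apply, mul_one, sub_self])
  refine ⟨_, ha, ψ₁ + ψ₂, add_mem hψ₁ hψ₂, ?_⟩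
  rw [map_add, ← h₂]
  abel

theorem homDeg_scalar_comp {f : X.Augmentation} {n : ℤ} {e : X.carrier →ₗ[k] X.carrier}
    (he : e ∈ homDeg X X n) : f.scalar ∘ₗ e ∈ X.bddCochain n := by
  refine ⟨?_, -n, fun q hq m hm => ?_⟩
  · rw [← toCochain_toKoszul_comp]
    exact toCochain_mem (hom_comp_homDeg he _)
  · rw [LinearMap.comp_apply, f.scalar_apply, f.map_gr (q + n) (by omega) _ (he.1 q m hm), map_zero]

theorem Augmentation.cochainD_scalar_comp (f : X.Augmentation) {n : ℤ}
    {e : X.carrier →ₗ[k] X.carrier} (he : e ∈ homDeg X X n) :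
    X.cochainD (f.scalar ∘ₗ e) = f.scalar ∘ₗ homD X X n e := by
  rw [← toCochain_toKoszul_comp, ← toCochain_toKoszul_comp, hom_comp_homD,
    toCochain_homD (hom_comp_homDeg he _)]

/-- The bounded version of `exists_eq_mulLeft_scalar_add`. -/
theorem Augmentation.exists_eq_mulLeft_scalar_add_bdd {f : X.Augmentation}
    (hX : X.IsSemiprojective) (hq : IsQuasiIso X.d 0 f.toLinearMap) {n : ℤ}
    {φ : X.carrier →ₗ[k] P.A.carrier} (hφ : φ ∈ X.bddCochain n) (hd : X.cochainD φ = 0) :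
    ∃ a ∈ P.A.gr n, ∃ ψ ∈ X.bddCochain (n - 1),
      φ = LinearMap.mulLeft k a ∘ₗ f.scalar + X.cochainD ψ := by
  obtain ⟨a, ha, ψ, hψ, h⟩ := exists_eq_mulLeft_scalar_add hX hq hφ.1 hd
  have hb : LinearMap.mulLeft k a ∘ₗ f.scalar ∈ X.bddCochain n := by
    have := mulLeft_comp_mem f.scalar_mem ha
    rw [zero_add] at this
    refine ⟨this, 0, fun q hq m hm => ?_⟩
    rw [LinearMap.comp_apply, f.scalar_apply, f.map_gr q hq.ne' m hm, map_zero, map_zero]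
  have hDψ : X.cochainD ψ ∈ X.bddCochain n := by
    have := sub_mem hφ hb
    rwa [h, add_sub_cancel_left] at this
  -- The primitive `ψ` may be unbounded, but `Dψ` is bounded, so `Dψ = t e + Dη` with `η` bounded.
  -- Then `t e = D(ψ - η)`, so `e` is the differential of some `e'` by the injectivity statement,
  -- and `t e' + η` is a bounded primitive of `Dψ`.
  obtain ⟨e, he, hed, η, hη, h'⟩ := f.exists_eq_scalar_comp_add hX hq hDψ (cochainD_cochainD hψ)
  obtain ⟨e', he', h''⟩ := f.exists_of_scalar_comp_eq hX hq he hed (sub_mem hψ hη.1) (by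
    rw [map_sub, h', add_sub_cancel_right])
  refine ⟨a, ha, f.scalar ∘ₗ e' + η, add_mem (homDeg_scalar_comp he') hη, ?_⟩
  rw [h, h', map_add, f.cochainD_scalar_comp he', ← h'']

end DGBimodule

end EqFormality

/-! ### Functionals on `k ⊗_K F ⊗_K B` -/

namespace EqFormality

variable {k : Type u} [Field k] {O : Type u} [CommRing O] [HopfAlgebra k O] {P : ParamAlgebra k O}
  {K : EquivariantKoszulResolution P}

theorem ParamAlgebra.B_eq_algebraMap {b : P.B.carrier} (hb : b ∈ P.B.gr 0) :
    b = algebraMap k P.B.carrier (P.augB b) := by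
  refine genGr_induction (p := fun b : P.B.carrier => b = algebraMap k P.B.carrier (P.augB b))
    hb ?_ (by rw [map_zero, map_zero]) (fun x y hx hy => by rw [map_add, map_add, ← hx, ← hy])
  intro i hi x hx
  obtain rfl : i = 0 := by omega
  have hx' : x ∈ (1 : Submodule k (ExteriorAlgebra k P.Cot)) :=
    (pow_zero (LinearMap.range (ExteriorAlgebra.ι k (M := P.Cot)))).le hx
  obtain ⟨c, rfl⟩ := Submodule.mem_one.1 hx'
  exact congrArg (algebraMap k P.B.carrier) (P.augB.commutes c).symm

/-- The augmentation of `B`, as a functional on the corresponding bimodule. -/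
noncomputable def EquivariantKoszulResolution.augExt (K : EquivariantKoszulResolution P) :
    K.extBimodule.carrier →ₗ[k] k := P.augB.toLinearMap

theorem EquivariantKoszulResolution.augExt_left (K : EquivariantKoszulResolution P) (a : K.carrier)
    (m : K.extBimodule.carrier) :
    K.augExt (K.extBimodule.left a m) = K.aug a * K.augExt m := map_smul P.augB (K.aug a) m

theorem EquivariantKoszulResolution.augExt_right (K : EquivariantKoszulResolution P)
    (a : K.carrier) (m : K.extBimodule.carrier) :
    K.augExt (K.extBimodule.right a m) = K.aug a * K.augExt m :=
  (map_mul P.augB (show P.B.carrier from m) (K.pi.toAlgHom a)).trans (mul_comm _ _)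

namespace DGBimodule

theorem IsSummandOfFree.exists_isBasis {K : EquivariantDGAlgebra P} {X : DGBimodule K}
    (hX : X.IsSummandOfFree) :
    ∃ (Y : DGBimodule K) (i : Hom X Y) (r : Hom Y X) (J : Type u) (deg : J → ℤ)
      (e : J → Y.carrier), IsBasis Y deg e ∧ ∀ x, r.toLinearMap (i.toLinearMap x) = x := by
  obtain ⟨Y, i, r, ⟨J, deg, e, he, -, hbij⟩, hri⟩ := hX
  exact ⟨Y, i, r, J, deg, e, ⟨he, hbij⟩, hri⟩

variable {X : DGBimodule K.toEquivariantDGAlgebra}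

/-- An augmentation of a semi-projective bimodule lifts to a map to `B`. -/
theorem Augmentation.exists_lift (f : X.Augmentation) (hX : X.IsSemiprojective) :
    ∃ τ ∈ homDeg X K.extBimodule 0, K.augExt ∘ₗ τ = f.toLinearMap := by
  -- Compatibility with the differential is not imposed: the lift is only a map of graded bimodules.
  -- On a free bimodule the basis elements are sent to constants.
  obtain ⟨h, hh, h'⟩ := IsSemiprojective.exists_solution (σ := Unit) (N := fun _ => K.extBimodule)
    (n := fun _ => 0) (W := k)
    (fun Y => AddMonoidHom.mk' (fun h => K.augExt ∘ₗ h ())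
      (fun h h' => LinearMap.comp_add _ _ _))
    (fun Y c => (∀ q, q ≠ 0 → ∀ y ∈ Y.gr q, c y = 0) ∧ (∀ a y, c (Y.left a y) = K.aug a * c y) ∧
      ∀ a y, c (Y.right a y) = K.aug a * c y)
    (fun _ _ _ _ => rfl)
    (by
      rintro Y Z u c ⟨h1, h2, h3⟩
      refine ⟨fun q hq y hy => h1 q hq _ (u.map_gr hy), fun a y => ?_, fun a y => ?_⟩
      · rw [LinearMap.comp_apply, u.map_left, h2]
        rfl
      · rw [LinearMap.comp_apply, u.map_right, h3]
        rfl)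
    (by
      rintro Y c h hh ⟨h1, h2, h3⟩
      have hl : ∀ a y, K.augExt (h () (Y.left a y)) = K.aug a * K.augExt (h () y) := by
        intro a y
        refine gr_induction (p := fun a => K.augExt (h () (Y.left a y)) =
          K.aug a * K.augExt (h () y)) K.isInternal a ?_ (by simp)
          (fun a b ha hb => by simp only [map_add, LinearMap.add_apply, ha, hb, add_mul])
        intro p a ha
        rw [(hh ()).2.1 p a ha, zero_mul, Int.negOnePow_zero, one_smul, K.augExt_left]
      have hr : ∀ a y, K.augExt (h () (Y.right a y)) = K.aug a * K.augExt (h () y) := by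
        intro a y
        rw [(hh ()).2.2, K.augExt_right]
      refine ⟨fun q hq y hy => ?_, fun a y => ?_, fun a y => ?_⟩
      · have := (hh ()).1 q y hy
        rw [add_zero] at this
        have := P.augB_gr hq this
        rw [LinearMap.sub_apply, h1 q hq y hy, zero_sub, neg_eq_zero]
        exact this
      · rw [LinearMap.sub_apply, LinearMap.sub_apply, h2, mul_sub]
        exact congrArg _ (hl a y)
      · rw [LinearMap.sub_apply, LinearMap.sub_apply, h3, mul_sub]
        exact congrArg _ (hr a y))
    (by
      rintro Y Z p hp c ⟨h1, h2, h3⟩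
      refine ⟨fun q hq z hz => ?_, fun a z => ?_, fun a z => ?_⟩
      · obtain ⟨y, hy, rfl⟩ := p.exists_mem_gr hp hz
        exact h1 q hq y hy
      · obtain ⟨y, rfl⟩ := hp z
        rw [← p.map_left]
        exact h2 a y
      · obtain ⟨y, rfl⟩ := hp z
        rw [← p.map_right]
        exact h3 a y)
    (by
      rintro Q hQ c ⟨h1, h2, h3⟩
      obtain ⟨Y, i, r, J, deg, e, hb, hri⟩ := hQ.exists_isBasis
      obtain ⟨h, hh, he⟩ := hb.exists_lift (Y := K.extBimodule) 0
        (fun j => algebraMap k P.B.carrier (c (r.toLinearMap (e j)))) (by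
          intro j
          rw [add_zero]
          by_cases hj : deg j = 0
          · rw [hj, Algebra.algebraMap_eq_smul_one]
            exact Submodule.smul_mem _ _ P.B.one_mem
          · rw [h1 _ hj _ (r.map_gr (hb.mem j)), map_zero]
            exact zero_mem _)
      refine ⟨fun _ => h ∘ₗ i.toLinearMap, fun _ => homDeg_comp_hom hh i, ?_⟩
      have key : K.augExt ∘ₗ h = c ∘ₗ r.toLinearMap := by
        ext y
        refine hb.induction (p := fun y => K.augExt (h y) = c (r.toLinearMap y)) y ?_
          (by simp only [map_zero]) (fun x y hx hy => by simp only [map_add, hx, hy])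
        intro j m n a ha b _
        rw [hh.2.1 m a ha, hh.2.2, he, r.map_left, r.map_right, h2, h3, zero_mul,
          Int.negOnePow_zero, one_smul, K.augExt_left]
        exact congrArg (K.aug a * ·) ((K.augExt_right b _).trans
          (congrArg (K.aug b * ·) (P.augB.commutes _)))
      refine LinearMap.ext fun x => ?_
      have := LinearMap.congr_fun key (i.toLinearMap x)
      rw [LinearMap.comp_apply, LinearMap.comp_apply, hri] at this
      exact this)
    hX (c := f.toLinearMap) ⟨f.map_gr, f.map_left, f.map_right⟩
  exact ⟨h (), hh (), h'⟩

variable (X) in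
/-- The sub-bimodule generated by `v` and `augSub X`, for a cocycle `v` of degree `0`. -/
noncomputable def orbitSub (v : X.carrier) : Submodule k X.carrier :=
  X.augSub ⊔ LinearMap.range (X.right.flip v ∘ₗ K.piSection)

theorem right_mem_orbitSub (v : X.carrier) (c : K.carrier) : X.right c v ∈ X.orbitSub v := by
  have h : X.right (c - K.piSection (K.pi.toAlgHom c)) v ∈ X.augSub :=
    right_mem_augSub (by rw [map_sub, K.pi_piSection, sub_self]) v
  rw [map_sub, LinearMap.sub_apply] at h
  have h2 : X.right (K.piSection (K.pi.toAlgHom c)) v ∈ X.orbitSub v :=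
    Submodule.mem_sup_right ⟨K.pi.toAlgHom c, rfl⟩
  have := add_mem (Submodule.mem_sup_left h : _ ∈ X.orbitSub v) h2
  rwa [sub_add_cancel] at this

theorem map_mem_orbitSub {v : X.carrier} (g : X.carrier →ₗ[k] X.carrier)
    (h1 : ∀ x ∈ X.augSub, g x ∈ X.augSub) (h2 : ∀ n, ∀ c ∈ K.gr n, g (X.right c v) ∈ X.orbitSub v)
    {x : X.carrier} (hx : x ∈ X.orbitSub v) : g x ∈ X.orbitSub v := by
  revert hx x
  change X.orbitSub v ≤ (X.orbitSub v).comap g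
  refine sup_le (fun x hx => Submodule.mem_sup_left (h1 x hx)) ?_
  rintro _ ⟨b, rfl⟩
  change g (X.right (K.piSection b) v) ∈ X.orbitSub v
  exact gr_induction (p := fun c => g (X.right c v) ∈ X.orbitSub v) K.isInternal (K.piSection b) h2
    (by rw [map_zero, LinearMap.zero_apply, map_zero]; exact zero_mem _)
    (fun x y hx hy => by
      rw [map_add, LinearMap.add_apply, map_add]
      exact add_mem hx hy)

variable (X) in
/-- `orbitSub X v` as a bimodule. -/
noncomputable def orbitBimodule {v : X.carrier} (hv : v ∈ X.gr 0) (hvd : X.d v = 0) :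
    DGBimodule K.toEquivariantDGAlgebra :=
  X.sub (X.orbitSub v)
    (fun n x hx => map_mem_orbitSub (component X.isInternal n)
      (fun x hx => component_mem_augSub n hx) (by
        intro m c hc
        rw [component_right hc]
        by_cases h : 0 = n - m
        · rw [← h, component_of_mem _ hv]
          exact right_mem_orbitSub v c
        · rw [component_of_ne _ h hv, map_zero]
          exact zero_mem _) hx)
    (fun x hx => map_mem_orbitSub X.d (fun x hx => d_mem_augSub hx) (by
        intro n c _
        rw [X.d_right c hv, hvd, map_zero, zero_add, Int.negOnePow_zero, one_smul]
        exact right_mem_orbitSub v _) hx)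
    (fun a x hx => map_mem_orbitSub (X.left a) (fun x hx => left_mem_augSub_of_mem a hx) (by
        intro n c _
        have h : _ ∈ X.orbitSub v := Submodule.mem_sup_left (left_sub_mem_augSub a (X.right c v))
        have h2 := add_mem h (Submodule.smul_mem _ (K.aug a) (right_mem_orbitSub v c))
        rwa [sub_add_cancel] at h2) hx)
    (fun b x hx => map_mem_orbitSub (X.right b) (fun x hx => right_mem_augSub_of_mem b hx) (by
        intro n c _
        rw [← X.right_mul]
        exact right_mem_orbitSub v _) hx)

variable (X) in
/-- The inclusion of `orbitBimodule`. -/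
noncomputable def orbitIncl {v : X.carrier} (hv : v ∈ X.gr 0) (hvd : X.d v = 0) :
    Hom (X.orbitBimodule hv hvd) X where
  toLinearMap := (X.orbitSub v).subtype
  map_gr h := h
  map_d _ := rfl
  map_left _ _ := rfl
  map_right _ _ := rfl

/-- Functionals which vanish on `augSub` factor through a fixed finite family. -/
theorem Augmentation.exists_eq_sum_comp {f : X.Augmentation} (hX : X.IsSemiprojective)
    {v : X.carrier} (hv : v ∈ X.gr 0) (hvd : X.d v = 0) (hv1 : f.toLinearMap v = 1) :
    ∃ (r : ℕ) (lam : Fin r → X.carrier →ₗ[k] k), (∀ s, ∀ x ∈ X.augSub, lam s x = 0) ∧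
      ∀ (q : ℤ) (ξ : X.carrier →ₗ[k] k), (∀ x ∈ X.augSub, ξ x = 0) →
        (∀ p, p ≠ q → ∀ x ∈ X.gr p, ξ x = 0) →
        ∃ (n : Fin r → ℤ) (h : Fin r → X.carrier →ₗ[k] X.carrier), (∀ s, h s ∈ homDeg X X (n s)) ∧
          (∀ s x, h s x ∈ X.orbitSub v) ∧ ξ = ∑ s, lam s ∘ₗ h s := by
  have := K.finite_B
  obtain ⟨τ, hτ, hτf⟩ := f.exists_lift hX
  obtain ⟨r, deg, β, hβ, hβ'⟩ := exists_homogeneous_basis P.B.isInternal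
  have hτS : ∀ x ∈ X.augSub, τ x = 0 := by
    intro x hx
    have := homDeg_mem_augSub hτ hx
    rwa [augSub_extBimodule, Submodule.mem_bot] at this
  -- `τ v` has degree `0` in `B`, so it is a scalar, and this scalar is `f(v) = 1`.
  have hτv : ∀ c, τ (X.right c v) = K.pi.toAlgHom c := by
    intro c
    rw [hτ.2.2]
    have h0 := hτ.1 0 v hv
    rw [add_zero] at h0
    have h1 : τ v = algebraMap k P.B.carrier (P.augB (τ v)) := P.B_eq_algebraMap h0
    have h2 : P.augB (τ v) = 1 := (LinearMap.congr_fun hτf v).trans hv1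
    rw [h2, map_one] at h1
    exact (congrArg (· * K.pi.toAlgHom c) h1).trans (one_mul _)
  let τ' : X.carrier →ₗ[k] P.B.carrier := τ
  refine ⟨r, fun s => β.coord s ∘ₗ τ', fun s x hx => ?_, fun q ξ hξS hξ => ?_⟩
  · exact (congrArg (β.coord s) (hτS x hx)).trans (map_zero _)
  -- The functionals, the coordinates of `τ`, do not depend on `ξ`. The maps `h s` are sought with
  -- values in the sub-bimodule generated by `v` and `augSub`, where the coaction is finite modulo
  -- `augSub`.
  let N := X.orbitBimodule hv hvd
  let ι : Hom N X := X.orbitIncl hv hvd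
  let lam : Fin r → N.carrier →ₗ[k] k := fun s => β.coord s ∘ₗ τ' ∘ₗ ι.toLinearMap
  have hlamS : ∀ s, ∀ x ∈ N.augSub, lam s x = 0 := fun s x hx =>
    (congrArg (β.coord s) (hτS _ (ι.mem_augSub hx))).trans (map_zero _)
  have hlam : ∀ s p, p ≠ deg s → ∀ x ∈ N.gr p, lam s x = 0 := by
    intro s p hp x hx
    have := hτ.1 p _ (ι.map_gr hx)
    rw [add_zero] at this
    exact hβ' s p hp _ this
  let v' : N.carrier := ⟨v, by simpa [X.right_one] using right_mem_orbitSub v (1 : K.carrier)⟩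
  have hv' : v' ∈ N.gr 0 := hv
  have hlamv : ∀ s c, lam s (N.right c v') = β.coord s (K.pi.toAlgHom c) := fun s c =>
    congrArg (β.coord s) (hτv c)
  obtain ⟨h, hh, h'⟩ := IsSemiprojective.exists_solution (σ := Fin r) (N := fun _ => N)
    (n := fun s => deg s - q) (W := k)
    (fun Y => AddMonoidHom.mk' (fun h => ∑ s, lam s ∘ₗ h s) (fun h h' => by
      rw [← Finset.sum_add_distrib]
      exact Finset.sum_congr rfl fun s _ => LinearMap.comp_add _ _ _))
    (fun Y c => (∀ y ∈ Y.augSub, c y = 0) ∧ ∀ p, p ≠ q → ∀ y ∈ Y.gr p, c y = 0)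
    (by
      intro Y Z u h
      ext y
      simp)
    (by
      rintro Y Z u c ⟨h1, h2⟩
      exact ⟨fun y hy => h1 _ (u.mem_augSub hy), fun p hp y hy => h2 p hp _ (u.map_gr hy)⟩)
    (by
      rintro Y c h hh ⟨h1, h2⟩
      refine ⟨fun y hy => ?_, fun p hp y hy => ?_⟩
      · rw [LinearMap.sub_apply, h1 y hy, zero_sub, neg_eq_zero]
        refine (LinearMap.sum_apply _ _ _).trans (Finset.sum_eq_zero fun s _ => ?_)
        exact hlamS s _ (homDeg_mem_augSub (hh s) hy)
      · rw [LinearMap.sub_apply, h2 p hp y hy, zero_sub, neg_eq_zero]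
        refine (LinearMap.sum_apply _ _ _).trans (Finset.sum_eq_zero fun s _ => ?_)
        exact hlam s _ (by omega) _ ((hh s).1 p y hy))
    (by
      rintro Y Z p hp c ⟨h1, h2⟩
      refine ⟨fun z hz => ?_, fun l hl z hz => ?_⟩
      · refine (Submodule.mem_bot k).1 (map_mem_of_mem_augSub (f := c) ?_ ?_ hz)
        · intro n a _ m
          obtain ⟨y, rfl⟩ := hp m
          rw [← p.map_left, ← map_smul, ← map_sub]
          exact (Submodule.mem_bot k).2 (h1 _ (left_sub_mem_augSub a y))
        · intro n b _ m hb
          obtain ⟨y, rfl⟩ := hp m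
          rw [← p.map_right]
          exact (Submodule.mem_bot k).2 (h1 _ (right_mem_augSub hb y))
      · obtain ⟨y, hy, rfl⟩ := p.exists_mem_gr hp hz
        exact h2 l hl y hy)
    (by
      rintro Q hQ c ⟨h1, h2⟩
      obtain ⟨Y, i, ρ, J, dg, e, hb, hri⟩ := hQ.exists_isBasis
      have hc : ∀ y ∈ Y.augSub, (c ∘ₗ ρ.toLinearMap) y = 0 := fun y hy => h1 _ (ρ.mem_augSub hy)
      have hc' : ∀ p, p ≠ q → ∀ y ∈ Y.gr p, (c ∘ₗ ρ.toLinearMap) y = 0 :=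
        fun p hp y hy => h2 p hp _ (ρ.map_gr hy)
      -- Put `h_s(e_j) = ξ(e_j β_s) v`. At `a e_j b` the sum of the `lam_s h_s` is then `aug(a) ∑
      -- ξ(e_j β_s) β_s^*(π b)`, which is `ξ(a e_j b)` by expanding `π b` in the basis `β`.
      have hex : ∀ s, ∃ h ∈ homDeg Y N (deg s - q), ∀ j,
          h (e j) = c (ρ.toLinearMap (Y.right (K.piSection (β s)) (e j))) • v' := by
        intro s
        refine hb.exists_lift _ _ fun j => ?_
        obtain ⟨b, hbs, hb'⟩ := K.pi_gr_surjective (hβ s)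
        by_cases hj : dg j + deg s = q
        · rw [show dg j + (deg s - q) = 0 by omega]
          exact Submodule.smul_mem _ _ hv'
        · have h3 : c (ρ.toLinearMap (Y.right (K.piSection (β s)) (e j))) = 0 := by
            refine (map_right_of_augSub hc (b' := b) ?_ (e j)).trans
              (hc' _ hj _ (Y.right_mem hbs (hb.mem j)))
            rw [K.pi_piSection, hb']
          rw [h3, zero_smul]
          exact zero_mem _
      choose h hh he using hex
      refine ⟨fun s => h s ∘ₗ i.toLinearMap, fun s => homDeg_comp_hom (hh s) i, ?_⟩
      have key : ∑ s, lam s ∘ₗ h s = c ∘ₗ ρ.toLinearMap := by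
        ext y
        refine hb.induction (p := fun y => (∑ s, lam s ∘ₗ h s) y = (c ∘ₗ ρ.toLinearMap) y) y ?_
          (by simp only [map_zero]) (fun x y hx hy => by simp only [map_add, hx, hy])
        intro j m n a ha b _
        have hpb : K.pi.toAlgHom b =
            K.pi.toAlgHom (∑ s, β.coord s (K.pi.toAlgHom b) • K.piSection (β s)) := by
          rw [map_sum]
          simp only [map_smul, K.pi_piSection]
          exact (β.sum_repr _).symm
        rw [map_left_of_augSub hc, map_right_of_augSub hc hpb, map_sum, LinearMap.sum_apply,
          LinearMap.sum_apply, map_sum, Finset.smul_sum]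
        refine Finset.sum_congr rfl fun s _ => ?_
        rw [LinearMap.comp_apply, (hh s).2.1 m a ha, (hh s).2.2, he, map_units_zsmul,
          map_left_of_augSub (hlamS s), map_smul, map_smul, hlamv]
        have hsign : ((deg s - q) * m).negOnePow • K.aug a = K.aug a := by
          by_cases hm : m = 0
          · rw [hm, mul_zero, Int.negOnePow_zero, one_smul]
          · rw [K.aug_gr hm ha, smul_zero]
        rw [← smul_assoc, hsign, map_smul, LinearMap.smul_apply, map_smul, smul_eq_mul, smul_eq_mul,
          smul_eq_mul, smul_eq_mul, mul_comm (β.coord s _)]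
        rfl
      refine LinearMap.ext fun x => ?_
      have h3 := LinearMap.congr_fun key (i.toLinearMap x)
      rw [LinearMap.comp_apply, hri, LinearMap.sum_apply] at h3
      exact (LinearMap.sum_apply _ _ _).trans h3)
    hX (c := ξ) ⟨hξS, hξ⟩
  refine ⟨_, fun s => ι.toLinearMap ∘ₗ h s, fun s => hom_comp_homDeg (hh s) ι,
    fun s x => (h s x).2, h'.symm⟩

end DGBimodule

end EqFormality

/-! ### Matrix coefficients of comodules -/

namespace EqFormality

section Coefficients

variable {k : Type*} [Field k] {M N W : Type*} [AddCommGroup M] [Module k M] [AddCommGroup N]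
  [Module k N] [AddCommGroup W] [Module k W]

theorem exists_eq_sum_slice (t : M ⊗[k] W) :
    ∃ (n : ℕ) (w : Fin n → W) (φ : Fin n → W →ₗ[k] k), t = ∑ i, slice (φ i) t ⊗ₜ w i := by
  classical
  let b := Module.Basis.ofVectorSpace k W
  have key : ∃ s : Finset _, ∀ s', s ⊆ s' → t = ∑ i ∈ s', slice (b.coord i) t ⊗ₜ b i := by
    induction t with
    | zero => exact ⟨∅, fun s' _ => by simp⟩
    | add x y hx hy =>
      obtain ⟨s, hs⟩ := hx
      obtain ⟨s₁, hs₁⟩ := hy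
      refine ⟨s ∪ s₁, fun s' h => ?_⟩
      simp only [map_add, TensorProduct.add_tmul, Finset.sum_add_distrib]
      rw [← hs s' (Finset.union_subset_left h), ← hs₁ s' (Finset.union_subset_right h)]
    | tmul m w =>
      refine ⟨(b.repr w).support, fun s' h => ?_⟩
      simp only [slice_tmul, TensorProduct.smul_tmul, ← TensorProduct.tmul_sum]
      congr 1
      conv_lhs => rw [← b.linearCombination_repr w]
      exact Finset.sum_subset h fun i _ hi => by
        simp [Finsupp.notMem_support_iff.1 hi]
  obtain ⟨s, hs⟩ := key
  have h := hs s subset_rfl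
  refine ⟨s.card, fun i => b (s.equivFin.symm i), fun i => b.coord (s.equivFin.symm i), ?_⟩
  rw [s.equivFin.symm.sum_comp (fun i => slice (b.coord i) t ⊗ₜ[k] b i)]
  exact h.trans (Finset.sum_coe_sort s (fun i => slice (b.coord i) t ⊗ₜ[k] b i)).symm

/-- One choice of vectors and functionals serves all tensors with coefficients in `C`: a basis of
`C` and extensions of its dual basis. -/
theorem exists_eq_sum_slice_of_fg {C : Submodule k W} (hC : C.FG) :
    ∃ (n : ℕ) (w : Fin n → W) (φ : Fin n → W →ₗ[k] k),
      ∀ y ∈ LinearMap.range (C.subtype.lTensor M), y = ∑ i, slice (φ i) y ⊗ₜ w i := by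
  have := Module.Finite.iff_fg.2 hC
  let b := Module.finBasis k C
  choose φ hφ using fun i => (b.coord i).exists_extend
  refine ⟨_, fun i => (b i : W), φ, ?_⟩
  rintro _ ⟨y, rfl⟩
  induction y with
  | zero => simp
  | add x y hx hy =>
    simp only [map_add, TensorProduct.add_tmul, Finset.sum_add_distrib]
    rw [← hx, ← hy]
  | tmul m c =>
    simp only [LinearMap.lTensor_tmul, slice_tmul, TensorProduct.smul_tmul,
      ← TensorProduct.tmul_sum]
    congr 1
    have h : ∀ i, φ i (C.subtype c) = b.repr c i := fun i => LinearMap.congr_fun (hφ i) c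
    simp only [h]
    conv_lhs => rw [← b.sum_repr c, map_sum]
    rfl

theorem range_lTensor_mono {C D : Submodule k W} (h : C ≤ D) :
    LinearMap.range (C.subtype.lTensor M) ≤ LinearMap.range (D.subtype.lTensor M) := by
  rintro _ ⟨y, rfl⟩
  refine ⟨(Submodule.inclusion h).lTensor M y, ?_⟩
  rw [← LinearMap.lTensor_comp_apply]
  rfl

variable {O : Type*} [CommRing O] [HopfAlgebra k O]

theorem conj_mem_range {ρM : M →ₗ[k] M ⊗[k] O} {ρN : N →ₗ[k] N ⊗[k] O} {f : M →ₗ[k] N}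
    {Y : Submodule k M} {Z : Submodule k N} {x : M}
    (hx : ρM x ∈ LinearMap.range (Y.subtype.rTensor O))
    (hf : ∀ y ∈ Y, ρN (f y) ∈ LinearMap.range (Z.subtype.rTensor O)) :
    conj ρM ρN f x ∈ LinearMap.range (Z.subtype.rTensor O) := by
  rw [conj_eq_extendO]
  obtain ⟨t, ht⟩ := hx
  rw [← ht]
  clear ht
  induction t with
  | zero => rw [map_zero, map_zero, map_zero]; exact zero_mem _
  | add x y hx hy => rw [map_add, map_add, map_add]; exact add_mem hx hy
  | tmul y o =>
    simp only [LinearMap.rTensor_tmul, Submodule.subtype_apply, TensorProduct.map_tmul,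
      extendO_tmul]
    obtain ⟨t, ht⟩ := hf y y.2
    refine ⟨mulR Z (HopfAlgebra.antipode k o) t, ?_⟩
    rw [← ht]
    clear ht
    induction t with
    | zero => simp
    | add x y hx hy => simp only [map_add, hx, hy]
    | tmul z o' => simp

/-- The function `m ↦ ξ(m₀) S(m₁)`. -/
noncomputable def matrixCoeff (ρ : M →ₗ[k] M ⊗[k] O) (ξ : M →ₗ[k] k) : M →ₗ[k] O :=
  (TensorProduct.lid k O).toLinearMap ∘ₗ TensorProduct.map ξ (HopfAlgebra.antipode k) ∘ₗ ρ

theorem matrixCoeff_apply (ρ : M →ₗ[k] M ⊗[k] O) (ξ : M →ₗ[k] k) (m : M) :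
    matrixCoeff ρ ξ m =
      TensorProduct.lid k O (TensorProduct.map ξ (HopfAlgebra.antipode k) (ρ m)) := rfl

theorem matrixCoeff_sum {ι : Type*} (s : Finset ι) (ρ : M →ₗ[k] M ⊗[k] O) (ξ : ι → M →ₗ[k] k)
    (m : M) : matrixCoeff ρ (∑ i ∈ s, ξ i) m = ∑ i ∈ s, matrixCoeff ρ (ξ i) m := by
  simp only [matrixCoeff_apply]
  induction ρ m with
  | zero => simp
  | add x y hx hy => simp only [map_add, hx, hy, Finset.sum_add_distrib]
  | tmul m o => simp [Finset.sum_smul]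

theorem mulR_add (r s : O) (y : M ⊗[k] O) :
    mulR (k := k) M (r + s) y = mulR M r y + mulR M s y := by
  induction y with
  | zero => simp
  | add x y hx hy =>
    rw [map_add, map_add, map_add, hx, hy]
    abel
  | tmul m o => simp [mul_add, TensorProduct.tmul_add]

theorem conj_smulRight (ρM : M →ₗ[k] M ⊗[k] O) (ρN : N →ₗ[k] N ⊗[k] O) (ξ : M →ₗ[k] k) (a : N)
    (m : M) : conj ρM ρN (ξ.smulRight a) m = mulR N (matrixCoeff ρM ξ m) (ρN a) := by
  rw [conj_eq_extendO, matrixCoeff_apply]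
  induction ρM m with
  | zero => simp [mulR]
  | add x y hx hy =>
    simp only [map_add, hx, hy, mulR_add]
  | tmul m o =>
    rw [TensorProduct.map_tmul, TensorProduct.map_tmul, extendO_tmul, TensorProduct.lid_tmul,
      LinearMap.smulRight_apply, map_smul]
    induction ρN a with
    | zero => simp
    | add x y hx hy => simp only [smul_add, map_add, hx, hy]
    | tmul n o' => simp

/-- The rule `x · (λ h) = (x · λ)(x · h)` in coaction form: with `n = h(m_0)`, the factors `S(n_1)
n_2` between the two actions cancel. -/
theorem matrixCoeff_comp {ρ : M →ₗ[k] M ⊗[k] O} (hρ : IsCoaction ρ) (lam : M →ₗ[k] k)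
    (h : M →ₗ[k] M) (m : M) : matrixCoeff ρ (lam ∘ₗ h) m =
      LinearMap.mul' k O ((matrixCoeff ρ lam).rTensor O (conj ρ ρ h m)) := by
  have key : ∀ n, LinearMap.mul' k O ((matrixCoeff ρ lam).rTensor O (ρ n)) =
      algebraMap k O (lam n) := by
    intro n
    have h1 := congrArg (fun y => TensorProduct.lid k O (lam.rTensor O y))
      (coassoc_antipode hρ ((LinearMap.mul k O).comp (HopfAlgebra.antipode k)) (by
        intro o
        rw [← HopfAlgebra.mul_antipode_rTensor_comul_apply]
        induction (Coalgebra.comul (R := k) o) with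
        | zero => simp
        | add x y hx hy => simp only [map_add, hx, hy]
        | tmul m s => simp) n)
    simp only [LinearMap.rTensor_tmul, TensorProduct.lid_tmul] at h1
    rw [Algebra.algebraMap_eq_smul_one, ← h1]
    generalize ρ n = t
    induction t with
    | zero => simp
    | add x y hx hy => simp only [map_add, hx, hy]
    | tmul n s =>
      rw [LinearMap.rTensor_tmul, LinearMap.mul'_apply, matrixCoeff_apply, LinearMap.rTensor_tmul]
      induction ρ n with
      | zero => simp
      | add x y hx hy => simp only [map_add, TensorProduct.add_tmul, add_mul, hx, hy]
      | tmul n s' => simp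
  rw [matrixCoeff_apply, conj_eq_extendO]
  induction ρ m with
  | zero => simp
  | add x y hx hy => simp only [map_add, hx, hy]
  | tmul m o =>
    rw [TensorProduct.map_tmul, TensorProduct.map_tmul, extendO_tmul, TensorProduct.lid_tmul,
      LinearMap.comp_apply, Algebra.smul_def, ← key (h m)]
    generalize ρ (h m) = t
    induction t with
    | zero => simp
    | add x y hx hy => simp only [map_add, add_mul, hx, hy]
    | tmul n s => simp [mul_assoc]

end Coefficients

variable {k : Type u} [Field k] {O : Type u} [CommRing O] [HopfAlgebra k O] {P : ParamAlgebra k O}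
  {K : EquivariantKoszulResolution P}

namespace EquivariantDGBimodule

variable {F : EquivariantDGBimodule K.toEquivariantDGAlgebra}

/-- `aug` and `π` are `G`-linear, so the subspace generated by means of their kernels is a
subrepresentation. -/
theorem coact_mem_augSub {x : F.carrier} (hx : x ∈ F.augSub) :
    F.coact x ∈ LinearMap.range (F.augSub.subtype.rTensor O) := by
  refine DGBimodule.map_mem_of_mem_augSub (f := F.coact) ?_ ?_ hx
  · intro n a _ m
    have h1 : ∀ (t : K.carrier ⊗[k] O) (y : F.carrier ⊗[k] O), act O F.left t y -
        act O (LinearMap.lsmul k F.carrier) (K.aug.toLinearMap.rTensor O t) y ∈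
          LinearMap.range (F.augSub.subtype.rTensor O) := by
      intro t y
      induction t with
      | zero => simp
      | add t t' ht ht' =>
        simp only [map_add, LinearMap.add_apply]
        rw [add_sub_add_comm]
        exact add_mem ht ht'
      | tmul a o =>
        induction y with
        | zero => simp
        | add y y' hy hy' =>
          simp only [map_add]
          rw [add_sub_add_comm]
          exact add_mem hy hy'
        | tmul m o' =>
          rw [LinearMap.rTensor_tmul, act_tmul, act_tmul, ← TensorProduct.sub_tmul]
          exact ⟨⟨_, DGBimodule.left_sub_mem_augSub a m⟩ ⊗ₜ (o * o'), rfl⟩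
    have h2 : ∀ y : F.carrier ⊗[k] O,
        act O (LinearMap.lsmul k F.carrier) (K.aug a ⊗ₜ 1) y = K.aug a • y := by
      intro y
      induction y with
      | zero => simp
      | add y y' hy hy' => simp only [map_add, hy, hy', smul_add]
      | tmul m o => simp [TensorProduct.smul_tmul']
    have h3 := h1 (K.coact a) (F.coact m)
    rw [K.aug_coact, h2] at h3
    rw [map_sub, map_smul, F.coact_left]
    exact h3
  · intro n b _ m hb
    have h1 : K.coact b ∈ LinearMap.range
        ((LinearMap.ker K.pi.toAlgHom.toLinearMap).subtype.rTensor O) := by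
      rw [mem_range_rTensor_iff]
      intro φ
      change K.pi.toAlgHom.toLinearMap (slice φ (K.coact b)) = 0
      rw [← slice_rTensor, ← K.pi.map_coact, hb, map_zero, map_zero]
    obtain ⟨t, ht⟩ := h1
    rw [F.coact_right, ← ht]
    clear ht
    induction t with
    | zero => simp
    | add t t' ht ht' =>
      simp only [map_add, LinearMap.add_apply]
      exact add_mem ht ht'
    | tmul b o =>
      induction F.coact m with
      | zero => simp
      | add y y' hy hy' =>
        rw [map_add]
        exact add_mem hy hy'
      | tmul m o' =>
        rw [LinearMap.rTensor_tmul, act_tmul]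
        exact ⟨⟨_, DGBimodule.right_mem_augSub b.2 m⟩ ⊗ₜ (o * o'), rfl⟩

theorem matrixCoeff_augSub {lam : F.carrier →ₗ[k] k} (hlam : ∀ x ∈ F.augSub, lam x = 0)
    {x : F.carrier} (hx : x ∈ F.augSub) : matrixCoeff F.coact lam x = 0 := by
  obtain ⟨t, ht⟩ := coact_mem_augSub hx
  rw [matrixCoeff_apply, ← ht]
  clear ht
  induction t with
  | zero => simp
  | add x y hx hy => simp only [map_add, hx, hy, add_zero]
  | tmul y o => simp [hlam _ y.2]

/-- A subspace which contains the coefficients of the coaction on `orbitSub`. -/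
theorem exists_coact_orbitSub (K : EquivariantKoszulResolution P)
    (F : EquivariantDGBimodule K.toEquivariantDGAlgebra) (v : F.carrier) :
    ∃ D : Submodule k F.carrier, D.FG ∧ ∀ x ∈ F.orbitSub v,
      F.coact x ∈ LinearMap.range ((F.augSub ⊔ D).subtype.rTensor O) := by
  have := K.finite_B
  let b := Module.finBasis k P.B.carrier
  let y := fun i => F.coact (F.right (K.piSection (b i)) v)
  choose n w φ hφ using fun i => exists_eq_sum_slice (y i)
  refine ⟨⨆ i, Submodule.span k (Set.range fun j => slice (φ i j) (y i)),
    Submodule.fg_iSup _ fun i => Submodule.fg_span (Set.finite_range _), ?_⟩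
  set D := ⨆ i, Submodule.span k (Set.range fun j => slice (φ i j) (y i)) with hD
  suffices h : F.orbitSub v ≤
      Submodule.comap F.coact (LinearMap.range ((F.augSub ⊔ D).subtype.rTensor O)) from
    fun x hx => h hx
  refine sup_le (fun x hx => ?_) ?_
  · obtain ⟨t, ht⟩ := coact_mem_augSub hx
    refine ⟨(Submodule.inclusion le_sup_left).rTensor O t, ?_⟩
    rw [← LinearMap.rTensor_comp_apply]
    exact ht
  · rintro _ ⟨c, rfl⟩
    rw [← b.sum_repr c, map_sum]
    refine sum_mem fun i _ => ?_
    rw [map_smul]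
    refine Submodule.smul_mem _ _ ?_
    change y i ∈ LinearMap.range ((F.augSub ⊔ D).subtype.rTensor O)
    rw [hφ i]
    refine sum_mem fun j _ => ?_
    exact ⟨⟨_, Submodule.mem_sup_right (Submodule.mem_iSup_of_mem i
      (Submodule.subset_span ⟨j, rfl⟩))⟩ ⊗ₜ w i j, rfl⟩

/-- By `matrixCoeff_comp` the coefficients of `lam ∘ h` are sums of products. One factor comes from
the action on `h` and ranges over a finite set by integrability. The other is a coefficient of `lam`
on values in `augSub + D`; it vanishes on `augSub`, and `D` is finite-dimensional. -/
theorem matrixCoeff_comp_fg (hF : F.EndIntegrable) {v : F.carrier} {lam : F.carrier →ₗ[k] k}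
    (hlam : ∀ x ∈ F.augSub, lam x = 0) {n : ℤ} {h : F.carrier →ₗ[k] F.carrier}
    (hh : h ∈ F.endDeg n) (hv : ∀ x, h x ∈ F.orbitSub v) :
    ∃ C : Submodule k O, C.FG ∧ ∀ m, matrixCoeff F.coact (lam ∘ₗ h) m ∈ C := by
  obtain ⟨D, hD, hD'⟩ := exists_coact_orbitSub K F v
  obtain ⟨t, ht⟩ := hF n ⟨h, hh⟩
  obtain ⟨r, w, φ, hφ⟩ := exists_eq_sum_slice t
  refine ⟨D.map (matrixCoeff F.coact lam) * Submodule.span k (Set.range w),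
    (hD.map _).mul (Submodule.fg_span (Set.finite_range _)), fun m => ?_⟩
  have h1 : ∀ m, conj F.coact F.coact h m ∈
      LinearMap.range ((F.augSub ⊔ D).subtype.rTensor O) := fun m =>
    conj_mem_range (Y := ⊤) ((mem_range_rTensor_iff _ _).2 fun _ => trivial)
      (fun y _ => hD' _ (hv y))
  have h2 : ∀ i, slice (φ i) (conj F.coact F.coact h m) = (slice (φ i) t : F.endDeg n).1 m := by
    intro i
    refine (congrArg (slice (φ i)) (ht m)).symm.trans ?_
    generalize t = t
    induction t with
    | zero => simp
    | add x y hx hy => simp only [map_add, LinearMap.add_apply, hx, hy]; rfl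
    | tmul g o => simp
  have h3 : conj F.coact F.coact h m =
      ∑ i, slice (φ i) (conj F.coact F.coact h m) ⊗ₜ w i := by
    have h4 := ht m
    rw [hφ] at h4
    simp only [map_sum, LinearMap.sum_apply, act_tmul, mul_one] at h4
    refine h4.symm.trans (Finset.sum_congr rfl fun i _ => ?_)
    rw [h2]
    rfl
  rw [matrixCoeff_comp F.isCoaction, h3, map_sum, map_sum]
  refine sum_mem fun i _ => ?_
  rw [LinearMap.rTensor_tmul, LinearMap.mul'_apply]
  refine Submodule.mul_mem_mul ?_ (Submodule.subset_span ⟨i, rfl⟩)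
  obtain ⟨x, hx, y, hy, hxy⟩ := Submodule.mem_sup.1 ((mem_range_rTensor_iff _ _).1 (h1 m) (φ i))
  rw [← hxy, map_add, matrixCoeff_augSub hlam hx, zero_add]
  exact ⟨y, hy, rfl⟩

end EquivariantDGBimodule

end EqFormality

/-! ### Invariance of the canonical element, and integrability of bounded cochains -/

namespace EqFormality

variable {k : Type u} [Field k] {O : Type u} [CommRing O] [HopfAlgebra k O] {P : ParamAlgebra k O}
  {K : EquivariantKoszulResolution P}

theorem conj_eq_zero {M N : Type*} [AddCommGroup M] [Module k M] [AddCommGroup N] [Module k N]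
    {ρM : M →ₗ[k] M ⊗[k] O} {ρN : N →ₗ[k] N ⊗[k] O} {f : M →ₗ[k] N} {Y : Submodule k M} {x : M}
    (hx : ρM x ∈ LinearMap.range (Y.subtype.rTensor O)) (hf : ∀ y ∈ Y, f y = 0) :
    conj ρM ρN f x = 0 := by
  rw [conj_eq_extendO]
  obtain ⟨t, ht⟩ := hx
  rw [← ht]
  clear ht
  induction t with
  | zero => simp
  | add x y hx hy => rw [map_add, map_add, map_add, hx, hy, add_zero]
  | tmul y o => simp [hf y y.2]

/-- The canonical element of `V^* ⊗ V` is invariant. -/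
theorem sum_act_dualCoact {V U : Type u} [AddCommGroup V] [Module k V] [Module.Finite k V]
    [AddCommGroup U] [Module k U] {ρ : V →ₗ[k] V ⊗[k] O} (hρ : IsCoaction ρ) {n : ℕ}
    (b : Module.Basis (Fin n) k V) (β : Module.Dual k V →ₗ[k] V →ₗ[k] U) :
    ∑ i, act O β (dualCoact ρ (b.coord i)) (ρ (b i)) = ∑ i, β (b.coord i) (b i) ⊗ₜ[k] (1 : O) := by
  classical
  let c : Matrix (Fin n) (Fin n) O := fun j i =>
    TensorProduct.lid k O ((b.coord j).rTensor O (ρ (b i)))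
  have hc : ∀ i, ρ (b i) = ∑ j, b j ⊗ₜ c j i := by
    intro i
    have : ∀ y : V ⊗[k] O, y = ∑ j, b j ⊗ₜ TensorProduct.lid k O ((b.coord j).rTensor O y) := by
      intro y
      induction y with
      | zero => simp
      | add x y hx hy =>
        simp only [map_add, TensorProduct.tmul_add, Finset.sum_add_distrib]
        rw [← hx, ← hy]
      | tmul v o =>
        simp only [LinearMap.rTensor_tmul, TensorProduct.lid_tmul, ← TensorProduct.smul_tmul,
          ← TensorProduct.sum_tmul]
        congr 1
        exact (b.sum_repr v).symm
    exact this _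
  let e : Matrix (Fin n) (Fin n) O := fun i l => TensorProduct.lid k O
    ((LinearMap.applyₗ (b l)).rTensor O (dualCoact ρ (b.coord i)))
  have he : ∀ i, dualCoact ρ (b.coord i) = ∑ l, b.coord l ⊗ₜ e i l := by
    intro i
    have : ∀ y : Module.Dual k V ⊗[k] O, y = ∑ l, b.coord l ⊗ₜ
        TensorProduct.lid k O ((LinearMap.applyₗ (b l)).rTensor O y) := by
      intro y
      induction y with
      | zero => simp
      | add x y hx hy =>
        simp only [map_add, TensorProduct.tmul_add, Finset.sum_add_distrib]
        rw [← hx, ← hy]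
      | tmul v o =>
        simp only [LinearMap.rTensor_tmul, TensorProduct.lid_tmul, ← TensorProduct.smul_tmul,
          ← TensorProduct.sum_tmul]
        congr 1
        refine b.ext fun j => ?_
        simp
    exact this _
  have h1 : e * c = 1 := by
    ext i j
    have h := homCoact_eval hρ (j := (LinearMap.id : Module.Dual k V →ₗ[k] V →ₗ[k] k))
      Function.injective_id (dual_isIntegrable ρ) (b.coord i) (b j)
    change act O _ (dualCoact ρ (b.coord i)) (ρ (b j)) = _ at h
    rw [he, hc] at h
    have h' := congrArg (TensorProduct.lid k O) h
    simp only [map_sum, LinearMap.sum_apply, act_tmul, LinearMap.id_apply, TensorProduct.lid_tmul,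
      Module.Basis.coord_apply, Module.Basis.repr_self, Finsupp.single_apply, trivialCoact,
        ite_smul, one_smul, zero_smul, Finset.sum_ite_eq, Finset.mem_univ,
      if_true] at h'
    rw [Matrix.mul_apply, h', Matrix.one_apply]
    by_cases hij : i = j
    · rw [if_pos hij.symm, if_pos hij]
      simp
    · rw [if_neg (Ne.symm hij), if_neg hij, map_zero, map_zero]
  -- Invariance of the evaluation pairing says that the two coefficient matrices are inverse on one
  -- side. Over the commutative ring `O` this is two-sided, and the other side is invariance of the
  -- canonical element.
  have h2 : c * e = 1 := mul_eq_one_comm.1 h1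
  simp only [hc, he, map_sum, LinearMap.sum_apply, act_tmul]
  have h3 : ∀ j l, ∑ i, e i l * c j i = if j = l then 1 else 0 := by
    intro j l
    rw [← Matrix.one_apply, ← h2, Matrix.mul_apply]
    exact Finset.sum_congr rfl fun i _ => mul_comm _ _
  rw [Finset.sum_comm]
  refine Finset.sum_congr rfl fun j _ => ?_
  rw [Finset.sum_comm]
  simp only [← TensorProduct.tmul_sum, h3]
  rw [Finset.sum_eq_single j (fun l _ hl => by rw [if_neg hl.symm, TensorProduct.tmul_zero])
    (fun h => (h (Finset.mem_univ j)).elim), if_pos rfl]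

namespace EquivariantDGBimodule

variable {F : EquivariantDGBimodule K.toEquivariantDGAlgebra}

/-- The dual of an infinite-dimensional comodule need not be a comodule. Here it helps that a
homogeneous functional killing `augSub` is a finite sum of fixed functionals composed with
homogeneous endomorphisms of `F`, and the action on the latter is integrable. -/
theorem exists_matrixCoeff_fg (hF : F.EndIntegrable) {f : F.toDGBimodule.Augmentation}
    (hX : F.IsSemiprojective) (hq : IsQuasiIso F.d 0 f.toLinearMap) {q : ℤ} {ξ : F.carrier →ₗ[k] k}
    (hξ : ∀ x ∈ F.augSub, ξ x = 0) (hξq : ∀ p, p ≠ q → ∀ x ∈ F.gr p, ξ x = 0) :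
    ∃ C : Submodule k O, C.FG ∧ ∀ m, matrixCoeff F.coact ξ m ∈ C := by
  obtain ⟨v, hv, hvd, hv1⟩ := f.exists_unit hq
  obtain ⟨r, lam, hlam, h⟩ := f.exists_eq_sum_comp hX hv hvd hv1
  obtain ⟨n, g, hg, hgv, rfl⟩ := h q ξ hξ hξq
  choose C hC hC' using fun s => matrixCoeff_comp_fg hF (hlam s) (hg s) (hgv s)
  refine ⟨⨆ s, C s, Submodule.fg_iSup _ hC, fun m => ?_⟩
  rw [matrixCoeff_sum]
  exact sum_mem fun s _ => Submodule.mem_iSup_of_mem s (hC' s m)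

theorem exists_conj_smulRight {ξ : F.carrier →ₗ[k] k} (a : P.A.carrier)
    (h : ∃ C : Submodule k O, C.FG ∧ ∀ m, matrixCoeff F.coact ξ m ∈ C) :
    ∃ C : Submodule k O, C.FG ∧ ∀ m, conj F.coact P.A.coact.toLinearMap (ξ.smulRight a) m ∈
      LinearMap.range (C.subtype.lTensor P.A.carrier) := by
  obtain ⟨C, hC, hC'⟩ := h
  obtain ⟨n, w, φ, hφ⟩ := exists_eq_sum_slice (P.A.coact.toLinearMap a)
  refine ⟨Submodule.span k (Set.range w) * C, (Submodule.fg_span (Set.finite_range _)).mul hC,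
    fun m => ?_⟩
  rw [conj_smulRight, hφ, map_sum]
  refine sum_mem fun i _ => ?_
  rw [mulR_tmul]
  exact ⟨_ ⊗ₜ ⟨_, Submodule.mul_mem_mul (Submodule.subset_span ⟨i, rfl⟩) (hC' m)⟩, rfl⟩

theorem exists_conj_sum {ι : Type*} (s : Finset ι) {φ : ι → F.carrier →ₗ[k] P.A.carrier}
    (h : ∀ i ∈ s, ∃ C : Submodule k O, C.FG ∧ ∀ m, conj F.coact P.A.coact.toLinearMap (φ i) m ∈
      LinearMap.range (C.subtype.lTensor P.A.carrier)) :
    ∃ C : Submodule k O, C.FG ∧ ∀ m, conj F.coact P.A.coact.toLinearMap (∑ i ∈ s, φ i) m ∈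
      LinearMap.range (C.subtype.lTensor P.A.carrier) := by
  classical
  induction s using Finset.induction_on with
  | empty =>
    refine ⟨⊥, Submodule.fg_bot, fun m => ?_⟩
    rw [Finset.sum_empty, map_zero]
    exact zero_mem _
  | insert i s hi ih =>
    obtain ⟨C, hC, hC'⟩ := ih fun j hj => h j (Finset.mem_insert_of_mem hj)
    obtain ⟨D, hD, hD'⟩ := h i (Finset.mem_insert_self i s)
    refine ⟨D ⊔ C, hD.sup hC, fun m => ?_⟩
    rw [Finset.sum_insert hi, map_add, LinearMap.add_apply]
    exact add_mem (range_lTensor_mono le_sup_left (hD' m)) (range_lTensor_mono le_sup_right (hC' m))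

/-- A bounded cochain has values in finitely many degrees of `A`: none below `0`, none above `Q +
n`. These pieces are finite-dimensional, so the cochain is a finite sum of maps `m ↦ ξ(m) a` with
homogeneous `ξ`. -/
theorem exists_conj_fg (hF : F.EndIntegrable) {f : F.toDGBimodule.Augmentation}
    (hX : F.IsSemiprojective) (hq : IsQuasiIso F.d 0 f.toLinearMap) {n : ℤ}
    {φ : F.carrier →ₗ[k] P.A.carrier} (hφ : φ ∈ F.bddCochain n) :
    ∃ C : Submodule k O, C.FG ∧ ∀ m, conj F.coact P.A.coact.toLinearMap φ m ∈
      LinearMap.range (C.subtype.lTensor P.A.carrier) := by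
  obtain ⟨h1, Q, hQ⟩ := hφ
  have hfin := P.A_gr_finite
  let b := fun j => Module.finBasis k (P.A.gr j)
  let proj := fun j => (component P.A.isInternal j).codRestrict (P.A.gr j) (component_mem _ j)
  have hsum : φ = ∑ j ∈ Finset.Icc 0 (Q + n), ∑ l,
      ((b j).coord l ∘ₗ proj j ∘ₗ φ).smulRight (b j l : P.A.carrier) := by
    have h2 : ∀ j m, ∑ l, ((b j).coord l ∘ₗ proj j ∘ₗ φ).smulRight (b j l : P.A.carrier) m =
        component P.A.isInternal j (φ m) := by
      intro j m
      have := congrArg Subtype.val ((b j).sum_repr (proj j (φ m)))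
      rw [AddSubmonoidClass.coe_finsetSum] at this
      exact this
    refine linearMap_ext_gr F.isInternal fun q m hm => ?_
    simp only [LinearMap.sum_apply]
    simp only [h2]
    by_cases hq : q + n ∈ Finset.Icc 0 (Q + n)
    · rw [Finset.sum_eq_single_of_mem (q + n) hq, component_of_mem _ (h1.1 q m hm)]
      intro j _ hj
      exact component_of_ne _ hj.symm (h1.1 q m hm)
    · have h3 : φ m = 0 := by
        rw [Finset.mem_Icc, not_and_or] at hq
        rcases hq with hq | hq
        · exact P.A_eq_zero_of_neg (by omega) (h1.1 q m hm)
        · exact hQ q (by omega) m hm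
      rw [h3]
      simp
  rw [hsum]
  refine exists_conj_sum _ fun j _ => exists_conj_sum _ fun l _ => exists_conj_smulRight _ ?_
  refine exists_matrixCoeff_fg hF hX hq (q := j - n) (fun x hx => ?_) (fun p hp x hx => ?_)
  · rw [LinearMap.comp_apply, LinearMap.comp_apply, h1.2 x hx, map_zero, map_zero]
  · have h4 : proj j (φ x) = 0 := Subtype.ext (component_of_ne _ (by omega) (h1.1 p x hx))
    rw [LinearMap.comp_apply, LinearMap.comp_apply, h4, map_zero]

theorem slice_conj_mem_bddCochain {n : ℤ} {φ : F.carrier →ₗ[k] P.A.carrier}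
    (hφ : φ ∈ F.bddCochain n) (ω : O →ₗ[k] k) :
    slice ω ∘ₗ conj F.coact P.A.coact.toLinearMap φ ∈ F.bddCochain n := by
  obtain ⟨h1, Q, hQ⟩ := hφ
  refine ⟨⟨fun q m hm => ?_, fun x hx => ?_⟩, Q, fun q hq m hm => ?_⟩
  · have h2 : conj F.coact P.A.coact.toLinearMap φ m ∈
        LinearMap.range ((P.A.gr (q + n)).subtype.rTensor O) :=
      conj_mem_range (F.coact_gr hm) fun y hy => P.A.coact_gr (h1.1 q y hy)
    exact (mem_range_rTensor_iff _ _).1 h2 ω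
  · rw [LinearMap.comp_apply, conj_eq_zero (coact_mem_augSub hx) h1.2, map_zero]
  · rw [LinearMap.comp_apply, conj_eq_zero (F.coact_gr hm) (hQ q hq), map_zero]

/-- When all coefficients lie in one finite-dimensional space, the conjugated cochain is the finite
sum of its slices along a basis of that space, and slices of bounded cochains are bounded cochains.
-/
theorem bddCochain_isIntegrable (hF : F.EndIntegrable) {f : F.toDGBimodule.Augmentation}
    (hX : F.IsSemiprojective) (hq : IsQuasiIso F.d 0 f.toLinearMap) (n : ℤ) :
    IsIntegrable (X := F.bddCochain n) F.coact P.A.coact.toLinearMap (F.bddCochain n).subtype := by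
  intro φ
  obtain ⟨C, hC, hC'⟩ := exists_conj_fg hF hX hq φ.2
  obtain ⟨r, w, ω, hω⟩ := exists_eq_sum_slice_of_fg (M := P.A.carrier) hC
  refine ⟨∑ i, (⟨_, slice_conj_mem_bddCochain φ.2 (ω i)⟩ : F.bddCochain n) ⊗ₜ w i, fun m => ?_⟩
  refine Eq.trans ?_ (hω _ (hC' m)).symm
  simp only [map_sum, LinearMap.sum_apply, act_tmul, mul_one]
  rfl

end EquivariantDGBimodule

end EqFormality

/-! ### The complex of bounded cochains and its two actions -/

namespace EqFormality

variable {k : Type u} [Field k] {O : Type u} [CommRing O] [HopfAlgebra k O] {P : ParamAlgebra k O}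
  {K : EquivariantKoszulResolution P}

theorem ParamAlgebra.sum_act_xA_xB (P : ParamAlgebra k O) {U : Type u} [AddCommGroup U] [Module k U]
    (β : P.A.carrier →ₗ[k] P.B.carrier →ₗ[k] U) :
    ∑ i, act O β (P.A.coact (P.xA i)) (P.B.coact (P.xB i)) =
      ∑ i, β (P.xA i) (P.xB i) ⊗ₜ[k] (1 : O) := by
  have h := sum_act_dualCoact P.isCoaction_cotCoact P.cotBasis (β.compl₁₂ P.ιA P.ιB)
  refine Eq.trans (Finset.sum_congr rfl fun i _ => ?_) h
  rw [ParamAlgebra.xA, ParamAlgebra.xB, P.coact_ιA, P.coact_ιB]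
  generalize dualCoact P.cotCoact (P.cotBasis.coord i) = s
  generalize P.cotCoact (P.cotBasis i) = t
  induction s with
  | zero => simp
  | add x y hx hy => simp only [map_add, LinearMap.add_apply, hx, hy]
  | tmul x o =>
    induction t with
    | zero => simp
    | add x y hx hy => simp only [map_add, hx, hy]
    | tmul y o' => simp

theorem isInternal_iSup_of_le_linHomGr {M N : Type*} [AddCommGroup M] [Module k M]
    [AddCommGroup N] [Module k N] {grM : ℤ → Submodule k M} {grN : ℤ → Submodule k N}
    (hM : DirectSum.IsInternal grM) (hN : DirectSum.IsInternal grN)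
    {H : ℤ → Submodule k (M →ₗ[k] N)} (hH : ∀ n, H n ≤ linHomGr grM grN n) :
    DirectSum.IsInternal fun n => (H n).comap (⨆ n, H n).subtype := by
  let p : ∀ n : ℤ, (⨆ n, H n : Submodule k (M →ₗ[k] N)) →ₗ[k] (∀ q : ℤ, grM q → N) := fun n =>
    { toFun := fun f q m => component hN (q + n) (f.1 m)
      map_add' := by intro f g; ext q m; simp
      map_smul' := by intro c f; ext q m; simp }
  refine isInternal_of_separating p ?_ ?_ ?_
  · intro n f hf h
    refine Subtype.ext (linearMap_ext_gr hM fun q m hm => ?_)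
    exact (component_of_mem hN (hH n hf q m hm)).symm.trans (congrFun (congrFun h q) ⟨m, hm⟩)
  · intro m n hmn f hf
    ext q x
    exact component_of_ne _ (by omega) (hH m hf q x x.2)
  · rw [eq_top_iff]
    rintro ⟨f, hf⟩ -
    refine Submodule.iSup_induction' (p := H) (motive := fun f hf =>
      (⟨f, hf⟩ : (⨆ n, H n : Submodule k (M →ₗ[k] N))) ∈
        ⨆ n, (H n).comap (⨆ n, H n).subtype) ?_ (zero_mem _) ?_ hf
    · intro n f hf
      exact Submodule.mem_iSup_of_mem n hf
    · intro f g hf hg h h'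
      exact add_mem h h'

namespace DGBimodule

variable (X : DGBimodule K.toEquivariantDGAlgebra)

/-- The complex of bounded cochains. -/
noncomputable def bddCochains : Submodule k (X.carrier →ₗ[k] P.A.carrier) := ⨆ n, X.bddCochain n

/-- The bounded cochains of degree `n`. -/
noncomputable def bddCochainsGr (n : ℤ) : Submodule k X.bddCochains :=
  (X.bddCochain n).comap X.bddCochains.subtype

variable {X}

theorem bddCochains_induction {p : X.bddCochains → Prop} (f : X.bddCochains)
    (hom : ∀ n, ∀ f ∈ X.bddCochainsGr n, p f) (add : ∀ f g, p f → p g → p (f + g)) : p f := by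
  obtain ⟨f, hf⟩ := f
  refine Submodule.iSup_induction' (p := X.bddCochain) (motive := fun f hf => p ⟨f, hf⟩) ?_ ?_ ?_ hf
  · intro n f hf
    exact hom n _ hf
  · exact hom 0 0 (zero_mem _)
  · intro f g hf hg h h'
    exact add _ _ h h'

theorem bddCochains_map {g : (X.carrier →ₗ[k] P.A.carrier) →ₗ[k] (X.carrier →ₗ[k] P.A.carrier)}
    (hg : ∀ n, ∀ f ∈ X.bddCochain n, g f ∈ X.bddCochains) {f : X.carrier →ₗ[k] P.A.carrier}
    (hf : f ∈ X.bddCochains) : g f ∈ X.bddCochains := by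
  revert hf f
  change X.bddCochains ≤ X.bddCochains.comap g
  exact iSup_le hg

theorem bddCochains_augSub (f : X.bddCochains) {x : X.carrier} (hx : x ∈ X.augSub) :
    f.1 x = 0 :=
  bddCochains_induction (p := fun f => f.1 x = 0) f (fun _ _ hf => hf.1.2 x hx)
    (fun _ _ hf hg => (congrArg₂ (· + ·) hf hg).trans (add_zero _))

theorem bddCochainsGr_isInternal : DirectSum.IsInternal X.bddCochainsGr :=
  isInternal_iSup_of_le_linHomGr X.isInternal P.A.isInternal fun _ _ hf => hf.1.1

theorem mulLeft_comp_mem_bdd {n p : ℤ} {φ : X.carrier →ₗ[k] P.A.carrier} (hφ : φ ∈ X.bddCochain n)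
    {a : P.A.carrier} (ha : a ∈ P.A.gr p) : LinearMap.mulLeft k a ∘ₗ φ ∈ X.bddCochain (p + n) := by
  obtain ⟨h1, Q, hQ⟩ := hφ
  refine ⟨by rw [add_comm]; exact mulLeft_comp_mem h1 ha, Q, fun q hq m hm => ?_⟩
  rw [LinearMap.comp_apply, hQ q hq m hm, map_zero]

theorem comp_mem_bdd {n p : ℤ} {φ : X.carrier →ₗ[k] P.A.carrier} (hφ : φ ∈ X.bddCochain n)
    {e : Module.End k X.carrier} (he : e ∈ X.endDeg p) : φ ∘ₗ e ∈ X.bddCochain (n + p) := by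
  obtain ⟨⟨h1, h2⟩, Q, hQ⟩ := hφ
  refine ⟨⟨fun q m hm => ?_, fun x hx => ?_⟩, Q - p, fun q hq m hm => ?_⟩
  · have := h1 _ _ (he.1 q m hm)
    rwa [add_assoc, add_comm p n] at this
  · exact h2 _ (homDeg_mem_augSub (X := X) (Y := X) he hx)
  · exact hQ (q + p) (by omega) _ (he.1 q m hm)

variable (X) in
/-- The differential on bounded cochains. -/
noncomputable def bddCochainsD : X.bddCochains →ₗ[k] X.bddCochains :=
  X.cochainD.restrict fun _ hf => bddCochains_map
    (fun n _ hf => Submodule.mem_iSup_of_mem (n + 1) (cochainD_mem_bdd hf)) hf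

variable (X) in
/-- The multiplication of cochains by elements of `A`. -/
noncomputable def bddCochainsLeft : P.A.carrier →ₗ[k] X.bddCochains →ₗ[k] X.bddCochains :=
  LinearMap.mk₂ k (fun a f => ⟨LinearMap.mulLeft k a ∘ₗ f.1, by
      refine gr_induction (p := fun a => LinearMap.mulLeft k a ∘ₗ f.1 ∈ X.bddCochains)
        P.A.isInternal a (fun p a ha => ?_) ?_ (fun a b ha hb => ?_)
      · exact bddCochains_map (g := LinearMap.compRight k (LinearMap.mulLeft k a))
          (fun n f hf => Submodule.mem_iSup_of_mem (p + n) (mulLeft_comp_mem_bdd hf ha)) f.2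
      · rw [LinearMap.mulLeft_zero_eq_zero, LinearMap.zero_comp]
        exact zero_mem _
      · have := add_mem ha hb
        convert this using 1
        ext m
        simp [add_mul]⟩)
    (fun a b f => Subtype.ext (by ext m; simp [add_mul]))
    (fun c a f => Subtype.ext (by ext m; simp))
    (fun a f g => Subtype.ext (by ext m; simp [mul_add]))
    (fun c a f => Subtype.ext (by ext m; simp))

variable (X) in
/-- The composition of cochains with endomorphisms. -/
noncomputable def bddCochainsRight : X.endSubalgebra →ₗ[k] X.bddCochains →ₗ[k] X.bddCochains :=
  LinearMap.mk₂ k (fun e f => ⟨f.1 ∘ₗ e.1, by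
      refine X.endSubalgebra_induction (p := fun e => f.1 ∘ₗ e.1 ∈ X.bddCochains) e
        (fun p e he => ?_) (fun a b ha hb => ?_)
      · exact bddCochains_map (g := LinearMap.lcomp k P.A.carrier e.1)
          (fun n f hf => Submodule.mem_iSup_of_mem (n + p) (comp_mem_bdd hf he)) f.2
      · have := add_mem ha hb
        convert this using 1
        ext m
        simp⟩)
    (fun a b f => Subtype.ext (by ext m; simp))
    (fun c a f => Subtype.ext (by ext m; simp))
    (fun a f g => Subtype.ext (by ext m; simp))
    (fun c a f => Subtype.ext (by ext m; simp))

/-- The Koszul sums agree because `e` commutes with the right action of `K`. The remaining terms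
differ by signs, which match since `A` is even and so fixes the parity of the degrees that
contribute. -/
theorem bddCochainsD_right {q : ℤ} {f : X.bddCochains} (e : X.endSubalgebra)
    (hf : f ∈ X.bddCochainsGr q) : X.bddCochainsD (X.bddCochainsRight e f) =
      X.bddCochainsRight e (X.bddCochainsD f) +
        q.negOnePow • X.bddCochainsRight (X.endDiff e) f := by
  refine X.endSubalgebra_induction (p := fun e => X.bddCochainsD (X.bddCochainsRight e f) =
      X.bddCochainsRight e (X.bddCochainsD f) +
        q.negOnePow • X.bddCochainsRight (X.endDiff e) f) e ?_ ?_
  · intro n e he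
    have he : (e : Module.End k X.carrier) ∈ X.endDeg n := he
    have hf : f.1 ∈ X.bddCochain q := hf
    refine Subtype.ext (linearMap_ext_gr X.isInternal fun p m hm => ?_)
    have h1 : (X.bddCochainsRight e (X.bddCochainsD f) +
        q.negOnePow • X.bddCochainsRight (X.endDiff e) f).1 m =
        X.cochainD f.1 (e.1 m) + q.negOnePow • f.1 (X.endD e.1 m) := by
      rw [Units.smul_def, Units.smul_def]
      rfl
    refine Eq.trans (b := X.cochainD (f.1 ∘ₗ e.1) m) rfl (Eq.trans ?_ h1.symm)
    rw [cochainD_of_mem _ hm, cochainD_of_mem _ (he.1 p m hm), endD_of_mem he, map_sub,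
      map_units_zsmul, smul_sub, smul_smul]
    simp only [LinearMap.comp_apply, he.2.2]
    have h2 := P.A_negOnePow_smul _ _ (hf.1.1 _ _ (X.d_mem (he.1 p m hm)))
    have h3 := P.A_negOnePow_smul _ _ (hf.1.1 _ _ (he.1 _ _ (X.d_mem hm)))
    have h4 : (p + n).negOnePow • f.1 (X.d (e.1 m)) = -(q.negOnePow • f.1 (X.d (e.1 m))) := by
      nth_rw 1 [← h2]
      rw [smul_smul, Int.negOnePow_add (p + n + 1) q, Int.negOnePow_succ, ← mul_assoc, mul_neg,
        Int.units_mul_self, neg_one_mul, Units.neg_smul]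
    have h5 : p.negOnePow • f.1 (e.1 (X.d m)) =
        -((q.negOnePow * n.negOnePow) • f.1 (e.1 (X.d m))) := by
      nth_rw 1 [← h3]
      rw [smul_smul, Int.negOnePow_add (p + 1 + n) q, Int.negOnePow_add (p + 1) n,
        Int.negOnePow_succ, ← mul_assoc, ← mul_assoc, mul_neg, Int.units_mul_self, neg_one_mul,
        neg_mul, Units.neg_smul, mul_comm n.negOnePow]
    rw [h4, h5]
    abel
  · intro e e' he he'
    simp only [map_add, LinearMap.add_apply, he, he', smul_add]
    abel

end DGBimodule

end EqFormality

/-! ### Bounded cochains as an equivariant bimodule -/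

namespace EqFormality

variable {k : Type u} [Field k] {O : Type u} [CommRing O] [HopfAlgebra k O] {P : ParamAlgebra k O}
  {K : EquivariantKoszulResolution P}

namespace EquivariantDGBimodule

variable {F : EquivariantDGBimodule K.toEquivariantDGAlgebra}

variable (F) in
/-- The bounded cochains form an integrable representation. -/
def BddIntegrable : Prop :=
  ∀ n, IsIntegrable (X := F.bddCochain n) F.coact P.A.coact.toLinearMap (F.bddCochain n).subtype

theorem exists_coact_iSup {M N : Type*} [AddCommGroup M] [Module k M] [AddCommGroup N] [Module k N]
    {ρM : M →ₗ[k] M ⊗[k] O} {ρN : N →ₗ[k] N ⊗[k] O} {H : ℤ → Submodule k (M →ₗ[k] N)}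
    (h : ∀ n, IsIntegrable (X := H n) ρM ρN (H n).subtype) {n : ℤ}
    {f : (⨆ n, H n : Submodule k (M →ₗ[k] N))} (hf : f.1 ∈ H n) :
    ∃ t ∈ LinearMap.range (((H n).comap (⨆ n, H n).subtype).subtype.rTensor O),
      ∀ m, act (X := (⨆ n, H n : Submodule k (M →ₗ[k] N))) O (⨆ n, H n).subtype t (m ⊗ₜ 1) =
        conj ρM ρN f.1 m := by
  obtain ⟨t, ht⟩ := h n ⟨f.1, hf⟩
  let i : H n →ₗ[k] ((H n).comap (⨆ n, H n).subtype) :=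
    (Submodule.inclusion (le_iSup H n)).codRestrict _ fun x => x.2
  refine ⟨_, ⟨i.rTensor O t, rfl⟩, fun m => ?_⟩
  refine Eq.trans ?_ (ht m)
  clear ht
  induction t with
  | zero => simp
  | add x y hx hy => simp only [map_add, LinearMap.add_apply, hx, hy]
  | tmul g o => simp; rfl

theorem isIntegrable_iSup {M N : Type*} [AddCommGroup M] [Module k M] [AddCommGroup N] [Module k N]
    {ρM : M →ₗ[k] M ⊗[k] O} {ρN : N →ₗ[k] N ⊗[k] O} {H : ℤ → Submodule k (M →ₗ[k] N)}
    (h : ∀ n, IsIntegrable (X := H n) ρM ρN (H n).subtype) :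
    IsIntegrable (X := (⨆ n, H n : Submodule k (M →ₗ[k] N))) ρM ρN (⨆ n, H n).subtype := by
  rintro ⟨f, hf⟩
  refine Submodule.iSup_induction' (p := H) (motive := fun f hf =>
    ∃ t : (⨆ n, H n : Submodule k (M →ₗ[k] N)) ⊗[k] O, ∀ m, act
      (X := (⨆ n, H n : Submodule k (M →ₗ[k] N))) O (⨆ n, H n).subtype t (m ⊗ₜ 1) =
        conj ρM ρN f m) ?_ ?_ ?_ hf
  · intro n f hf
    obtain ⟨t, -, ht⟩ := exists_coact_iSup h (f := ⟨f, Submodule.mem_iSup_of_mem n hf⟩) hf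
    exact ⟨t, ht⟩
  · exact ⟨0, fun m => by simp⟩
  · rintro f g - - ⟨t, ht⟩ ⟨s, hs⟩
    refine ⟨t + s, fun m => ?_⟩
    rw [map_add, LinearMap.add_apply, ht, hs, map_add, LinearMap.add_apply]

theorem BddIntegrable.exists_coact (h : F.BddIntegrable) {n : ℤ} {f : F.bddCochains}
    (hf : f ∈ F.bddCochainsGr n) : ∃ t ∈ LinearMap.range ((F.bddCochainsGr n).subtype.rTensor O),
      ∀ m, act (X := F.bddCochains) (N := P.A.carrier) O F.bddCochains.subtype t (m ⊗ₜ 1) =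
        conj F.coact P.A.coact.toLinearMap f.1 m :=
  exists_coact_iSup h hf

theorem BddIntegrable.isIntegrable (h : F.BddIntegrable) : IsIntegrable (X := F.bddCochains)
    (N := P.A.carrier) F.coact P.A.coact.toLinearMap F.bddCochains.subtype :=
  isIntegrable_iSup h

/-- The coaction on the bounded cochains. -/
noncomputable def bddCoact (h : F.BddIntegrable) : F.bddCochains →ₗ[k] F.bddCochains ⊗[k] O :=
  homCoact (X := F.bddCochains) F.bddCochains.injective_subtype h.isIntegrable

theorem bddCoact_spec (h : F.BddIntegrable) (f : F.bddCochains) (m : F.carrier) :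
    act (X := F.bddCochains) (N := P.A.carrier) O F.bddCochains.subtype (bddCoact h f) (m ⊗ₜ 1) =
      conj F.coact P.A.coact.toLinearMap f.1 m :=
  homCoact_spec (X := F.bddCochains) F.bddCochains.injective_subtype h.isIntegrable f m

theorem bddCoact_eval (h : F.BddIntegrable) (f : F.bddCochains) (m : F.carrier) :
    act (X := F.bddCochains) (N := P.A.carrier) O F.bddCochains.subtype (bddCoact h f) (F.coact m) =
      P.A.coact (f.1 m) :=
  homCoact_eval (X := F.bddCochains) F.isCoaction F.bddCochains.injective_subtype h.isIntegrable f m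

theorem bddCoact_ext {t t' : F.bddCochains ⊗[k] O}
    (h : ∀ m, act (X := F.bddCochains) (N := P.A.carrier) O F.bddCochains.subtype t (F.coact m) =
      act (X := F.bddCochains) (N := P.A.carrier) O F.bddCochains.subtype t' (F.coact m)) :
    t = t' := by
  refine act_ext_coaction (X := F.bddCochains) (N := P.A.carrier) F.isCoaction (AlgHom.id k O)
    F.bddCochains.injective_subtype
    (fun m => ?_)
  simpa using h m

theorem isCoaction_bddCoact (h : F.BddIntegrable) : IsCoaction (M := F.bddCochains) (bddCoact h) :=
  isCoaction_homCoact (X := F.bddCochains) F.isCoaction P.A.isCoaction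
    F.bddCochains.injective_subtype h.isIntegrable

theorem bddCoact_gr (h : F.BddIntegrable) {n : ℤ} {f : F.bddCochains}
    (hf : f ∈ F.bddCochainsGr n) :
    bddCoact h f ∈ LinearMap.range ((F.bddCochainsGr n).subtype.rTensor O) := by
  obtain ⟨t, ht, ht'⟩ := h.exists_coact hf
  have : bddCoact h f = t := act_ext (X := F.bddCochains) (N := P.A.carrier)
    F.bddCochains.injective_subtype fun m => by
    rw [bddCoact_spec, ht']
  rwa [this]

theorem act_bddCochainsLeft (s : P.A.carrier ⊗[k] O) (t : F.bddCochains ⊗[k] O)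
    (y : F.carrier ⊗[k] O) :
    act (X := F.bddCochains) (N := P.A.carrier) O F.bddCochains.subtype
        (act (M := F.bddCochains) (N := F.bddCochains) O F.bddCochainsLeft s t) y =
      s * act (X := F.bddCochains) (N := P.A.carrier) O F.bddCochains.subtype t y := by
  induction s with
  | zero => simp
  | add x y hx hy => simp only [map_add, LinearMap.add_apply, add_mul, hx, hy]
  | tmul a o =>
    induction t with
    | zero => simp
    | add x y hx hy => simp only [map_add, LinearMap.add_apply, mul_add, hx, hy]
    | tmul f o' =>
      induction y with
      | zero => simp
      | add x y hx hy => simp only [map_add, mul_add, hx, hy]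
      | tmul m o'' =>
        simp only [act_tmul, Algebra.TensorProduct.tmul_mul_tmul, mul_assoc]
        rfl

theorem act_bddCochainsRight (s : F.endSubalgebra ⊗[k] O) (t : F.bddCochains ⊗[k] O)
    (y : F.carrier ⊗[k] O) :
    act (X := F.bddCochains) (N := P.A.carrier) O F.bddCochains.subtype
        (act (M := F.bddCochains) (N := F.bddCochains) O F.bddCochainsRight s t) y =
      act (X := F.bddCochains) (N := P.A.carrier) O F.bddCochains.subtype t
        (act O F.endSubalgebra.val.toLinearMap s y) := by
  induction s with
  | zero => simp
  | add x y hx hy => simp only [map_add, LinearMap.add_apply, hx, hy]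
  | tmul e o =>
    induction t with
    | zero => simp
    | add x y hx hy => simp only [map_add, LinearMap.add_apply, hx, hy]
    | tmul f o' =>
      induction y with
      | zero => simp
      | add x y hx hy => simp only [map_add, hx, hy]
      | tmul m o'' =>
        simp only [act_tmul]
        rw [mul_left_comm, ← mul_assoc]
        rfl

/-- The bilinear map `(x, b) ↦ x f(m b)` on `A × B`. -/
noncomputable def pairing (f : F.carrier →ₗ[k] P.A.carrier) (m : F.carrier) :
    P.A.carrier →ₗ[k] P.B.carrier →ₗ[k] P.A.carrier :=
  (LinearMap.mul k P.A.carrier).compl₂ (f ∘ₗ F.right.flip m ∘ₗ K.piSection)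

theorem pairing_apply (f : F.carrier →ₗ[k] P.A.carrier) (m : F.carrier) (x : P.A.carrier)
    (b : P.B.carrier) : pairing f m x b = x * f (F.right (K.piSection b) m) := rfl

/-- The form of the differential from which `G`-linearity can be read off: the coactions of the
`x_i` and of the lifts of the `b_i` may be inserted, because the canonical element is invariant. The
non-equivariant lifts do no harm, since cochains see them only through the `G`-linear map `π`. -/
theorem act_bddCochainsD (t : F.bddCochains ⊗[k] O) (y : F.carrier ⊗[k] O) :
    act (X := F.bddCochains) (N := P.A.carrier) O F.bddCochains.subtype
        (F.bddCochainsD.rTensor O t) y =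
      act (X := F.bddCochains) (N := P.A.carrier) O F.bddCochains.subtype t
        ((F.d ∘ₗ signMap F.isInternal).rTensor O y) +
      ∑ i, P.A.coact (P.xA i) * act (X := F.bddCochains) (N := P.A.carrier) O F.bddCochains.subtype
        t
        (act O F.right (K.coact (K.piSection (P.xB i))) y) := by
  induction t with
  | zero => simp
  | add x y hx hy =>
    simp only [map_add, LinearMap.add_apply, hx, hy, mul_add, Finset.sum_add_distrib]
    abel
  | tmul f o =>
    induction y with
    | zero => simp
    | add x y hx hy =>
      simp only [map_add, hx, hy, mul_add, Finset.sum_add_distrib]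
      abel
    | tmul m o' =>
      have h1 : ∀ (s : P.A.carrier ⊗[k] O) (u : K.carrier ⊗[k] O),
          s * act (X := F.bddCochains) (N := P.A.carrier) O F.bddCochains.subtype (f ⊗ₜ o)
            (act O F.right u (m ⊗ₜ o')) =
          mulR P.A.carrier (o * o')
            (act O (pairing f.1 m) s (K.pi.toAlgHom.toLinearMap.rTensor O u)) := by
        intro s u
        induction s with
        | zero => simp
        | add x y hx hy => simp only [map_add, LinearMap.add_apply, add_mul, hx, hy]
        | tmul x o₁ =>
          induction u with
          | zero => simp
          | add x y hx hy => simp only [map_add, LinearMap.add_apply, mul_add, hx, hy]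
          | tmul b o₂ =>
            simp only [act_tmul, LinearMap.rTensor_tmul, Algebra.TensorProduct.tmul_mul_tmul,
              mulR_tmul, pairing_apply]
            have h2 : F.bddCochains.subtype f (F.right b m) =
                f.1 (F.right (K.piSection (K.pi.toAlgHom.toLinearMap b)) m) :=
              DGBimodule.map_right_of_augSub (fun x hx => DGBimodule.bddCochains_augSub f hx)
                (K.pi_piSection _).symm m
            rw [h2]
            congr 1
            ring
      simp only [h1]
      rw [← map_sum]
      -- Here the coaction of the chosen lift becomes the coaction of the basis vector in `B`.
      simp only [← K.pi.map_coact, K.pi_piSection]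
      rw [P.sum_act_xA_xB, map_sum, LinearMap.rTensor_tmul, act_tmul, LinearMap.rTensor_tmul,
        act_tmul]
      simp only [mulR_tmul, one_mul, pairing_apply]
      rw [← TensorProduct.sum_tmul, ← TensorProduct.add_tmul]
      congr 1
      exact DGBimodule.cochainD_apply f.1 m

theorem bddCoact_d (h : F.BddIntegrable) (f : F.bddCochains) :
    bddCoact h (F.bddCochainsD f) = F.bddCochainsD.rTensor O (bddCoact h f) := by
  apply bddCoact_ext
  intro m
  rw [bddCoact_eval, act_bddCochainsD, LinearMap.rTensor_comp_apply, ← coact_sign, ← F.coact_d,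
    bddCoact_eval]
  have h1 : (F.bddCochainsD f).1 m = _ := DGBimodule.cochainD_apply f.1 m
  rw [h1, map_add, map_sum]
  congr 1
  refine Finset.sum_congr rfl fun i _ => ?_
  rw [map_mul, ← F.coact_right, bddCoact_eval]

theorem bddCoact_right (hF : F.EndIntegrable) (h : F.BddIntegrable) (e : F.endSubalgebra)
    (f : F.bddCochains) : bddCoact h (F.bddCochainsRight e f) =
      act (M := F.bddCochains) (N := F.bddCochains) O F.bddCochainsRight
        (endCoact hF e) (bddCoact h f) := by
  apply bddCoact_ext
  intro m
  rw [bddCoact_eval, act_bddCochainsRight, endCoact_eval, bddCoact_eval]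
  rfl

/-- An invariant augmentation, as a bounded cochain. -/
noncomputable def bddPt (f : F.toDGBimodule.Augmentation) : F.bddCochains :=
  ⟨f.scalar, Submodule.mem_iSup_of_mem 0
    (DGBimodule.homDeg_scalar_comp (f := f) (e := LinearMap.id) DGBimodule.endDeg_one)⟩

theorem bddCoact_pt (h : F.BddIntegrable) {f : F.toDGBimodule.Augmentation}
    (hf : ∀ m, f.toLinearMap.rTensor O (F.coact m) = f.toLinearMap m ⊗ₜ 1) :
    bddCoact h (bddPt f) = bddPt f ⊗ₜ 1 := by
  apply bddCoact_ext
  intro m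
  rw [bddCoact_eval]
  have h1 : ∀ y : F.carrier ⊗[k] O, act (X := F.bddCochains) (N := P.A.carrier) O
    F.bddCochains.subtype (bddPt f ⊗ₜ 1) y =
      (Algebra.linearMap k P.A.carrier).rTensor O (f.toLinearMap.rTensor O y) := by
    intro y
    induction y with
    | zero => simp
    | add x y hx hy => simp only [map_add, hx, hy]
    | tmul m o =>
      rw [act_tmul, one_mul]
      rfl
  rw [h1, hf]
  exact P.A.coact.commutes _

theorem bddCochainsD_mem {n : ℤ} {x : F.bddCochains} (hx : x ∈ F.bddCochainsGr n) :
    F.bddCochainsD x ∈ F.bddCochainsGr (n + 1) := by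
  have hx : x.1 ∈ F.bddCochain n := hx
  exact DGBimodule.cochainD_mem_bdd hx

theorem bddCochainsD_bddCochainsD (x : F.bddCochains) : F.bddCochainsD (F.bddCochainsD x) = 0 := by
  refine DGBimodule.bddCochains_induction (p := fun x => F.bddCochainsD (F.bddCochainsD x) = 0) x
    (fun _ x hx => ?_) (fun x y hx hy => by rw [map_add, map_add, hx, hy, add_zero])
  have hx : x.1 ∈ F.bddCochain _ := hx
  exact Subtype.ext (DGBimodule.cochainD_cochainD hx.1)

/-- The bimodule of bounded cochains, which relates `A` to `End(F)`. -/
noncomputable def bddBimodule (hF : F.EndIntegrable) (h : F.BddIntegrable)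
    (f : F.toDGBimodule.Augmentation)
    (hf : ∀ m, f.toLinearMap.rTensor O (F.coact m) = f.toLinearMap m ⊗ₜ 1) :
    PointedBimodule P.A (F.endAlgebra hF) where
  carrier := F.bddCochains
  addCommGroup := F.bddCochains.addCommGroup
  module := F.bddCochains.module
  gr := F.bddCochainsGr
  isInternal := by
    have h := DGBimodule.bddCochainsGr_isInternal (X := F.toDGBimodule)
    exact h
  d := F.bddCochainsD
  d_mem hx := bddCochainsD_mem hx
  d_d := bddCochainsD_bddCochainsD
  left := F.bddCochainsLeft
  left_one m := Subtype.ext (LinearMap.ext fun x => one_mul _)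
  left_mul a b m := Subtype.ext (LinearMap.ext fun x => mul_assoc _ _ _)
  right := F.bddCochainsRight
  right_one m := rfl
  right_mul a b m := rfl
  left_right a b m := rfl
  left_mem ha hm := DGBimodule.mulLeft_comp_mem_bdd hm ha
  right_mem hb hm := DGBimodule.comp_mem_bdd hm hb
  d_left a m := Subtype.ext (DGBimodule.cochainD_mulLeft a m.1)
  d_right b hm := DGBimodule.bddCochainsD_right b hm
  coact := bddCoact h
  isCoaction := isCoaction_bddCoact h
  coact_gr hx := bddCoact_gr h hx
  coact_d := bddCoact_d h
  coact_left a x := bddCoact_ext fun m => by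
    rw [bddCoact_eval, act_bddCochainsLeft, bddCoact_eval, ← map_mul]
    rfl
  coact_right := bddCoact_right hF h
  pt := bddPt f
  pt_mem := DGBimodule.homDeg_scalar_comp (f := f) (e := LinearMap.id) DGBimodule.endDeg_one
  d_pt := Subtype.ext f.cochainD_scalar
  coact_pt := bddCoact_pt h hf

end EquivariantDGBimodule

end EqFormality

/-! ### The two quasi-isomorphisms and the conclusion -/

namespace EqFormality

theorem IsQuasiIso.comp {k M N L : Type*} [Field k] [AddCommGroup M] [Module k M]
    [AddCommGroup N] [Module k N] [AddCommGroup L] [Module k L] {dM : M →ₗ[k] M} {dN : N →ₗ[k] N}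
    {dL : L →ₗ[k] L} {g : N →ₗ[k] L} {f : M →ₗ[k] N} (hg : IsQuasiIso dN dL g)
    (hf : IsQuasiIso dM dN f) (hfd : ∀ x, f (dM x) = dN (f x)) (hgd : ∀ x, g (dN x) = dL (g x)) :
    IsQuasiIso dM dL (g ∘ₗ f) := by
  constructor
  · intro x hx hw
    exact hf.1 x hx (hg.1 (f x) (by rw [← hfd, hx, map_zero]) hw)
  · intro y hy
    obtain ⟨x, hx, w, hw⟩ := hg.2 y hy
    obtain ⟨x', hx', w', hw'⟩ := hf.2 x hx
    refine ⟨x', hx', g w' + w, ?_⟩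
    rw [hw, hw', map_add, hgd, map_add, LinearMap.comp_apply, add_assoc]

variable {k : Type u} [Field k] {O : Type u} [CommRing O] [HopfAlgebra k O] {P : ParamAlgebra k O}
  {K : EquivariantKoszulResolution P}

namespace EquivariantDGBimodule

variable {F : EquivariantDGBimodule K.toEquivariantDGAlgebra}

theorem isQuasiIso_bddBimodule_left (hF : F.EndIntegrable) (h : F.BddIntegrable)
    (f : F.toDGBimodule.Augmentation)
    (hf : ∀ m, f.toLinearMap.rTensor O (F.coact m) = f.toLinearMap m ⊗ₜ 1)
    (hX : F.IsSemiprojective) (hq : IsQuasiIso F.d 0 f.toLinearMap) :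
    IsQuasiIso P.A.d (bddBimodule hF h f hf).d
      ((bddBimodule hF h f hf).left.flip (bddBimodule hF h f hf).pt) := by
  let T := bddBimodule hF h f hf
  change IsQuasiIso P.A.d T.d (T.left.flip T.pt)
  refine isQuasiIso_of_homogeneous P.A.isInternal T.isInternal (fun n x hx => P.A.d_mem hx)
    (fun n x hx => T.d_mem hx) ?_ ?_ ?_
  · intro n x hx
    have := T.left_mem hx T.pt_mem
    rwa [add_zero] at this
  · intro n x hx _ (w : F.bddCochains) (hw : w.1 ∈ F.bddCochain (n - 1)) h
    exact ⟨0, (DGBimodule.Augmentation.eq_zero_of_mulLeft_scalar hX hq hw.1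
      (congrArg (Subtype.val : F.bddCochains → _) h)).trans (map_zero _).symm⟩
  · intro n (y : F.bddCochains) (hy : y.1 ∈ F.bddCochain n) hd
    obtain ⟨a, ha, ψ, hψ, h⟩ := DGBimodule.Augmentation.exists_eq_mulLeft_scalar_add_bdd hX hq hy
      (congrArg (Subtype.val : F.bddCochains → _) hd)
    let w : F.bddCochains := ⟨ψ, Submodule.mem_iSup_of_mem _ hψ⟩
    exact ⟨a, by rw [P.A_d]; rfl, w, (Subtype.ext h : y = F.bddCochainsLeft a (bddPt f) +
      F.bddCochainsD w)⟩

theorem isQuasiIso_bddBimodule_right (hF : F.EndIntegrable) (h : F.BddIntegrable)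
    (f : F.toDGBimodule.Augmentation)
    (hf : ∀ m, f.toLinearMap.rTensor O (F.coact m) = f.toLinearMap m ⊗ₜ 1)
    (hX : F.IsSemiprojective) (hq : IsQuasiIso F.d 0 f.toLinearMap) :
    IsQuasiIso (F.endAlgebra hF).d (bddBimodule hF h f hf).d
      ((bddBimodule hF h f hf).right.flip (bddBimodule hF h f hf).pt) := by
  let T := bddBimodule hF h f hf
  let E := F.endAlgebra hF
  change IsQuasiIso E.d T.d (T.right.flip T.pt)
  have hE : ∀ {n : ℤ} {e : Module.End k F.carrier}, e ∈ F.endDeg n →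
      DGBimodule.homD F.toDGBimodule F.toDGBimodule n e = F.endD e := fun he =>
    LinearMap.ext fun x => (DGBimodule.endD_of_mem he x).symm
  refine isQuasiIso_of_homogeneous E.isInternal T.isInternal (fun n x hx => E.d_mem hx)
    (fun n x hx => T.d_mem hx) ?_ ?_ ?_
  · intro n x hx
    have := T.right_mem hx T.pt_mem
    rwa [zero_add] at this
  · intro n (x : F.endSubalgebra) (hx : x.1 ∈ F.endDeg n) hxd (w : F.bddCochains)
      (hw : w.1 ∈ F.bddCochain (n - 1)) h
    obtain ⟨e, he, h'⟩ := DGBimodule.Augmentation.exists_of_scalar_comp_eq f hX hq hx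
      ((hE hx).trans (congrArg (Subtype.val : F.endSubalgebra → _) hxd)) hw.1
      (congrArg (Subtype.val : F.bddCochains → _) h)
    let v : F.endSubalgebra := ⟨e, Submodule.mem_iSup_of_mem _ he⟩
    exact ⟨v, (Subtype.ext (h'.trans (hE he)) : x = F.endDiff v)⟩
  · intro n (y : F.bddCochains) (hy : y.1 ∈ F.bddCochain n) hd
    obtain ⟨e, he, hed, ψ, hψ, h⟩ := DGBimodule.Augmentation.exists_eq_scalar_comp_add f hX hq hy
      (congrArg (Subtype.val : F.bddCochains → _) hd)
    let v : F.endSubalgebra := ⟨e, Submodule.mem_iSup_of_mem _ he⟩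
    let w : F.bddCochains := ⟨ψ, Submodule.mem_iSup_of_mem _ hψ⟩
    exact ⟨v, (Subtype.ext ((hE he).symm.trans hed) : F.endDiff v = 0), w,
      (Subtype.ext h : y = F.bddCochainsRight v (bddPt f) + F.bddCochainsD w)⟩

namespace SemiprojectiveResolution

variable (R : SemiprojectiveResolution (regularBimodule K.toEquivariantDGAlgebra))

/-- The augmentation `F → K → k`. -/
noncomputable def aug : R.F.toDGBimodule.Augmentation where
  toLinearMap := K.aug.toLinearMap ∘ₗ R.map.toLinearMap
  map_gr n hn x hx := K.aug_gr hn (R.map.map_gr hx)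
  map_d x := by
    have := K.aug_d (R.map.toLinearMap x)
    rwa [show K.d (R.map.toLinearMap x) = _ from (R.map.map_d x).symm] at this
  map_left a x := (congrArg K.aug (R.map.map_left a x)).trans (map_mul K.aug a _)
  map_right b x := ((congrArg K.aug (R.map.map_right b x)).trans (map_mul K.aug _ b)).trans
    (mul_comm _ _)

theorem aug_coact (x : R.F.carrier) :
    R.aug.toLinearMap.rTensor O (R.F.coact x) = R.aug.toLinearMap x ⊗ₜ 1 := by
  have h := K.aug_coact (R.map.toLinearMap x)
  rw [show K.coact (R.map.toLinearMap x) = _ from R.map.map_coact x] at h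
  refine Eq.trans ?_ h
  exact LinearMap.rTensor_comp_apply O K.aug.toLinearMap R.map.toLinearMap (R.F.coact x)

theorem aug_isQuasiIso : IsQuasiIso R.F.d 0 R.aug.toLinearMap :=
  K.aug_isQuasiIso.comp R.quasiIso R.map.map_d K.aug_d

/-- `REnd_{K ⊗_Z K}(K)` is equivariantly homotopy isomorphic to `A`. -/
theorem homotopyIso (hR : R.F.EndIntegrable) :
    DGGAlgebra.HomotopyIso (R.F.endAlgebra hR) P.A :=
  have h : R.F.BddIntegrable := bddCochain_isIntegrable hR R.semiprojective R.aug_isQuasiIso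
  (bddBimodule hR h R.aug R.aug_coact).homotopyIso P.A_negOnePow_smul P.A_d
    (isQuasiIso_bddBimodule_left hR h R.aug R.aug_coact R.semiprojective R.aug_isQuasiIso)
    (isQuasiIso_bddBimodule_right hR h R.aug R.aug_coact R.semiprojective R.aug_isQuasiIso)

end SemiprojectiveResolution

end EquivariantDGBimodule

end EqFormality

theorem mainTheorem5 {k : Type u} [Field k] (p : ℕ) [Fact p.Prime] [CharP k p]
    {O : Type u} [CommRing O] [HopfAlgebra k O] [Algebra.FiniteType k O]
    (P : EqFormality.ParamAlgebra k O) (K : EqFormality.EquivariantKoszulResolution P)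
    (R : EqFormality.EquivariantDGBimodule.SemiprojectiveResolution
      (EqFormality.regularBimodule K.toEquivariantDGAlgebra))
    (hR : R.F.EndIntegrable) :
    EqFormality.DGGAlgebra.HomotopyIso (R.F.endAlgebra hR) P.A ∧
      (R.F.endAlgebra hR).EquivariantlyFormal :=
  have h := R.homotopyIso hR
  ⟨h, h.equivariantlyFormal P.A_d⟩
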